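/- **Theorem (Local semicircle law).** *Model.* For each $N$ let $H=(h_{ij})_{i,j=1}^N$ be a random Hermitian matrix whose entries $h_{ij}$, $i\le j$, are independent, with $\mathbb E h_{ij}=0$. Put $s_{ij}=\mathbb E|h_{ij}|^2$, $S=(s_{ij})$ and $M=M_N=1/\max_{i,j}s_{ij}$. Assume that $S$ is irreducible and stochastic ($\sum_j s_{ij}=1$ for all $i$), that $N^\delta\le M\le N$ for a fixed $\delta>0$, and that the normalized entries $\zeta_{ij}=s_{ij}^{-1/2}h_{ij}$ (for $s_{ij}\ne 0$) satisfy $\mathbb E|\zeta_{ij}|^p\le\mu_p$ for all $p\in\mathbb N$, with constants $\mu_p$ independent of $N,i,j$. *Notation.* For $z=E+\mathrm i\eta$ with $\eta>0$ let $$m(z)=\frac1{2\pi}\int_{-2}^2\frac{\sqrt{4-x^2}}{x-z}\,dx,\qquad G(z)=(H-z)^{-1},\qquad m_N(z)=\frac1N\operatorname{Tr}G(z),$$ $$\kappa=\big||E|-2\big|,\qquad \Pi(z)=\sqrt{\frac{\operatorname{Im}m(z)}{M\eta}}+\frac1{M\eta},$$ and let $\widetilde\Gamma(z)$ be the $\ell^\infty\to\ell^\infty$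 operator norm of the restriction of $(1-m(z)^2S)^{-1}$ to the subspace of $\mathbb C^N$ orthogonal to the constant vectors. Fix $\gamma\in(0,1/2)$. For $|E|\le10$ let $\widetilde\eta_E$ be the smallest $\eta\in(0,10]$ such that $$\frac1{M\eta}\le\min\left\{\frac{M^{-\gamma}}{\widetilde\Gamma(w)^3},\ \frac{M^{-2\gamma}}{\widetilde\Gamma(w)^4\operatorname{Im}m(w)}\right\}\quad\text{for all } w\in[E+\mathrm i\eta,E+10\mathrm i],$$ and let $\widetilde{\mathbf S}=\{E+\mathrm i\eta: |E|\le10,\ \widetilde\eta_E\le\eta\le10\}$. For families of nonnegative random variables, $X\prec Y$ uniformly in $z\in\mathbf D$ means: for all $\epsilon,D>0$ there is $N_0$, depending only on $\epsilon,D,\gamma,\delta$ and $(\mu_p)_p$, such that $\sup_{z\in\mathbf D}\mathbb P[X(z)>N^\epsilon Y(z)]\le N^{-D}$ for all $N\ge N_0$. *Conclusion.* Uniformly in $z\in\widetilde{\mathbf S}$, $$\max_{i,j}|G_{ij}(z)-\delta_{ij}m(z)|\prec\Pi(z),\qquad |m_N(z)-m(z)|\prec\frac1{M\eta}.$$ Moreover,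 uniformly in $z\in\widetilde{\mathbf S}\cap\{|E|\ge2,\ M\eta\sqrt{\kappa+\eta}\ge M^\gamma\}$, $$|m_N(z)-m(z)|\prec\frac1{M(\kappa+\eta)}+\frac1{(M\eta)^2\sqrt{\kappa+\eta}}.$$ -/

import Mathlib

open MeasureTheory ProbabilityTheory
open scoped BigOperators

universe u

namespace LocalSemicircle

noncomputable section

/-! ### Stochastic domination -/

/-- `X ≺ Y`, uniformly in `u ∈ U N`: for all `ε, D > 0` there is `N₀(ε, D)` such that
`sup_u P(X(u) > N ^ ε * Y(u)) ≤ N ^ (-D)` for `N ≥ N₀(ε, D)`.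
The probability space may itself depend on `N` and on the parameter `u`. -/
def StochDom {U : ℕ → Type*} {Ω : ∀ N, U N → Type*} [∀ N u, MeasurableSpace (Ω N u)]
    (P : ∀ N u, Measure (Ω N u)) (X Y : ∀ N u, Ω N u → ℝ) : Prop :=
  ∀ ε : ℝ, 0 < ε → ∀ D : ℝ, 0 < D → ∃ N₀ : ℕ, ∀ N : ℕ, N₀ ≤ N → ∀ u : U N,
    (P N u).real {ω | (N : ℝ) ^ ε * Y N u ω < X N u ω} ≤ (N : ℝ) ^ (-D)

/-! ### The semicircle law and deterministic control parameters -/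

/-- Stieltjes transform of the semicircle law,
`m(z) = (2π)⁻¹ ∫_{-2}^{2} √(4 - x²) / (x - z) dx`. -/
def msc (z : ℂ) : ℂ :=
  (1 / (2 * (Real.pi : ℂ))) *
    ∫ x in (-2 : ℝ)..2, ((Real.sqrt (4 - x ^ 2) : ℝ) : ℂ) / ((x : ℂ) - z)

/-- Distance of `E` to the spectral edge, `κ_E = ||E| - 2|`. -/
def kappa (E : ℝ) : ℝ := |(|E| - 2)|

/-- The control parameter `Π(z) = √(Im m(z) / (M η)) + 1 / (M η)`, where `η = Im z`. -/
def controlPi (M : ℝ) (z : ℂ) : ℝ :=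
  Real.sqrt ((msc z).im / (M * z.im)) + 1 / (M * z.im)

variable {N : ℕ}

/-- The parameter `M = 1 / max_{i,j} s_ij`. -/
def invMax (S : Matrix (Fin N) (Fin N) ℝ) : ℝ :=
  (⨆ p : Fin N × Fin N, S p.1 p.2)⁻¹

/-- The subspace `e^⊥` of `ℂ^N` orthogonal to the constant vectors. It inherits from
`Fin N → ℂ` the `ℓ^∞` norm. -/
def ePerp (N : ℕ) : Submodule ℂ (Fin N → ℂ) where
  carrier := {v | ∑ i, v i = 0}
  add_mem' := by
    intro v w hv hw
    simp only [Set.mem_ofPred_eq, Pi.add_apply, Finset.sum_add_distrib] at *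
    rw [hv, hw, add_zero]
  zero_mem' := by simp
  smul_mem' := by
    intro c v hv
    simp only [Set.mem_ofPred_eq, Pi.smul_apply, smul_eq_mul, ← Finset.mul_sum] at *
    rw [hv, mul_zero]

/-- `Γ̃(z)`: the `ℓ^∞ → ℓ^∞` operator norm of `(1 - m(z)² S)⁻¹` restricted to `e^⊥`. -/
def gammaTilde (S : Matrix (Fin N) (Fin N) ℝ) (z : ℂ) : ℝ :=
  ‖LinearMap.toContinuousLinearMap
    ((Matrix.toLin' ((1 : Matrix (Fin N) (Fin N) ℂ)
      - (msc z) ^ 2 • S.map (fun x : ℝ => (x : ℂ)))⁻¹).domRestrict (ePerp N))‖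

/-- `η̃_E`: the smallest `η` such that
`1 / (M η) ≤ min (M ^ (-γ) / Γ̃(z)³) (M ^ (-2γ) / (Γ̃(z)⁴ Im m(z)))` for all `z` in the
segment `[E + i η, E + 10 i]`. -/
def etaTilde (γ : ℝ) (S : Matrix (Fin N) (Fin N) ℝ) (E : ℝ) : ℝ :=
  sInf {η : ℝ | 0 < η ∧ η ≤ 10 ∧ ∀ y ∈ Set.Icc η 10,
    1 / (invMax S * η) ≤
      min ((invMax S) ^ (-γ) / (gammaTilde S ⟨E, y⟩) ^ 3)
        ((invMax S) ^ (-2 * γ) / ((gammaTilde S ⟨E, y⟩) ^ 4 * (msc ⟨E, y⟩).im))}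

/-- The spectral domain `S̃ = {E + i η : |E| ≤ 10, η̃_E ≤ η ≤ 10}` (with `η > 0`, as for every
spectral parameter). -/
def domain (γ : ℝ) (S : Matrix (Fin N) (Fin N) ℝ) : Set ℂ :=
  {z | |z.re| ≤ 10 ∧ 0 < z.im ∧ etaTilde γ S z.re ≤ z.im ∧ z.im ≤ 10}

/-- The part of `S̃` outside of the spectrum: `|E| ≥ 2` and `M η √(κ + η) ≥ M ^ γ`. -/
def outerDomain (γ : ℝ) (S : Matrix (Fin N) (Fin N) ℝ) : Set ℂ :=
  {z ∈ domain γ S | 2 ≤ |z.re| ∧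
    (invMax S) ^ γ ≤ invMax S * z.im * Real.sqrt (kappa z.re + z.im)}

/-! ### The random matrix model -/

section Model

variable {Ω : Type u} [MeasurableSpace Ω]

/-- The variance matrix `s_ij = E |h_ij|²`. -/
def varMatrix (P : Measure Ω) (H : Ω → Matrix (Fin N) (Fin N) ℂ) : Matrix (Fin N) (Fin N) ℝ :=
  Matrix.of fun i j => ∫ ω, ‖H ω i j‖ ^ 2 ∂P

/-- The normalized entries `ζ_ij = s_ij ^ (-1/2) h_ij`. (If `s_ij = 0` then `h_ij = 0` almost
surely, and this expression is `0`; the value is immaterial.) -/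
def normEntry (P : Measure Ω) (H : Ω → Matrix (Fin N) (Fin N) ℂ) (i j : Fin N) (ω : Ω) : ℂ :=
  ((Real.sqrt (varMatrix P H i j) : ℝ) : ℂ)⁻¹ * H ω i j

/-- The assumptions on the random matrix `H` with parameters `δ` and `(μ_p)`. -/
structure IsModel (δ : ℝ) (μ : ℕ → ℝ) (P : Measure Ω)
    (H : Ω → Matrix (Fin N) (Fin N) ℂ) : Prop where
  measurable : ∀ i j, Measurable fun ω => H ω i j
  hermitian : ∀ ω, (H ω).IsHermitian
  /-- the entries `h_ij`, `i ≤ j`, are independent -/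
  indep : iIndepFun (fun (p : {p : Fin N × Fin N // p.1 ≤ p.2}) (ω : Ω) => H ω p.1.1 p.1.2) P
  /-- all moments are finite -/
  memLp : ∀ i j, ∀ p : ℕ, MemLp (fun ω => H ω i j) p P
  centered : ∀ i j, ∫ ω, H ω i j ∂P = 0
  stochastic : ∀ i, ∑ j, varMatrix P H i j = 1
  irreducible : (varMatrix P H).IsIrreducible
  lower_M : (N : ℝ) ^ δ ≤ invMax (varMatrix P H)
  upper_M : invMax (varMatrix P H) ≤ N
  moments : ∀ i j, ∀ p : ℕ, ∫ ω, ‖normEntry P H i j ω‖ ^ p ∂P ≤ μ p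

end Model

/-- An `N × N` random matrix on some probability space that satisfies the assumptions with
parameters `δ` and `(μ_p)`. -/
structure Model (δ : ℝ) (μ : ℕ → ℝ) (N : ℕ) where
  Ω : Type u
  [measurableSpace : MeasurableSpace Ω]
  P : Measure Ω
  [isProbabilityMeasure : IsProbabilityMeasure P]
  H : Ω → Matrix (Fin N) (Fin N) ℂ
  isModel : IsModel δ μ P H

attribute [instance] Model.measurableSpace Model.isProbabilityMeasure

namespace Model

variable {δ : ℝ} {μ : ℕ → ℝ}

/-- The variance matrix `S` of the model. -/
def S (A : Model.{u} δ μ N) : Matrix (Fin N) (Fin N) ℝ := varMatrix A.P A.H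

/-- The parameter `M` of the model. -/
def M (A : Model.{u} δ μ N) : ℝ := invMax A.S

/-- The Green function `G(z) = (H - z)⁻¹`. -/
def G (A : Model.{u} δ μ N) (z : ℂ) (ω : A.Ω) : Matrix (Fin N) (Fin N) ℂ :=
  (A.H ω - z • (1 : Matrix (Fin N) (Fin N) ℂ))⁻¹

/-- `m_N(z) = N⁻¹ Tr G(z)`. -/
def mN (A : Model.{u} δ μ N) (z : ℂ) (ω : A.Ω) : ℂ := (1 / (N : ℂ)) * (A.G z ω).trace

/-- The random variable `max_{i,j} |G_ij(z) - δ_ij m(z)|`. -/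
def entryError (A : Model.{u} δ μ N) (z : ℂ) (ω : A.Ω) : ℝ :=
  ⨆ p : Fin N × Fin N, ‖A.G z ω p.1 p.2 - (if p.1 = p.2 then msc z else 0)‖

end Model

/-- The parameter set over which the bounds in `S̃` are uniform: all `N × N` models with
parameters `δ`, `(μ_p)`, and all `z ∈ S̃`. -/
abbrev Param (γ δ : ℝ) (μ : ℕ → ℝ) (N : ℕ) : Type (u + 1) :=
  Σ A : Model.{u} δ μ N, ↥(domain γ A.S)

/-- The parameter set over which the bound outside of the spectrum is uniform. -/
abbrev OuterParam (γ δ : ℝ) (μ : ℕ → ℝ) (N : ℕ) : Type (u + 1) :=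
  Σ A : Model.{u} δ μ N, ↥(outerDomain γ A.S)

end

end LocalSemicircle

namespace LocalSemicircle

/-! ### The Stieltjes transform of the semicircle law -/

section Semicircle

open Complex

theorem ofReal_sub_ne_zero {z : ℂ} (hz : 0 < z.im) (x : ℝ) : (x : ℂ) - z ≠ 0 := by
  intro h
  have := congrArg Complex.im h
  simp at this
  linarith

theorem exists_small_root {z : ℂ} (hz : 0 < z.im) :
    ∃ w : ℂ, w ≠ 0 ∧ ‖w‖ < 1 ∧ z = -(w + w⁻¹) := by
  obtain ⟨s, hs⟩ := IsSquare.exists_sq (z ^ 2 - 4) (by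
    obtain ⟨r, hr⟩ := IsAlgClosed.exists_pow_nat_eq (z ^ 2 - 4) (n := 2) (by norm_num)
    exact ⟨r, by rw [← hr]; ring⟩)
  set w := (-z + s) / 2 with hw
  have h1 : w * w + z * w + 1 = 0 := by
    rw [hw]; linear_combination (-1 / 4 : ℂ) * hs
  have hw0 : w ≠ 0 := by rintro h; rw [h] at h1; simp at h1
  have hzw : z = -(w + w⁻¹) := by
    field_simp; linear_combination h1
  have hn : ‖w‖ ≠ 1 := by
    intro h
    have h2 : w⁻¹ = (starRingEnd ℂ) w := by
      rw [Complex.inv_def, Complex.normSq_eq_norm_sq, h]; simp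
    rw [h2] at hzw
    have := congrArg Complex.im hzw
    simp at this
    linarith
  rcases lt_or_gt_of_ne hn with h | h
  · exact ⟨w, hw0, h, hzw⟩
  · refine ⟨w⁻¹, inv_ne_zero hw0, ?_, by rw [inv_inv, add_comm]; exact hzw⟩
    rw [norm_inv]; exact inv_lt_one_of_one_lt₀ h

theorem integral_inv_sub_cos {w : ℂ} (hw0 : w ≠ 0) (hw : ‖w‖ < 1) :
    ∫ θ in (0 : ℝ)..Real.pi, (w + w⁻¹ - 2 * (Real.cos θ : ℂ))⁻¹
      = Real.pi * w / (1 - w ^ 2) := by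
  have hne : ∀ ζ : ℂ, ‖ζ‖ ≤ 1 → 1 - w * ζ ≠ 0 := by
    intro ζ hζ h
    have : ‖w * ζ‖ = 1 := by rw [← sub_eq_zero.1 h]; simp
    rw [norm_mul] at this
    nlinarith [norm_nonneg w, norm_nonneg ζ]
  have hC : (∮ ζ in C(0, 1), (ζ - w)⁻¹ • (w / (1 - w * ζ)))
      = (2 * Real.pi * I : ℂ) • (w / (1 - w * w)) := by
    have hd : DifferentiableOn ℂ (fun ζ : ℂ => w / (1 - w * ζ)) (Metric.closedBall 0 1) := by
      intro ζ hζ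
      have : 1 - w * ζ ≠ 0 := hne ζ (by simpa using hζ)
      exact DifferentiableAt.differentiableWithinAt (by fun_prop (disch := exact this))
    exact hd.circleIntegral_sub_inv_smul (by simpa using hw)
  have h2 : (∮ ζ in C(0, 1), (ζ - w)⁻¹ • (w / (1 - w * ζ)))
      = I * ∫ θ in (0 : ℝ)..2 * Real.pi, (w + w⁻¹ - 2 * (Real.cos θ : ℂ))⁻¹ := by
    rw [circleIntegral, ← intervalIntegral.integral_const_mul]
    apply intervalIntegral.integral_congr
    intro θ _
    simp only [deriv_circleMap, circleMap_zero, smul_eq_mul, Complex.ofReal_one, one_mul]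
    have hcos : (Real.cos θ : ℂ) = (cexp (θ * I) + (cexp (θ * I))⁻¹) / 2 := by
      rw [Complex.ofReal_cos, Complex.cos, ← Complex.exp_neg, neg_mul]
    have hnorm : ‖cexp (θ * I)‖ = 1 := Complex.norm_exp_ofReal_mul_I θ
    rw [hcos]
    set ζ := cexp (θ * I)
    have hζ0 : ζ ≠ 0 := Complex.exp_ne_zero _
    have hζw : ζ - w ≠ 0 := by
      intro h
      rw [sub_eq_zero.1 h] at hnorm; linarith
    have h1 := hne ζ hnorm.le
    have h3 : w + w⁻¹ - 2 * ((ζ + ζ⁻¹) / 2) = (1 - w * ζ) * (ζ - w) / (w * ζ) := by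
      field_simp; ring
    rw [h3]
    field_simp
  have hcont : Continuous fun θ : ℝ => (w + w⁻¹ - 2 * (Real.cos θ : ℂ))⁻¹ := by
    refine Continuous.inv₀ (by fun_prop) fun θ h => ?_
    have hcos : (Real.cos θ : ℂ) = (cexp (θ * I) + (cexp (θ * I))⁻¹) / 2 := by
      rw [Complex.ofReal_cos, Complex.cos, ← Complex.exp_neg, neg_mul]
    have hnorm : ‖cexp (θ * I)‖ = 1 := Complex.norm_exp_ofReal_mul_I θ
    rw [hcos] at h
    set ζ := cexp (θ * I)
    have hζ0 : ζ ≠ 0 := Complex.exp_ne_zero _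
    have h3 : (1 - w * ζ) * (ζ - w) = 0 := by
      field_simp at h; linear_combination h
    rcases mul_eq_zero.1 h3 with h | h
    · exact hne ζ hnorm.le h
    · rw [sub_eq_zero.1 h] at hnorm; linarith
  have hsym : ∫ θ in (Real.pi : ℝ)..2 * Real.pi, (w + w⁻¹ - 2 * (Real.cos θ : ℂ))⁻¹
      = ∫ θ in (0 : ℝ)..Real.pi, (w + w⁻¹ - 2 * (Real.cos θ : ℂ))⁻¹ := by
    have := intervalIntegral.integral_comp_sub_left (a := 0) (b := Real.pi)
      (fun θ : ℝ => (w + w⁻¹ - 2 * (Real.cos θ : ℂ))⁻¹) (2 * Real.pi)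
    simp only [Real.cos_two_pi_sub, sub_zero] at this
    rw [this]; congr 1; ring
  have hadd := intervalIntegral.integral_add_adjacent_intervals
    (hcont.intervalIntegrable (μ := volume) 0 Real.pi)
    (hcont.intervalIntegrable (μ := volume) Real.pi (2 * Real.pi))
  rw [hsym] at hadd
  rw [h2, ← hadd] at hC
  have h1 : 1 - w ^ 2 ≠ 0 := by
    have := hne w hw.le
    rwa [← sq] at this
  rw [← sq] at hC
  have hI : I ≠ 0 := Complex.I_ne_zero
  simp only [smul_eq_mul] at hC
  have : ∀ J : ℂ, I * (J + J) = 2 * Real.pi * I * (w / (1 - w ^ 2)) →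
      J = Real.pi * w / (1 - w ^ 2) := by
    intro J hJ
    have : (2 * I) * J = (2 * I) * (Real.pi * w / (1 - w ^ 2)) := by
      rw [show (2 * I) * J = I * (J + J) by ring, hJ]; ring
    exact mul_left_cancel₀ (by simp) this
  exact this _ hC

theorem msc_eq_root {z w : ℂ} (hz : 0 < z.im) (hw0 : w ≠ 0) (hw : ‖w‖ < 1)
    (hzw : z = -(w + w⁻¹)) : msc z = w := by
  have hsub : ∫ x in (-2 : ℝ)..2, ((Real.sqrt (4 - x ^ 2) : ℝ) : ℂ) / ((x : ℂ) - z)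
      = ∫ θ in (0 : ℝ)..Real.pi, (2 * (Real.sin θ : ℂ)) *
          (((Real.sqrt (4 - (-2 * Real.cos θ) ^ 2) : ℝ) : ℂ) /
            (((-2 * Real.cos θ : ℝ) : ℂ) - z)) := by
    have h := intervalIntegral.integral_deriv_smul_comp (a := 0) (b := Real.pi)
      (f := fun θ => -2 * Real.cos θ) (f' := fun θ => 2 * Real.sin θ)
      (g := fun x : ℝ => ((Real.sqrt (4 - x ^ 2) : ℝ) : ℂ) / ((x : ℂ) - z))
      (fun θ _ => ((Real.hasDerivAt_cos θ).const_mul (-2)).congr_deriv (by ring))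
      (by fun_prop)
      (Continuous.div (by fun_prop) (by fun_prop) (ofReal_sub_ne_zero hz))
    simp only [Real.cos_zero, Real.cos_pi] at h
    norm_num at h
    rw [← h]
    apply intervalIntegral.integral_congr
    intro θ _
    simp
  have hpt : ∀ θ ∈ Set.uIcc (0 : ℝ) Real.pi, (2 * (Real.sin θ : ℂ)) *
          (((Real.sqrt (4 - (-2 * Real.cos θ) ^ 2) : ℝ) : ℂ) /
            (((-2 * Real.cos θ : ℝ) : ℂ) - z))
      = (2 * (Real.cos θ : ℂ) - z) + (4 - z ^ 2) * (w + w⁻¹ - 2 * (Real.cos θ : ℂ))⁻¹ := by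
    intro θ hθ
    rw [Set.uIcc_of_le Real.pi_pos.le] at hθ
    have hs : Real.sqrt (4 - (-2 * Real.cos θ) ^ 2) = 2 * Real.sin θ := by
      rw [show 4 - (-2 * Real.cos θ) ^ 2 = (2 * Real.sin θ) ^ 2 by
        nlinarith [Real.sin_sq_add_cos_sq θ]]
      exact Real.sqrt_sq (by have := Real.sin_nonneg_of_nonneg_of_le_pi hθ.1 hθ.2; linarith)
    have hne := ofReal_sub_ne_zero hz (-2 * Real.cos θ)
    have h3 : ((-2 * Real.cos θ : ℝ) : ℂ) = -2 * (Real.cos θ : ℂ) := by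
      rw [Complex.ofReal_mul, Complex.ofReal_neg, Complex.ofReal_ofNat]
    rw [h3] at hne ⊢
    have h4 : w + w⁻¹ - 2 * (Real.cos θ : ℂ) = -2 * (Real.cos θ : ℂ) - z := by
      rw [hzw]; ring
    have hsc : (Real.sin θ : ℂ) ^ 2 = 1 - (Real.cos θ : ℂ) ^ 2 := by
      exact_mod_cast (by nlinarith [Real.sin_sq_add_cos_sq θ] :
        Real.sin θ ^ 2 = 1 - Real.cos θ ^ 2)
    rw [hs, h4, Complex.ofReal_mul, Complex.ofReal_ofNat]
    generalize (Real.cos θ : ℂ) = c at *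
    generalize (Real.sin θ : ℂ) = t at *
    rw [← div_eq_mul_inv, mul_div_assoc', div_eq_iff hne, add_mul, div_mul_cancel₀ _ hne]
    linear_combination 4 * hsc
  have hne2 : 1 - w ^ 2 ≠ 0 := by
    intro h
    have : ‖w ^ 2‖ = 1 := by rw [← sub_eq_zero.1 h]; simp
    rw [norm_pow] at this
    nlinarith [norm_nonneg w]
  have hcont : Continuous fun θ : ℝ => (w + w⁻¹ - 2 * (Real.cos θ : ℂ))⁻¹ := by
    refine Continuous.inv₀ (by fun_prop) fun θ h => ?_
    apply ofReal_sub_ne_zero hz (-2 * Real.cos θ)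
    rw [hzw]
    simp only [Complex.ofReal_mul, Complex.ofReal_neg, Complex.ofReal_ofNat]
    linear_combination h
  rw [msc, hsub, intervalIntegral.integral_congr hpt, intervalIntegral.integral_add
    (Continuous.intervalIntegrable (by fun_prop) _ _)
    (Continuous.intervalIntegrable (by fun_prop) _ _),
    intervalIntegral.integral_const_mul, integral_inv_sub_cos hw0 hw,
    intervalIntegral.integral_sub (Continuous.intervalIntegrable (by fun_prop) _ _)
    (Continuous.intervalIntegrable (by fun_prop) _ _), intervalIntegral.integral_const_mul,
    intervalIntegral.integral_ofReal, integral_cos]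
  simp only [Real.sin_pi, Real.sin_zero, intervalIntegral.integral_const, sub_zero]
  have hpi : (Real.pi : ℂ) ≠ 0 := by exact_mod_cast Real.pi_ne_zero
  rw [hzw]
  simp
  field_simp
  ring

variable {z : ℂ}

theorem msc_facts (hz : 0 < z.im) : msc z ≠ 0 ∧ ‖msc z‖ < 1 ∧ z = -(msc z + (msc z)⁻¹) := by
  obtain ⟨w, h0, h1, h2⟩ := exists_small_root hz
  rw [msc_eq_root hz h0 h1 h2]
  exact ⟨h0, h1, h2⟩

theorem msc_ne_zero (hz : 0 < z.im) : msc z ≠ 0 := (msc_facts hz).1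
theorem norm_msc_lt_one (hz : 0 < z.im) : ‖msc z‖ < 1 := (msc_facts hz).2.1
theorem inv_msc (hz : 0 < z.im) : (msc z)⁻¹ = -z - msc z := by
  have := (msc_facts hz).2.2
  linear_combination this

theorem continuous_semicircle_kernel (hz : 0 < z.im) :
    Continuous fun x : ℝ => ((Real.sqrt (4 - x ^ 2) : ℝ) : ℂ) / ((x : ℂ) - z) :=
  Continuous.div (by fun_prop) (by fun_prop) (ofReal_sub_ne_zero hz)

theorem im_msc_eq_integral (hz : 0 < z.im) : (msc z).im = 1 / (2 * Real.pi) *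
    ∫ x in (-2 : ℝ)..2, Real.sqrt (4 - x ^ 2) * (z.im / ((x - z.re) ^ 2 + z.im ^ 2)) := by
  have h := Complex.imCLM.intervalIntegral_comp_comm
    ((continuous_semicircle_kernel hz).intervalIntegrable (μ := volume) (-2) 2)
  have h2 : (1 / (2 * (Real.pi : ℂ))) = ((1 / (2 * Real.pi) : ℝ) : ℂ) := by push_cast; rfl
  rw [msc, h2, Complex.im_ofReal_mul]
  congr 1
  simp only [Complex.imCLM_apply] at h
  rw [← h]
  apply intervalIntegral.integral_congr
  intro x _
  simp only [Complex.div_im, Complex.ofReal_im, Complex.ofReal_re, Complex.sub_im, Complex.sub_re,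
    Complex.normSq_apply]
  ring

theorem im_msc_div_antitone (E : ℝ) {y y' : ℝ} (hy : 0 < y) (hyy' : y ≤ y') :
    (msc ⟨E, y'⟩).im / y' ≤ (msc ⟨E, y⟩).im / y := by
  have hy' : 0 < y' := hy.trans_le hyy'
  have key : ∀ t : ℝ, 0 < t → (msc ⟨E, t⟩).im / t = 1 / (2 * Real.pi) *
      ∫ x in (-2 : ℝ)..2, Real.sqrt (4 - x ^ 2) * (1 / ((x - E) ^ 2 + t ^ 2)) := by
    intro t ht
    rw [im_msc_eq_integral (z := ⟨E, t⟩) ht, mul_div_assoc, ← intervalIntegral.integral_div]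
    congr 1
    apply intervalIntegral.integral_congr
    intro x _
    have : (x - E) ^ 2 + t ^ 2 ≠ 0 := by positivity
    simp only
    field_simp
  have hc : ∀ t : ℝ, 0 < t → Continuous fun x : ℝ =>
      Real.sqrt (4 - x ^ 2) * (1 / ((x - E) ^ 2 + t ^ 2)) := fun t ht =>
    Continuous.mul (by fun_prop) (Continuous.div (by fun_prop) (by fun_prop)
      fun x => by positivity)
  rw [key y hy, key y' hy']
  apply mul_le_mul_of_nonneg_left _ (by positivity)
  apply intervalIntegral.integral_mono_on (by norm_num)
    ((hc y' hy').intervalIntegrable _ _) ((hc y hy).intervalIntegrable _ _)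
  intro x _
  gcongr

theorem norm_msc_sub_le {z z' : ℂ} (hz : 0 < z.im) (hz' : 0 < z'.im) :
    ‖msc z - msc z'‖ ≤ 2 * (‖z - z'‖ / (z.im * z'.im)) := by
  rw [msc, msc, ← mul_sub, ← intervalIntegral.integral_sub
    ((continuous_semicircle_kernel hz).intervalIntegrable _ _)
    ((continuous_semicircle_kernel hz').intervalIntegrable _ _), norm_mul]
  have hb : ∀ x ∈ Set.uIoc (-2 : ℝ) 2,
      ‖((Real.sqrt (4 - x ^ 2) : ℝ) : ℂ) / ((x : ℂ) - z)
        - ((Real.sqrt (4 - x ^ 2) : ℝ) : ℂ) / ((x : ℂ) - z')‖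
        ≤ 2 * (‖z - z'‖ / (z.im * z'.im)) := by
    intro x _
    have h1 := ofReal_sub_ne_zero hz x
    have h2 := ofReal_sub_ne_zero hz' x
    have h3 : ((Real.sqrt (4 - x ^ 2) : ℝ) : ℂ) / ((x : ℂ) - z)
        - ((Real.sqrt (4 - x ^ 2) : ℝ) : ℂ) / ((x : ℂ) - z')
        = ((Real.sqrt (4 - x ^ 2) : ℝ) : ℂ) * ((z - z') / (((x : ℂ) - z) * ((x : ℂ) - z'))) := by
      field_simp; ring
    rw [h3, norm_mul, norm_div, norm_mul, Complex.norm_real, Real.norm_of_nonneg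
      (Real.sqrt_nonneg _)]
    have h4 : Real.sqrt (4 - x ^ 2) ≤ 2 := by
      rw [Real.sqrt_le_left (by norm_num)]; nlinarith [sq_nonneg x]
    have hi : ∀ u : ℂ, 0 < u.im → u.im ≤ ‖(x : ℂ) - u‖ := by
      intro u hu
      have := Complex.abs_im_le_norm ((x : ℂ) - u)
      simp at this
      rwa [abs_of_pos hu] at this
    gcongr
    · exact hi z hz
    · exact hi z' hz'
  have := intervalIntegral.norm_integral_le_of_norm_le_const hb
  have hpi := Real.pi_gt_three
  have h5 : ‖(1 / (2 * (Real.pi : ℂ)))‖ = 1 / (2 * Real.pi) := by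
    rw [norm_div, norm_mul]; simp [abs_of_pos Real.pi_pos]
  rw [h5]
  have h6 : |(2 : ℝ) - -2| = 4 := by norm_num
  rw [h6] at this
  have h0 : 0 ≤ ‖z - z'‖ / (z.im * z'.im) := by positivity
  calc 1 / (2 * Real.pi) * _ ≤ 1 / (2 * Real.pi) * (2 * (‖z - z'‖ / (z.im * z'.im)) * 4) := by
        gcongr
    _ = (4 / Real.pi) * (‖z - z'‖ / (z.im * z'.im)) := by field_simp
    _ ≤ 2 * (‖z - z'‖ / (z.im * z'.im)) := by
        gcongr
        rw [div_le_iff₀ (by positivity)]; linarith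

theorem im_eq_im_msc_mul (hz : 0 < z.im) :
    z.im * ‖msc z‖ ^ 2 = (msc z).im * (1 - ‖msc z‖ ^ 2) := by
  have h0 := msc_ne_zero hz
  have h := congrArg Complex.im (msc_facts hz).2.2
  have hn : Complex.normSq (msc z) ≠ 0 := by simpa [Complex.normSq_eq_zero] using h0
  rw [Complex.neg_im, Complex.add_im, Complex.inv_im] at h
  rw [← Complex.normSq_eq_norm_sq, h]
  field_simp
  ring

theorem im_msc_pos (hz : 0 < z.im) : 0 < (msc z).im := by
  have h := im_eq_im_msc_mul hz
  have h1 := norm_msc_lt_one hz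
  have h2 : 0 < ‖msc z‖ := norm_pos_iff.2 (msc_ne_zero hz)
  have h3 : 0 < 1 - ‖msc z‖ ^ 2 := by nlinarith
  by_contra hc
  push Not at hc
  have : 0 < z.im * ‖msc z‖ ^ 2 := by positivity
  nlinarith

theorem norm_msc_le_inv_im (hz : 0 < z.im) : ‖msc z‖ ≤ 1 / z.im := by
  have h : ‖(msc z)⁻¹‖ ≥ z.im := by
    rw [inv_msc hz]
    have := Complex.abs_im_le_norm (-z - msc z)
    rw [Complex.sub_im, Complex.neg_im, abs_of_neg (by linarith [im_msc_pos hz])] at this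
    linarith [im_msc_pos hz]
  rw [norm_inv] at h
  have h2 : 0 < ‖msc z‖ := norm_pos_iff.2 (msc_ne_zero hz)
  rw [le_div_iff₀ hz]
  calc ‖msc z‖ * z.im ≤ ‖msc z‖ * ‖msc z‖⁻¹ := by gcongr
    _ = 1 := mul_inv_cancel₀ h2.ne'

theorem norm_le_of_box (hre : |z.re| ≤ 10) (hz : 0 < z.im) (him : z.im ≤ 10) : ‖z‖ ≤ 15 := by
  rw [← abs_of_nonneg (norm_nonneg z), ← abs_of_pos (show (0 : ℝ) < 15 by norm_num), ← sq_le_sq,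
    ← Complex.normSq_eq_norm_sq, Complex.normSq_apply]
  have := abs_le.1 hre
  nlinarith

theorem le_norm_msc (hre : |z.re| ≤ 10) (hz : 0 < z.im) (him : z.im ≤ 10) :
    1 / 16 ≤ ‖msc z‖ := by
  have h2 : 0 < ‖msc z‖ := norm_pos_iff.2 (msc_ne_zero hz)
  have h : ‖(msc z)⁻¹‖ ≤ 16 := by
    rw [inv_msc hz]
    calc ‖-z - msc z‖ ≤ ‖-z‖ + ‖msc z‖ := norm_sub_le _ _
      _ ≤ 15 + 1 := by
        rw [norm_neg]; exact add_le_add (norm_le_of_box hre hz him) (norm_msc_lt_one hz).le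
      _ = 16 := by norm_num
  rw [norm_inv] at h
  rw [div_le_iff₀ (by norm_num)]
  calc (1 : ℝ) = ‖msc z‖ * ‖msc z‖⁻¹ := (mul_inv_cancel₀ h2.ne').symm
    _ ≤ ‖msc z‖ * 16 := by gcongr

theorem im_le_im_msc (hre : |z.re| ≤ 10) (hz : 0 < z.im) (him : z.im ≤ 10) :
    z.im / 256 ≤ (msc z).im := by
  have h := im_eq_im_msc_mul hz
  have h1 := norm_msc_lt_one hz
  have h2 := le_norm_msc hre hz him
  have h3 := im_msc_pos hz
  nlinarith [sq_nonneg ‖msc z‖, mul_nonneg hz.le (show 0 ≤ ‖msc z‖ ^ 2 - 1 / 256 by nlinarith),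
    mul_nonneg h3.le (sq_nonneg ‖msc z‖)]

/-- `|m⁻¹ - m| = |z² - 4|^{1/2}`, the distance of the two roots of `x² + z x + 1`. -/
noncomputable def rootGap (z : ℂ) : ℝ := ‖(msc z)⁻¹ - msc z‖

theorem rootGap_sq (hz : 0 < z.im) : rootGap z ^ 2 = ‖z ^ 2 - 4‖ := by
  rw [rootGap, ← norm_pow]
  congr 1
  have h0 := msc_ne_zero hz
  conv_rhs => rw [(msc_facts hz).2.2]
  field_simp
  ring

theorem im_msc_le_rootGap (hz : 0 < z.im) : 2 * (msc z).im ≤ rootGap z := by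
  have h := Complex.abs_im_le_norm ((msc z)⁻¹ - msc z)
  have h1 : ((msc z)⁻¹).im ≤ -(msc z).im := by
    rw [inv_msc hz, Complex.sub_im, Complex.neg_im]; linarith
  rw [Complex.sub_im, abs_of_neg (by linarith [im_msc_pos hz])] at h
  rw [rootGap]; linarith

theorem rootGap_mono (E : ℝ) {y y' : ℝ} (hy : 0 < y) (hyy' : y ≤ y') :
    rootGap ⟨E, y⟩ ≤ rootGap ⟨E, y'⟩ := by
  have hfac : ∀ t : ℝ, ‖(⟨E, t⟩ : ℂ) ^ 2 - 4‖ = ‖(⟨E, t⟩ : ℂ) - 2‖ * ‖(⟨E, t⟩ : ℂ) + 2‖ := by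
    intro t; rw [← norm_mul]; congr 1; ring
  have hm : ∀ c : ℝ, ‖(⟨E, y⟩ : ℂ) - c‖ ≤ ‖(⟨E, y'⟩ : ℂ) - c‖ := by
    intro c
    apply le_of_sq_le_sq _ (norm_nonneg _)
    rw [← Complex.normSq_eq_norm_sq, ← Complex.normSq_eq_norm_sq, Complex.normSq_apply,
      Complex.normSq_apply]
    simp
    nlinarith
  apply le_of_sq_le_sq _ (show 0 ≤ rootGap ⟨E, y'⟩ from norm_nonneg _)
  rw [rootGap_sq hy, rootGap_sq (hy.trans_le hyy'), hfac, hfac]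
  have h1 := hm 2
  have h2 := hm (-2)
  simp only [Complex.ofReal_neg, Complex.ofReal_ofNat, sub_neg_eq_add] at h1 h2
  gcongr

theorem kappa_add_le_rootGap_sq (hre : 2 ≤ |z.re|) (hz : 0 < z.im) :
    kappa z.re + z.im ≤ rootGap z ^ 2 := by
  rw [rootGap_sq hz, show z ^ 2 - 4 = (z - 2) * (z + 2) by ring, norm_mul]
  have key : ∀ E y : ℝ, 2 ≤ E → 0 < y →
      (E - 2 + y) ^ 2 ≤ ((E - 2) ^ 2 + y ^ 2) * ((E + 2) ^ 2 + y ^ 2) := by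
    intro E y hE hy
    nlinarith [sq_nonneg (E - 2 - y), mul_nonneg (sq_nonneg (E - 2)) (sq_nonneg y),
      mul_nonneg (add_nonneg (sq_nonneg (E - 2)) (sq_nonneg y))
        (show 0 ≤ (E + 2) ^ 2 + y ^ 2 - 2 by nlinarith)]
  have hk : 0 ≤ kappa z.re := abs_nonneg _
  apply le_of_sq_le_sq _ (by positivity)
  rw [mul_pow, ← Complex.normSq_eq_norm_sq, ← Complex.normSq_eq_norm_sq, Complex.normSq_apply,
    Complex.normSq_apply]
  simp only [Complex.sub_re, Complex.sub_im, Complex.add_re, Complex.add_im, Complex.re_ofNat,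
    Complex.im_ofNat, sub_zero, add_zero]
  rw [kappa, abs_of_nonneg (by linarith : 0 ≤ |z.re| - 2)]
  rcases abs_cases z.re with ⟨h, _⟩ | ⟨h, _⟩
  · rw [h] at hre ⊢
    have := key z.re z.im hre hz
    nlinarith
  · rw [h] at hre ⊢
    have := key (-z.re) z.im hre hz
    nlinarith

theorem im_msc_mul_rootGap_le (hre : 2 ≤ |z.re|) (hre' : |z.re| ≤ 10) (hz : 0 < z.im)
    (him : z.im ≤ 10) : (msc z).im * rootGap z ≤ 200 * z.im := by
  set q := msc z - (msc z)⁻¹ with hq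
  have hqn : ‖q‖ = rootGap z := by rw [hq, rootGap, norm_sub_rev]
  have hqq : q ^ 2 = z ^ 2 - 4 := by
    have h0 := msc_ne_zero hz
    conv_rhs => rw [(msc_facts hz).2.2]
    rw [hq]; field_simp; ring
  have hqm : 2 * (msc z).im ≤ q.im := by
    rw [hq, inv_msc hz, Complex.sub_im, Complex.sub_im, Complex.neg_im]; linarith
  have hmpos := im_msc_pos hz
  have h1 := congrArg Complex.re hqq
  have h2 := congrArg Complex.im hqq
  simp only [pow_two, Complex.mul_re, Complex.mul_im, Complex.sub_re, Complex.sub_im,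
    Complex.re_ofNat, Complex.im_ofNat] at h1 h2
  have hnq : ‖q‖ ^ 2 = q.re ^ 2 + q.im ^ 2 := by
    rw [← Complex.normSq_eq_norm_sq, Complex.normSq_apply]; ring
  have hre2 : 4 ≤ z.re ^ 2 := by nlinarith [sq_abs z.re]
  have hre3 : z.re ^ 2 ≤ 100 := by nlinarith [sq_abs z.re, abs_nonneg z.re]
  rw [← hqn]
  have hn0 := norm_nonneg q
  apply le_of_sq_le_sq _ (by positivity)
  rw [mul_pow, hnq]
  have hqi : 0 < q.im := by linarith
  have hA : (msc z).im ^ 2 ≤ q.im ^ 2 / 4 := by nlinarith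
  have hB : (q.re * q.im) ^ 2 = (z.re * z.im) ^ 2 := by
    have : q.re * q.im = z.re * z.im := by linarith
    rw [this]
  calc (msc z).im ^ 2 * (q.re ^ 2 + q.im ^ 2) ≤ q.im ^ 2 / 4 * (q.re ^ 2 + q.im ^ 2) := by gcongr
    _ = (q.re * q.im) ^ 2 / 4 + (q.im ^ 2) ^ 2 / 4 := by ring
    _ ≤ (200 * z.im) ^ 2 := by
      rw [hB]
      have h5 : (z.re * z.im) ^ 2 ≤ 100 * z.im ^ 2 := by rw [mul_pow]; gcongr
      have h6 : (q.im ^ 2) ^ 2 ≤ (z.re * z.im) ^ 2 + z.im ^ 2 * q.im ^ 2 := by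
        rw [← hB]
        nlinarith [mul_nonneg (sq_nonneg q.im) (show 0 ≤ z.re ^ 2 - 4 by linarith)]
      have h7 : q.im ^ 2 ≤ 200 := by
        by_contra hc
        push Not at hc
        nlinarith
      nlinarith

end Semicircle
end LocalSemicircle

namespace LocalSemicircle

/-! ### Stability of the self-consistent equation on the spectral domain -/

section Stability

variable {N : ℕ}

/-- The action of the real matrix `S` on complex vectors. -/
def avg (S : Matrix (Fin N) (Fin N) ℝ) (u : Fin N → ℂ) : Fin N → ℂ :=
  fun i => ∑ j, (S i j : ℂ) * u j

/-- Symmetric stochastic matrices with nonnegative entries. -/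
structure IsSymmStochastic (S : Matrix (Fin N) (Fin N) ℝ) : Prop where
  nonneg : ∀ i j, 0 ≤ S i j
  symm : ∀ i j, S i j = S j i
  row_sum : ∀ i, ∑ j, S i j = 1

variable {S : Matrix (Fin N) (Fin N) ℝ}

theorem IsSymmStochastic.col_sum (hS : IsSymmStochastic S) (j : Fin N) : ∑ i, S i j = 1 := by
  rw [← hS.row_sum j]
  exact Finset.sum_congr rfl fun i _ => hS.symm i j

theorem norm_sum_mul_le_of_sum_le_one {ι : Type*} (s : Finset ι) {t : ι → ℝ} (ht : ∀ i ∈ s, 0 ≤ t i)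
    (hs : ∑ i ∈ s, t i ≤ 1) {u : ι → ℂ} {b : ℝ} (hb0 : 0 ≤ b) (hb : ∀ i ∈ s, ‖u i‖ ≤ b) :
    ‖∑ i ∈ s, (t i : ℂ) * u i‖ ≤ b := by
  calc ‖∑ i ∈ s, (t i : ℂ) * u i‖ ≤ ∑ i ∈ s, t i * b := by
        refine norm_sum_le_of_le _ fun i hi => ?_
        rw [norm_mul, Complex.norm_real, Real.norm_of_nonneg (ht i hi)]
        exact mul_le_mul_of_nonneg_left (hb i hi) (ht i hi)
    _ = (∑ i ∈ s, t i) * b := by rw [Finset.sum_mul]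
    _ ≤ 1 * b := by gcongr
    _ = b := one_mul b

theorem norm_avg_le (hS : IsSymmStochastic S) (u : Fin N → ℂ) : ‖avg S u‖ ≤ ‖u‖ := by
  rw [pi_norm_le_iff_of_nonneg (norm_nonneg _)]
  exact fun i => norm_sum_mul_le_of_sum_le_one _ (fun j _ => hS.nonneg i j) (hS.row_sum i).le
    (norm_nonneg _) fun j _ => norm_le_pi_norm u j

theorem sum_avg (hS : IsSymmStochastic S) (u : Fin N → ℂ) : ∑ i, avg S u i = ∑ i, u i := by
  simp only [avg]
  rw [Finset.sum_comm]
  refine Finset.sum_congr rfl fun j _ => ?_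
  rw [← Finset.sum_mul, ← Complex.ofReal_sum, hS.col_sum]
  simp

theorem avg_sub (u v : Fin N → ℂ) : avg S (u - v) = avg S u - avg S v := by
  ext i; simp [avg, mul_sub, Finset.sum_sub_distrib]

theorem avg_smul (c : ℂ) (u : Fin N → ℂ) : avg S (c • u) = c • avg S u := by
  ext i
  simp only [avg, Pi.smul_apply, smul_eq_mul, Finset.mul_sum]
  exact Finset.sum_congr rfl fun j _ => by ring

theorem avg_const (hS : IsSymmStochastic S) (c : ℂ) : avg S (fun _ => c) = fun _ => c := by
  ext i
  simp only [avg]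
  rw [← Finset.sum_mul, ← Complex.ofReal_sum, hS.row_sum]
  simp

theorem mulVec_one_sub (c : ℂ) (u : Fin N → ℂ) :
    ((1 : Matrix (Fin N) (Fin N) ℂ) - c • S.map (fun x : ℝ => (x : ℂ))).mulVec u
      = u - c • avg S u := by
  rw [Matrix.sub_mulVec, Matrix.one_mulVec, Matrix.smul_mulVec]
  rfl

theorem norm_sub_smul_avg_ge (hS : IsSymmStochastic S) (c : ℂ) (u : Fin N → ℂ) :
    (1 - ‖c‖) * ‖u‖ ≤ ‖u - c • avg S u‖ := by
  have h1 : ‖c • avg S u‖ ≤ ‖c‖ * ‖u‖ := by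
    rw [norm_smul]; exact mul_le_mul_of_nonneg_left (norm_avg_le hS u) (norm_nonneg _)
  have h2 := norm_sub_norm_le u (c • avg S u)
  linarith

theorem isUnit_one_sub (hS : IsSymmStochastic S) {c : ℂ} (hc : ‖c‖ < 1) :
    IsUnit ((1 : Matrix (Fin N) (Fin N) ℂ) - c • S.map (fun x : ℝ => (x : ℂ))) := by
  rw [← Matrix.mulVec_injective_iff_isUnit]
  intro u v huv
  simp only [mulVec_one_sub] at huv
  have h : (u - v) - c • avg S (u - v) = 0 := by
    rw [avg_sub, smul_sub]
    linear_combination (norm := module) huv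
  have h2 := norm_sub_smul_avg_ge hS c (u - v)
  rw [h, norm_zero] at h2
  have h3 : ‖u - v‖ = 0 := by
    have : 0 < 1 - ‖c‖ := by linarith
    nlinarith [norm_nonneg (u - v)]
  exact sub_eq_zero.1 (norm_eq_zero.1 h3)

theorem norm_msc_sq_lt_one {z : ℂ} (hz : 0 < z.im) : ‖msc z ^ 2‖ < 1 := by
  rw [norm_pow]
  have := norm_msc_lt_one hz
  nlinarith [norm_nonneg (msc z)]

theorem norm_le_gammaTilde_mul (hS : IsSymmStochastic S) {z : ℂ} (hz : 0 < z.im)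
    (u : Fin N → ℂ) (hu : ∑ i, u i = 0) :
    ‖u‖ ≤ gammaTilde S z * ‖u - msc z ^ 2 • avg S u‖ := by
  have hunit := isUnit_one_sub hS (norm_msc_sq_lt_one hz)
  have hv : u - msc z ^ 2 • avg S u ∈ ePerp N := by
    change ∑ i, (u - msc z ^ 2 • avg S u) i = 0
    simp only [Pi.sub_apply, Pi.smul_apply, smul_eq_mul, Finset.sum_sub_distrib, ← Finset.mul_sum,
      sum_avg hS, hu]
    simp
  have h := ContinuousLinearMap.le_opNorm (LinearMap.toContinuousLinearMap
    ((Matrix.toLin' ((1 : Matrix (Fin N) (Fin N) ℂ)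
      - (msc z) ^ 2 • S.map (fun x : ℝ => (x : ℂ)))⁻¹).domRestrict (ePerp N))) ⟨_, hv⟩
  have hT : ((1 : Matrix (Fin N) (Fin N) ℂ)
      - (msc z) ^ 2 • S.map (fun x : ℝ => (x : ℂ)))⁻¹.mulVec (u - msc z ^ 2 • avg S u) = u := by
    rw [← mulVec_one_sub, Matrix.mulVec_mulVec, Matrix.nonsing_inv_mul _
      ((Matrix.isUnit_iff_isUnit_det _).1 hunit), Matrix.one_mulVec]
  simp only [LinearMap.coe_toContinuousLinearMap', LinearMap.domRestrict_apply,
    Matrix.toLin'_apply] at h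
  rw [hT] at h
  exact h

theorem half_le_gammaTilde (hN : 2 ≤ N) (hS : IsSymmStochastic S) {z : ℂ} (hz : 0 < z.im) :
    1 / 2 ≤ gammaTilde S z := by
  let a : Fin N := ⟨0, by omega⟩
  let b : Fin N := ⟨1, by omega⟩
  have hab : a ≠ b := by simp [a, b]
  let u : Fin N → ℂ := Pi.single a 1 - Pi.single b 1
  have hu : ∑ i, u i = 0 := by simp [u, Finset.sum_sub_distrib]
  have hne : 0 < ‖u‖ := by
    rw [norm_pos_iff]
    intro h
    have := congrFun h a
    simp [u, hab] at this
  have h := norm_le_gammaTilde_mul hS hz u hu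
  have h2 : ‖u - msc z ^ 2 • avg S u‖ ≤ 2 * ‖u‖ := by
    calc ‖u - msc z ^ 2 • avg S u‖ ≤ ‖u‖ + ‖msc z ^ 2 • avg S u‖ := norm_sub_le _ _
      _ ≤ ‖u‖ + 1 * ‖u‖ := by
        rw [norm_smul]
        gcongr
        · exact (norm_msc_sq_lt_one hz).le
        · exact norm_avg_le hS u
      _ = 2 * ‖u‖ := by ring
  have h0 : 0 ≤ gammaTilde S z := by unfold gammaTilde; positivity
  have : ‖u‖ ≤ gammaTilde S z * (2 * ‖u‖) := h.trans (by gcongr)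
  by_contra hc
  push Not at hc
  nlinarith

theorem gammaTilde_le (hS : IsSymmStochastic S) {z : ℂ} (hz : 0 < z.im) :
    gammaTilde S z ≤ (1 - ‖msc z ^ 2‖)⁻¹ := by
  have hlt := norm_msc_sq_lt_one hz
  have hpos : 0 < 1 - ‖msc z ^ 2‖ := by linarith
  have hunit := isUnit_one_sub hS hlt
  refine ContinuousLinearMap.opNorm_le_bound _ (by positivity) fun v => ?_
  simp only [LinearMap.coe_toContinuousLinearMap', LinearMap.domRestrict_apply,
    Matrix.toLin'_apply]
  set A := (1 : Matrix (Fin N) (Fin N) ℂ) - (msc z) ^ 2 • S.map (fun x : ℝ => (x : ℂ)) with hA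
  have h := norm_sub_smul_avg_ge hS (msc z ^ 2) (A⁻¹.mulVec v)
  rw [← mulVec_one_sub, ← hA, Matrix.mulVec_mulVec,
    Matrix.mul_nonsing_inv _ ((Matrix.isUnit_iff_isUnit_det _).1 hunit), Matrix.one_mulVec] at h
  rw [inv_mul_eq_div, le_div_iff₀ hpos, mul_comm]
  exact h

variable {γ : ℝ}

theorem ten_mem_etaTilde_set (hγ₀ : 0 < γ) (hγ₁ : γ < 1 / 2) (hN : 2 ≤ N)
    (hS : IsSymmStochastic S) (hM : 1 ≤ invMax S) (E : ℝ) :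
    (10 : ℝ) ∈ {η : ℝ | 0 < η ∧ η ≤ 10 ∧ ∀ y ∈ Set.Icc η 10,
    1 / (invMax S * η) ≤
      min ((invMax S) ^ (-γ) / (gammaTilde S ⟨E, y⟩) ^ 3)
        ((invMax S) ^ (-2 * γ) / ((gammaTilde S ⟨E, y⟩) ^ 4 * (msc ⟨E, y⟩).im))} := by
  refine ⟨by norm_num, le_refl _, fun y hy => ?_⟩
  have hy10 : y = 10 := le_antisymm hy.2 hy.1
  subst hy10
  have hz : 0 < (⟨E, 10⟩ : ℂ).im := by norm_num
  have hm := norm_msc_le_inv_im hz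
  have hg0 := half_le_gammaTilde hN hS hz
  have hg1 := gammaTilde_le hS hz
  have hmi := im_msc_pos hz
  have hmi2 : (msc ⟨E, 10⟩).im ≤ 1 / 10 := (Complex.im_le_norm _).trans hm
  simp only at hm
  have hg2 : gammaTilde S ⟨E, 10⟩ ≤ 2 := by
    refine hg1.trans (inv_le_of_inv_le₀ (by norm_num) ?_)
    rw [norm_pow]
    nlinarith [norm_nonneg (msc ⟨E, 10⟩)]
  have hg3 : gammaTilde S ⟨E, 10⟩ ≤ 100 / 99 := by
    refine hg1.trans (inv_le_of_inv_le₀ (by norm_num) ?_)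
    rw [norm_pow]
    nlinarith [norm_nonneg (msc ⟨E, 10⟩)]
  set g := gammaTilde S ⟨E, 10⟩
  have hMp : 0 < invMax S := by linarith
  have e1 : 1 / (invMax S * 10) = invMax S ^ (-1 : ℝ) / 10 := by
    rw [Real.rpow_neg_one]; field_simp
  rw [e1]
  apply le_min
  · have : g ^ 3 ≤ 2 ^ 3 := by gcongr
    apply div_le_div₀ (by positivity) (Real.rpow_le_rpow_of_exponent_le hM (by linarith))
      (by positivity) (by linarith)
  · have : g ^ 4 * (msc ⟨E, 10⟩).im ≤ 2 ^ 4 * (1 / 10) := by gcongr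
    apply div_le_div₀ (by positivity) (Real.rpow_le_rpow_of_exponent_le hM (by linarith))
      (by positivity) (by linarith)

theorem controlPi_mul_le_of_bound {g M y : ℝ} {z : ℂ} (hg : 1 / 2 ≤ g) (hM : 0 < M)
    (hz : 0 < z.im) (hy : y = z.im)
    (h : 1 / (M * y) ≤ min (M ^ (-γ) / g ^ 3) (M ^ (-2 * γ) / (g ^ 4 * (msc z).im))) :
    controlPi M z * g ≤ 6 * M ^ (-γ) := by
  subst hy
  have hmi := im_msc_pos hz
  have hg0 : 0 < g := by linarith
  obtain ⟨h1, h2⟩ := le_min_iff.1 h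
  have hMy : 0 < M * z.im := by positivity
  have hMg : 0 < M ^ (-γ) := by positivity
  rw [le_div_iff₀ (by positivity)] at h1 h2
  have h3 : 1 / (M * z.im) * g ≤ 4 * M ^ (-γ) := by
    have : 1 / (M * z.im) * g ^ 3 = (1 / (M * z.im) * g) * g ^ 2 := by ring
    rw [this] at h1
    have h0 : 0 ≤ 1 / (M * z.im) * g := by positivity
    nlinarith [mul_le_mul_of_nonneg_left (show 1 / 4 ≤ g ^ 2 by nlinarith) h0]
  have h4 : Real.sqrt ((msc z).im / (M * z.im)) * g ≤ 2 * M ^ (-γ) := by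
    apply le_of_sq_le_sq _ (by positivity)
    rw [mul_pow, Real.sq_sqrt (by positivity)]
    have e : M ^ (-2 * γ) = (M ^ (-γ)) ^ 2 := by
      rw [← Real.rpow_natCast, ← Real.rpow_mul hM.le]; congr 1; push_cast; ring
    rw [e] at h2
    have e2 : 1 / (M * z.im) * (g ^ 4 * (msc z).im)
        = ((msc z).im / (M * z.im) * g ^ 2) * g ^ 2 := by
      field_simp
    rw [e2] at h2
    have h0 : 0 ≤ (msc z).im / (M * z.im) * g ^ 2 := by positivity
    nlinarith [mul_le_mul_of_nonneg_left (show 1 / 4 ≤ g ^ 2 by nlinarith) h0]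
  rw [controlPi, add_mul]
  linarith

theorem continuousAt_msc_vertical (E : ℝ) {y : ℝ} (hy : 0 < y) :
    ContinuousAt (fun t : ℝ => msc ⟨E, t⟩) y := by
  rw [ContinuousAt, tendsto_iff_norm_sub_tendsto_zero]
  have h : Filter.Tendsto (fun t : ℝ => 2 * (‖(⟨E, t⟩ : ℂ) - ⟨E, y⟩‖ / (t * y))) (nhds y)
      (nhds 0) := by
    have : ContinuousAt (fun t : ℝ => 2 * (|t - y| / (t * y))) y := by
      apply ContinuousAt.mul continuousAt_const
      exact ContinuousAt.div (by fun_prop) (by fun_prop) (by positivity)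
    have h2 := this.tendsto
    simp only [sub_self, abs_zero, zero_div, mul_zero] at h2
    refine h2.congr fun t => ?_
    have : (⟨E, t⟩ : ℂ) - ⟨E, y⟩ = ((t - y : ℝ) : ℂ) * Complex.I := by
      apply Complex.ext <;> simp
    rw [this, norm_mul, Complex.norm_I, mul_one, Complex.norm_real, Real.norm_eq_abs]
  refine squeeze_zero' (Filter.Eventually.of_forall fun t => norm_nonneg _) ?_ h
  filter_upwards [lt_mem_nhds hy] with t ht
  exact norm_msc_sub_le (z := ⟨E, t⟩) (z' := ⟨E, y⟩) ht hy

theorem continuousAt_controlPi_vertical {M : ℝ} (hM : 0 < M) (E : ℝ) {y : ℝ} (hy : 0 < y) :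
    ContinuousAt (fun t : ℝ => controlPi M ⟨E, t⟩) y := by
  have h := continuousAt_msc_vertical E hy
  have h2 : ContinuousAt (fun t : ℝ => (msc ⟨E, t⟩).im) y :=
      Complex.continuous_im.continuousAt.comp h
  simp only [controlPi]
  apply ContinuousAt.add
  · apply ContinuousAt.sqrt
    exact h2.div (by fun_prop) (by positivity)
  · exact ContinuousAt.div continuousAt_const (by fun_prop) (by positivity)

/-- On the spectral domain, the operator `1 - m² S` is bounded below on `e^⊥`, with a constant
that beats the control parameter `Π`. -/
theorem domain_stable (hγ₀ : 0 < γ) (hγ₁ : γ < 1 / 2) (hN : 2 ≤ N) (hS : IsSymmStochastic S)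
    (hM : 1 ≤ invMax S) {z : ℂ} (hz : z ∈ domain γ S) {y : ℝ} (hzy : z.im ≤ y) (hy : y ≤ 10)
    (u : Fin N → ℂ) (hu : ∑ i, u i = 0) :
    controlPi (invMax S) ⟨z.re, y⟩ * ‖u‖
      ≤ 6 * (invMax S) ^ (-γ) * ‖u - msc ⟨z.re, y⟩ ^ 2 • avg S u‖ := by
  obtain ⟨-, him, hη, -⟩ := hz
  set E := z.re
  have hMp : 0 < invMax S := by linarith
  set F := {η : ℝ | 0 < η ∧ η ≤ 10 ∧ ∀ y ∈ Set.Icc η 10,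
    1 / (invMax S * η) ≤
      min ((invMax S) ^ (-γ) / (gammaTilde S ⟨E, y⟩) ^ 3)
        ((invMax S) ^ (-2 * γ) / ((gammaTilde S ⟨E, y⟩) ^ 4 * (msc ⟨E, y⟩).im))} with hF
  have hηF : etaTilde γ S E = sInf F := rfl
  have h10 : (10 : ℝ) ∈ F := ten_mem_etaTilde_set hγ₀ hγ₁ hN hS hM E
  have key : ∀ η ∈ F, ∀ t, η ≤ t → t ≤ 10 → controlPi (invMax S) ⟨E, t⟩ * ‖u‖
      ≤ 6 * (invMax S) ^ (-γ) * ‖u - msc ⟨E, t⟩ ^ 2 • avg S u‖ := by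
    intro η hη t ht ht10
    have ht0 : 0 < t := hη.1.trans_le ht
    have hz : 0 < (⟨E, t⟩ : ℂ).im := ht0
    have h1 := hη.2.2 t ⟨ht, ht10⟩
    have h2 : 1 / (invMax S * t) ≤ 1 / (invMax S * η) := by
      have := hη.1
      gcongr
    have h3 := controlPi_mul_le_of_bound (half_le_gammaTilde hN hS hz) hMp hz rfl (h2.trans h1)
    have h4 := norm_le_gammaTilde_mul hS hz u hu
    have hPi : 0 ≤ controlPi (invMax S) ⟨E, t⟩ := by
      rw [controlPi]; positivity
    calc controlPi (invMax S) ⟨E, t⟩ * ‖u‖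
        ≤ controlPi (invMax S) ⟨E, t⟩ * (gammaTilde S ⟨E, t⟩ * ‖u - msc ⟨E, t⟩ ^ 2 • avg S u‖) := by
          gcongr
      _ = (controlPi (invMax S) ⟨E, t⟩ * gammaTilde S ⟨E, t⟩) * ‖u - msc ⟨E, t⟩ ^ 2 • avg S u‖ := by
          ring
      _ ≤ _ := by gcongr
  have hlt : ∀ t, sInf F < t → t ≤ 10 → controlPi (invMax S) ⟨E, t⟩ * ‖u‖
      ≤ 6 * (invMax S) ^ (-γ) * ‖u - msc ⟨E, t⟩ ^ 2 • avg S u‖ := by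
    intro t ht ht10
    obtain ⟨η, hη, hηt⟩ := exists_lt_of_csInf_lt ⟨10, h10⟩ ht
    exact key η hη t hηt.le ht10
  have hy0 : 0 < y := him.trans_le hzy
  rw [hηF] at hη
  rcases hy.eq_or_lt with rfl | hy10
  · exact key 10 h10 10 le_rfl le_rfl
  · have hm := (continuousAt_msc_vertical E hy0)
    have hP := (continuousAt_controlPi_vertical hMp E hy0)
    have h1 : ContinuousAt (fun t : ℝ => controlPi (invMax S) ⟨E, t⟩ * ‖u‖) y :=
      hP.mul continuousAt_const
    have h2 : ContinuousAt
        (fun t : ℝ => 6 * (invMax S) ^ (-γ) * ‖u - msc ⟨E, t⟩ ^ 2 • avg S u‖) y :=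
      continuousAt_const.mul ((continuousAt_const.sub ((hm.pow 2).smul continuousAt_const)).norm)
    refine le_of_tendsto_of_tendsto (b := nhdsWithin y (Set.Ioi y))
      (h1.tendsto.mono_left nhdsWithin_le_nhds) (h2.tendsto.mono_left nhdsWithin_le_nhds) ?_
    filter_upwards [Ioo_mem_nhdsGT hy10] with t ht
    exact hlt t (lt_of_le_of_lt (hη.trans hzy) ht.1) ht.2.le

theorem controlPi_le_of_mem_domain (hγ₀ : 0 < γ) (hγ₁ : γ < 1 / 2) (hN : 2 ≤ N)
    (hS : IsSymmStochastic S) (hM : 1 ≤ invMax S) {z : ℂ} (hz : z ∈ domain γ S) :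
    controlPi (invMax S) z ≤ 12 * (invMax S) ^ (-γ) := by
  let a : Fin N := ⟨0, by omega⟩
  let b : Fin N := ⟨1, by omega⟩
  have hab : a ≠ b := by simp [a, b]
  let u : Fin N → ℂ := Pi.single a 1 - Pi.single b 1
  have hu : ∑ i, u i = 0 := by simp [u, Finset.sum_sub_distrib]
  have hne : 0 < ‖u‖ := by
    rw [norm_pos_iff]
    intro h
    have := congrFun h a
    simp [u, hab] at this
  have h := domain_stable hγ₀ hγ₁ hN hS hM hz le_rfl hz.2.2.2 u hu
  have h2 : ‖u - msc z ^ 2 • avg S u‖ ≤ 2 * ‖u‖ := by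
    calc ‖u - msc z ^ 2 • avg S u‖ ≤ ‖u‖ + ‖msc z ^ 2 • avg S u‖ := norm_sub_le _ _
      _ ≤ ‖u‖ + 1 * ‖u‖ := by
        rw [norm_smul]
        gcongr
        · exact (norm_msc_sq_lt_one hz.2.1).le
        · exact norm_avg_le hS u
      _ = 2 * ‖u‖ := by ring
  have hMp : 0 < invMax S := by linarith
  have h3 : controlPi (invMax S) z * ‖u‖ ≤ 12 * (invMax S) ^ (-γ) * ‖u‖ := by
    calc _ ≤ 6 * (invMax S) ^ (-γ) * ‖u - msc z ^ 2 • avg S u‖ := h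
      _ ≤ 6 * (invMax S) ^ (-γ) * (2 * ‖u‖) := by gcongr
      _ = _ := by ring
  exact le_of_mul_le_mul_right h3 hne

theorem domain_vertical {z : ℂ} (hz : z ∈ domain γ S) {y : ℝ} (hzy : z.im ≤ y) (hy : y ≤ 10) :
    (⟨z.re, y⟩ : ℂ) ∈ domain γ S :=
  ⟨hz.1, hz.2.1.trans_le hzy, hz.2.2.1.trans hzy, hy⟩

end Stability
end LocalSemicircle

namespace LocalSemicircle

/-! ### Resolvents of Hermitian matrices and of their minors -/

section Resolvent

variable {N : ℕ}

/-- The resolvent `(H - z)⁻¹`. -/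
noncomputable def green (H : Matrix (Fin N) (Fin N) ℂ) (z : ℂ) : Matrix (Fin N) (Fin N) ℂ :=
  (H - z • (1 : Matrix (Fin N) (Fin N) ℂ))⁻¹

/-- The matrix `H` with the rows and columns in `T` set to zero. -/
def zeroOut (H : Matrix (Fin N) (Fin N) ℂ) (T : Finset (Fin N)) : Matrix (Fin N) (Fin N) ℂ :=
  Matrix.of fun i j => if i ∈ T ∨ j ∈ T then 0 else H i j

variable {H : Matrix (Fin N) (Fin N) ℂ} {z : ℂ}

theorem zeroOut_apply (T : Finset (Fin N)) (i j : Fin N) :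
    zeroOut H T i j = if i ∈ T ∨ j ∈ T then 0 else H i j := rfl

theorem zeroOut_empty : zeroOut H ∅ = H := by
  ext i j; simp [zeroOut_apply]

theorem zeroOut_zeroOut (T : Finset (Fin N)) (a : Fin N) :
    zeroOut (zeroOut H T) {a} = zeroOut H (insert a T) := by
  ext i j
  simp only [zeroOut_apply, Finset.mem_singleton, Finset.mem_insert]
  split_ifs <;> tauto

theorem isHermitian_zeroOut (hH : H.IsHermitian) (T : Finset (Fin N)) :
    (zeroOut H T).IsHermitian := by
  ext i j
  rw [Matrix.conjTranspose_apply, zeroOut_apply, zeroOut_apply]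
  by_cases h : i ∈ T ∨ j ∈ T
  · rw [if_pos h, if_pos h.symm, star_zero]
  · rw [if_neg h, if_neg (fun h' => h h'.symm), hH.apply]

theorem exists_spectral_rep (hH : H.IsHermitian) :
    ∃ (l : Fin N → ℝ) (U : Matrix (Fin N) (Fin N) ℂ),
      (∀ i, ∑ k, ‖U i k‖ ^ 2 = 1) ∧ ∀ z : ℂ, 0 < z.im →
        (H - z • (1 : Matrix (Fin N) (Fin N) ℂ)) * green H z = 1 ∧
        ∀ i, green H z i i = ∑ k, ((‖U i k‖ ^ 2 : ℝ) : ℂ) / ((l k : ℂ) - z) := by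
  set U : Matrix (Fin N) (Fin N) ℂ := (hH.eigenvectorUnitary : Matrix (Fin N) (Fin N) ℂ) with hU
  have hUU : U * star U = 1 := Matrix.mem_unitaryGroup_iff.1 hH.eigenvectorUnitary.2
  have hUU' : star U * U = 1 := Matrix.mem_unitaryGroup_iff'.1 hH.eigenvectorUnitary.2
  have hsp : H = U * Matrix.diagonal (fun k => (hH.eigenvalues k : ℂ)) * star U := by
    have := hH.spectral_theorem
    rw [Unitary.conjStarAlgAut_apply] at this
    exact this
  refine ⟨hH.eigenvalues, U, fun i => ?_, fun z hz => ?_⟩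
  · have h1 := congrFun (congrFun hUU i) i
    rw [Matrix.mul_apply, Matrix.one_apply_eq] at h1
    have : ((∑ k, ‖U i k‖ ^ 2 : ℝ) : ℂ) = 1 := by
      rw [← h1]
      push_cast
      refine Finset.sum_congr rfl fun k _ => ?_
      rw [Matrix.star_apply, Complex.star_def, Complex.mul_conj, Complex.normSq_eq_norm_sq]
      push_cast; rfl
    exact_mod_cast this
  · set D : Matrix (Fin N) (Fin N) ℂ :=
      Matrix.diagonal fun k => ((hH.eigenvalues k : ℂ) - z)⁻¹ with hD
    have h1 : (H - z • (1 : Matrix (Fin N) (Fin N) ℂ)) * (U * D * star U) = 1 := by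
      have hz1 : H - z • (1 : Matrix (Fin N) (Fin N) ℂ)
          = U * Matrix.diagonal (fun k => (hH.eigenvalues k : ℂ) - z) * star U := by
        have : Matrix.diagonal (fun k => (hH.eigenvalues k : ℂ) - z)
            = Matrix.diagonal (fun k => (hH.eigenvalues k : ℂ))
              - z • (1 : Matrix (Fin N) (Fin N) ℂ) := by
          ext i j
          by_cases h : i = j <;> simp [h]
        rw [this, mul_sub, sub_mul, ← hsp, mul_smul_comm, smul_mul_assoc, mul_one, hUU]
      rw [hz1]
      calc _ = U * Matrix.diagonal (fun k => (hH.eigenvalues k : ℂ) - z) * (star U * U) * D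
            * star U := by simp only [Matrix.mul_assoc]
        _ = U * (Matrix.diagonal (fun k => (hH.eigenvalues k : ℂ) - z) * D) * star U := by
          rw [hUU', mul_one, Matrix.mul_assoc U]
        _ = 1 := by
          rw [hD, Matrix.diagonal_mul_diagonal]
          have : (fun k => ((hH.eigenvalues k : ℂ) - z) * ((hH.eigenvalues k : ℂ) - z)⁻¹)
              = fun _ => 1 := by
            ext k; exact mul_inv_cancel₀ (ofReal_sub_ne_zero hz _)
          rw [this, Matrix.diagonal_one, mul_one, hUU]
    have h2 : green H z = U * D * star U := Matrix.inv_eq_right_inv h1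
    refine ⟨by rw [h2, h1], fun i => ?_⟩
    rw [h2, Matrix.mul_apply]
    refine Finset.sum_congr rfl fun k _ => ?_
    rw [hD, Matrix.mul_diagonal, Matrix.star_apply, Complex.star_def, mul_right_comm,
      Complex.mul_conj, Complex.normSq_eq_norm_sq]
    push_cast
    rw [div_eq_mul_inv]

theorem sub_mul_green (hH : H.IsHermitian) (hz : 0 < z.im) :
    (H - z • (1 : Matrix (Fin N) (Fin N) ℂ)) * green H z = 1 := by
  obtain ⟨_, _, _, h⟩ := exists_spectral_rep hH
  exact (h z hz).1

theorem green_mul_sub (hH : H.IsHermitian) (hz : 0 < z.im) :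
    green H z * (H - z • (1 : Matrix (Fin N) (Fin N) ℂ)) = 1 :=
  mul_eq_one_comm.1 (sub_mul_green hH hz)

theorem inv_sub_im {x : ℝ} {z : ℂ} : (1 / ((x : ℂ) - z)).im = z.im / ‖(x : ℂ) - z‖ ^ 2 := by
  rw [one_div, Complex.inv_im, Complex.normSq_eq_norm_sq]
  simp

theorem green_diag_im (hH : H.IsHermitian) : ∃ (l : Fin N → ℝ) (p : Fin N → Fin N → ℝ),
    (∀ i k, 0 ≤ p i k) ∧ (∀ i, ∑ k, p i k = 1) ∧ ∀ z : ℂ, 0 < z.im → ∀ i,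
      green H z i i = ∑ k, (p i k : ℂ) * (1 / ((l k : ℂ) - z)) ∧
      (green H z i i).im = ∑ k, p i k * (z.im / ‖(l k : ℂ) - z‖ ^ 2) := by
  obtain ⟨l, U, h1, h2⟩ := exists_spectral_rep hH
  refine ⟨l, fun i k => ‖U i k‖ ^ 2, fun i k => by positivity, h1, fun z hz i => ?_⟩
  have h3 : green H z i i = ∑ k, ((‖U i k‖ ^ 2 : ℝ) : ℂ) * (1 / ((l k : ℂ) - z)) := by
    rw [(h2 z hz).2 i]
    exact Finset.sum_congr rfl fun k _ => by rw [mul_one_div]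
  refine ⟨h3, ?_⟩
  rw [h3, Complex.im_sum]
  exact Finset.sum_congr rfl fun k _ => by rw [Complex.im_ofReal_mul, inv_sub_im]

theorem im_le_norm_ofReal_sub (hz : 0 < z.im) (x : ℝ) : z.im ≤ ‖(x : ℂ) - z‖ := by
  have := Complex.abs_im_le_norm ((x : ℂ) - z)
  simp at this
  rwa [abs_of_pos hz] at this

theorem green_diag_im_pos (hH : H.IsHermitian) (hz : 0 < z.im) (i : Fin N) :
    0 < (green H z i i).im := by
  obtain ⟨l, p, hp0, hp1, h⟩ := green_diag_im hH
  rw [(h z hz i).2]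
  have hpos : ∀ k, 0 < z.im / ‖(l k : ℂ) - z‖ ^ 2 := fun k => by
    have := norm_pos_iff.2 (ofReal_sub_ne_zero hz (l k)); positivity
  obtain ⟨k, hk⟩ : ∃ k, 0 < p i k := by
    by_contra hc
    push Not at hc
    have : ∑ k, p i k ≤ 0 := Finset.sum_nonpos fun k _ => hc k
    rw [hp1] at this; linarith
  exact Finset.sum_pos' (fun k _ => mul_nonneg (hp0 i k) (hpos k).le)
    ⟨k, Finset.mem_univ _, mul_pos hk (hpos k)⟩

theorem green_diag_ne_zero (hH : H.IsHermitian) (hz : 0 < z.im) (i : Fin N) :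
    green H z i i ≠ 0 := by
  intro h
  have := green_diag_im_pos hH hz i
  rw [h] at this
  simp at this

theorem norm_green_diag_le (hH : H.IsHermitian) (hz : 0 < z.im) (i : Fin N) :
    ‖green H z i i‖ ≤ 1 / z.im := by
  obtain ⟨l, p, hp0, hp1, h⟩ := green_diag_im hH
  rw [(h z hz i).1]
  refine norm_sum_mul_le_of_sum_le_one _ (fun k _ => hp0 i k) (hp1 i).le (by positivity)
    fun k _ => ?_
  rw [norm_div, norm_one]
  exact one_div_le_one_div_of_le hz (im_le_norm_ofReal_sub hz _)

theorem norm_green_diag_sub_le (hH : H.IsHermitian) {z' : ℂ} (hz : 0 < z.im) (hz' : 0 < z'.im)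
    (i : Fin N) : ‖green H z i i - green H z' i i‖ ≤ ‖z - z'‖ / (z.im * z'.im) := by
  obtain ⟨l, p, hp0, hp1, h⟩ := green_diag_im hH
  rw [(h z hz i).1, (h z' hz' i).1, ← Finset.sum_sub_distrib]
  simp only [← mul_sub]
  refine norm_sum_mul_le_of_sum_le_one _ (fun k _ => hp0 i k) (hp1 i).le (by positivity)
    fun k _ => ?_
  have h1 := ofReal_sub_ne_zero hz (l k)
  have h2 := ofReal_sub_ne_zero hz' (l k)
  have h3 : 1 / ((l k : ℂ) - z) - 1 / ((l k : ℂ) - z')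
      = (z - z') / (((l k : ℂ) - z) * ((l k : ℂ) - z')) := by
    field_simp; ring
  rw [h3, norm_div, norm_mul]
  gcongr
  · exact im_le_norm_ofReal_sub hz _
  · exact im_le_norm_ofReal_sub hz' _

theorem mul_norm_sub_vertical_le (E : ℝ) {y y' : ℝ} (hy : 0 < y) (hyy' : y ≤ y') (x : ℝ) :
    y * ‖(x : ℂ) - ⟨E, y'⟩‖ ≤ y' * ‖(x : ℂ) - ⟨E, y⟩‖ := by
  have hy' : 0 < y' := hy.trans_le hyy'
  apply le_of_sq_le_sq _ (by positivity)
  rw [mul_pow, mul_pow, ← Complex.normSq_eq_norm_sq, ← Complex.normSq_eq_norm_sq,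
    Complex.normSq_apply, Complex.normSq_apply]
  simp
  have : y ^ 2 ≤ y' ^ 2 := by gcongr
  nlinarith [mul_nonneg (sub_nonneg.2 this) (sq_nonneg (x - E))]

theorem green_diag_im_vertical (hH : H.IsHermitian) (E : ℝ) {y y' : ℝ} (hy : 0 < y)
    (hyy' : y ≤ y') (i : Fin N) :
    y * (green H ⟨E, y⟩ i i).im ≤ y' * (green H ⟨E, y'⟩ i i).im := by
  have hy' : 0 < y' := hy.trans_le hyy'
  obtain ⟨l, p, hp0, hp1, h⟩ := green_diag_im hH
  rw [(h ⟨E, y⟩ hy i).2, (h ⟨E, y'⟩ hy' i).2, Finset.mul_sum, Finset.mul_sum]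
  refine Finset.sum_le_sum fun k _ => ?_
  have h1 := norm_pos_iff.2 (ofReal_sub_ne_zero (z := ⟨E, y⟩) hy (l k))
  have h2 := norm_pos_iff.2 (ofReal_sub_ne_zero (z := ⟨E, y'⟩) hy' (l k))
  have h3 := mul_norm_sub_vertical_le E hy hyy' (l k)
  simp only
  rw [mul_left_comm, mul_left_comm y']
  refine mul_le_mul_of_nonneg_left ?_ (hp0 i k)
  rw [mul_div_assoc', mul_div_assoc', div_le_div_iff₀ (by positivity) (by positivity)]
  calc y * y * ‖(l k : ℂ) - ⟨E, y'⟩‖ ^ 2 = (y * ‖(l k : ℂ) - ⟨E, y'⟩‖) ^ 2 := by ring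
    _ ≤ (y' * ‖(l k : ℂ) - ⟨E, y⟩‖) ^ 2 := by gcongr
    _ = _ := by ring

theorem norm_green_diag_sub_vertical_le (hH : H.IsHermitian) (E : ℝ) {y y' : ℝ} (hy : 0 < y)
    (hyy' : y ≤ y') (i : Fin N) :
    ‖green H ⟨E, y⟩ i i - green H ⟨E, y'⟩ i i‖ ≤ y' / y * (green H ⟨E, y'⟩ i i).im := by
  have hy' : 0 < y' := hy.trans_le hyy'
  obtain ⟨l, p, hp0, hp1, h⟩ := green_diag_im hH
  rw [(h ⟨E, y'⟩ hy' i).2, (h ⟨E, y⟩ hy i).1, (h ⟨E, y'⟩ hy' i).1, ← Finset.sum_sub_distrib,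
    Finset.mul_sum]
  refine norm_sum_le_of_le _ fun k _ => ?_
  have h1 := ofReal_sub_ne_zero (z := ⟨E, y⟩) hy (l k)
  have h2 := ofReal_sub_ne_zero (z := ⟨E, y'⟩) hy' (l k)
  have h1' := norm_pos_iff.2 h1
  have h2' := norm_pos_iff.2 h2
  have h3 := mul_norm_sub_vertical_le E hy hyy' (l k)
  rw [← mul_sub, norm_mul, Complex.norm_real, Real.norm_of_nonneg (hp0 i k), mul_left_comm]
  refine mul_le_mul_of_nonneg_left ?_ (hp0 i k)
  have h4 : 1 / ((l k : ℂ) - ⟨E, y⟩) - 1 / ((l k : ℂ) - ⟨E, y'⟩)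
      = (((⟨E, y⟩ : ℂ) - ⟨E, y'⟩)) / (((l k : ℂ) - ⟨E, y⟩) * ((l k : ℂ) - ⟨E, y'⟩)) := by
    field_simp; ring
  have h5 : ‖(⟨E, y⟩ : ℂ) - ⟨E, y'⟩‖ ≤ y' := by
    have : (⟨E, y⟩ : ℂ) - ⟨E, y'⟩ = ((y - y' : ℝ) : ℂ) * Complex.I := by
      apply Complex.ext <;> simp
    rw [this, norm_mul, Complex.norm_I, mul_one, Complex.norm_real, Real.norm_eq_abs,
      abs_of_nonpos (by linarith)]
    linarith
  rw [h4, norm_div, norm_mul]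
  simp only
  rw [div_mul_div_comm, div_le_div_iff₀ (by positivity) (by positivity)]
  calc ‖(⟨E, y⟩ : ℂ) - ⟨E, y'⟩‖ * (y * ‖(l k : ℂ) - ⟨E, y'⟩‖ ^ 2)
      ≤ y' * ((y * ‖(l k : ℂ) - ⟨E, y'⟩‖) * ‖(l k : ℂ) - ⟨E, y'⟩‖) := by
        rw [pow_two, mul_assoc]; gcongr
    _ ≤ y' * ((y' * ‖(l k : ℂ) - ⟨E, y⟩‖) * ‖(l k : ℂ) - ⟨E, y'⟩‖) := by gcongr
    _ = _ := by ring

theorem conjTranspose_green_mul (hH : H.IsHermitian) (hz : 0 < z.im) :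
    green H z - (green H z).conjTranspose
      = (2 * z.im * Complex.I : ℂ) • (green H z * (green H z).conjTranspose) ∧
    green H z - (green H z).conjTranspose
      = (2 * z.im * Complex.I : ℂ) • ((green H z).conjTranspose * green H z) := by
  set G := green H z
  have h1 := sub_mul_green hH hz
  have h2 := green_mul_sub hH hz
  have h3 := congrArg Matrix.conjTranspose h1
  have h4 := congrArg Matrix.conjTranspose h2
  have hA : (H - z • (1 : Matrix (Fin N) (Fin N) ℂ)).conjTranspose
      = (H - z • (1 : Matrix (Fin N) (Fin N) ℂ)) + (2 * z.im * Complex.I : ℂ) • 1 := by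
    rw [Matrix.conjTranspose_sub, hH.eq, Matrix.conjTranspose_smul, Matrix.conjTranspose_one,
      sub_add, ← sub_smul]
    congr 2
    apply Complex.ext <;> simp
    ring
  rw [Matrix.conjTranspose_mul, Matrix.conjTranspose_one, hA] at h3 h4
  constructor
  · calc G - G.conjTranspose
        = G * (((H - z • (1 : Matrix (Fin N) (Fin N) ℂ))
            + (2 * z.im * Complex.I : ℂ) • 1) * G.conjTranspose)
          - (G * (H - z • (1 : Matrix (Fin N) (Fin N) ℂ))) * G.conjTranspose := by
          rw [h4, h2, mul_one, one_mul]
      _ = _ := by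
          rw [add_mul, mul_add, ← mul_assoc, add_sub_cancel_left, smul_mul_assoc, one_mul,
            mul_smul_comm]
  · calc G - G.conjTranspose
        = (G.conjTranspose * ((H - z • (1 : Matrix (Fin N) (Fin N) ℂ))
            + (2 * z.im * Complex.I : ℂ) • 1)) * G
          - G.conjTranspose * ((H - z • (1 : Matrix (Fin N) (Fin N) ℂ)) * G) := by
          rw [h3, h1, mul_one, one_mul]
      _ = _ := by
          rw [mul_add, add_mul, mul_assoc, add_sub_cancel_left, mul_smul_comm, mul_one,
            smul_mul_assoc]

theorem sum_norm_sq_green_row (hH : H.IsHermitian) (hz : 0 < z.im) (i : Fin N) :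
    ∑ k, ‖green H z i k‖ ^ 2 = (green H z i i).im / z.im := by
  have h := congrArg Complex.im (congrFun (congrFun (conjTranspose_green_mul hH hz).1 i) i)
  simp only [Matrix.sub_apply, Matrix.smul_apply, Matrix.mul_apply, Matrix.conjTranspose_apply,
    Complex.star_def, Complex.mul_conj, smul_eq_mul] at h
  rw [← Complex.ofReal_sum] at h
  simp only [Complex.normSq_eq_norm_sq] at h
  generalize ∑ k, ‖green H z i k‖ ^ 2 = r at h ⊢
  simp at h
  rw [eq_div_iff hz.ne']
  linarith

theorem sum_norm_sq_green_col (hH : H.IsHermitian) (hz : 0 < z.im) (i : Fin N) :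
    ∑ k, ‖green H z k i‖ ^ 2 = (green H z i i).im / z.im := by
  have h := congrArg Complex.im (congrFun (congrFun (conjTranspose_green_mul hH hz).2 i) i)
  simp only [Matrix.sub_apply, Matrix.smul_apply, Matrix.mul_apply, Matrix.conjTranspose_apply,
    Complex.star_def, mul_comm ((starRingEnd ℂ) _), Complex.mul_conj, smul_eq_mul] at h
  rw [← Complex.ofReal_sum] at h
  simp only [Complex.normSq_eq_norm_sq] at h
  generalize ∑ k, ‖green H z k i‖ ^ 2 = r at h ⊢
  simp at h
  rw [eq_div_iff hz.ne']
  linarith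

theorem norm_green_le (hH : H.IsHermitian) (hz : 0 < z.im) (i j : Fin N) :
    ‖green H z i j‖ ≤ 1 / z.im := by
  apply le_of_sq_le_sq _ (by positivity)
  calc ‖green H z i j‖ ^ 2 ≤ ∑ k, ‖green H z i k‖ ^ 2 :=
        Finset.single_le_sum (f := fun k => ‖green H z i k‖ ^ 2) (fun _ _ => by positivity)
          (Finset.mem_univ j)
    _ = (green H z i i).im / z.im := sum_norm_sq_green_row hH hz i
    _ ≤ (1 / z.im) / z.im := by
        gcongr
        exact (Complex.im_le_norm _).trans (norm_green_diag_le hH hz i)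
    _ = _ := by field_simp

theorem green_zeroOut_of_mem_right (hH : H.IsHermitian) (hz : 0 < z.im) {T : Finset (Fin N)}
    {j : Fin N} (hj : j ∈ T) (i : Fin N) :
    green (zeroOut H T) z i j = if i = j then -z⁻¹ else 0 := by
  have hz0 : z ≠ 0 := by rintro rfl; simp at hz
  have h := congrFun (congrFun (green_mul_sub (isHermitian_zeroOut hH T) hz) i) j
  rw [mul_sub, Matrix.sub_apply, Matrix.mul_apply, Finset.sum_eq_zero, mul_smul_comm, mul_one,
    Matrix.smul_apply, Matrix.one_apply, smul_eq_mul] at h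
  · split_ifs at h ⊢
    · field_simp; linear_combination -h
    · simpa [hz0] using h
  · intro k _
    rw [zeroOut_apply, if_pos (Or.inr hj), mul_zero]

theorem green_sub_green (hH : H.IsHermitian) {H' : Matrix (Fin N) (Fin N) ℂ}
    (hH' : H'.IsHermitian) (hz : 0 < z.im) :
    green H z - green H' z = -(green H' z * (H - H') * green H z) := by
  have h1 := sub_mul_green hH hz
  have h2 := green_mul_sub hH' hz
  have h3 : H - H' = (H - z • (1 : Matrix (Fin N) (Fin N) ℂ))
      - (H' - z • (1 : Matrix (Fin N) (Fin N) ℂ)) := by abel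
  rw [h3, mul_sub, sub_mul, mul_assoc, h1, h2, mul_one, one_mul]
  abel

theorem sum_row_sub_zeroOut (a : Fin N) (u w : Fin N → ℂ) (hu : u a = 0) :
    ∑ l, (∑ k, u k * (H - zeroOut H {a}) k l) * w l
      = (∑ k ∈ Finset.univ.erase a, u k * H k a) * w a := by
  rw [Finset.sum_eq_single a]
  · congr 1
    rw [← Finset.add_sum_erase _ _ (Finset.mem_univ a), hu, zero_mul, zero_add]
    refine Finset.sum_congr rfl fun k hk => ?_
    rw [Matrix.sub_apply, zeroOut_apply, if_pos (Or.inr (by simp)), sub_zero]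
  · intro l _ hl
    rw [Finset.sum_eq_zero, zero_mul]
    intro k _
    by_cases hk : k = a
    · rw [hk, hu, zero_mul]
    · rw [Matrix.sub_apply, zeroOut_apply, if_neg (by simp [hk, hl]), sub_self, mul_zero]
  · simp

theorem green_sub_green_zeroOut (hH : H.IsHermitian) (hz : 0 < z.im) {a i : Fin N} (hi : i ≠ a)
    (j : Fin N) : green H z i j - green (zeroOut H {a}) z i j
      = -((∑ k ∈ Finset.univ.erase a, green (zeroOut H {a}) z i k * H k a) * green H z a j) := by
  have h := congrFun (congrFun (green_sub_green hH (isHermitian_zeroOut hH {a}) hz) i) j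
  rw [Matrix.sub_apply, Matrix.neg_apply, Matrix.mul_apply] at h
  simp only [Matrix.mul_apply (M := green (zeroOut H {a}) z)] at h
  rw [h, sum_row_sub_zeroOut a (fun k => green (zeroOut H {a}) z i k) (fun l => green H z l j)]
  rw [green_zeroOut_of_mem_right hH hz (by simp), if_neg hi]

theorem green_off_col (hH : H.IsHermitian) (hz : 0 < z.im) {a i : Fin N} (hi : i ≠ a) :
    green H z i a
      = -((∑ k ∈ Finset.univ.erase a, green (zeroOut H {a}) z i k * H k a) * green H z a a) := by
  rw [← green_sub_green_zeroOut hH hz hi, green_zeroOut_of_mem_right hH hz (by simp), if_neg hi,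
    sub_zero]

theorem green_sub_minor (hH : H.IsHermitian) (hz : 0 < z.im) {a i j : Fin N} (hi : i ≠ a) :
    green H z i j - green (zeroOut H {a}) z i j
      = green H z i a * green H z a j * (green H z a a)⁻¹ := by
  have h0 := green_diag_ne_zero hH hz a
  rw [green_sub_green_zeroOut hH hz hi, green_off_col hH hz hi]
  field_simp

theorem green_schur (hH : H.IsHermitian) (hz : 0 < z.im) (a : Fin N) :
    (green H z a a)⁻¹ = H a a - z - ∑ k ∈ Finset.univ.erase a, ∑ l ∈ Finset.univ.erase a,
      H a k * green (zeroOut H {a}) z k l * H l a := by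
  have h0 := green_diag_ne_zero hH hz a
  have h := congrFun (congrFun (sub_mul_green hH hz) a) a
  rw [sub_mul, Matrix.sub_apply, Matrix.mul_apply, smul_mul_assoc, one_mul, Matrix.smul_apply,
    Matrix.one_apply_eq, smul_eq_mul, ← Finset.add_sum_erase _ _ (Finset.mem_univ a)] at h
  have h2 : ∑ k ∈ Finset.univ.erase a, H a k * green H z k a
      = -((∑ k ∈ Finset.univ.erase a, ∑ l ∈ Finset.univ.erase a,
      H a k * green (zeroOut H {a}) z k l * H l a) * green H z a a) := by
    rw [Finset.sum_mul, ← Finset.sum_neg_distrib]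
    refine Finset.sum_congr rfl fun k hk => ?_
    rw [green_off_col hH hz (Finset.ne_of_mem_erase hk), mul_neg, ← mul_assoc, Finset.mul_sum]
    simp only [mul_assoc]
  rw [h2] at h
  rw [inv_eq_iff_eq_inv, eq_comm, inv_eq_iff_eq_inv, eq_comm, ← one_div, div_eq_iff h0]
  linear_combination -h

theorem sum_minor_diag (hH : H.IsHermitian) (hz : 0 < z.im) (s : Fin N → ℝ) (i : Fin N) :
    ∑ k ∈ Finset.univ.erase i, (s k : ℂ) * green (zeroOut H {i}) z k k
      = ∑ k, (s k : ℂ) * green H z k k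
        - (∑ k, (s k : ℂ) * (green H z i k * green H z k i)) * (green H z i i)⁻¹ := by
  have h0 := green_diag_ne_zero hH hz i
  rw [Finset.sum_mul, ← Finset.sum_sub_distrib,
    ← Finset.add_sum_erase Finset.univ _ (Finset.mem_univ i)]
  have h1 : (s i : ℂ) * green H z i i - (s i : ℂ) * (green H z i i * green H z i i)
      * (green H z i i)⁻¹ = 0 := by field_simp; ring
  rw [h1, zero_add]
  refine Finset.sum_congr rfl fun k hk => ?_
  have := green_sub_minor hH hz (j := k) (Finset.ne_of_mem_erase hk)
  linear_combination (-(s k : ℂ)) * this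

end Resolvent
end LocalSemicircle

namespace LocalSemicircle

/-! ### Moment bounds for linear and quadratic forms of independent variables -/

section Moments

variable {Ω : Type*} [MeasurableSpace Ω] {P : Measure Ω} [IsProbabilityMeasure P]

/-- `f` has finite moments of all orders. -/
def HasAllMoments (P : Measure Ω) (f : Ω → ℂ) : Prop := ∀ p : ℕ, MemLp f p P

namespace HasAllMoments

variable {f g : Ω → ℂ}

theorem aesm (hf : HasAllMoments P f) : AEStronglyMeasurable f P := (hf 0).1

theorem integrable (hf : HasAllMoments P f) : Integrable f P := by
  have := hf 1
  rwa [Nat.cast_one, memLp_one_iff_integrable] at this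

theorem integrable_norm_pow (hf : HasAllMoments P f) (n : ℕ) :
    Integrable (fun ω => ‖f ω‖ ^ n) P := (hf n).integrable_norm_pow'

theorem of_bound {C : ℝ} (hf : AEStronglyMeasurable f P) (hC : ∀ ω, ‖f ω‖ ≤ C) :
    HasAllMoments P f := fun p => MemLp.of_bound hf C (Filter.Eventually.of_forall hC)

theorem const (c : ℂ) : HasAllMoments P fun _ => c := fun p => memLp_const c

theorem add (hf : HasAllMoments P f) (hg : HasAllMoments P g) :
    HasAllMoments P fun ω => f ω + g ω := fun p => (hf p).add (hg p)

theorem sub (hf : HasAllMoments P f) (hg : HasAllMoments P g) :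
    HasAllMoments P fun ω => f ω - g ω := fun p => (hf p).sub (hg p)

theorem mul (hf : HasAllMoments P f) (hg : HasAllMoments P g) :
    HasAllMoments P fun ω => f ω * g ω := by
  intro p
  rcases Nat.eq_zero_or_pos p with rfl | hp
  · rw [Nat.cast_zero, memLp_zero_iff_aestronglyMeasurable]
    exact hf.aesm.mul hg.aesm
  · have : ENNReal.HolderTriple ((2 * p : ℕ) : ENNReal) ((2 * p : ℕ) : ENNReal) (p : ENNReal) := by
      constructor
      push_cast
      rw [ENNReal.mul_inv (Or.inl (by norm_num)) (Or.inl (by norm_num)), ← add_mul,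
        ENNReal.inv_two_add_inv_two, one_mul]
    exact (hg (2 * p)).mul (hf (2 * p))

theorem conj (hf : HasAllMoments P f) : HasAllMoments P fun ω => (starRingEnd ℂ) (f ω) :=
  fun p => (hf p).star

theorem pow (hf : HasAllMoments P f) (n : ℕ) : HasAllMoments P fun ω => f ω ^ n := by
  induction n with
  | zero => simpa using const 1
  | succ n ih => simpa [pow_succ] using ih.mul hf

theorem sum {ι : Type*} (s : Finset ι) {f : ι → Ω → ℂ} (hf : ∀ i ∈ s, HasAllMoments P (f i)) :
    HasAllMoments P fun ω => ∑ i ∈ s, f i ω := fun p => memLp_finsetSum s fun i hi => hf i hi p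

end HasAllMoments

/-- The derivative-like factor `y ↦ |y|^{2r} ȳ` of `|y|^{2r+2}`. -/
noncomputable def dualPow (r : ℕ) (y : ℂ) : ℂ := (starRingEnd ℂ) y * ((starRingEnd ℂ) y * y) ^ r

theorem mul_dualPow (r : ℕ) (y : ℂ) : y * dualPow r y = ((‖y‖ ^ (2 * r + 2) : ℝ) : ℂ) := by
  have h : (starRingEnd ℂ) y * y = ((‖y‖ ^ 2 : ℝ) : ℂ) := by
    rw [mul_comm, Complex.mul_conj, Complex.normSq_eq_norm_sq]
  rw [dualPow, ← mul_assoc, mul_comm y, h]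
  push_cast
  ring

theorem norm_dualPow (r : ℕ) (y : ℂ) : ‖dualPow r y‖ = ‖y‖ ^ (2 * r + 1) := by
  rw [dualPow, norm_mul, norm_pow, norm_mul, RCLike.norm_conj]; ring

theorem norm_dualPow_sub_le (r : ℕ) {a b : ℂ} {m : ℝ} (ha : ‖a‖ ≤ m) (hb : ‖b‖ ≤ m) :
    ‖dualPow r a - dualPow r b‖ ≤ (2 * r + 1) * m ^ (2 * r) * ‖a - b‖ := by
  have hm : 0 ≤ m := (norm_nonneg a).trans ha
  induction r with
  | zero => simp [dualPow, ← map_sub]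
  | succ r ih =>
    have h1 : ∀ y : ℂ, dualPow (r + 1) y = dualPow r y * ((starRingEnd ℂ) y * y) := by
      intro y; simp only [dualPow, pow_succ]; ring
    have h2 : dualPow (r + 1) a - dualPow (r + 1) b
        = (dualPow r a - dualPow r b) * ((starRingEnd ℂ) a * a)
          + dualPow r b * ((starRingEnd ℂ) a * (a - b) + (starRingEnd ℂ) (a - b) * b) := by
      rw [h1, h1, map_sub]; ring
    rw [h2]
    calc _ ≤ ‖dualPow r a - dualPow r b‖ * (‖a‖ * ‖a‖)
          + ‖dualPow r b‖ * (‖a‖ * ‖a - b‖ + ‖a - b‖ * ‖b‖) := by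
          refine (norm_add_le _ _).trans (add_le_add ?_ ?_)
          · rw [norm_mul, norm_mul, RCLike.norm_conj]
          · rw [norm_mul]
            refine mul_le_mul_of_nonneg_left ((norm_add_le _ _).trans ?_) (norm_nonneg _)
            rw [norm_mul, norm_mul, RCLike.norm_conj, RCLike.norm_conj]
      _ ≤ ((2 * r + 1) * m ^ (2 * r) * ‖a - b‖) * (m * m)
          + m ^ (2 * r + 1) * (m * ‖a - b‖ + ‖a - b‖ * m) := by
          rw [norm_dualPow]
          gcongr
      _ = _ := by push_cast; ring

theorem mul_mul_pow_le {a b c : ℝ} (ha : 0 ≤ a) (hb : 0 ≤ b) (hc : 0 ≤ c) (r : ℕ) :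
    a * b * c ^ (2 * r) ≤ a ^ (2 * r + 2) + b ^ (2 * r + 2) + c ^ (2 * r + 2) := by
  set m := max a (max b c) with hm
  have h1 : a ≤ m := le_max_left _ _
  have h2 : b ≤ m := (le_max_left _ _).trans (le_max_right _ _)
  have h3 : c ≤ m := (le_max_right _ _).trans (le_max_right _ _)
  have hm0 : 0 ≤ m := ha.trans h1
  calc a * b * c ^ (2 * r) ≤ m * m * m ^ (2 * r) := by gcongr
    _ = m ^ (2 * r + 2) := by ring
    _ ≤ _ := by
      have ea : 0 ≤ a ^ (2 * r + 2) := by positivity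
      have eb : 0 ≤ b ^ (2 * r + 2) := by positivity
      have ec : 0 ≤ c ^ (2 * r + 2) := by positivity
      rcases max_choice a (max b c) with h | h
      · rw [← hm] at h; rw [h]; linarith
      · rcases max_choice b c with h' | h'
        · rw [← hm, h'] at h; rw [h]; linarith
        · rw [← hm, h'] at h; rw [h]; linarith

theorem ae_eq_zero_of_integral_pow {U : Ω → ℂ} {r : ℕ} (hU : HasAllMoments P U)
    (h : ∫ ω, ‖U ω‖ ^ (2 * r + 2) ∂P ≤ 0) : ∀ᵐ ω ∂P, U ω = 0 := by
  have h0 : ∫ ω, ‖U ω‖ ^ (2 * r + 2) ∂P = 0 :=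
    le_antisymm h (integral_nonneg fun ω => by positivity)
  rw [integral_eq_zero_iff_of_nonneg (fun ω => by positivity) (hU.integrable_norm_pow _)] at h0
  filter_upwards [h0] with ω hω
  simpa using hω

theorem integral_mul_mul_pow_le {U D Z : Ω → ℂ} {r : ℕ} (hU : HasAllMoments P U)
    (hD : HasAllMoments P D) (hZ : HasAllMoments P Z) {u b c Q : ℝ} (hu : 0 ≤ u) (hb : 0 ≤ b)
    (hQ : 0 < Q)
    (hU' : ∫ ω, ‖U ω‖ ^ (2 * r + 2) ∂P ≤ c * u ^ (2 * r + 2))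
    (hD' : ∫ ω, ‖D ω‖ ^ (2 * r + 2) ∂P ≤ c * b ^ (2 * r + 2)) :
    ∫ ω, ‖U ω‖ * ‖D ω‖ * ‖Z ω‖ ^ (2 * r) ∂P
      ≤ u * b * Q ^ (2 * r) * (2 * c + (∫ ω, ‖Z ω‖ ^ (2 * r + 2) ∂P) / Q ^ (2 * r + 2)) := by
  rcases hu.eq_or_lt with rfl | hu
  · have h0 := ae_eq_zero_of_integral_pow hU (by simpa using hU')
    rw [integral_eq_zero_of_ae (by filter_upwards [h0] with ω hω; simp [hω])]
    simp
  rcases hb.eq_or_lt with rfl | hb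
  · have h0 := ae_eq_zero_of_integral_pow hD (by simpa using hD')
    rw [integral_eq_zero_of_ae (by filter_upwards [h0] with ω hω; simp [hω])]
    simp
  have hpt : ∀ ω, ‖U ω‖ * ‖D ω‖ * ‖Z ω‖ ^ (2 * r) ≤ u * b * Q ^ (2 * r) *
      (‖U ω‖ ^ (2 * r + 2) / u ^ (2 * r + 2) + ‖D ω‖ ^ (2 * r + 2) / b ^ (2 * r + 2)
        + ‖Z ω‖ ^ (2 * r + 2) / Q ^ (2 * r + 2)) := by
    intro ω
    have := mul_mul_pow_le (a := ‖U ω‖ / u) (b := ‖D ω‖ / b) (c := ‖Z ω‖ / Q) (by positivity)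
      (by positivity) (by positivity) r
    simp only [div_pow] at this
    calc ‖U ω‖ * ‖D ω‖ * ‖Z ω‖ ^ (2 * r)
        = u * b * Q ^ (2 * r) * (‖U ω‖ / u * (‖D ω‖ / b) * (‖Z ω‖ ^ (2 * r) / Q ^ (2 * r))) := by
          field_simp
      _ ≤ _ := by gcongr
  have i1 := (hU.integrable_norm_pow (2 * r + 2)).div_const (u ^ (2 * r + 2))
  have i2 := (hD.integrable_norm_pow (2 * r + 2)).div_const (b ^ (2 * r + 2))
  have i3 := (hZ.integrable_norm_pow (2 * r + 2)).div_const (Q ^ (2 * r + 2))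
  have iL : Integrable (fun ω => ‖U ω‖ * ‖D ω‖ * ‖Z ω‖ ^ (2 * r)) P := by
    have := ((hU.mul hD).mul (hZ.pow (2 * r))).integrable.norm
    simpa [norm_mul, norm_pow] using this
  calc _ ≤ ∫ ω, u * b * Q ^ (2 * r) *
      (‖U ω‖ ^ (2 * r + 2) / u ^ (2 * r + 2) + ‖D ω‖ ^ (2 * r + 2) / b ^ (2 * r + 2)
        + ‖Z ω‖ ^ (2 * r + 2) / Q ^ (2 * r + 2)) ∂P :=
        integral_mono iL (((i1.add i2).add i3).const_mul _) hpt
    _ = u * b * Q ^ (2 * r) * ((∫ ω, ‖U ω‖ ^ (2 * r + 2) ∂P) / u ^ (2 * r + 2)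
        + (∫ ω, ‖D ω‖ ^ (2 * r + 2) ∂P) / b ^ (2 * r + 2)
        + (∫ ω, ‖Z ω‖ ^ (2 * r + 2) ∂P) / Q ^ (2 * r + 2)) := by
        rw [integral_const_mul, integral_add (f := fun ω => ‖U ω‖ ^ (2 * r + 2) / u ^ (2 * r + 2)
          + ‖D ω‖ ^ (2 * r + 2) / b ^ (2 * r + 2)) (i1.add i2) i3, integral_add i1 i2, integral_div,
          integral_div, integral_div]
    _ ≤ _ := by
        have h1 : (∫ ω, ‖U ω‖ ^ (2 * r + 2) ∂P) / u ^ (2 * r + 2) ≤ c := by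
          rwa [div_le_iff₀ (by positivity)]
        have h2 : (∫ ω, ‖D ω‖ ^ (2 * r + 2) ∂P) / b ^ (2 * r + 2) ≤ c := by
          rwa [div_le_iff₀ (by positivity)]
        gcongr
        linarith

/-- The constant `(2r+1) 4^{r+1}` bounding the increments of `dualPow r`. -/
noncomputable def dualConst (r : ℕ) : ℝ := (2 * r + 1) * 4 ^ (r + 1)

/-- The constant of `moment_bound`. -/
noncomputable def momConst (r : ℕ) : ℝ :=
  2 * dualConst r * (2 * (2 * dualConst r) ^ r + 3)

theorem dualConst_pos (r : ℕ) : 0 < dualConst r := by unfold dualConst; positivity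
theorem momConst_pos (r : ℕ) : 0 < momConst r := by
  have := dualConst_pos r
  unfold momConst; positivity

theorem norm_dualPow_sub_le' (r : ℕ) (a b : ℂ) :
    ‖dualPow r a - dualPow r b‖
      ≤ dualConst r * (‖a - b‖ * (‖a‖ ^ (2 * r) + ‖a - b‖ ^ (2 * r))) := by
  have hb : ‖b‖ ≤ ‖a‖ + ‖a - b‖ := by
    calc ‖b‖ = ‖a - (a - b)‖ := by rw [sub_sub_cancel]
      _ ≤ _ := norm_sub_le _ _
  have h := norm_dualPow_sub_le r (le_add_of_nonneg_right (norm_nonneg (a - b)) : ‖a‖ ≤ _) hb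
  have h2 : (‖a‖ + ‖a - b‖) ^ (2 * r) ≤ 4 ^ (r + 1) * (‖a‖ ^ (2 * r) + ‖a - b‖ ^ (2 * r)) := by
    have h3 := add_pow_le (norm_nonneg a) (norm_nonneg (a - b)) (2 * r)
    have h4 : (2 : ℝ) ^ (2 * r - 1) ≤ 4 ^ (r + 1) := by
      rw [show (4 : ℝ) = 2 ^ 2 by norm_num, ← pow_mul]
      exact pow_le_pow_right₀ (by norm_num) (by omega)
    exact h3.trans (by gcongr)
  calc _ ≤ _ := h
    _ ≤ (2 * r + 1) * (4 ^ (r + 1) * (‖a‖ ^ (2 * r) + ‖a - b‖ ^ (2 * r))) * ‖a - b‖ := by gcongr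
    _ = _ := by rw [dualConst]; ring

theorem le_of_forall_pos_le_pow {E A W : ℝ} {n : ℕ}
    (h : ∀ ε : ℝ, 0 < ε → E ≤ A * (W + ε) ^ n) : E ≤ A * W ^ n := by
  have hc : Filter.Tendsto (fun ε : ℝ => A * (W + ε) ^ n) (nhdsWithin 0 (Set.Ioi 0))
      (nhds (A * (W + 0) ^ n)) := by
    have : Continuous fun ε : ℝ => A * (W + ε) ^ n := by fun_prop
    exact this.continuousAt.tendsto.mono_left nhdsWithin_le_nhds
  rw [add_zero] at hc
  exact ge_of_tendsto hc (by filter_upwards [self_mem_nhdsWithin] with ε hε using h ε hε)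

theorem HasAllMoments.dualPow {f : Ω → ℂ} (hf : HasAllMoments P f) (r : ℕ) :
    HasAllMoments P fun ω => dualPow r (f ω) := hf.conj.mul ((hf.conj.mul hf).pow r)

/-- A high moment bound for a sum `Y = ∑ U_k` such that `U_k` is orthogonal to a power of some
`Y_k` close to `Y`. -/
theorem moment_bound {ι : Type*} (s : Finset ι) (r : ℕ) {U V : ι → Ω → ℂ} {Y : Ω → ℂ}
    (hU : ∀ k ∈ s, HasAllMoments P (U k)) (hV : ∀ k ∈ s, HasAllMoments P (V k))
    (hY : ∀ ω, Y ω = ∑ k ∈ s, U k ω)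
    (horth : ∀ k ∈ s, ∫ ω, U k ω * dualPow r (V k ω) ∂P = 0)
    {u b : ι → ℝ} {c W : ℝ} (hc : 0 ≤ c) (hu : ∀ k ∈ s, 0 ≤ u k) (hb : ∀ k ∈ s, 0 ≤ b k)
    (hU' : ∀ k ∈ s, ∫ ω, ‖U k ω‖ ^ (2 * r + 2) ∂P ≤ c * u k ^ (2 * r + 2))
    (hV' : ∀ k ∈ s, ∫ ω, ‖Y ω - V k ω‖ ^ (2 * r + 2) ∂P ≤ c * b k ^ (2 * r + 2))
    (hW : ∑ k ∈ s, u k * b k ≤ W) (hbW : ∀ k ∈ s, b k ^ 2 ≤ W) :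
    ∫ ω, ‖Y ω‖ ^ (2 * r + 2) ∂P ≤ momConst r * c * W ^ (r + 1) := by
  have hYm : HasAllMoments P Y := by
    rw [show Y = fun ω => ∑ k ∈ s, U k ω from funext hY]
    exact HasAllMoments.sum s hU
  have hW0 : 0 ≤ W := (Finset.sum_nonneg fun k hk => mul_nonneg (hu k hk) (hb k hk)).trans hW
  apply le_of_forall_pos_le_pow
  intro ε hε
  set W' := W + ε
  have hW'0 : 0 < W' := by positivity
  set E := ∫ ω, ‖Y ω‖ ^ (2 * r + 2) ∂P with hE
  have hE0 : 0 ≤ E := integral_nonneg fun ω => by positivity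
  set d := dualConst r
  have hd : 0 < d := dualConst_pos r
  have h1 : E ≤ ∑ k ∈ s, d * ((∫ ω, ‖U k ω‖ * ‖Y ω - V k ω‖ * ‖Y ω‖ ^ (2 * r) ∂P)
      + ∫ ω, ‖U k ω‖ * ‖Y ω - V k ω‖ * ‖Y ω - V k ω‖ ^ (2 * r) ∂P) := by
    have e1 : (E : ℂ) = ∑ k ∈ s, ∫ ω, U k ω * (dualPow r (Y ω) - dualPow r (V k ω)) ∂P := by
      rw [hE, ← integral_complex_ofReal]
      calc _ = ∫ ω, ∑ k ∈ s, U k ω * dualPow r (Y ω) ∂P := by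
            congr 1; ext ω
            rw [← Finset.sum_mul, ← hY, mul_dualPow]
        _ = ∑ k ∈ s, ∫ ω, U k ω * dualPow r (Y ω) ∂P :=
            integral_finsetSum s fun k hk => ((hU k hk).mul (hYm.dualPow r)).integrable
        _ = _ := by
            refine Finset.sum_congr rfl fun k hk => ?_
            simp only [mul_sub]
            rw [integral_sub ((hU k hk).mul (hYm.dualPow r)).integrable
              ((hU k hk).mul ((hV k hk).dualPow r)).integrable, horth k hk, sub_zero]
    have e2 : E = ‖(E : ℂ)‖ := by rw [Complex.norm_real, Real.norm_of_nonneg hE0]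
    rw [e2, e1]
    refine norm_sum_le_of_le s fun k hk => (norm_integral_le_integral_norm _).trans ?_
    have hD := hYm.sub (hV k hk)
    have i1 : Integrable (fun ω => ‖U k ω‖ * ‖Y ω - V k ω‖ * ‖Y ω‖ ^ (2 * r)) P := by
      have := (((hU k hk).mul hD).mul (hYm.pow (2 * r))).integrable.norm
      simpa [norm_mul, norm_pow] using this
    have i2 : Integrable (fun ω => ‖U k ω‖ * ‖Y ω - V k ω‖ * ‖Y ω - V k ω‖ ^ (2 * r)) P := by
      have := (((hU k hk).mul hD).mul (hD.pow (2 * r))).integrable.norm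
      simpa [norm_mul, norm_pow] using this
    rw [← integral_add i1 i2, ← integral_const_mul]
    refine integral_mono ((hU k hk).mul ((hYm.dualPow r).sub ((hV k hk).dualPow r))).integrable.norm
      ((i1.add i2).const_mul d) fun ω => ?_
    simp only [norm_mul]
    calc ‖U k ω‖ * ‖dualPow r (Y ω) - dualPow r (V k ω)‖ ≤ ‖U k ω‖ * (d * (‖Y ω - V k ω‖ *
          (‖Y ω‖ ^ (2 * r) + ‖Y ω - V k ω‖ ^ (2 * r)))) := by
          gcongr; exact norm_dualPow_sub_le' r _ _
      _ = _ := by ring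
  set q := 2 * d with hq
  have hq0 : 0 < q := by positivity
  have hqW : 0 < q * W' := by positivity
  have hpow : ∀ x : ℝ, 0 ≤ x → ∀ n : ℕ, Real.sqrt x ^ (2 * n) = x ^ n := fun x hx n => by
    rw [pow_mul, Real.sq_sqrt hx]
  have h2 : ∀ k ∈ s, d * ((∫ ω, ‖U k ω‖ * ‖Y ω - V k ω‖ * ‖Y ω‖ ^ (2 * r) ∂P)
      + ∫ ω, ‖U k ω‖ * ‖Y ω - V k ω‖ * ‖Y ω - V k ω‖ ^ (2 * r) ∂P)
      ≤ u k * b k * (d * ((q * W') ^ r * (2 * c + E / (q * W') ^ (r + 1)) + W' ^ r * (3 * c))) := by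
    intro k hk
    have hD := hYm.sub (hV k hk)
    have a1 := integral_mul_mul_pow_le (hU k hk) hD hYm (hu k hk) (hb k hk)
      (Real.sqrt_pos.2 hqW) (hU' k hk) (hV' k hk)
    have a2 := integral_mul_mul_pow_le (hU k hk) hD hD (hu k hk) (hb k hk)
      (Real.sqrt_pos.2 hW'0) (hU' k hk) (hV' k hk)
    rw [← mul_add_one 2 r, hpow _ hqW.le, hpow _ hqW.le] at a1
    rw [← mul_add_one 2 r, hpow _ hW'0.le, hpow _ hW'0.le] at a2
    have hub := mul_nonneg (hu k hk) (hb k hk)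
    have a3 : (∫ ω, ‖Y ω - V k ω‖ ^ (2 * (r + 1)) ∂P) / W' ^ (r + 1) ≤ c := by
      rw [div_le_iff₀ (by positivity)]
      refine (hV' k hk).trans ?_
      rw [← mul_add_one 2 r, pow_mul]
      have := hb k hk
      have : b k ^ 2 ≤ W' := (hbW k hk).trans (by simp [W', hε.le])
      gcongr
    have a4 : u k * b k * W' ^ r * (2 * c + (∫ ω, ‖Y ω - V k ω‖ ^ (2 * (r + 1)) ∂P) / W' ^ (r + 1))
        ≤ u k * b k * W' ^ r * (3 * c) := by
      gcongr; linarith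
    calc _ ≤ d * (u k * b k * (q * W') ^ r * (2 * c + E / (q * W') ^ (r + 1))
          + u k * b k * W' ^ r * (3 * c)) := by
          gcongr
          · exact a1
          · exact a2.trans a4
      _ = _ := by ring
  have h3 : E ≤ W' * (d * ((q * W') ^ r * (2 * c + E / (q * W') ^ (r + 1)) + W' ^ r *
      (3 * c))) := by
    refine (h1.trans (Finset.sum_le_sum h2)).trans ?_
    rw [← Finset.sum_mul]
    gcongr
    exact hW.trans (by simp [W', hε.le])
  have h4 : W' * (d * ((q * W') ^ r * (2 * c + E / (q * W') ^ (r + 1)) + W' ^ r * (3 * c)))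
      = momConst r * c * W' ^ (r + 1) / 2 + E / 2 := by
    have : momConst r = q * (2 * q ^ r + 3) := rfl
    rw [this]
    have hd2 : d = q / 2 := by rw [hq]; ring
    rw [hd2]
    field_simp
    ring_nf
  rw [h4] at h3
  linarith

/-- The σ-algebra generated by a subfamily. -/
@[reducible] def sigmaOf {ι : Type*} {β : Type*} [MeasurableSpace β] (X : ι → Ω → β) (A : Set ι) :
    MeasurableSpace Ω := ⨆ k ∈ A, MeasurableSpace.comap (X k) inferInstance

theorem measurable_sigmaOf {ι β : Type*} [MeasurableSpace β] {X : ι → Ω → β} {A : Set ι} {k : ι}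
    (hk : k ∈ A) : Measurable[sigmaOf X A] (X k) := by
  have h : MeasurableSpace.comap (X k) inferInstance ≤ sigmaOf X A :=
    le_iSup₂ (f := fun k (_ : k ∈ A) => MeasurableSpace.comap (X k) inferInstance) k hk
  exact (comap_measurable (X k)).mono h le_rfl

theorem sigmaOf_mono {ι β : Type*} [MeasurableSpace β] {X : ι → Ω → β} {A B : Set ι}
    (h : A ⊆ B) : sigmaOf X A ≤ sigmaOf X B :=
  iSup₂_le fun k hk => le_iSup₂ (f := fun k (_ : k ∈ B) =>
    MeasurableSpace.comap (X k) inferInstance) k (h hk)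

theorem indepFun_of_sigmaOf {ι β γ γ' : Type*} [MeasurableSpace β] [MeasurableSpace γ]
    [MeasurableSpace γ'] {X : ι → Ω → β} (hX : ∀ k, Measurable (X k)) (hind : iIndepFun X P)
    {A B : Set ι} (hAB : Disjoint A B) {f : Ω → γ} {g : Ω → γ'}
    (hf : Measurable[sigmaOf X A] f) (hg : Measurable[sigmaOf X B] g) : IndepFun f g P := by
  have h := indep_iSup_of_disjoint (fun k => (hX k).comap_le) hind hAB
  rw [IndepFun_iff_Indep]
  exact indep_of_indep_of_le_left (indep_of_indep_of_le_right h hg.comap_le) hf.comap_le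

theorem sigmaOf_le {ι β : Type*} [MeasurableSpace β] {X : ι → Ω → β} (hX : ∀ k, Measurable (X k))
    (A : Set ι) : sigmaOf X A ≤ (inferInstance : MeasurableSpace Ω) :=
  iSup₂_le fun k _ => (hX k).comap_le

theorem measurable_dualPow (r : ℕ) : Measurable (dualPow r) := by
  have : Continuous (dualPow r) := by unfold dualPow; fun_prop
  exact this.measurable

end Moments
end LocalSemicircle

namespace LocalSemicircle

section LargeDeviation

variable {Ω : Type*} [MeasurableSpace Ω] {P : Measure Ω} [IsProbabilityMeasure P]
variable {ι : Type*} [DecidableEq ι]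

theorem integral_mul_eq_zero_of_indep {X Z : Ω → ℂ} (h : IndepFun X Z P)
    (hX : AEStronglyMeasurable X P) (hZ : AEStronglyMeasurable Z P) (h0 : ∫ ω, X ω ∂P = 0) :
    ∫ ω, X ω * Z ω ∂P = 0 := by
  rw [h.integral_fun_mul_eq_mul_integral hX hZ, h0, zero_mul]

theorem linear_moment (s : Finset ι) (r : ℕ) {X : ι → Ω → ℂ} (hXm : ∀ k, Measurable (X k))
    (hind : iIndepFun X P) (hX : ∀ k, HasAllMoments P (X k)) (h0 : ∀ k, ∫ ω, X k ω ∂P = 0)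
    {c : ℝ} (hc : 0 ≤ c) {σ : ι → ℝ} (hσ : ∀ k, 0 ≤ σ k)
    (hm : ∀ k, ∫ ω, ‖X k ω‖ ^ (2 * r + 2) ∂P ≤ c * σ k ^ (2 * r + 2)) (a : ι → ℂ) :
    ∫ ω, ‖∑ k ∈ s, a k * X k ω‖ ^ (2 * r + 2) ∂P
      ≤ momConst r * c * (∑ k ∈ s, (‖a k‖ * σ k) ^ 2) ^ (r + 1) := by
  have hVm : ∀ k, Measurable[sigmaOf X {k}ᶜ] fun ω => ∑ j ∈ s.erase k, a j * X j ω := by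
    intro k
    refine Finset.measurable_fun_sum _ fun j hj => ?_
    exact (measurable_sigmaOf (by simpa using Finset.ne_of_mem_erase hj)).const_mul (a j)
  have hVm' : ∀ k, Measurable fun ω => ∑ j ∈ s.erase k, a j * X j ω := fun k =>
    (hVm k).mono (sigmaOf_le hXm _) le_rfl
  have hmom : ∀ k, ∫ ω, ‖a k * X k ω‖ ^ (2 * r + 2) ∂P ≤ c * (‖a k‖ * σ k) ^ (2 * r + 2) := by
    intro k
    simp only [norm_mul, mul_pow]
    rw [integral_const_mul, mul_left_comm]
    exact mul_le_mul_of_nonneg_left (hm k) (by positivity)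
  refine moment_bound (P := P) s r (U := fun k ω => a k * X k ω)
    (V := fun k ω => ∑ j ∈ s.erase k, a j * X j ω) (u := fun k => ‖a k‖ * σ k)
    (b := fun k => ‖a k‖ * σ k)
    (fun k _ => (HasAllMoments.const _).mul (hX k))
    (fun k _ => HasAllMoments.sum _ fun j _ => (HasAllMoments.const _).mul (hX j))
    (fun ω => rfl) (fun k _ => ?_) hc (fun k _ => mul_nonneg (norm_nonneg _) (hσ k))
    (fun k _ => mul_nonneg (norm_nonneg _) (hσ k)) (fun k _ => hmom k) (fun k hk => ?_) ?_
    (fun k hk => ?_)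
  · simp only [mul_assoc]
    have hz := integral_mul_eq_zero_of_indep (X := X k)
      (Z := fun ω => dualPow r (∑ j ∈ s.erase k, a j * X j ω))
      (indepFun_of_sigmaOf hXm hind (A := {k}) (B := {k}ᶜ) disjoint_compl_right
        (measurable_sigmaOf rfl) ((measurable_dualPow r).comp (hVm k))) (hX k).aesm
      ((measurable_dualPow r).comp (hVm' k)).aestronglyMeasurable (h0 k)
    rw [integral_const_mul, hz, mul_zero]
  · refine le_of_eq_of_le ?_ (hmom k)
    congr 1; ext ω
    rw [← Finset.add_sum_erase s _ hk, add_sub_cancel_right]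
  · simp only [pow_two]; exact le_rfl
  · exact Finset.single_le_sum (f := fun k => (‖a k‖ * σ k) ^ 2) (fun _ _ => by positivity) hk

theorem integral_norm_pow_mul_of_indep {X Z : Ω → ℂ} (h : IndepFun X Z P)
    (hX : HasAllMoments P X) (hZ : HasAllMoments P Z) (n : ℕ) :
    ∫ ω, ‖X ω * Z ω‖ ^ n ∂P = (∫ ω, ‖X ω‖ ^ n ∂P) * ∫ ω, ‖Z ω‖ ^ n ∂P := by
  simp only [norm_mul, mul_pow]
  have h2 : IndepFun (fun ω => ‖X ω‖ ^ n) (fun ω => ‖Z ω‖ ^ n) P :=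
    h.comp (φ := fun x => ‖x‖ ^ n) (ψ := fun x => ‖x‖ ^ n) (by fun_prop) (by fun_prop)
  exact h2.integral_fun_mul_eq_mul_integral (hX.integrable_norm_pow n).1
    (hZ.integrable_norm_pow n).1

theorem integral_norm_add_pow_le {f g : Ω → ℂ} (hf : HasAllMoments P f) (hg : HasAllMoments P g)
    (n : ℕ) : ∫ ω, ‖f ω + g ω‖ ^ n ∂P
      ≤ 2 ^ n * ((∫ ω, ‖f ω‖ ^ n ∂P) + ∫ ω, ‖g ω‖ ^ n ∂P) := by
  rw [← integral_add (hf.integrable_norm_pow n) (hg.integrable_norm_pow n), ← integral_const_mul]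
  refine integral_mono ((hf.add hg).integrable_norm_pow n)
    (((hf.integrable_norm_pow n).add (hg.integrable_norm_pow n)).const_mul _) fun ω => ?_
  calc ‖f ω + g ω‖ ^ n ≤ (‖f ω‖ + ‖g ω‖) ^ n := by gcongr; exact norm_add_le _ _
    _ ≤ 2 ^ (n - 1) * (‖f ω‖ ^ n + ‖g ω‖ ^ n) := add_pow_le (norm_nonneg _) (norm_nonneg _) n
    _ ≤ 2 ^ n * (‖f ω‖ ^ n + ‖g ω‖ ^ n) := by
      gcongr
      · norm_num
      · omega

/-- The constant of `quadratic_moment`. -/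
noncomputable def quadConst (r : ℕ) (c : ℝ) : ℝ :=
  momConst r * (2 ^ (2 * r + 2) * (c * (momConst r * c))) * 2 ^ (r + 1)

theorem add_pow_le_two {x y : ℝ} (hx : 0 ≤ x) (hy : 0 ≤ y) (n : ℕ) :
    x ^ n + y ^ n ≤ 2 * (x + y) ^ n := by
  have h1 : x ^ n ≤ (x + y) ^ n := by gcongr; linarith
  have h2 : y ^ n ≤ (x + y) ^ n := by gcongr; linarith
  linarith

theorem sum_sum_erase_split {M : Type*} [AddCommMonoid M] (s : Finset ι) (f : ι → ι → M) {k : ι}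
    (hk : k ∈ s) : ∑ i ∈ s, ∑ j ∈ s.erase i, f i j
      = ∑ j ∈ s.erase k, f k j + (∑ j ∈ s.erase k, f j k
        + ∑ i ∈ s.erase k, ∑ j ∈ (s.erase k).erase i, f i j) := by
  have h : ∑ i ∈ s.erase k, ∑ j ∈ s.erase i, f i j = ∑ j ∈ s.erase k, f j k
        + ∑ i ∈ s.erase k, ∑ j ∈ (s.erase k).erase i, f i j := by
    rw [← Finset.sum_add_distrib]
    refine Finset.sum_congr rfl fun i hi => ?_
    have : k ∈ s.erase i := Finset.mem_erase.2 ⟨(Finset.ne_of_mem_erase hi).symm, hk⟩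
    rw [← Finset.add_sum_erase (s.erase i) (fun j => f i j) this, Finset.erase_right_comm]
  rw [← Finset.add_sum_erase s _ hk, h]

theorem quadratic_moment (s : Finset ι) (r : ℕ) {X : ι → Ω → ℂ} (hXm : ∀ k, Measurable (X k))
    (hind : iIndepFun X P) (hX : ∀ k, HasAllMoments P (X k)) (h0 : ∀ k, ∫ ω, X k ω ∂P = 0)
    {c : ℝ} (hc : 0 ≤ c) {σ : ι → ℝ} (hσ : ∀ k, 0 ≤ σ k)
    (hm : ∀ k, ∫ ω, ‖X k ω‖ ^ (2 * r + 2) ∂P ≤ c * σ k ^ (2 * r + 2)) (a : ι → ι → ℂ) :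
    ∫ ω, ‖∑ k ∈ s, ∑ j ∈ s.erase k, X k ω * a k j * (starRingEnd ℂ) (X j ω)‖ ^ (2 * r + 2) ∂P
      ≤ 2 * quadConst r c
        * (∑ k ∈ s, ∑ j ∈ s, σ k ^ 2 * σ j ^ 2 * ‖a k j‖ ^ 2) ^ (r + 1) := by
  set R : ι → Ω → ℂ := fun k ω => ∑ j ∈ s.erase k, a k j * (starRingEnd ℂ) (X j ω) with hR
  set R' : ι → Ω → ℂ := fun k ω => ∑ j ∈ s.erase k, a j k * X j ω with hR'
  set V : ι → Ω → ℂ := fun k ω => ∑ i ∈ s.erase k, ∑ j ∈ (s.erase k).erase i,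
    X i ω * a i j * (starRingEnd ℂ) (X j ω) with hV
  have hconj : Measurable (starRingEnd ℂ) := Complex.continuous_conj.measurable
  have hXk : ∀ k j, j ∈ s.erase k → Measurable[sigmaOf X {k}ᶜ] (X j) := fun k j hj =>
    measurable_sigmaOf (by simpa using Finset.ne_of_mem_erase hj)
  have hRm : ∀ k, Measurable[sigmaOf X {k}ᶜ] (R k) := fun k =>
    Finset.measurable_fun_sum _ fun j hj => (hconj.comp (hXk k j hj)).const_mul _
  have hRm' : ∀ k, Measurable[sigmaOf X {k}ᶜ] (R' k) := fun k =>
    Finset.measurable_fun_sum _ fun j hj => (hXk k j hj).const_mul _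
  have hVm : ∀ k, Measurable[sigmaOf X {k}ᶜ] (V k) := fun k =>
    Finset.measurable_fun_sum _ fun i hi => Finset.measurable_fun_sum _ fun j hj =>
      ((hXk k i hi).mul_const _).mul (hconj.comp (hXk k j (Finset.mem_of_mem_erase hj)))
  have hRM : ∀ k, HasAllMoments P (R k) := fun k => HasAllMoments.sum _ fun j _ =>
    (HasAllMoments.const _).mul (hX j).conj
  have hRM' : ∀ k, HasAllMoments P (R' k) := fun k => HasAllMoments.sum _ fun j _ =>
    (HasAllMoments.const _).mul (hX j)
  have hVM : ∀ k, HasAllMoments P (V k) := fun k => HasAllMoments.sum _ fun i _ =>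
    HasAllMoments.sum _ fun j _ => ((hX i).mul (HasAllMoments.const _)).mul (hX j).conj
  have hindk : ∀ k {f : Ω → ℂ}, Measurable[sigmaOf X {k}ᶜ] f → IndepFun (X k) f P := fun k f hf =>
    indepFun_of_sigmaOf hXm hind (A := {k}) (B := {k}ᶜ) disjoint_compl_right
      (measurable_sigmaOf rfl) hf
  set A : ι → ℝ := fun k => ∑ j ∈ s.erase k, (‖a k j‖ * σ j) ^ 2 with hA
  set A' : ι → ℝ := fun k => ∑ j ∈ s.erase k, (‖a j k‖ * σ j) ^ 2 with hA'
  have hA0 : ∀ k, 0 ≤ A k := fun k => Finset.sum_nonneg fun j _ => by positivity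
  have hA0' : ∀ k, 0 ≤ A' k := fun k => Finset.sum_nonneg fun j _ => by positivity
  have hRb : ∀ k, ∫ ω, ‖R k ω‖ ^ (2 * r + 2) ∂P ≤ momConst r * c * A k ^ (r + 1) := by
    intro k
    have h := linear_moment (s.erase k) r hXm hind hX h0 hc hσ hm
      (fun j => (starRingEnd ℂ) (a k j))
    simp only [RCLike.norm_conj] at h
    refine le_of_eq_of_le ?_ h
    congr 1; ext ω
    rw [← RCLike.norm_conj (R k ω), hR, map_sum]
    simp only [map_mul, Complex.conj_conj]
  have hRb' : ∀ k, ∫ ω, ‖R' k ω‖ ^ (2 * r + 2) ∂P ≤ momConst r * c * A' k ^ (r + 1) := fun k =>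
    linear_moment (s.erase k) r hXm hind hX h0 hc hσ hm (fun j => a j k)
  have hK := momConst_pos r
  set c' : ℝ := 2 * (2 ^ (2 * r + 2) * (c * (momConst r * c))) with hc'
  have hc'0 : 0 ≤ c' := by positivity
  set b : ι → ℝ := fun k => Real.sqrt (σ k ^ 2 * (A k + A' k)) with hb
  have hbn : ∀ k, b k ^ (2 * r + 2) = σ k ^ (2 * r + 2) * (A k + A' k) ^ (r + 1) := by
    intro k
    have := hA0 k; have := hA0' k
    rw [← mul_add_one 2 r, pow_mul, hb]
    simp only
    rw [Real.sq_sqrt (by positivity), mul_pow, pow_mul]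
  have hXR : ∀ k {f : Ω → ℂ}, IndepFun (X k) f P → HasAllMoments P f → ∀ B : ℝ, 0 ≤ B →
      ∫ ω, ‖f ω‖ ^ (2 * r + 2) ∂P ≤ momConst r * c * B →
      ∫ ω, ‖X k ω * f ω‖ ^ (2 * r + 2) ∂P ≤ c * (momConst r * c) * (σ k ^ (2 * r + 2) * B) := by
    intro k f hf hfM B hB hfb
    rw [integral_norm_pow_mul_of_indep hf (hX k) hfM]
    have := hσ k
    calc _ ≤ (c * σ k ^ (2 * r + 2)) * (momConst r * c * B) :=
          mul_le_mul (hm k) hfb (integral_nonneg fun ω => by positivity) (by positivity)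
      _ = _ := by ring
  have hUb : ∀ k, ∫ ω, ‖X k ω * R k ω‖ ^ (2 * r + 2) ∂P ≤
      c * (momConst r * c) * (σ k ^ (2 * r + 2) * A k ^ (r + 1)) := fun k =>
    hXR k (hindk k (hRm k)) (hRM k) _ (pow_nonneg (hA0 k) _) (hRb k)
  have hUb' : ∀ k, ∫ ω, ‖(starRingEnd ℂ) (X k ω) * R' k ω‖ ^ (2 * r + 2) ∂P ≤
      c * (momConst r * c) * (σ k ^ (2 * r + 2) * A' k ^ (r + 1)) := by
    intro k
    refine le_of_eq_of_le ?_ (hXR k (hindk k (hRm' k)) (hRM' k) _ (pow_nonneg (hA0' k) _) (hRb' k))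
    congr 1; ext ω
    rw [norm_mul, norm_mul, RCLike.norm_conj]
  have hdiff : ∀ k ∈ s, ∀ ω,
      (∑ k ∈ s, ∑ j ∈ s.erase k, X k ω * a k j * (starRingEnd ℂ) (X j ω)) - V k ω
        = X k ω * R k ω + (starRingEnd ℂ) (X k ω) * R' k ω := by
    intro k hk ω
    rw [sum_sum_erase_split s (fun i j => X i ω * a i j * (starRingEnd ℂ) (X j ω)) hk]
    simp only [hV, hR, hR', Finset.mul_sum]
    rw [← add_assoc, add_sub_cancel_right]
    congr 1 <;> exact Finset.sum_congr rfl fun j _ => by ring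
  have hWle : ∑ k ∈ s, b k * b k
      ≤ 2 * ∑ k ∈ s, ∑ j ∈ s, σ k ^ 2 * σ j ^ 2 * ‖a k j‖ ^ 2 := by
    have e1 : ∀ k, b k * b k = σ k ^ 2 * (A k + A' k) := fun k => by
      have := hA0 k; have := hA0' k
      exact Real.mul_self_sqrt (by positivity)
    have e2 : ∑ k ∈ s, ∑ j ∈ s, σ k ^ 2 * σ j ^ 2 * ‖a k j‖ ^ 2
        = ∑ k ∈ s, ∑ j ∈ s, σ k ^ 2 * σ j ^ 2 * ‖a j k‖ ^ 2 := by
      rw [Finset.sum_comm]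
      exact Finset.sum_congr rfl fun k _ => Finset.sum_congr rfl fun j _ => by ring
    rw [two_mul]
    nth_rw 2 [e2]
    rw [← Finset.sum_add_distrib]
    refine Finset.sum_le_sum fun k _ => ?_
    rw [e1, mul_add, hA, hA', Finset.mul_sum, Finset.mul_sum]
    refine add_le_add ?_ ?_
    · refine (Finset.sum_le_sum_of_subset_of_nonneg (Finset.erase_subset k s)
        fun _ _ _ => by positivity).trans (le_of_eq (Finset.sum_congr rfl fun j _ => by ring))
    · refine (Finset.sum_le_sum_of_subset_of_nonneg (Finset.erase_subset k s)
        fun _ _ _ => by positivity).trans (le_of_eq (Finset.sum_congr rfl fun j _ => by ring))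
  have hfin := moment_bound (P := P) s r (U := fun k ω => X k ω * R k ω) (V := V)
    (Y := fun ω => ∑ k ∈ s, ∑ j ∈ s.erase k, X k ω * a k j * (starRingEnd ℂ) (X j ω))
    (u := b) (b := b) (c := c')
    (W := 2 * ∑ k ∈ s, ∑ j ∈ s, σ k ^ 2 * σ j ^ 2 * ‖a k j‖ ^ 2)
    (fun k _ => (hX k).mul (hRM k)) (fun k _ => hVM k)
    (fun ω => by
      refine Finset.sum_congr rfl fun k _ => ?_
      rw [hR, Finset.mul_sum]
      exact Finset.sum_congr rfl fun j _ => by ring)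
    (fun k _ => by
      simp only [mul_assoc]
      refine integral_mul_eq_zero_of_indep (hindk k ((hRm k).mul
        ((measurable_dualPow r).comp (hVm k)))) (hX k).aesm
        ((hRM k).mul ((hVM k).dualPow r)).aesm (h0 k)) hc'0
    (fun k _ => Real.sqrt_nonneg _) (fun k _ => Real.sqrt_nonneg _)
    (fun k _ => by
      rw [hbn]
      have := hA0 k; have := hA0' k; have := hσ k
      have h2 : (1 : ℝ) ≤ 2 * 2 ^ (2 * r + 2) := by
        have : (1 : ℝ) ≤ 2 ^ (2 * r + 2) := one_le_pow₀ (by norm_num)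
        linarith
      calc _ ≤ 1 * (c * (momConst r * c) * (σ k ^ (2 * r + 2) * A k ^ (r + 1))) := by
            rw [one_mul]; exact hUb k
        _ ≤ (2 * 2 ^ (2 * r + 2)) * (c * (momConst r * c)
            * (σ k ^ (2 * r + 2) * (A k + A' k) ^ (r + 1))) := by
            gcongr; linarith
        _ = _ := by rw [hc']; ring)
    (fun k hk => by
      simp only [hdiff k hk]
      refine (integral_norm_add_pow_le ((hX k).mul (hRM k)) ((hX k).conj.mul (hRM' k)) _).trans ?_
      rw [hbn]
      have := hA0 k; have := hA0' k; have := hσ k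
      calc _ ≤ 2 ^ (2 * r + 2) * (c * (momConst r * c) * (σ k ^ (2 * r + 2) * A k ^ (r + 1))
            + c * (momConst r * c) * (σ k ^ (2 * r + 2) * A' k ^ (r + 1))) := by
            gcongr
            · exact hUb k
            · exact hUb' k
        _ = 2 ^ (2 * r + 2) * (c * (momConst r * c)) * σ k ^ (2 * r + 2)
            * (A k ^ (r + 1) + A' k ^ (r + 1)) := by ring
        _ ≤ 2 ^ (2 * r + 2) * (c * (momConst r * c)) * σ k ^ (2 * r + 2)
            * (2 * (A k + A' k) ^ (r + 1)) := by
            gcongr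
            exact add_pow_le_two (hA0 k) (hA0' k) _
        _ = _ := by rw [hc']; ring)
    hWle
    (fun k hk => by
      rw [pow_two]
      exact (Finset.single_le_sum (f := fun k => b k * b k) (fun k _ => mul_self_nonneg _) hk).trans
        hWle)
  refine hfin.trans (le_of_eq ?_)
  rw [mul_pow, quadConst, hc']
  ring

theorem measureReal_lt_le_of_moment {f : Ω → ℝ} (hf : Integrable f P) (hf0 : ∀ ω, 0 ≤ f ω)
    {C w t : ℝ} (hw : 0 ≤ w) (ht : 0 < t) (hC : 0 ≤ C) (h : ∫ ω, f ω ∂P ≤ C * w) :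
    P.real {ω | t * w < f ω} ≤ C / t := by
  rcases hw.eq_or_lt with rfl | hw
  · have h0 : ∫ ω, f ω ∂P = 0 := le_antisymm (by simpa using h) (integral_nonneg hf0)
    rw [integral_eq_zero_iff_of_nonneg hf0 hf] at h0
    have : P.real {ω | t * 0 < f ω} = 0 := by
      rw [measureReal_eq_zero_iff]
      refine measure_mono_null ?_ h0
      intro ω hω h2
      simp only [Set.mem_ofPred_eq, mul_zero] at hω
      exact hω.ne' h2
    rw [this]; positivity
  · have h1 := mul_meas_ge_le_integral_of_nonneg (Filter.Eventually.of_forall hf0) hf (t * w)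
    have h2 : P.real {ω | t * w < f ω} ≤ P.real {ω | t * w ≤ f ω} :=
      measureReal_mono (by
        intro ω hω
        simp only [Set.mem_ofPred_eq] at *
        exact hω.le)
    rw [le_div_iff₀ ht]
    have h3 : t * w * P.real {ω | t * w < f ω} ≤ C * w :=
      (mul_le_mul_of_nonneg_left h2 (by positivity)).trans (h1.trans h)
    have : (P.real {ω | t * w < f ω} * t) * w ≤ C * w := by linarith
    exact le_of_mul_le_mul_right this hw

theorem measureReal_prod_le_of_indep {α β : Type*} [MeasurableSpace α] [MeasurableSpace β]
    {X : Ω → α} {Y : Ω → β} (hX : Measurable X) (hY : Measurable Y) (hXY : IndepFun X Y P)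
    {B : Set (α × β)} (hB : MeasurableSet B) {ε : ℝ} 
    (h : ∀ y, P.real {ω | (X ω, y) ∈ B} ≤ ε) : P.real {ω | (X ω, Y ω) ∈ B} ≤ ε := by
  have hε : 0 ≤ ε := by
    obtain ⟨ω⟩ : Nonempty Ω := nonempty_of_isProbabilityMeasure P
    exact measureReal_nonneg.trans (h (Y ω))
  have h1 := (indepFun_iff_map_prod_eq_prod_map_map hX.aemeasurable hY.aemeasurable).1 hXY
  have : IsProbabilityMeasure (P.map Y) := Measure.isProbabilityMeasure_map hY.aemeasurable
  have : IsProbabilityMeasure (P.map X) := Measure.isProbabilityMeasure_map hX.aemeasurable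
  have h2 : P {ω | (X ω, Y ω) ∈ B} = (P.map fun ω => (X ω, Y ω)) B :=
    (Measure.map_apply (hX.prodMk hY) hB).symm
  have h3 : P {ω | (X ω, Y ω) ∈ B} ≤ ENNReal.ofReal ε := by
    rw [h2, h1, Measure.prod_apply_symm hB]
    calc _ ≤ ∫⁻ _y, ENNReal.ofReal ε ∂(P.map Y) := by
          refine lintegral_mono fun y => ?_
          rw [Measure.map_apply hX (measurable_prodMk_right hB)]
          rw [← ENNReal.ofReal_toReal (measure_ne_top P _)]
          exact ENNReal.ofReal_le_ofReal (h y)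
      _ = ENNReal.ofReal ε := by simp
  exact ENNReal.toReal_le_of_le_ofReal hε h3

end LargeDeviation
end LocalSemicircle

namespace LocalSemicircle

/-! ### Finite differences with respect to the removed rows -/

section Differences

variable {N : ℕ}

/-- The difference operator in the direction of the row `a`. -/
def rowDiff (a : Fin N) (f : Finset (Fin N) → ℂ) : Finset (Fin N) → ℂ :=
  fun T => f T - f (insert a T)

/-- All iterated differences of `f` of order `m ≤ d` in distinct directions outside `E` are at
most `C ψ ^ (r + m)` at `∅`. -/
def SmallDiff (ψ : ℝ) : ℕ → Finset (Fin N) → ℕ → ℝ → (Finset (Fin N) → ℂ) → Prop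
  | 0, _, r, C, f => ‖f ∅‖ ≤ C * ψ ^ r
  | d + 1, E, r, C, f => ‖f ∅‖ ≤ C * ψ ^ r ∧
      ∀ a, a ∉ E → SmallDiff ψ d (insert a E) (r + 1) C (rowDiff a f)

namespace SmallDiff

variable {ψ : ℝ} {d : ℕ} {E : Finset (Fin N)} {r : ℕ} {C : ℝ} {f g : Finset (Fin N) → ℂ}

theorem norm_le (h : SmallDiff ψ d E r C f) : ‖f ∅‖ ≤ C * ψ ^ r := by
  cases d with
  | zero => exact h
  | succ d => exact h.1

theorem mono (hψ : 0 ≤ ψ) (h : SmallDiff ψ d E r C f) {E' : Finset (Fin N)} (hE : E ⊆ E') {C' : ℝ}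
    (hC : C ≤ C') : SmallDiff ψ d E' r C' f := by
  induction d generalizing E E' r f with
  | zero => exact h.trans (by gcongr)
  | succ d ih =>
    exact ⟨h.1.trans (by gcongr), fun a ha =>
      ih (h.2 a fun h' => ha (hE h')) (Finset.insert_subset_insert a hE)⟩

theorem of_succ (h : SmallDiff ψ (d + 1) E r C f) : SmallDiff ψ d E r C f := by
  induction d generalizing E r f with
  | zero => exact h.1
  | succ d ih => exact ⟨h.1, fun a ha => ih (h.2 a ha)⟩

theorem of_order (hψ : 0 ≤ ψ) (hψ1 : ψ ≤ 1) (hC : 0 ≤ C) (h : SmallDiff ψ d E (r + 1) C f) :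
    SmallDiff ψ d E r C f := by
  have hp : ∀ r : ℕ, C * ψ ^ (r + 1) ≤ C * ψ ^ r := fun r =>
    mul_le_mul_of_nonneg_left (pow_le_pow_of_le_one hψ hψ1 (Nat.le_succ r)) hC
  induction d generalizing E r f with
  | zero => exact h.trans (hp r)
  | succ d ih => exact ⟨h.1.trans (hp r), fun a ha => ih (h.2 a ha)⟩

theorem congr (h : SmallDiff ψ d E r C f) (hfg : ∀ T, Disjoint T E → f T = g T) :
    SmallDiff ψ d E r C g := by
  have h0 := hfg ∅ (Finset.disjoint_empty_left E)
  induction d generalizing E r f g with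
  | zero => rw [SmallDiff, ← h0]; exact h
  | succ d ih =>
    refine ⟨by rw [← h0]; exact h.1, fun a ha => ?_⟩
    have key : ∀ T, Disjoint T (insert a E) → rowDiff a f T = rowDiff a g T := by
      intro T hT
      rw [Finset.disjoint_insert_right] at hT
      rw [rowDiff, rowDiff, hfg T hT.2, hfg (insert a T) (Finset.disjoint_insert_left.2 ⟨ha, hT.2⟩)]
    exact ih (h.2 a ha) key (key ∅ (Finset.disjoint_empty_left _))

theorem add {C' : ℝ} (hf : SmallDiff ψ d E r C f) (hg : SmallDiff ψ d E r C' g) :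
    SmallDiff ψ d E r (C + C') fun T => f T + g T := by
  induction d generalizing E r f g with
  | zero => rw [SmallDiff, add_mul]; exact norm_add_le_of_le hf hg
  | succ d ih =>
    refine ⟨by rw [add_mul]; exact norm_add_le_of_le hf.1 hg.1, fun a ha => ?_⟩
    have := ih (hf.2 a ha) (hg.2 a ha)
    convert this using 1
    ext T
    simp only [rowDiff]
    ring

theorem const_mul (hψ : 0 ≤ ψ) (hC : 0 ≤ C) (hf : SmallDiff ψ d E r C f) {s : ℂ} {m : ℕ}
    (hs : ‖s‖ ≤ ψ ^ m) : SmallDiff ψ d E (r + m) C fun T => s * f T := by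
  have hp : ∀ {r : ℕ} {x : ℂ}, ‖x‖ ≤ C * ψ ^ r → ‖s * x‖ ≤ C * ψ ^ (r + m) := by
    intro r x hx
    rw [norm_mul, pow_add]
    calc ‖s‖ * ‖x‖ ≤ ψ ^ m * (C * ψ ^ r) := by gcongr
      _ = _ := by ring
  induction d generalizing E r f with
  | zero => exact hp hf
  | succ d ih =>
    refine ⟨hp hf.1, fun a ha => ?_⟩
    have := ih (hf.2 a ha)
    rw [add_right_comm] at this
    convert this using 1
    ext T
    simp only [rowDiff]
    ring

theorem neg (hf : SmallDiff ψ d E r C f) : SmallDiff ψ d E r C fun T => -f T := by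
  induction d generalizing E r f with
  | zero => rw [SmallDiff, norm_neg]; exact hf
  | succ d ih =>
    refine ⟨by rw [norm_neg]; exact hf.1, fun a ha => ?_⟩
    have := ih (hf.2 a ha)
    convert this using 1
    ext T
    simp only [rowDiff]
    ring

theorem shift (hψ : 0 ≤ ψ) (hψ1 : ψ ≤ 1) (hC : 0 ≤ C) (hf : SmallDiff ψ (d + 1) E r C f)
    {a : Fin N} (ha : a ∉ E) : SmallDiff ψ d (insert a E) r (C + C) fun T => f (insert a T) := by
  have h1 := (hf.of_succ).mono hψ (Finset.subset_insert a E) le_rfl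
  have h2 := ((hf.2 a ha).of_order hψ hψ1 hC).neg
  refine (h1.add h2).congr fun T _ => ?_
  simp only [rowDiff]
  ring

theorem mul (hψ : 0 ≤ ψ) (hψ1 : ψ ≤ 1) {C' : ℝ} {r' : ℕ} (hC : 0 ≤ C) (hC' : 0 ≤ C')
    (hf : SmallDiff ψ d E r C f) (hg : SmallDiff ψ d E r' C' g) :
    SmallDiff ψ d E (r + r') (4 ^ d * (C * C')) fun T => f T * g T := by
  have hp : ∀ {r r' : ℕ} {x y : ℂ} {C C' : ℝ}, 0 ≤ C → ‖x‖ ≤ C * ψ ^ r → ‖y‖ ≤ C' * ψ ^ r' →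
      ‖x * y‖ ≤ (C * C') * ψ ^ (r + r') := by
    intro r r' x y C C' hC hx hy
    rw [norm_mul, pow_add]
    calc ‖x‖ * ‖y‖ ≤ (C * ψ ^ r) * (C' * ψ ^ r') := by gcongr
      _ = _ := by ring
  induction d generalizing E r r' f g C C' with
  | zero => rw [SmallDiff, pow_zero, one_mul]; exact hp hC hf hg
  | succ d ih =>
    have h4 : (1 : ℝ) ≤ 4 ^ (d + 1) := one_le_pow₀ (by norm_num)
    refine ⟨(hp hC hf.1 hg.1).trans ?_, fun a ha => ?_⟩
    · have : 0 ≤ C * C' := by positivity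
      exact mul_le_mul_of_nonneg_right (le_mul_of_one_le_left this h4) (by positivity)
    · have hsh := hf.shift hψ hψ1 hC ha
      have h1 := ih hC hC' (hf.2 a ha) ((hg.of_succ).mono hψ (Finset.subset_insert a E) le_rfl)
      have h2 := ih (by positivity) hC' hsh (hg.2 a ha)
      rw [add_right_comm] at h1
      rw [← add_assoc] at h2
      have h3 := (h1.add h2).mono hψ (Finset.Subset.refl _)
        (show 4 ^ d * (C * C') + 4 ^ d * ((C + C) * C') ≤ 4 ^ (d + 1) * (C * C') by
          have : 0 ≤ 4 ^ d * (C * C') := by positivity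
          rw [pow_succ]; nlinarith)
      refine h3.congr fun T _ => ?_
      simp only [rowDiff]
      ring

/-- Weighted sums of functions `f k` that vanish when the row `k` is removed. -/
theorem sum (hψ : 0 ≤ ψ) (hψ1 : ψ ≤ 1) (hC : 0 ≤ C) (K : Finset (Fin N)) {s : Fin N → ℝ}
    (hs : ∀ k, 0 ≤ s k) (hsψ : ∀ k, s k ≤ ψ) (hs1 : ∑ k ∈ K, s k ≤ 1)
    {f : Fin N → Finset (Fin N) → ℂ} (hf : ∀ k ∈ K, SmallDiff ψ d (insert k E) r C (f k))
    (hkill : ∀ k ∈ K, ∀ T, k ∈ T → f k T = 0) :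
    SmallDiff ψ d E r ((d + 1) * C) fun T => ∑ k ∈ K, (s k : ℂ) * f k T := by
  have hsize : ‖∑ k ∈ K, (s k : ℂ) * f k ∅‖ ≤ C * ψ ^ r :=
    norm_sum_mul_le_of_sum_le_one K (fun k _ => hs k) hs1 (by positivity)
      fun k hk => (hf k hk).norm_le
  induction d generalizing E r f K with
  | zero => simpa [SmallDiff] using hsize
  | succ d ih =>
    refine ⟨hsize.trans ?_, fun a ha => ?_⟩
    · have : 0 ≤ C * ψ ^ r := by positivity
      rw [mul_assoc]
      have hd : (0 : ℝ) ≤ ((d + 1 : ℕ) : ℝ) := by positivity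
      nlinarith
    have hK' : ∑ k ∈ K.erase a, s k ≤ 1 :=
      (Finset.sum_le_sum_of_subset_of_nonneg (Finset.erase_subset a K) fun k _ _ => hs k).trans hs1
    have hf' : ∀ k ∈ K.erase a, SmallDiff ψ d (insert k (insert a E)) (r + 1) C
        (rowDiff a (f k)) := by
      intro k hk
      by_cases hak : a ∈ insert k E
      · exfalso
        rcases Finset.mem_insert.1 hak with h | h
        · exact Finset.ne_of_mem_erase hk h.symm
        · exact ha h
      · have := (hf k (Finset.mem_of_mem_erase hk)).2 a hak
        rwa [Finset.insert_comm] at this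
    have h1 := ih (K := K.erase a) (E := insert a E) (r := r + 1) hK' hf'
      (fun k hk T hT => by
        simp only [rowDiff]
        rw [hkill k (Finset.mem_of_mem_erase hk) T hT,
          hkill k (Finset.mem_of_mem_erase hk) _ (Finset.mem_insert_of_mem hT), sub_zero])
      (norm_sum_mul_le_of_sum_le_one _ (fun k _ => hs k) hK' (by positivity)
        fun k hk => (hf' k hk).norm_le)
    by_cases haK : a ∈ K
    · have h2 := ((hf a haK).of_succ).const_mul hψ hC (s := (s a : ℂ)) (m := 1)
        (by rw [Complex.norm_real, Real.norm_of_nonneg (hs a), pow_one]; exact hsψ a)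
      refine ((h1.add h2).mono hψ (Finset.Subset.refl _) (by push_cast; linarith)).congr
        fun T hT => ?_
      simp only [rowDiff]
      rw [← Finset.add_sum_erase K _ haK, ← Finset.add_sum_erase K _ haK,
        hkill a haK (insert a T) (Finset.mem_insert_self a T)]
      simp only [mul_sub, Finset.sum_sub_distrib]
      ring
    · refine (h1.mono hψ (Finset.Subset.refl _) (by push_cast; linarith)).congr fun T hT => ?_
      simp only [rowDiff]
      rw [Finset.erase_eq_of_notMem haK]
      simp only [mul_sub, Finset.sum_sub_distrib]

end SmallDiff

/-! ### Differences of resolvent entries -/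

variable {H : Matrix (Fin N) (Fin N) ℂ} {z : ℂ}

/-- The entry `(i, j)` of the resolvent of the minor of `H` with the rows in `T` removed. -/
noncomputable def minorGreen (H : Matrix (Fin N) (Fin N) ℂ) (z : ℂ) (i j : Fin N) :
    Finset (Fin N) → ℂ := fun T => green (zeroOut H T) z i j

theorem minorGreen_sub (hH : H.IsHermitian) (hz : 0 < z.im) {a i : Fin N} (hi : i ≠ a) (j : Fin N)
    (T : Finset (Fin N)) : minorGreen H z i j T - minorGreen H z i j (insert a T)
      = minorGreen H z i a T * minorGreen H z a j T * (minorGreen H z a a T)⁻¹ := by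
  have := green_sub_minor (isHermitian_zeroOut hH T) hz (j := j) hi
  rwa [zeroOut_zeroOut] at this

theorem minorGreen_ne_zero (hH : H.IsHermitian) (hz : 0 < z.im) (i : Fin N) (T : Finset (Fin N)) :
    minorGreen H z i i T ≠ 0 := green_diag_ne_zero (isHermitian_zeroOut hH T) hz i

theorem minorGreen_inv_sub (hH : H.IsHermitian) (hz : 0 < z.im) {a i : Fin N} (hi : i ≠ a)
    (T : Finset (Fin N)) : (minorGreen H z i i T)⁻¹ - (minorGreen H z i i (insert a T))⁻¹
      = -((minorGreen H z i a T * minorGreen H z a i T * (minorGreen H z a a T)⁻¹) *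
        ((minorGreen H z i i T)⁻¹ * (minorGreen H z i i (insert a T))⁻¹)) := by
  rw [← minorGreen_sub hH hz hi]
  have h1 := minorGreen_ne_zero hH hz i T
  have h2 := minorGreen_ne_zero hH hz i (insert a T)
  field_simp
  ring

/-- Bounds on the entries of the resolvent of `H` with parameters `L` and `ψ`. -/
structure GreenBound (H : Matrix (Fin N) (Fin N) ℂ) (z : ℂ) (L ψ c : ℝ)
    (T : Finset (Fin N)) : Prop where
  off : ∀ i j, i ≠ j → i ∉ T → j ∉ T → ‖minorGreen H z i j T‖ ≤ c * (L⁻¹ * ψ)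
  inv : ∀ i, i ∉ T → ‖(minorGreen H z i i T)⁻¹‖ ≤ c * L
  diag : ∀ i, i ∉ T → ‖minorGreen H z i i T‖ ≤ c * L

variable {L ψ : ℝ}

theorem GreenBound.step (hH : H.IsHermitian) (hz : 0 < z.im) (hL : 1 ≤ L) (hψ : 0 ≤ ψ)
    (hψ4 : ψ ≤ 1 / 16) {c : ℝ} (hc1 : 1 ≤ c) (hc2 : c ≤ 2) {T : Finset (Fin N)}
    (h : GreenBound H z L ψ c T) {a : Fin N} (ha : a ∉ T) :
    GreenBound H z L ψ (c + 16 * ψ) (insert a T) := by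
  have hL0 : 0 < L := by linarith
  have hc0 : 0 ≤ c := by linarith
  have hc3 : c ^ 3 ≤ 8 := by
    calc c ^ 3 ≤ 2 ^ 3 := by gcongr
      _ = 8 := by norm_num
  have hx : ∀ i j, i ∉ insert a T → j ∉ insert a T →
      ‖minorGreen H z i a T * minorGreen H z a j T * (minorGreen H z a a T)⁻¹‖
        ≤ 8 * (L⁻¹ * ψ ^ 2) := by
    intro i j hi hj
    rw [Finset.mem_insert, not_or] at hi hj
    rw [norm_mul, norm_mul]
    calc _ ≤ (c * (L⁻¹ * ψ)) * (c * (L⁻¹ * ψ)) * (c * L) := by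
          gcongr
          · exact h.off i a hi.1 hi.2 ha
          · exact h.off a j (Ne.symm hj.1) ha hj.2
          · exact h.inv a ha
      _ = c ^ 3 * (L⁻¹ * ψ ^ 2) * (L⁻¹ * L) := by ring
      _ ≤ 8 * (L⁻¹ * ψ ^ 2) * (L⁻¹ * L) := by gcongr
      _ = _ := by rw [inv_mul_cancel₀ hL0.ne', mul_one]
  have hi1 : L⁻¹ ≤ L := (inv_le_one_of_one_le₀ hL).trans hL
  have hx' : ∀ i j, i ∉ insert a T → j ∉ insert a T →
      ‖minorGreen H z i j (insert a T)‖ ≤ ‖minorGreen H z i j T‖ + 8 * (L⁻¹ * ψ ^ 2) := by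
    intro i j hi hj
    have h1 := minorGreen_sub hH hz (a := a) (i := i) (by
      rw [Finset.mem_insert, not_or] at hi; exact hi.1) j T
    have h2 : minorGreen H z i j (insert a T) = minorGreen H z i j T
        - minorGreen H z i a T * minorGreen H z a j T * (minorGreen H z a a T)⁻¹ := by
      rw [← h1]; ring
    rw [h2]
    exact (norm_sub_le _ _).trans (by gcongr; exact hx i j hi hj)
  refine ⟨fun i j hij hi hj => ?_, fun i hi => ?_, fun i hi => ?_⟩
  · refine (hx' i j hi hj).trans ?_
    rw [Finset.mem_insert, not_or] at hi hj
    have h1 := h.off i j hij hi.2 hj.2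
    have h3 : 0 ≤ L⁻¹ * ψ := by positivity
    nlinarith
  · have h1 := minorGreen_inv_sub hH hz (a := a) (i := i) (by
      rw [Finset.mem_insert, not_or] at hi; exact hi.1) T
    have hi' : i ∉ T := fun h' => hi (Finset.mem_insert_of_mem h')
    have h2 := h.inv i hi'
    set p := (minorGreen H z i i T)⁻¹
    set p' := (minorGreen H z i i (insert a T))⁻¹
    set x := minorGreen H z i a T * minorGreen H z a i T * (minorGreen H z a a T)⁻¹
    have hxi : ‖x‖ ≤ 8 * (L⁻¹ * ψ ^ 2) := hx i i hi hi
    have h4 : p' = p + x * (p * p') := by linear_combination -h1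
    have h5 : ‖p'‖ ≤ ‖p‖ + 16 * ψ ^ 2 * ‖p'‖ := by
      conv_lhs => rw [h4]
      refine (norm_add_le _ _).trans ?_
      gcongr
      rw [norm_mul x, norm_mul p, ← mul_assoc]
      refine mul_le_mul_of_nonneg_right ?_ (norm_nonneg _)
      calc ‖x‖ * ‖p‖ ≤ (8 * (L⁻¹ * ψ ^ 2)) * (c * L) := by gcongr
        _ = 8 * c * ψ ^ 2 * (L⁻¹ * L) := by ring
        _ ≤ 8 * 2 * ψ ^ 2 * (L⁻¹ * L) := by gcongr
        _ = 16 * ψ ^ 2 := by rw [inv_mul_cancel₀ hL0.ne']; ring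
    have h6 : 16 * ψ ^ 2 ≤ ψ := by nlinarith
    have h7 : ‖p'‖ * (1 - ψ) ≤ c * L := by nlinarith [norm_nonneg p']
    have h8 : ‖p'‖ ≤ 4 * L := by nlinarith [norm_nonneg p']
    nlinarith [norm_nonneg p']
  · refine (hx' i i hi hi).trans ?_
    have hi' : i ∉ T := fun h' => hi (Finset.mem_insert_of_mem h')
    have h1 := h.diag i hi'
    have h2 : L⁻¹ * ψ ^ 2 ≤ L * ψ := by
      have : ψ ^ 2 ≤ ψ := by nlinarith
      gcongr
    nlinarith [mul_nonneg hL0.le hψ]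

theorem GreenBound.minor (hH : H.IsHermitian) (hz : 0 < z.im) (hL : 1 ≤ L) (hψ : 0 ≤ ψ)
    (h : GreenBound H z L ψ 1 ∅) {n : ℕ} (hn : 16 * (n + 1) * ψ ≤ 1) (T : Finset (Fin N))
    (hT : T.card ≤ n) : GreenBound H z L ψ 2 T := by
  have key : ∀ T : Finset (Fin N), T.card ≤ n → GreenBound H z L ψ (1 + 16 * T.card * ψ) T := by
    intro T
    induction T using Finset.induction_on with
    | empty => intro _; simpa using h
    | insert a T ha ih =>
      intro hT
      rw [Finset.card_insert_of_notMem ha] at hT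
      have hTn : (T.card : ℝ) ≤ n := by exact_mod_cast (by omega : T.card ≤ n)
      have h1 : 16 * (T.card : ℝ) * ψ ≤ 16 * (n + 1) * ψ := by gcongr; linarith
      have h0 : 0 ≤ 16 * (T.card : ℝ) * ψ := by positivity
      have hn0 : 0 ≤ 16 * (n : ℝ) * ψ := by positivity
      have := (ih (by omega)).step hH hz hL hψ (by linarith) (by linarith) (by linarith) ha
      rw [Finset.card_insert_of_notMem ha]
      convert this using 1
      push_cast; ring
  have hTn : (T.card : ℝ) ≤ n := by exact_mod_cast hT
  have h1 : 16 * (T.card : ℝ) * ψ ≤ 16 * (n + 1) * ψ := by gcongr; linarith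
  have hL0 : 0 < L := by linarith
  have h2 := key T hT
  have h3 : 1 + 16 * (T.card : ℝ) * ψ ≤ 2 := by linarith
  exact ⟨fun i j h h' h'' => (h2.off i j h h' h'').trans (by gcongr),
    fun i hi => (h2.inv i hi).trans (by gcongr), fun i hi => (h2.diag i hi).trans (by gcongr)⟩

/-- The constants of the difference bounds. -/
noncomputable def diffConst : ℕ → ℝ
  | 0 => 2
  | d + 1 => 4 ^ (4 * d) * diffConst d ^ 5 + diffConst d

theorem two_le_diffConst (d : ℕ) : 2 ≤ diffConst d := by
  induction d with
  | zero => exact le_rfl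
  | succ d ih =>
    have : 0 ≤ 4 ^ (4 * d) * diffConst d ^ 5 := by
      have : 0 ≤ diffConst d := by linarith
      positivity
    rw [diffConst]; linarith

variable {n : ℕ}

/-- Difference bounds of depth `d` for the resolvent entries of a matrix. -/
structure DiffBound (ψ L : ℝ) (d : ℕ) (H : Matrix (Fin N) (Fin N) ℂ) (z : ℂ) (C : ℝ)
    (T₀ : Finset (Fin N)) : Prop where
  off : ∀ i j, i ≠ j → i ∉ T₀ → j ∉ T₀ →
    SmallDiff ψ d (T₀ ∪ {i, j}) 1 (C * L⁻¹) fun T => minorGreen H z i j (T₀ ∪ T)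
  inv : ∀ i, i ∉ T₀ →
    SmallDiff ψ d (T₀ ∪ {i}) 0 (C * L) fun T => (minorGreen H z i i (T₀ ∪ T))⁻¹

theorem DiffBound.diff_off (hH : H.IsHermitian) (hz : 0 < z.im) (hL : 1 ≤ L) (hψ : 0 ≤ ψ)
    (hψ1 : ψ ≤ 1) {d : ℕ} {C : ℝ} (hC : 1 ≤ C) {T₀ : Finset (Fin N)}
    (h : DiffBound ψ L d H z C T₀)
    {i j a : Fin N} (hi : i ∉ T₀) (hj : j ∉ T₀) (ha : a ∉ T₀) (hai : a ≠ i) (haj : a ≠ j) :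
    SmallDiff ψ d (insert a (T₀ ∪ {i, j})) 2 (4 ^ (2 * d) * C ^ 3 * L⁻¹)
      (rowDiff a fun T => minorGreen H z i j (T₀ ∪ T)) := by
  have hL0 : 0 < L := by linarith
  have hC0 : 0 ≤ C := by linarith
  have h1 := (h.off i a hai.symm hi ha).mono hψ (E' := insert a (T₀ ∪ {i, j}))
    (by intro x; simp only [Finset.mem_union, Finset.mem_insert, Finset.mem_singleton]; tauto)
        le_rfl
  have h2 := (h.off a j haj ha hj).mono hψ (E' := insert a (T₀ ∪ {i, j}))
    (by intro x; simp only [Finset.mem_union, Finset.mem_insert, Finset.mem_singleton]; tauto)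
        le_rfl
  have h3 := (h.inv a ha).mono hψ (E' := insert a (T₀ ∪ {i, j}))
    (by intro x; simp only [Finset.mem_union, Finset.mem_insert, Finset.mem_singleton]; tauto)
        le_rfl
  have h4 := (h1.mul hψ hψ1 (by positivity) (by positivity) h2).mul hψ hψ1 (by positivity)
    (by positivity) h3
  refine (h4.mono hψ (Finset.Subset.refl _) (le_of_eq ?_)).congr fun T _ => ?_
  · field_simp; ring
  · simp only [rowDiff, Finset.union_insert]
    exact (minorGreen_sub hH hz hai.symm j (T₀ ∪ T)).symm

theorem DiffBound.diff_inv (hH : H.IsHermitian) (hz : 0 < z.im) (hL : 1 ≤ L) (hψ : 0 ≤ ψ)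
    (hψ1 : ψ ≤ 1) {d : ℕ} {C : ℝ} (hC : 1 ≤ C) {T₀ : Finset (Fin N)}
    (h : DiffBound ψ L d H z C T₀) {a : Fin N} (h' : DiffBound ψ L d H z C (insert a T₀))
    {i : Fin N} (hi : i ∉ T₀) (ha : a ∉ T₀) (hai : a ≠ i) :
    SmallDiff ψ d (insert a (T₀ ∪ {i})) 2 (4 ^ (4 * d) * C ^ 5 * L)
      (rowDiff a fun T => (minorGreen H z i i (T₀ ∪ T))⁻¹) := by
  have hL0 : 0 < L := by linarith
  have hC0 : 0 ≤ C := by linarith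
  have h1 := (h.diff_off hH hz hL hψ hψ1 hC hi hi ha hai hai).mono hψ
    (E' := insert a (T₀ ∪ {i})) (by
      intro x; simp only [Finset.mem_union, Finset.mem_insert, Finset.mem_singleton]; tauto) le_rfl
  have h2 := (h.inv i hi).mono hψ (E' := insert a (T₀ ∪ {i})) (Finset.subset_insert _ _) le_rfl
  have h3 := (h'.inv i (by simp [hai.symm, hi])).mono hψ (E' := insert a (T₀ ∪ {i}))
    (by intro x; simp only [Finset.mem_union, Finset.mem_insert, Finset.mem_singleton]; tauto)
        le_rfl
  have h4 := h1.mul hψ hψ1 (by positivity) (by positivity)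
    (h2.mul hψ hψ1 (by positivity) (by positivity) h3)
  refine (h4.neg.mono hψ (Finset.Subset.refl _) (le_of_eq ?_)).congr fun T _ => ?_
  · field_simp
    ring
  · have e1 := minorGreen_inv_sub hH hz hai.symm (T₀ ∪ T)
    have e2 := minorGreen_sub hH hz hai.symm i (T₀ ∪ T)
    simp only [rowDiff, Finset.union_insert, Finset.insert_union] at *
    rw [e1, e2]

theorem diffBound_of_greenBound (hH : H.IsHermitian) (hz : 0 < z.im) (hL : 1 ≤ L) (hψ : 0 ≤ ψ)
    (hψ1 : ψ ≤ 1) (h : ∀ T : Finset (Fin N), T.card ≤ n → GreenBound H z L ψ 2 T) (d : ℕ)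
    (T₀ : Finset (Fin N)) (hT : T₀.card + d ≤ n) : DiffBound ψ L d H z (diffConst d) T₀ := by
  have hL0 : 0 < L := by linarith
  induction d generalizing T₀ with
  | zero =>
    have h1 := h T₀ (by omega)
    refine ⟨fun i j hij hi hj => ?_, fun i hi => ?_⟩
    · have := h1.off i j hij hi hj
      simpa [SmallDiff, diffConst, mul_assoc] using this
    · have := h1.inv i hi
      simpa [SmallDiff, diffConst, mul_assoc] using this
  | succ d ih =>
    have h1 := h T₀ (by omega)
    have hC := two_le_diffConst d
    have hC' := two_le_diffConst (d + 1)
    have hC3 : diffConst d ^ 3 ≤ diffConst d ^ 5 := pow_le_pow_right₀ (by linarith) (by norm_num)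
    have h4 : (4 : ℝ) ^ (2 * d) ≤ 4 ^ (4 * d) := pow_le_pow_right₀ (by norm_num) (by omega)
    have e1 : diffConst (d + 1) = 4 ^ (4 * d) * diffConst d ^ 5 + diffConst d := rfl
    have hD := ih T₀ (by omega)
    refine ⟨fun i j hij hi hj => ⟨?_, fun a ha => ?_⟩, fun i hi => ⟨?_, fun a ha => ?_⟩⟩
    · refine (h1.off i j hij hi hj).trans_eq' ?_ |>.trans (?_ : 2 * (L⁻¹ * ψ) ≤ _)
      · simp
      · rw [pow_one, mul_assoc]; gcongr
    · simp only [Finset.mem_union, Finset.mem_insert, Finset.mem_singleton, not_or] at ha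
      refine (hD.diff_off hH hz hL hψ hψ1 (by linarith) hi hj ha.1 ha.2.1 ha.2.2).mono hψ
        (Finset.Subset.refl _) ?_
      have : 4 ^ (2 * d) * diffConst d ^ 3 ≤ diffConst (d + 1) := by
        rw [e1]
        have : 4 ^ (2 * d) * diffConst d ^ 3 ≤ 4 ^ (4 * d) * diffConst d ^ 5 := by gcongr
        linarith
      gcongr
    · have := h1.inv i hi
      simp only [pow_zero, mul_one, Finset.union_empty]
      exact this.trans (by gcongr)
    · simp only [Finset.mem_union, Finset.mem_singleton, not_or] at ha
      have hD' := ih (insert a T₀) (by rw [Finset.card_insert_of_notMem ha.1]; omega)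
      refine ((hD.diff_inv hH hz hL hψ hψ1 (by linarith) hD' hi ha.1 ha.2).of_order hψ hψ1
        (by positivity)).mono hψ (Finset.Subset.refl _) ?_
      have : 4 ^ (4 * d) * diffConst d ^ 5 ≤ diffConst (d + 1) := by
        rw [e1]; linarith
      gcongr

theorem smallDiff_diag (hH : H.IsHermitian) (hz : 0 < z.im) (hL : 1 ≤ L) (hψ : 0 ≤ ψ)
    (hψ1 : ψ ≤ 1) (h : ∀ T : Finset (Fin N), T.card ≤ n → GreenBound H z L ψ 2 T) (d : ℕ)
    (T₀ : Finset (Fin N)) (hT : T₀.card + d ≤ n) {i : Fin N} (hi : i ∉ T₀) :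
    SmallDiff ψ d (T₀ ∪ {i}) 0 (diffConst d * L) fun T => minorGreen H z i i (T₀ ∪ T) := by
  have hL0 : 0 < L := by linarith
  have h1 := (h T₀ (by omega)).diag i hi
  have hC' := two_le_diffConst d
  have hs : ‖minorGreen H z i i (T₀ ∪ ∅)‖ ≤ diffConst d * L * ψ ^ 0 := by
    rw [pow_zero, mul_one, Finset.union_empty]
    exact h1.trans (by gcongr)
  cases d with
  | zero => exact hs
  | succ d =>
    refine ⟨hs, fun a ha => ?_⟩
    have hC := two_le_diffConst d
    simp only [Finset.mem_union, Finset.mem_singleton, not_or] at ha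
    have hD := diffBound_of_greenBound hH hz hL hψ hψ1 h d T₀ (by omega)
    refine ((hD.diff_off hH hz hL hψ hψ1 (by linarith) hi hi ha.1 ha.2 ha.2).of_order hψ hψ1
        (by positivity)).mono hψ (by simp) ?_
    have hC3 : diffConst d ^ 3 ≤ diffConst d ^ 5 := pow_le_pow_right₀ (by linarith) (by norm_num)
    have h4 : (4 : ℝ) ^ (2 * d) ≤ 4 ^ (4 * d) := pow_le_pow_right₀ (by norm_num) (by omega)
    have : 4 ^ (2 * d) * diffConst d ^ 3 ≤ diffConst (d + 1) := by
      have e1 : diffConst (d + 1) = 4 ^ (4 * d) * diffConst d ^ 5 + diffConst d := rfl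
      have : 4 ^ (2 * d) * diffConst d ^ 3 ≤ 4 ^ (4 * d) * diffConst d ^ 5 := by gcongr
      linarith
    have hi1 : L⁻¹ ≤ L := (inv_le_one_of_one_le₀ hL).trans hL
    gcongr

/-- The fluctuating part `(G_ll)⁻¹ + z + ∑_k s_lk G^(l)_kk` of the inverse diagonal entries, for
all minors of `H`. -/
noncomputable def invFluct (s : Fin N → ℝ) (H : Matrix (Fin N) (Fin N) ℂ) (z : ℂ) (l : Fin N) :
    Finset (Fin N) → ℂ := fun T => (minorGreen H z l l T)⁻¹ + z
      + ∑ k ∈ Finset.univ.erase l, (s k : ℂ) *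
          (if k ∈ T then 0 else minorGreen H z k k (insert l T))

/-- The constant of `smallDiff_invFluct`. -/
noncomputable def fluctConst (d : ℕ) : ℝ :=
  4 ^ (4 * d) * diffConst d ^ 5 + ((d + 1) * (4 ^ (2 * d) * diffConst d ^ 3) + diffConst d)

theorem fluctConst_pos (d : ℕ) : 0 < fluctConst d := by
  have := two_le_diffConst d
  have : 0 < diffConst d := by linarith
  unfold fluctConst; positivity

theorem smallDiff_invFluct (hH : H.IsHermitian) (hz : 0 < z.im) (hL : 1 ≤ L) (hψ : 0 ≤ ψ)
    (hψ1 : ψ ≤ 1) (h : ∀ T : Finset (Fin N), T.card ≤ n → GreenBound H z L ψ 2 T) {d : ℕ}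
    (hd : d + 1 ≤ n) {s : Fin N → ℝ} (hs : ∀ k, 0 ≤ s k) (hsψ : ∀ k, s k ≤ ψ ^ 2)
    (hs1 : ∑ k, s k ≤ 1) {l a : Fin N} (hal : a ≠ l) :
    SmallDiff ψ d {a, l} 2 (fluctConst d * L) (rowDiff a (invFluct s H z l)) := by
  have hL0 : 0 < L := by linarith
  have hC := two_le_diffConst d
  have hC0 : 0 ≤ diffConst d := by linarith
  have hi1 : L⁻¹ ≤ L := (inv_le_one_of_one_le₀ hL).trans hL
  set f : Fin N → Finset (Fin N) → ℂ := fun k T =>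
    if k ∈ T then 0 else minorGreen H z k k (insert l T) with hf
  have hψ2 : ψ ^ 2 ≤ ψ := by nlinarith
  have hD0 := diffBound_of_greenBound hH hz hL hψ hψ1 h d ∅ (by simp; omega)
  have hDa := diffBound_of_greenBound hH hz hL hψ hψ1 h d (insert a ∅) (by simp; omega)
  have hDl := diffBound_of_greenBound hH hz hL hψ hψ1 h d {l} (by simp; omega)
  have h1 := hD0.diff_inv hH hz hL hψ hψ1 (by linarith) hDa (i := l) (by simp) (by simp) hal
  simp only [Finset.empty_union] at h1
  have h2 : SmallDiff ψ d {a, l} 2 ((d + 1) * (4 ^ (2 * d) * diffConst d ^ 3 * L⁻¹))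
      fun T => ∑ k ∈ (Finset.univ.erase l).erase a, (s k : ℂ) * rowDiff a (f k) T := by
    refine SmallDiff.sum hψ hψ1 (by positivity) _ hs (fun k => (hsψ k).trans hψ2) ?_
      (fun k hk => ?_) (fun k hk T hT => ?_)
    · exact (Finset.sum_le_sum_of_subset_of_nonneg (Finset.subset_univ _)
        fun k _ _ => hs k).trans hs1
    · have hka : k ≠ a := Finset.ne_of_mem_erase hk
      have hkl : k ≠ l := Finset.ne_of_mem_erase (Finset.mem_of_mem_erase hk)
      have := hDl.diff_off hH hz hL hψ hψ1 (by linarith) (i := k) (j := k) (a := a) (by simp [hkl])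
        (by simp [hkl]) (by simp [hal]) hka.symm hka.symm
      refine (this.mono hψ (E' := insert k {a, l}) (by
        intro x
        simp only [Finset.mem_union, Finset.mem_insert, Finset.mem_singleton]; tauto)
        le_rfl).congr fun T hT => ?_
      rw [Finset.disjoint_insert_right] at hT
      simp only [rowDiff, hf, if_neg hT.1, Finset.mem_insert, hka, false_or, Finset.singleton_union]
    · simp only [rowDiff, hf, if_pos hT, if_pos (Finset.mem_insert_of_mem hT), sub_zero]
  have h3 : SmallDiff ψ d {a, l} 2 (diffConst d * L) fun T => (s a : ℂ) * f a T := by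
    have := smallDiff_diag hH hz hL hψ hψ1 h d {l} (by simp; omega) (i := a) (by simp [hal])
    have := this.const_mul hψ (by positivity) (s := (s a : ℂ)) (m := 2)
      (by rw [Complex.norm_real, Real.norm_of_nonneg (hs a)]; exact hsψ a)
    refine (this.mono hψ (E' := {a, l}) (by
        intro x
        simp only [Finset.mem_union, Finset.mem_insert, Finset.mem_singleton]; tauto)
        le_rfl).congr fun T hT => ?_
    rw [Finset.disjoint_insert_right] at hT
    simp only [hf, if_neg hT.1, Finset.singleton_union]
  have h4 := h1.add (h2.add h3)
  refine (h4.mono hψ (Finset.Subset.refl _) ?_).congr fun T hT => ?_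
  · have h5 : ((d : ℝ) + 1) * (4 ^ (2 * d) * diffConst d ^ 3 * L⁻¹)
        ≤ (d + 1) * (4 ^ (2 * d) * diffConst d ^ 3 * L) := by gcongr
    have h6 : fluctConst d * L = 4 ^ (4 * d) * diffConst d ^ 5 * L
        + ((d + 1) * (4 ^ (2 * d) * diffConst d ^ 3 * L) + diffConst d * L) := by
      rw [fluctConst]; ring
    rw [h6]
    linarith
  · rw [Finset.disjoint_insert_right] at hT
    have hmem : a ∈ Finset.univ.erase l := Finset.mem_erase.2 ⟨hal, Finset.mem_univ a⟩
    simp only [rowDiff, invFluct]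
    change _ = _ + z + ∑ k ∈ Finset.univ.erase l, (s k : ℂ) * f k T
      - (_ + z + ∑ k ∈ Finset.univ.erase l, (s k : ℂ) * f k (insert a T))
    rw [← Finset.add_sum_erase _ _ hmem, ← Finset.add_sum_erase _ _ hmem]
    have : f a (insert a T) = 0 := by simp [hf]
    rw [this]
    simp only [mul_sub, Finset.sum_sub_distrib]
    ring

end Differences
end LocalSemicircle

namespace LocalSemicircle

/-! ### Fluctuation averaging -/

section FluctuationAveraging

variable {Ω : Type*} [MeasurableSpace Ω] {P : Measure Ω} [IsProbabilityMeasure P] {N : ℕ}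

/-- A family of random variables `X T l`, indexed by sets `T` of removed rows and by rows `l`, which
are independent of the removed rows and centered with respect to the row `l`. The σ-algebra `F k`
contains the information on all rows but `k`. -/
structure FluctFamily (P : Measure Ω) (F : Fin N → MeasurableSpace Ω)
    (X : Finset (Fin N) → Fin N → Ω → ℂ) : Prop where
  moments : ∀ T l, HasAllMoments P (X T l)
  removed : ∀ T l, l ∈ T → X T l = 0
  measurable : ∀ T l k, k ∈ T → Measurable[F k] (X T l)
  centered : ∀ T l (Z : Ω → ℂ), Measurable[F l] Z → HasAllMoments P Z →
    ∫ ω, X T l ω * Z ω ∂P = 0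

/-- The difference of a family in the direction of the row `k`. -/
def diffFamily (k : Fin N) (X : Finset (Fin N) → Fin N → Ω → ℂ) :
    Finset (Fin N) → Fin N → Ω → ℂ :=
  fun T l ω => if l = k then 0 else X T l ω - X (insert k T) l ω

theorem hasAllMoments_diffFamily {X : Finset (Fin N) → Fin N → Ω → ℂ}
    (h : ∀ T l, HasAllMoments P (X T l)) (k : Fin N) (T : Finset (Fin N)) (l : Fin N) :
    HasAllMoments P (diffFamily k X T l) := by
  unfold diffFamily
  by_cases hlk : l = k
  · simp only [hlk, if_true]; exact HasAllMoments.const (P := P) 0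
  · simp only [hlk, if_false]; exact (h _ _).sub (h _ _)

theorem FluctFamily.diff {F : Fin N → MeasurableSpace Ω} {X : Finset (Fin N) → Fin N → Ω → ℂ}
    (h : FluctFamily P F X) (k : Fin N) : FluctFamily P F (diffFamily k X) := by
  refine ⟨fun T l => ?_, fun T l hl => ?_, fun T l j hj => ?_, fun T l Z hZ hZ' => ?_⟩
  · exact hasAllMoments_diffFamily h.moments k T l
  · ext ω
    simp [diffFamily, h.removed T l hl, h.removed (insert k T) l (Finset.mem_insert_of_mem hl)]
  · unfold diffFamily
    by_cases hlk : l = k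
    · simp only [hlk, if_true]; exact measurable_const
    · simp only [hlk, if_false]
      exact (h.measurable _ _ _ hj).sub (h.measurable _ _ _ (Finset.mem_insert_of_mem hj))
  · by_cases hlk : l = k
    · simp [diffFamily, hlk]
    · simp only [diffFamily, hlk, if_false, sub_mul]
      rw [integral_sub ((h.moments _ _).mul hZ').integrable ((h.moments _ _).mul hZ').integrable,
        h.centered _ _ Z hZ hZ', h.centered _ _ Z hZ hZ', sub_zero]

/-- All iterated differences of `X` of order `m ≤ n` in distinct directions outside `E` have
moments of order `q` bounded by `(κ ψ ^ m) ^ q`. -/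
def MomentDiff (P : Measure Ω) (q : ℕ) (ψ : ℝ) : ℕ → Finset (Fin N) → ℝ →
    (Finset (Fin N) → Fin N → Ω → ℂ) → Prop
  | 0, _, κ, X => ∀ l, ∫ ω, ‖X ∅ l ω‖ ^ q ∂P ≤ κ ^ q
  | n + 1, E, κ, X => (∀ l, ∫ ω, ‖X ∅ l ω‖ ^ q ∂P ≤ κ ^ q) ∧
      ∀ k, k ∉ E → MomentDiff P q ψ n (insert k E) (κ * ψ) (diffFamily k X)

/-- The gain of an average over the individual terms. -/
noncomputable def avgGain (ψ : ℝ) : ℕ → ℝ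
  | 0 => 1
  | n + 1 => Real.sqrt (ψ * avgGain ψ n)

theorem avgGain_eq {ψ : ℝ} (hψ : 0 < ψ) (n : ℕ) : avgGain ψ n = ψ ^ (1 - (2 : ℝ)⁻¹ ^ n) := by
  induction n with
  | zero => simp [avgGain]
  | succ n ih =>
    rw [avgGain, ih, Real.sqrt_eq_rpow]
    nth_rewrite 1 [← Real.rpow_one ψ]
    rw [← Real.rpow_add hψ, ← Real.rpow_mul hψ.le, pow_succ]
    congr 1
    ring

theorem avgGain_pos {ψ : ℝ} (hψ : 0 < ψ) (n : ℕ) : 0 < avgGain ψ n := by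
  rw [avgGain_eq hψ]; positivity

theorem avgGain_bounds {ψ : ℝ} (hψ : 0 < ψ) (hψ1 : ψ ≤ 1) (n : ℕ) :
    ψ ≤ avgGain ψ n ∧ avgGain ψ n ≤ 1 := by
  have h : (0 : ℝ) < (2 : ℝ)⁻¹ ^ n := by positivity
  have h' : (2 : ℝ)⁻¹ ^ n ≤ 1 := pow_le_one₀ (by norm_num) (by norm_num)
  rw [avgGain_eq hψ]
  constructor
  · nth_rewrite 1 [← Real.rpow_one ψ]
    exact Real.rpow_le_rpow_of_exponent_ge hψ hψ1 (by linarith)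
  · exact Real.rpow_le_one hψ.le hψ1 (by linarith)

/-- The constants of the averaging bound. -/
noncomputable def avgConst (r : ℕ) : ℕ → ℝ
  | 0 => 1
  | n + 1 => avgConst r n * (1 + momConst r * (2 ^ (2 * r + 2) * 2))

theorem one_le_avgConst (r n : ℕ) : 1 ≤ avgConst r n := by
  induction n with
  | zero => exact le_rfl
  | succ n ih =>
    have := momConst_pos r
    exact one_le_mul_of_one_le_of_one_le ih (le_add_of_nonneg_right (by positivity))

theorem integral_norm_average_pow_le {ι : Type*} (s : Finset ι) {t : ι → ℝ}
    (ht : ∀ l ∈ s, 0 ≤ t l) (ht1 : ∑ l ∈ s, t l ≤ 1) {X : ι → Ω → ℂ}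
    (hX : ∀ l ∈ s, HasAllMoments P (X l)) {q : ℕ} (hq : q ≠ 0) {B : ℝ} (hB : 0 ≤ B)
    (h : ∀ l ∈ s, ∫ ω, ‖X l ω‖ ^ q ∂P ≤ B) :
    ∫ ω, ‖∑ l ∈ s, (t l : ℂ) * X l ω‖ ^ q ∂P ≤ B := by
  have key : ∀ x : ι → ℝ, (∀ l ∈ s, 0 ≤ x l) →
      (∑ l ∈ s, t l * x l) ^ q ≤ ∑ l ∈ s, t l * x l ^ q := by
    intro x hx
    set τ := ∑ l ∈ s, t l with hτ
    have hτ0 : 0 ≤ τ := Finset.sum_nonneg ht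
    rcases hτ0.eq_or_lt with h0 | h0
    · have h0' : ∀ l ∈ s, t l = 0 := (Finset.sum_eq_zero_iff_of_nonneg ht).1 h0.symm
      rw [Finset.sum_eq_zero fun l hl => by rw [h0' l hl, zero_mul], zero_pow hq,
        Finset.sum_eq_zero fun l hl => by rw [h0' l hl, zero_mul]]
    · have h1 := Real.pow_arith_mean_le_arith_mean_pow s (fun l => t l / τ) x
        (fun l hl => div_nonneg (ht l hl) hτ0) (by rw [← Finset.sum_div, div_self h0.ne']) hx q
      have e1 : ∀ y : ι → ℝ, ∑ l ∈ s, t l / τ * y l = (∑ l ∈ s, t l * y l) / τ := by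
        intro y; rw [Finset.sum_div]; exact Finset.sum_congr rfl fun l _ => by ring
      rw [e1, e1, div_pow, div_le_div_iff₀ (by positivity) h0] at h1
      have h2 : τ ^ q ≤ τ := by
        calc τ ^ q ≤ τ ^ 1 := pow_le_pow_of_le_one hτ0 ht1 (Nat.one_le_iff_ne_zero.2 hq)
          _ = τ := pow_one τ
      have h3 : 0 ≤ ∑ l ∈ s, t l * x l ^ q :=
        Finset.sum_nonneg fun l hl => mul_nonneg (ht l hl) (pow_nonneg (hx l hl) q)
      have h4 := h1.trans (mul_le_mul_of_nonneg_left h2 h3)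
      exact le_of_mul_le_mul_right h4 h0
  have hY : HasAllMoments P fun ω => ∑ l ∈ s, (t l : ℂ) * X l ω :=
    HasAllMoments.sum s fun l hl => (HasAllMoments.const _).mul (hX l hl)
  calc ∫ ω, ‖∑ l ∈ s, (t l : ℂ) * X l ω‖ ^ q ∂P
      ≤ ∫ ω, ∑ l ∈ s, t l * ‖X l ω‖ ^ q ∂P := by
        refine integral_mono (hY.integrable_norm_pow q)
          (integrable_finsetSum s fun l hl => ((hX l hl).integrable_norm_pow q).const_mul _)
          fun ω => ?_
        refine le_trans ?_ (key (fun l => ‖X l ω‖) fun l _ => norm_nonneg _)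
        refine pow_le_pow_left₀ (norm_nonneg _) ((norm_sum_le _ _).trans (le_of_eq ?_)) q
        refine Finset.sum_congr rfl fun l hl => ?_
        rw [norm_mul, Complex.norm_real, Real.norm_of_nonneg (ht l hl)]
    _ = ∑ l ∈ s, t l * ∫ ω, ‖X l ω‖ ^ q ∂P := by
        rw [integral_finsetSum s fun l hl => ((hX l hl).integrable_norm_pow q).const_mul _]
        exact Finset.sum_congr rfl fun l _ => integral_const_mul _ _
    _ ≤ ∑ l ∈ s, t l * B := Finset.sum_le_sum fun l hl => mul_le_mul_of_nonneg_left (h l hl)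
        (ht l hl)
    _ = (∑ l ∈ s, t l) * B := (Finset.sum_mul _ _ _).symm
    _ ≤ B := mul_le_of_le_one_left hB ht1

theorem fluctuation_averaging {F : Fin N → MeasurableSpace Ω} (r : ℕ) {ψ : ℝ} (hψ : 0 < ψ)
    (hψ1 : ψ ≤ 1) {t : Fin N → ℝ} (ht : ∀ l, 0 ≤ t l) (ht1 : ∑ l, t l ≤ 1)
    (htψ : ∀ l, t l ≤ ψ ^ 2) (n : ℕ) {E : Finset (Fin N)} {κ : ℝ} (hκ : 0 ≤ κ)
    {X : Finset (Fin N) → Fin N → Ω → ℂ} (hX : FluctFamily P F X)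
    (hE : ∀ T, ∀ l ∈ E, X T l = 0) (h : MomentDiff P (2 * r + 2) ψ n E κ X) :
    ∫ ω, ‖∑ l, (t l : ℂ) * X ∅ l ω‖ ^ (2 * r + 2) ∂P
      ≤ (avgConst r n * κ * avgGain ψ n) ^ (2 * r + 2) := by
  induction n generalizing E κ X with
  | zero =>
    have := integral_norm_average_pow_le (P := P) Finset.univ (fun l _ => ht l) ht1
      (fun l _ => hX.moments ∅ l) (q := 2 * r + 2) (by omega) (by positivity) fun l _ => h l
    simpa [avgConst, avgGain] using this
  | succ n ih =>
    set A := avgConst r n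
    set g := avgGain ψ n with hg
    have hA : 1 ≤ A := one_le_avgConst r n
    have hg0 : 0 < g := avgGain_pos hψ n
    obtain ⟨hgψ, hg1⟩ := avgGain_bounds hψ hψ1 n
    set s : Finset (Fin N) := Finset.univ.filter fun l => l ∉ E with hs
    have hsum : ∀ ω, ∑ l, (t l : ℂ) * X ∅ l ω = ∑ l ∈ s, (t l : ℂ) * X ∅ l ω := by
      intro ω
      rw [hs, Finset.sum_filter]
      refine Finset.sum_congr rfl fun l _ => ?_
      by_cases hl : l ∈ E
      · simp [hl, hE ∅ l hl]
      · simp [hl]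
    have hV : ∀ l, HasAllMoments P fun ω => ∑ j, (t j : ℂ) * X {l} j ω := fun l =>
      HasAllMoments.sum _ fun j _ => (HasAllMoments.const _).mul (hX.moments _ _)
    have hVm : ∀ l, Measurable[F l] fun ω => ∑ j, (t j : ℂ) * X {l} j ω := fun l =>
      Finset.measurable_sum _ fun j _ =>
        (hX.measurable {l} j l (Finset.mem_singleton_self l)).const_mul _
    set b : ℝ := A * κ * (ψ * g) with hb
    have hb0 : 0 ≤ b := by positivity
    have hU1 : ∀ l, ∫ ω, ‖(t l : ℂ) * X ∅ l ω‖ ^ (2 * r + 2) ∂P ≤ (t l * κ) ^ (2 * r + 2) := by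
      intro l
      simp only [norm_mul, mul_pow, Complex.norm_real, Real.norm_of_nonneg (ht l)]
      rw [integral_const_mul]
      exact mul_le_mul_of_nonneg_left (h.1 l) (pow_nonneg (ht l) _)
    have hc1 : (1 : ℝ) ≤ 2 ^ (2 * r + 2) * 2 := by
      have : (1 : ℝ) ≤ 2 ^ (2 * r + 2) := one_le_pow₀ (by norm_num)
      linarith
    have hfin := moment_bound (P := P) s r (U := fun l ω => (t l : ℂ) * X ∅ l ω)
      (V := fun l ω => ∑ j, (t j : ℂ) * X {l} j ω)
      (fun l _ => (HasAllMoments.const _).mul (hX.moments _ _)) (fun l _ => hV l) hsum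
      (fun l _ => by
        simp only [mul_assoc]
        have h0 : ∫ ω, X ∅ l ω * dualPow r (∑ j, (t j : ℂ) * X {l} j ω) ∂P = 0 :=
          hX.centered ∅ l _ ((measurable_dualPow r).comp (hVm l)) ((hV l).dualPow r)
        rw [integral_const_mul, h0, mul_zero])
      (u := fun l => t l * κ) (b := fun _ => b) (c := 2 ^ (2 * r + 2) * 2) (W := A * κ * b)
      (by positivity) (fun l _ => mul_nonneg (ht l) hκ) (fun _ _ => hb0)
      (fun l _ => (hU1 l).trans (le_mul_of_one_le_left (pow_nonneg (mul_nonneg (ht l) hκ) _) hc1))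
      (fun l hl => by
        have hlE : l ∉ E := (Finset.mem_filter.1 hl).2
        have hih := ih (E := insert l E) (κ := κ * ψ) (by positivity) (hX.diff l)
          (fun T j hj => by
            ext ω
            rcases Finset.mem_insert.1 hj with rfl | hj
            · simp [diffFamily]
            · simp [diffFamily, hE _ j hj]) (h.2 l hlE)
        have hD : HasAllMoments P fun ω => ∑ j, (t j : ℂ) * diffFamily l X ∅ j ω :=
          HasAllMoments.sum _ fun j _ => (HasAllMoments.const _).mul ((hX.diff l).moments _ _)
        have hsplit : ∀ ω, (∑ j, (t j : ℂ) * X ∅ j ω) - ∑ j, (t j : ℂ) * X {l} j ω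
            = (t l : ℂ) * X ∅ l ω + ∑ j, (t j : ℂ) * diffFamily l X ∅ j ω := by
          intro ω
          rw [← Finset.sum_sub_distrib, ← Finset.add_sum_erase _ _ (Finset.mem_univ l),
            ← Finset.add_sum_erase _ (fun j => (t j : ℂ) * diffFamily l X ∅ j ω)
                (Finset.mem_univ l)]
          have : X {l} l = 0 := hX.removed {l} l (Finset.mem_singleton_self l)
          simp only [this, Pi.zero_apply, mul_zero, sub_zero, diffFamily, if_true, zero_add]
          congr 1
          refine Finset.sum_congr rfl fun j hj => ?_
          rw [if_neg (Finset.ne_of_mem_erase hj), mul_sub]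
          rfl
        simp only [hsplit]
        refine (integral_norm_add_pow_le ((HasAllMoments.const _).mul
            (hX.moments _ _)) hD _).trans ?_
        rw [mul_assoc]
        refine mul_le_mul_of_nonneg_left ?_ (by positivity)
        have e1 : ∫ ω, ‖(t l : ℂ) * X ∅ l ω‖ ^ (2 * r + 2) ∂P ≤ b ^ (2 * r + 2) := by
          refine (hU1 l).trans (pow_le_pow_left₀ (mul_nonneg (ht l) hκ) ?_ _)
          calc t l * κ ≤ ψ ^ 2 * κ := mul_le_mul_of_nonneg_right (htψ l) hκ
            _ ≤ (ψ * g) * κ := by rw [pow_two]; gcongr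
            _ = 1 * κ * (ψ * g) := by ring
            _ ≤ A * κ * (ψ * g) := by gcongr
        have e2 : (avgConst r n * (κ * ψ) * avgGain ψ n) = b := by rw [hb, hg]; ring
        rw [e2] at hih
        linarith)
      (by
        rw [← Finset.sum_mul, ← Finset.sum_mul]
        have h1 : ∑ l ∈ s, t l ≤ 1 := (Finset.sum_le_sum_of_subset_of_nonneg
          (Finset.subset_univ _) fun l _ _ => ht l).trans ht1
        have h0 : 0 ≤ ∑ l ∈ s, t l := Finset.sum_nonneg fun l _ => ht l
        gcongr
        linarith)
      (fun l _ => by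
        rw [pow_two]
        refine mul_le_mul_of_nonneg_right ?_ hb0
        have : ψ * g ≤ 1 := by nlinarith
        calc b ≤ A * κ * 1 := by rw [hb]; gcongr
          _ = A * κ := mul_one _)
    refine hfin.trans ?_
    have e1 : A * κ * b = (A * κ * avgGain ψ (n + 1)) ^ 2 := by
      rw [mul_pow, avgGain, Real.sq_sqrt (by positivity)]
      rw [hb, hg]; ring
    rw [e1, ← pow_mul, show 2 * (r + 1) = 2 * r + 2 by ring]
    have hm := momConst_pos r
    set c := momConst r * (2 ^ (2 * r + 2) * 2)
    have hc0 : 0 ≤ c := by positivity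
    have e2 : avgConst r (n + 1) * κ * avgGain ψ (n + 1)
        = (1 + c) * (A * κ * avgGain ψ (n + 1)) := by
      rw [avgConst]; ring
    rw [e2, mul_pow (1 + c)]
    have h3 : c ≤ (1 + c) ^ (2 * r + 2) := by
      have := one_add_mul_le_pow (show (-2 : ℝ) ≤ c by linarith) (2 * r + 2)
      push_cast at this
      nlinarith [mul_nonneg (show (0 : ℝ) ≤ 2 * r + 1 by positivity) hc0]
    exact mul_le_mul_of_nonneg_right h3 (pow_nonneg (mul_nonneg (by positivity) (avgGain_pos hψ
        (n + 1)).le) _)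

/-- Bounds on an event of high probability imply bounds on the moments. -/
theorem integral_norm_pow_le_of_good {f : Ω → ℂ} (hf : HasAllMoments P f) {Ξ : Set Ω}
    (hΞ : MeasurableSet Ξ) {q : ℕ} {A K B ε : ℝ} (hA : 0 ≤ A) (hK : 0 < K) (hε : 0 < ε)
    (hP : P.real Ξᶜ ≤ ε) (hgood : ∀ ω ∈ Ξ, ‖f ω‖ ≤ A) (hB : ∫ ω, ‖f ω‖ ^ (2 * q) ∂P ≤ B)
    (hBK : ε * B ≤ K ^ (2 * q)) : ∫ ω, ‖f ω‖ ^ q ∂P ≤ A ^ q + K ^ q := by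
  set lam := K ^ q / ε with hlam
  have hlam0 : 0 < lam := by positivity
  have hpt : ∀ ω, ‖f ω‖ ^ q
      ≤ A ^ q + (Ξᶜ.indicator (fun _ => lam / 2) ω + (2 * lam)⁻¹ * ‖f ω‖ ^ (2 * q)) := by
    intro ω
    have h0 : 0 ≤ (2 * lam)⁻¹ * ‖f ω‖ ^ (2 * q) := by positivity
    by_cases hω : ω ∈ Ξ
    · have : ‖f ω‖ ^ q ≤ A ^ q := pow_le_pow_left₀ (norm_nonneg _) (hgood ω hω) q
      rw [Set.indicator_of_notMem (by simpa using hω)]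
      linarith
    · rw [Set.indicator_of_mem (by simpa using hω)]
      have h1 : 0 ≤ A ^ q := by positivity
      have h2 : ‖f ω‖ ^ q ≤ lam / 2 + (2 * lam)⁻¹ * ‖f ω‖ ^ (2 * q) := by
        have h3 : lam / 2 + (2 * lam)⁻¹ * ‖f ω‖ ^ (2 * q) - ‖f ω‖ ^ q
            = (2 * lam)⁻¹ * (‖f ω‖ ^ q - lam) ^ 2 := by
          field_simp; ring
        have : 0 ≤ (2 * lam)⁻¹ * (‖f ω‖ ^ q - lam) ^ 2 := by positivity
        linarith
      linarith
  have hi1 : Integrable (Ξᶜ.indicator fun _ : Ω => lam / 2) P :=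
    (integrable_const _).indicator hΞ.compl
  have hi2 := (hf.integrable_norm_pow (2 * q)).const_mul (2 * lam)⁻¹
  calc ∫ ω, ‖f ω‖ ^ q ∂P
      ≤ ∫ ω, A ^ q + (Ξᶜ.indicator (fun _ => lam / 2) ω + (2 * lam)⁻¹ * ‖f ω‖ ^ (2 * q)) ∂P :=
        integral_mono (hf.integrable_norm_pow q) ((integrable_const _).add (hi1.add hi2)) hpt
    _ = A ^ q + (P.real Ξᶜ * (lam / 2) + (2 * lam)⁻¹ * ∫ ω, ‖f ω‖ ^ (2 * q) ∂P) := by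
        have e1 := integral_add (integrable_const (μ := P) (A ^ q)) (hi1.add hi2)
        have e2 := integral_add hi1 hi2
        simp only [Pi.add_apply] at e1 e2
        rw [e1, e2, integral_indicator hΞ.compl, integral_const_mul]
        simp
    _ ≤ A ^ q + (ε * (lam / 2) + (2 * lam)⁻¹ * B) := by gcongr
    _ ≤ A ^ q + K ^ q := by
        have h1 : ε * (lam / 2) = K ^ q / 2 := by rw [hlam]; field_simp
        have h2 : (2 * lam)⁻¹ * B = ε * B / (2 * K ^ q) := by rw [hlam]; field_simp
        have h3 : ε * B / (2 * K ^ q) ≤ K ^ q / 2 := by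
          rw [div_le_div_iff₀ (by positivity) (by norm_num)]
          have : K ^ (2 * q) = K ^ q * K ^ q := by rw [two_mul, pow_add]
          nlinarith
        rw [h1, h2]; linarith

theorem integral_norm_pow_le_of_smallDiff {q : ℕ} {ψ : ℝ} (hψ : 0 < ψ) (hψ1 : ψ ≤ 1) {Ξ : Set Ω}
    (hΞ : MeasurableSet Ξ) {ε : ℝ} (hε : 0 < ε) (hP : P.real Ξᶜ ≤ ε) {C : ℝ} (hC : 0 < C)
    {n m : ℕ} {E : Finset (Fin N)} {B : ℝ} {f : Finset (Fin N) → Ω → ℂ} (hB : 0 ≤ B)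
    (hf : HasAllMoments P (f ∅)) (hgood : ∀ ω ∈ Ξ, SmallDiff ψ n E m C fun T => f T ω)
    (hfB : ∫ ω, ‖f ∅ ω‖ ^ (2 * q) ∂P ≤ B)
    (hBK : ε * ((2 ^ (2 * q) * 2) ^ n * B) ≤ (C * ψ ^ (m + n)) ^ (2 * q)) (hq : q ≠ 0) :
    ∫ ω, ‖f ∅ ω‖ ^ q ∂P ≤ (2 * C * ψ ^ m) ^ q := by
  have h2 : (1 : ℝ) ≤ 2 ^ (2 * q) * 2 := by
    have : (1 : ℝ) ≤ 2 ^ (2 * q) := one_le_pow₀ (by norm_num)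
    linarith
  have h1 := integral_norm_pow_le_of_good hf hΞ (A := C * ψ ^ m) (K := C * ψ ^ (m + n))
    (by positivity) (by positivity) hε hP (fun ω hω => (hgood ω hω).norm_le) hfB
    (le_trans (mul_le_mul_of_nonneg_left (le_mul_of_one_le_left hB (one_le_pow₀ h2)) hε.le) hBK)
  refine h1.trans ?_
  have h3 : C * ψ ^ (m + n) ≤ C * ψ ^ m :=
    mul_le_mul_of_nonneg_left (pow_le_pow_of_le_one hψ.le hψ1 (Nat.le_add_right m n)) hC.le
  have h4 : (C * ψ ^ (m + n)) ^ q ≤ (C * ψ ^ m) ^ q := pow_le_pow_left₀ (by positivity) h3 q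
  have h5 : (2 * C * ψ ^ m) ^ q = 2 ^ q * (C * ψ ^ m) ^ q := by rw [mul_assoc, mul_pow]
  have h6 : (2 : ℝ) ≤ 2 ^ q := by
    calc (2 : ℝ) = 2 ^ 1 := (pow_one 2).symm
      _ ≤ 2 ^ q := pow_le_pow_right₀ (by norm_num) (Nat.one_le_iff_ne_zero.2 hq)
  rw [h5]
  nlinarith [show 0 ≤ (C * ψ ^ m) ^ q by positivity]

theorem momentDiff_of_smallDiff {q : ℕ} {ψ : ℝ} (hψ : 0 < ψ) (hψ1 : ψ ≤ 1) {Ξ : Set Ω}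
    (hΞ : MeasurableSet Ξ) {ε : ℝ} (hε : 0 < ε) (hP : P.real Ξᶜ ≤ ε) {C : ℝ} (hC : 0 < C)
    {n m : ℕ} {E : Finset (Fin N)} {B : ℝ} {X : Finset (Fin N) → Fin N → Ω → ℂ} (hB : 0 ≤ B)
    (hX : ∀ T l, HasAllMoments P (X T l)) (hE : ∀ T, ∀ l ∈ E, X T l = 0)
    (hgood : ∀ ω ∈ Ξ, ∀ l, l ∉ E → SmallDiff ψ n (insert l E) m C fun T => X T l ω)
    (hXB : ∀ T l, ∫ ω, ‖X T l ω‖ ^ (2 * q) ∂P ≤ B)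
    (hBK : ε * ((2 ^ (2 * q) * 2) ^ n * B) ≤ (C * ψ ^ (m + n)) ^ (2 * q)) (hq : q ≠ 0) :
    MomentDiff P q ψ n E (2 * C * ψ ^ m) X := by
  induction n generalizing E B X m with
  | zero =>
    intro l
    by_cases hl : l ∈ E
    · rw [hE ∅ l hl]
      simp only [Pi.zero_apply, norm_zero, zero_pow hq, integral_zero]
      positivity
    · exact integral_norm_pow_le_of_smallDiff hψ hψ1 hΞ hε hP hC hB (f := fun T => X T l) (hX ∅ l)
        (fun ω hω => hgood ω hω l hl) (hXB ∅ l) hBK hq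
  | succ n ih =>
    refine ⟨fun l => ?_, fun k hk => ?_⟩
    · by_cases hl : l ∈ E
      · rw [hE ∅ l hl]
        simp only [Pi.zero_apply, norm_zero, zero_pow hq, integral_zero]
        positivity
      · exact integral_norm_pow_le_of_smallDiff hψ hψ1 hΞ hε hP hC hB (f := fun T => X T l) (hX ∅ l)
          (fun ω hω => hgood ω hω l hl) (hXB ∅ l) hBK hq
    have hEk : ∀ T, ∀ l ∈ insert k E, diffFamily k X T l = 0 := by
      intro T l hl
      ext ω
      rcases Finset.mem_insert.1 hl with rfl | hl
      · simp [diffFamily]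
      · simp [diffFamily, hE _ l hl]
    have hgk : ∀ ω ∈ Ξ, ∀ l, l ∉ insert k E →
        SmallDiff ψ n (insert l (insert k E)) (m + 1) C fun T => diffFamily k X T l ω := by
      intro ω hω l hl
      rw [Finset.mem_insert, not_or] at hl
      have := (hgood ω hω l hl.2).2 k (by simp [hk, Ne.symm hl.1])
      rw [Finset.insert_comm] at this
      refine this.congr fun T _ => ?_
      simp [rowDiff, diffFamily, hl.1]
    have hBk : ∀ T l, ∫ ω, ‖diffFamily k X T l ω‖ ^ (2 * q) ∂P ≤ 2 ^ (2 * q) * 2 * B := by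
      intro T l
      unfold diffFamily
      by_cases hlk : l = k
      · simp only [hlk, if_true, norm_zero, zero_pow (show 2 * q ≠ 0 by omega), integral_zero]
        positivity
      · simp only [hlk, if_false, sub_eq_add_neg]
        have hn : HasAllMoments P fun ω => -X (insert k T) l ω := by
          simpa using (HasAllMoments.const (P := P) (-1)).mul (hX (insert k T) l)
        refine (integral_norm_add_pow_le (hX T l) hn (2 * q)).trans ?_
        simp only [norm_neg]
        rw [mul_assoc]
        refine mul_le_mul_of_nonneg_left ?_ (by positivity)
        linarith [hXB T l, hXB (insert k T) l]
    have := ih (E := insert k E) (m := m + 1) (B := 2 ^ (2 * q) * 2 * B) (by positivity)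
      (hasAllMoments_diffFamily hX k) hEk hgk hBk (by
        convert hBK using 1
        · rw [pow_succ]; ring
        · congr 3; omega)
    convert this using 1
    rw [pow_succ]; ring

end FluctuationAveraging
end LocalSemicircle

namespace LocalSemicircle

section LargeDeviationRandom

variable {Ω : Type*} [MeasurableSpace Ω] {P : Measure Ω} [IsProbabilityMeasure P]
variable {ι : Type*} [DecidableEq ι]

/-- Large deviation bound for linear forms with independent random coefficients. -/
theorem measureReal_linear_le (s : Finset ι) (r : ℕ) {X : ι → Ω → ℂ} (hXm : ∀ k, Measurable (X k))
    (hind : iIndepFun X P) (hX : ∀ k, HasAllMoments P (X k)) (h0 : ∀ k, ∫ ω, X k ω ∂P = 0)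
    {c : ℝ} (hc : 0 ≤ c) {σ : ι → ℝ} (hσ : ∀ k, 0 ≤ σ k)
    (hm : ∀ k, ∫ ω, ‖X k ω‖ ^ (2 * r + 2) ∂P ≤ c * σ k ^ (2 * r + 2)) {a : Ω → ι → ℂ}
    (ha : Measurable a) (hXa : IndepFun (fun ω k => X k ω) a P) {t : ℝ} (ht : 0 < t) :
    P.real {ω | t * (∑ k ∈ s, (‖a ω k‖ * σ k) ^ 2) ^ (r + 1)
      < ‖∑ k ∈ s, a ω k * X k ω‖ ^ (2 * r + 2)} ≤ momConst r * c / t := by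
  have hB : MeasurableSet {p : (ι → ℂ) × (ι → ℂ) | t * (∑ k ∈ s, (‖p.2 k‖ * σ k) ^ 2) ^ (r + 1)
      < ‖∑ k ∈ s, p.2 k * p.1 k‖ ^ (2 * r + 2)} := by
    apply measurableSet_lt <;> fun_prop
  refine measureReal_prod_le_of_indep (measurable_pi_lambda _ hXm) ha hXa hB fun y => ?_
  have hY : HasAllMoments P fun ω => ∑ k ∈ s, y k * X k ω :=
    HasAllMoments.sum s fun k _ => (HasAllMoments.const _).mul (hX k)
  exact measureReal_lt_le_of_moment (hY.integrable_norm_pow _) (fun ω => by positivity)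
    (by positivity) ht (mul_nonneg (momConst_pos r).le hc)
    (linear_moment s r hXm hind hX h0 hc hσ hm y)

theorem quadConst_nonneg (r : ℕ) {c : ℝ} (hc : 0 ≤ c) : 0 ≤ quadConst r c := by
  have := momConst_pos r
  unfold quadConst; positivity

/-- Large deviation bound for quadratic forms with independent random coefficients. -/
theorem measureReal_quadratic_le (s : Finset ι) (r : ℕ) {X : ι → Ω → ℂ}
    (hXm : ∀ k, Measurable (X k))
    (hind : iIndepFun X P) (hX : ∀ k, HasAllMoments P (X k)) (h0 : ∀ k, ∫ ω, X k ω ∂P = 0)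
    {c : ℝ} (hc : 0 ≤ c) {σ : ι → ℝ} (hσ : ∀ k, 0 ≤ σ k)
    (hm : ∀ k, ∫ ω, ‖X k ω‖ ^ (2 * r + 2) ∂P ≤ c * σ k ^ (2 * r + 2)) {a : Ω → ι → ι → ℂ}
    (ha : Measurable a) (hXa : IndepFun (fun ω k => X k ω) a P) {t : ℝ} (ht : 0 < t) :
    P.real {ω | t * (∑ k ∈ s, ∑ j ∈ s, σ k ^ 2 * σ j ^ 2 * ‖a ω k j‖ ^ 2) ^ (r + 1)
      < ‖∑ k ∈ s, ∑ j ∈ s.erase k, X k ω * a ω k j * (starRingEnd ℂ) (X j ω)‖ ^ (2 * r + 2)}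
      ≤ 2 * quadConst r c / t := by
  have hB : MeasurableSet {p : (ι → ℂ) × (ι → ι → ℂ) |
      t * (∑ k ∈ s, ∑ j ∈ s, σ k ^ 2 * σ j ^ 2 * ‖p.2 k j‖ ^ 2) ^ (r + 1)
      < ‖∑ k ∈ s, ∑ j ∈ s.erase k, p.1 k * p.2 k j * (starRingEnd ℂ) (p.1 j)‖ ^ (2 * r + 2)} := by
    have hcj : Measurable (starRingEnd ℂ) := Complex.continuous_conj.measurable
    apply measurableSet_lt <;> fun_prop
  refine measureReal_prod_le_of_indep (measurable_pi_lambda _ hXm) ha hXa hB fun y => ?_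
  have hY : HasAllMoments P fun ω => ∑ k ∈ s, ∑ j ∈ s.erase k,
      X k ω * y k j * (starRingEnd ℂ) (X j ω) :=
    HasAllMoments.sum s fun k _ => HasAllMoments.sum _ fun j _ =>
      ((hX k).mul (HasAllMoments.const _)).mul (hX j).conj
  exact measureReal_lt_le_of_moment (hY.integrable_norm_pow _) (fun ω => by positivity)
    (pow_nonneg (Finset.sum_nonneg fun k _ => Finset.sum_nonneg fun j _ => by
      have := hσ k; have := hσ j; positivity) _) ht
    (mul_nonneg zero_le_two (quadConst_nonneg r hc))
    (quadratic_moment s r hXm hind hX h0 hc hσ hm y)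

end LargeDeviationRandom

section ResolventMeasurability

variable {Ω : Type*} {N : ℕ} {m : MeasurableSpace Ω}

theorem measurable_det {A : Ω → Matrix (Fin N) (Fin N) ℂ}
    (hA : ∀ i j, Measurable[m] fun ω => A ω i j) :
    Measurable[m] fun ω => (A ω).det := by
  simp only [Matrix.det_apply']
  exact Finset.measurable_sum _ fun σ _ => (measurable_const).mul
    (Finset.measurable_prod _ fun i _ => hA _ _)

theorem measurable_inv_apply {A : Ω → Matrix (Fin N) (Fin N) ℂ}
    (hA : ∀ i j, Measurable[m] fun ω => A ω i j) (i j : Fin N) :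
    Measurable[m] fun ω => (A ω)⁻¹ i j := by
  simp only [Matrix.inv_def, Matrix.smul_apply, Ring.inverse_eq_inv', smul_eq_mul,
    Matrix.adjugate_apply]
  refine (measurable_det hA).inv.mul (measurable_det fun k l => ?_)
  simp only [Matrix.updateRow_apply]
  by_cases h : k = j
  · simp only [h, if_true]; exact measurable_const
  · simp only [h, if_false]; exact hA k l

theorem measurable_green {A : Ω → Matrix (Fin N) (Fin N) ℂ}
    (hA : ∀ i j, Measurable[m] fun ω => A ω i j) (z : ℂ) (i j : Fin N) :
    Measurable[m] fun ω => green (A ω) z i j := by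
  unfold green
  refine measurable_inv_apply (fun k l => ?_) i j
  simp only [Matrix.sub_apply]
  exact (hA k l).sub measurable_const

end ResolventMeasurability

section ModelFacts

variable {Ω : Type u} [MeasurableSpace Ω] {P : Measure Ω} [IsProbabilityMeasure P] {N : ℕ}
  {δ : ℝ} {μ : ℕ → ℝ} {H : Ω → Matrix (Fin N) (Fin N) ℂ}

/-- The index set of the independent entries. -/
abbrev UpperPair (N : ℕ) : Type := {p : Fin N × Fin N // p.1 ≤ p.2}

/-- The independent entries of `H`. -/
def upperEntry (H : Ω → Matrix (Fin N) (Fin N) ℂ) (p : UpperPair N) (ω : Ω) : ℂ :=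
  H ω p.1.1 p.1.2

/-- The position of the entry `(l, k)` in the upper triangle. -/
def upperPos (l k : Fin N) : UpperPair N := ⟨(min l k, max l k), min_le_max⟩

theorem upperPos_injective (l : Fin N) : Function.Injective (upperPos l) := by
  intro j k h
  have h1 : min l j = min l k := congrArg (fun p : UpperPair N => p.1.1) h
  have h2 : max l j = max l k := congrArg (fun p : UpperPair N => p.1.2) h
  rcases le_total l j with h3 | h3 <;> rcases le_total l k with h4 | h4 <;>
    simp only [h3, h4, min_eq_left, min_eq_right, max_eq_left, max_eq_right] at h1 h2
  · exact h2
  · exact h2.trans h1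
  · exact h1.trans h2
  · exact h1

/-- The information on the entries outside of the rows in `T`. -/
@[reducible] noncomputable def minorInfo (H : Ω → Matrix (Fin N) (Fin N) ℂ) (T : Finset (Fin N)) :
    MeasurableSpace Ω :=
  sigmaOf (upperEntry H) {p | p.1.1 ∉ T ∧ p.1.2 ∉ T}

/-- The information on the entries in the row `l`. -/
@[reducible] noncomputable def rowInfo (H : Ω → Matrix (Fin N) (Fin N) ℂ) (l : Fin N) :
    MeasurableSpace Ω :=
  sigmaOf (upperEntry H) {p | p.1.1 = l ∨ p.1.2 = l}

namespace IsModel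

theorem apply_swap (h : IsModel δ μ P H) (ω : Ω) (i j : Fin N) :
    H ω j i = (starRingEnd ℂ) (H ω i j) :=
  ((h.hermitian ω).apply j i).symm

theorem apply_eq_upperEntry (h : IsModel δ μ P H) (l k : Fin N) : (fun ω => H ω l k)
    = (if l ≤ k then id else (starRingEnd ℂ : ℂ → ℂ)) ∘ upperEntry H (upperPos l k) := by
  ext ω
  by_cases hlk : l ≤ k
  · simp [upperEntry, upperPos, hlk]
  · have hkl := (not_le.1 hlk).le
    simp only [hlk, if_false, upperEntry, upperPos, Function.comp_apply, min_eq_right hkl,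
      max_eq_left hkl]
    exact h.apply_swap ω k l

theorem measurable_sigmaOf_apply (h : IsModel δ μ P H) {A : Set (UpperPair N)} {l k : Fin N}
    (hA : upperPos l k ∈ A) :
    Measurable[sigmaOf (upperEntry H) A] fun ω => H ω l k := by
  rw [h.apply_eq_upperEntry]
  refine Measurable.comp ?_ (measurable_sigmaOf hA)
  split_ifs
  · exact measurable_id
  · exact Complex.continuous_conj.measurable

theorem measurable_row (h : IsModel δ μ P H) (l k : Fin N) :
    Measurable[rowInfo H l] fun ω => H ω l k :=
  h.measurable_sigmaOf_apply (by
    rcases le_total l k with h' | h'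
    · exact Or.inl (min_eq_left h')
    · exact Or.inr (max_eq_left h'))

theorem measurable_minor (h : IsModel δ μ P H) {T : Finset (Fin N)} {i j : Fin N}
    (hi : i ∉ T) (hj : j ∉ T) :
    Measurable[minorInfo H T] fun ω => H ω i j :=
  h.measurable_sigmaOf_apply (by
    rcases le_total i j with h' | h'
    · simp only [upperPos, min_eq_left h', max_eq_right h']; exact ⟨hi, hj⟩
    · simp only [upperPos, min_eq_right h', max_eq_left h']; exact ⟨hj, hi⟩)

theorem measurable_minorGreen (h : IsModel δ μ P H) {T T' : Finset (Fin N)} (hT : T' ⊆ T)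
    (z : ℂ) (i j : Fin N) :
    Measurable[minorInfo H T'] fun ω => minorGreen (H ω) z i j T := by
  have hle : minorInfo H T ≤ minorInfo H T' :=
    sigmaOf_mono fun p hp => ⟨fun h' => hp.1 (hT h'), fun h' => hp.2 (hT h')⟩
  refine Measurable.mono (measurable_green (fun k l => ?_) z i j) hle le_rfl
  simp only [zeroOut_apply]
  by_cases hkl : k ∈ T ∨ l ∈ T
  · simp only [hkl, if_true]; exact measurable_const
  · simp only [hkl, if_false]
    rw [not_or] at hkl
    exact h.measurable_minor hkl.1 hkl.2

theorem measurable_upperEntry (h : IsModel δ μ P H) (p : UpperPair N) :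
    Measurable (upperEntry H p) := h.measurable _ _

theorem indepFun_row_minor (h : IsModel δ μ P H) {γ γ' : Type*} [MeasurableSpace γ]
    [MeasurableSpace γ'] {l : Fin N}
    {T : Finset (Fin N)} (hl : l ∈ T) {f : Ω → γ} {g : Ω → γ'} (hf : Measurable[rowInfo H l] f)
    (hg : Measurable[minorInfo H T] g) : IndepFun f g P := by
  refine indepFun_of_sigmaOf h.measurable_upperEntry h.indep ?_ hf hg
  rw [Set.disjoint_left]
  rintro p (h1 | h1) h2
  · exact h2.1 (h1 ▸ hl)
  · exact h2.2 (h1 ▸ hl)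

theorem minorInfo_le (h : IsModel δ μ P H) (T : Finset (Fin N)) :
    minorInfo H T ≤ (inferInstance : MeasurableSpace Ω) :=
  sigmaOf_le h.measurable_upperEntry _

theorem iIndepFun_row (h : IsModel δ μ P H) (l : Fin N) : iIndepFun (fun k ω => H ω l k) P := by
  have h1 := (iIndepFun.precomp (upperPos_injective l) h.indep).comp
    (fun k => if l ≤ k then id else (starRingEnd ℂ : ℂ → ℂ)) fun k => by
      split_ifs
      · exact measurable_id
      · exact Complex.continuous_conj.measurable
  convert h1 using 1
  ext k ω
  exact congrFun (h.apply_eq_upperEntry l k) ω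

theorem hasAllMoments (h : IsModel δ μ P H) (i j : Fin N) : HasAllMoments P fun ω => H ω i j :=
    h.memLp i j

theorem varMatrix_nonneg (_ : IsModel δ μ P H) (i j : Fin N) : 0 ≤ varMatrix P H i j :=
  integral_nonneg fun ω => by positivity

theorem isSymmStochastic (h : IsModel δ μ P H) : IsSymmStochastic (varMatrix P H) := by
  refine ⟨h.varMatrix_nonneg, fun i j => ?_, h.stochastic⟩
  simp only [varMatrix, Matrix.of_apply]
  congr 1
  ext ω
  rw [h.apply_swap ω j i, RCLike.norm_conj]

theorem varMatrix_le_one (h : IsModel δ μ P H) (i j : Fin N) : varMatrix P H i j ≤ 1 := by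
  rw [← h.stochastic i]
  exact Finset.single_le_sum (f := fun j => varMatrix P H i j)
    (fun k _ => h.varMatrix_nonneg i k) (Finset.mem_univ j)

theorem invMax_pos (h : IsModel δ μ P H) (hN : 0 < N) : 0 < invMax (varMatrix P H) :=
  lt_of_lt_of_le (by positivity) h.lower_M

theorem varMatrix_le (_ : IsModel δ μ P H) (i j : Fin N) :
    varMatrix P H i j ≤ (invMax (varMatrix P H))⁻¹ := by
  rw [invMax, inv_inv]
  exact le_ciSup (f := fun p : Fin N × Fin N => varMatrix P H p.1 p.2) (Set.finite_range _).bddAbove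
    (i, j)

theorem integral_norm_pow_le (h : IsModel δ μ P H) (i j : Fin N) {p : ℕ} (hp : p ≠ 0) :
    ∫ ω, ‖H ω i j‖ ^ p ∂P ≤ |μ p| * Real.sqrt (varMatrix P H i j) ^ p := by
  rcases (h.varMatrix_nonneg i j).eq_or_lt with h0 | h0
  · have h1 : (fun ω => H ω i j) =ᵐ[P] 0 := by
      have := ae_eq_zero_of_integral_pow (r := 0) (h.hasAllMoments i j) (by
        simpa [varMatrix] using h0.ge)
      exact this
    have h2 : ∫ ω, ‖H ω i j‖ ^ p ∂P = 0 := by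
      rw [← integral_zero Ω ℝ (μ := P)]
      refine integral_congr_ae ?_
      filter_upwards [h1] with ω hω
      simp only [hω, Pi.zero_apply, norm_zero, zero_pow hp]
    rw [h2]; positivity
  · have hs : 0 < Real.sqrt (varMatrix P H i j) := Real.sqrt_pos.2 h0
    have h1 : ∀ ω, ‖H ω i j‖ ^ p
        = Real.sqrt (varMatrix P H i j) ^ p * ‖normEntry P H i j ω‖ ^ p := by
      intro ω
      rw [normEntry, norm_mul, norm_inv, Complex.norm_real, Real.norm_of_nonneg hs.le, ← mul_pow]
      field_simp
    simp only [h1]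
    rw [integral_const_mul, mul_comm]
    exact mul_le_mul_of_nonneg_right ((h.moments i j p).trans (le_abs_self _)) (by positivity)

/-- Moments of the centered squares of the entries. -/
theorem integral_norm_sq_sub_pow_le (h : IsModel δ μ P H) (i j : Fin N) {p : ℕ} (hp : p ≠ 0) :
    ∫ ω, ‖((‖H ω i j‖ ^ 2 : ℝ) : ℂ) - (varMatrix P H i j : ℂ)‖ ^ p ∂P
      ≤ 2 ^ p * (|μ (2 * p)| + 1) * varMatrix P H i j ^ p := by
  have hs := h.varMatrix_nonneg i j
  have e : ∀ ω, ((‖H ω i j‖ ^ 2 : ℝ) : ℂ) = H ω i j * (starRingEnd ℂ) (H ω i j) := fun ω => by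
    rw [Complex.mul_conj, Complex.normSq_eq_norm_sq]
  have h1 : HasAllMoments P fun ω => ((‖H ω i j‖ ^ 2 : ℝ) : ℂ) := by
    simp only [e]; exact (h.hasAllMoments i j).mul (h.hasAllMoments i j).conj
  have h2 := integral_norm_add_pow_le h1 (HasAllMoments.const (-(varMatrix P H i j : ℂ))) p
  simp only [← sub_eq_add_neg] at h2
  refine h2.trans ?_
  rw [mul_assoc]
  refine mul_le_mul_of_nonneg_left ?_ (by positivity)
  have h3 := h.integral_norm_pow_le i j (p := 2 * p) (by omega)
  simp only [norm_neg, Complex.norm_real, integral_const, probReal_univ, one_smul,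
    Real.norm_of_nonneg hs, norm_pow, norm_norm, ← pow_mul]
  rw [pow_mul (Real.sqrt _), Real.sq_sqrt hs] at h3
  rw [add_mul, one_mul]
  exact add_le_add h3 le_rfl

theorem hasAllMoments_norm_sq_sub (h : IsModel δ μ P H) (i j : Fin N) :
    HasAllMoments P fun ω => ((‖H ω i j‖ ^ 2 : ℝ) : ℂ) - (varMatrix P H i j : ℂ) := by
  have e : ∀ ω, ((‖H ω i j‖ ^ 2 : ℝ) : ℂ) = H ω i j * (starRingEnd ℂ) (H ω i j) := fun ω => by
    rw [Complex.mul_conj, Complex.normSq_eq_norm_sq]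
  simp only [e]
  exact ((h.hasAllMoments i j).mul (h.hasAllMoments i j).conj).sub (HasAllMoments.const _)

theorem integral_norm_sq_sub (h : IsModel δ μ P H) (i j : Fin N) :
    ∫ ω, (((‖H ω i j‖ ^ 2 : ℝ) : ℂ) - (varMatrix P H i j : ℂ)) ∂P = 0 := by
  have h1 := (h.hasAllMoments i j).integrable_norm_pow 2
  have e : ∫ ω, ((‖H ω i j‖ ^ 2 : ℝ) : ℂ) ∂P = (varMatrix P H i j : ℂ) := integral_complex_ofReal
  rw [integral_sub h1.ofReal (integrable_const _), e]
  simp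

end IsModel

end ModelFacts
end LocalSemicircle

namespace LocalSemicircle

section FluctuationFamily

variable {N : ℕ}

/-- Schur complement formula for the fluctuating part of the inverse diagonal entries. -/
theorem invFluct_eq {H : Matrix (Fin N) (Fin N) ℂ} (hH : H.IsHermitian) {z : ℂ} (hz : 0 < z.im)
    (s : Fin N → ℝ) {l : Fin N} {T : Finset (Fin N)} (hl : l ∉ T) :
    invFluct s H z l T = H l l
      - ∑ k ∈ Finset.univ \ insert l T, ∑ j ∈ (Finset.univ \ insert l T).erase k,
          H l k * minorGreen H z k j (insert l T) * (starRingEnd ℂ) (H l j)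
      - ∑ k ∈ Finset.univ \ insert l T, (((‖H l k‖ ^ 2 : ℝ) : ℂ) - (s k : ℂ)) *
          minorGreen H z k k (insert l T) := by
  set B := Finset.univ \ insert l T with hB
  have hsub : B ⊆ Finset.univ.erase l := by
    intro k hk
    simp only [hB, Finset.mem_sdiff, Finset.mem_univ, true_and, Finset.mem_insert, not_or] at hk
    simpa using hk.1
  have hmem : ∀ k, k ∈ Finset.univ.erase l → k ∉ B → k ∈ T := by
    intro k hk hkB
    simp only [hB, Finset.mem_sdiff, Finset.mem_univ, true_and, Finset.mem_insert, not_or, not_and,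
      not_not] at hkB
    exact hkB (Finset.ne_of_mem_erase hk)
  have hB' : ∀ k ∈ B, k ∉ T := by
    intro k hk
    simp only [hB, Finset.mem_sdiff, Finset.mem_univ, true_and, Finset.mem_insert, not_or] at hk
    exact hk.2
  have h1 := green_schur (isHermitian_zeroOut hH T) hz l
  rw [zeroOut_zeroOut] at h1
  have h2 : ∑ k ∈ Finset.univ.erase l, ∑ j ∈ Finset.univ.erase l,
      zeroOut H T l k * green (zeroOut H (insert l T)) z k j * zeroOut H T j l
      = ∑ k ∈ B, ∑ j ∈ B, H l k * minorGreen H z k j (insert l T) * (starRingEnd ℂ) (H l j) := by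
    rw [← Finset.sum_subset hsub fun k hk hkB => Finset.sum_eq_zero fun j _ => by
      simp [zeroOut_apply, hmem k hk hkB]]
    refine Finset.sum_congr rfl fun k hk => ?_
    rw [← Finset.sum_subset hsub fun j hj hjB => by simp [zeroOut_apply, hmem j hj hjB]]
    refine Finset.sum_congr rfl fun j hj => ?_
    rw [zeroOut_apply, zeroOut_apply, if_neg (by simp [hl, hB' k hk]),
      if_neg (by simp [hl, hB' j hj]), ← hH.apply j l]
    rfl
  have h3 : ∑ k ∈ Finset.univ.erase l, (s k : ℂ) *
      (if k ∈ T then 0 else minorGreen H z k k (insert l T))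
      = ∑ k ∈ B, (s k : ℂ) * minorGreen H z k k (insert l T) := by
    rw [← Finset.sum_subset hsub fun k hk hkB => by simp [hmem k hk hkB]]
    exact Finset.sum_congr rfl fun k hk => by rw [if_neg (hB' k hk)]
  have h4 : ∀ k ∈ B, ∑ j ∈ B, H l k * minorGreen H z k j (insert l T) * (starRingEnd ℂ) (H l j)
      = (∑ j ∈ B.erase k, H l k * minorGreen H z k j (insert l T) * (starRingEnd ℂ) (H l j))
        + ((‖H l k‖ ^ 2 : ℝ) : ℂ) * minorGreen H z k k (insert l T) := by
    intro k hk
    rw [← Finset.add_sum_erase _ _ hk, add_comm]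
    congr 1
    rw [mul_right_comm, Complex.mul_conj, Complex.normSq_eq_norm_sq]
  have h5 : (minorGreen H z l l T)⁻¹ = (green (zeroOut H T) z l l)⁻¹ := rfl
  rw [invFluct, h3, h5, h1, h2, Finset.sum_congr rfl h4, zeroOut_apply, if_neg (by simp [hl])]
  simp only [sub_mul, Finset.sum_sub_distrib, Finset.sum_add_distrib]
  ring

variable {Ω : Type u} [MeasurableSpace Ω] {P : Measure Ω} [IsProbabilityMeasure P]
  {δ : ℝ} {μ : ℕ → ℝ} {H : Ω → Matrix (Fin N) (Fin N) ℂ}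

/-- The fluctuating parts of the inverse diagonal resolvent entries of the minors of `H`. -/
noncomputable def fluct (P : Measure Ω) (H : Ω → Matrix (Fin N) (Fin N) ℂ) (z : ℂ)
    (T : Finset (Fin N)) (l : Fin N) (ω : Ω) : ℂ :=
  if l ∈ T then 0 else invFluct (varMatrix P H l) (H ω) z l T

namespace IsModel

theorem norm_minorGreen_le (h : IsModel δ μ P H) {z : ℂ} (hz : 0 < z.im) (i j : Fin N)
    (T : Finset (Fin N)) (ω : Ω) : ‖minorGreen (H ω) z i j T‖ ≤ 1 / z.im :=
  norm_green_le (isHermitian_zeroOut (h.hermitian ω) T) hz i j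

theorem hasAllMoments_minorGreen (h : IsModel δ μ P H) {z : ℂ} (hz : 0 < z.im) (i j : Fin N)
    (T : Finset (Fin N)) : HasAllMoments P fun ω => minorGreen (H ω) z i j T :=
  HasAllMoments.of_bound
    ((h.measurable_minorGreen (Finset.Subset.refl T) z i j).mono
      (h.minorInfo_le T) le_rfl).aestronglyMeasurable
    (h.norm_minorGreen_le hz i j T)

theorem fluct_eq (h : IsModel δ μ P H) {z : ℂ} (hz : 0 < z.im) {l : Fin N} {T : Finset (Fin N)}
    (hl : l ∉ T) : fluct P H z T l = fun ω => H ω l l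
      - ∑ k ∈ Finset.univ \ insert l T, ∑ j ∈ (Finset.univ \ insert l T).erase k,
          H ω l k * minorGreen (H ω) z k j (insert l T) * (starRingEnd ℂ) (H ω l j)
      - ∑ k ∈ Finset.univ \ insert l T,
          (((‖H ω l k‖ ^ 2 : ℝ) : ℂ) - (varMatrix P H l k : ℂ)) *
          minorGreen (H ω) z k k (insert l T) := by
  ext ω
  rw [fluct, if_neg hl, invFluct_eq (h.hermitian ω) hz _ hl]

theorem hasAllMoments_fluct (h : IsModel δ μ P H) {z : ℂ} (hz : 0 < z.im) (T : Finset (Fin N))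
    (l : Fin N) : HasAllMoments P (fluct P H z T l) := by
  by_cases hl : l ∈ T
  · have : fluct P H z T l = fun _ => 0 := by ext ω; rw [fluct, if_pos hl]
    rw [this]; exact HasAllMoments.const 0
  · rw [h.fluct_eq hz hl]
    exact ((h.hasAllMoments l l).sub (HasAllMoments.sum _ fun k _ => HasAllMoments.sum _ fun j _ =>
      ((h.hasAllMoments l k).mul (h.hasAllMoments_minorGreen hz _ _ _)).mul
        (h.hasAllMoments l j).conj)).sub (HasAllMoments.sum _ fun k _ =>
      (h.hasAllMoments_norm_sq_sub l k).mul (h.hasAllMoments_minorGreen hz _ _ _))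

/-- A centered function of the row `l` is orthogonal to functions of the minor. -/
theorem integral_row_mul_eq_zero (h : IsModel δ μ P H) {l : Fin N} {f g : Ω → ℂ}
    (hf : Measurable[rowInfo H l] f) (hg : Measurable[minorInfo H {l}] g) (h0 : ∫ ω, f ω ∂P = 0) :
    ∫ ω, f ω * g ω ∂P = 0 :=
  integral_mul_eq_zero_of_indep (h.indepFun_row_minor (Finset.mem_singleton_self l) hf hg)
    (hf.mono (sigmaOf_le h.measurable_upperEntry _) le_rfl).aestronglyMeasurable
    (hg.mono (h.minorInfo_le _) le_rfl).aestronglyMeasurable h0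

theorem integral_row_mul_conj (h : IsModel δ μ P H) {l j k : Fin N} (hjk : j ≠ k) :
    ∫ ω, H ω l k * (starRingEnd ℂ) (H ω l j) ∂P = 0 := by
  have h1 := (h.iIndepFun_row l).indepFun hjk.symm
  have h2 : IndepFun (fun ω => H ω l k) (fun ω => (starRingEnd ℂ) (H ω l j)) P :=
    h1.comp measurable_id Complex.continuous_conj.measurable
  exact integral_mul_eq_zero_of_indep h2 (h.hasAllMoments l k).aesm (h.hasAllMoments l j).conj.aesm
    (h.centered l k)

theorem fluctFamily (h : IsModel δ μ P H) {z : ℂ} (hz : 0 < z.im) :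
    FluctFamily P (fun l => minorInfo H {l}) (fluct P H z) := by
  refine ⟨h.hasAllMoments_fluct hz, fun T l hl => ?_, fun T l k hk => ?_, fun T l Z hZ hZ' => ?_⟩
  · ext ω; rw [fluct, if_pos hl]; rfl
  · by_cases hl : l ∈ T
    · have : fluct P H z T l = fun _ => 0 := by ext ω; rw [fluct, if_pos hl]
      rw [this]; exact measurable_const
    · have hle : ∀ T' : Finset (Fin N), T ⊆ T' → ∀ i j,
          Measurable[minorInfo H {k}] fun ω => minorGreen (H ω) z i j T' := fun T' hT' i j =>
        h.measurable_minorGreen (Finset.singleton_subset_iff.2 (hT' hk)) z i j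
      have : fluct P H z T l = fun ω => (minorGreen (H ω) z l l T)⁻¹ + z
          + ∑ k ∈ Finset.univ.erase l, (varMatrix P H l k : ℂ) *
            (if k ∈ T then 0 else minorGreen (H ω) z k k (insert l T)) := by
        ext ω; rw [fluct, if_neg hl]; rfl
      rw [this]
      refine ((hle T (Finset.Subset.refl T) l l).inv.add measurable_const).add
        (Finset.measurable_sum _ fun j _ => measurable_const.mul ?_)
      by_cases hj : j ∈ T
      · simp only [hj, if_true]; exact measurable_const
      · simp only [hj, if_false]; exact hle _ (Finset.subset_insert l T) j j
  · by_cases hl : l ∈ T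
    · simp [fluct, if_pos hl]
    · have hG : ∀ i j, Measurable[minorInfo H {l}] fun ω => minorGreen (H ω) z i j (insert l T) :=
        fun i j => h.measurable_minorGreen (by simp) z i j
      have hM := fun i j => h.hasAllMoments_minorGreen hz i j (insert l T)
      rw [h.fluct_eq hz hl]
      simp only [sub_mul, Finset.sum_mul]
      have e1 : HasAllMoments P fun ω => H ω l l * Z ω := (h.hasAllMoments l l).mul hZ'
      have e2' : ∀ k j, HasAllMoments P fun ω =>
          H ω l k * minorGreen (H ω) z k j (insert l T) * (starRingEnd ℂ) (H ω l j) * Z ω :=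
        fun k j => (((h.hasAllMoments l k).mul (hM k j)).mul (h.hasAllMoments l j).conj).mul hZ'
      have e3' : ∀ k, HasAllMoments P fun ω =>
          (((‖H ω l k‖ ^ 2 : ℝ) : ℂ) - (varMatrix P H l k : ℂ)) *
          minorGreen (H ω) z k k (insert l T) * Z ω :=
        fun k => ((h.hasAllMoments_norm_sq_sub l k).mul (hM k k)).mul hZ'
      have e2 : HasAllMoments P fun ω => ∑ k ∈ Finset.univ \ insert l T,
          ∑ j ∈ (Finset.univ \ insert l T).erase k,
          H ω l k * minorGreen (H ω) z k j (insert l T) * (starRingEnd ℂ) (H ω l j) * Z ω :=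
        HasAllMoments.sum _ fun k _ => HasAllMoments.sum _ fun j _ => e2' k j
      have e3 : HasAllMoments P fun ω => ∑ k ∈ Finset.univ \ insert l T,
          (((‖H ω l k‖ ^ 2 : ℝ) : ℂ) - (varMatrix P H l k : ℂ)) *
          minorGreen (H ω) z k k (insert l T) * Z ω := HasAllMoments.sum _ fun k _ => e3' k
      have i1 := integral_sub (e1.sub e2).integrable e3.integrable
      simp only [sub_mul] at i1
      rw [i1, integral_sub e1.integrable e2.integrable,
        integral_finsetSum _ fun k _ => integrable_finsetSum _ fun j _ => (e2' k j).integrable,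
        h.integral_row_mul_eq_zero (h.measurable_row l l) hZ (h.centered l l)]
      simp only [← sub_mul]
      rw [integral_finsetSum _ fun k _ => (e3' k).integrable]
      rw [Finset.sum_eq_zero, Finset.sum_eq_zero, sub_zero, sub_zero]
      · intro k _
        have := h.integral_row_mul_eq_zero (l := l)
          (f := fun ω => ((‖H ω l k‖ ^ 2 : ℝ) : ℂ) - (varMatrix P H l k : ℂ))
          (g := fun ω => minorGreen (H ω) z k k (insert l T) * Z ω)
          (Measurable.comp (g := fun x : ℂ => ((‖x‖ ^ 2 : ℝ) : ℂ) - (varMatrix P H l k : ℂ))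
            (by fun_prop) (h.measurable_row l k)) ((hG k k).mul hZ) (h.integral_norm_sq_sub l k)
        simpa only [mul_assoc] using this
      · intro k _
        rw [integral_finsetSum _ fun j _ => (e2' k j).integrable]
        refine Finset.sum_eq_zero fun j hj => ?_
        have := h.integral_row_mul_eq_zero (l := l)
          (f := fun ω => H ω l k * (starRingEnd ℂ) (H ω l j))
          (g := fun ω => minorGreen (H ω) z k j (insert l T) * Z ω)
          ((h.measurable_row l k).mul
            (Complex.continuous_conj.measurable.comp (h.measurable_row l j)))
          ((hG k j).mul hZ) (h.integral_row_mul_conj (Finset.ne_of_mem_erase hj))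
        rw [← this]
        congr 1; ext ω; ring

/-- A crude bound on the moments of the fluctuations. -/
theorem integral_norm_fluct_pow_le (h : IsModel δ μ P H) {z : ℂ} (hz : 0 < z.im)
    (hz10 : z.im ≤ 10) {q : ℕ} (hq : q ≠ 0) (T : Finset (Fin N)) (l : Fin N) :
    ∫ ω, ‖fluct P H z T l ω‖ ^ q ∂P
      ≤ (7 / z.im) ^ q * (2 ^ q * (1 + (N : ℝ) ^ (2 * q) * |μ (2 * q)|)) := by
  have hpt : ∀ ω, ‖fluct P H z T l ω‖ ≤ 7 / z.im * (1 + (∑ k, ‖H ω l k‖) ^ 2) := by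
    intro ω
    set X := ∑ k, ‖H ω l k‖ with hX
    set y := 1 / z.im with hy
    have hy0 : 0 < y := by positivity
    have hX0 : 0 ≤ X := Finset.sum_nonneg fun k _ => norm_nonneg _
    have hy1 : 1 ≤ 10 * y := by rw [hy, mul_one_div]; exact (one_le_div hz).2 hz10
    have h1 : ‖H ω l l‖ ≤ X := Finset.single_le_sum (f := fun k => ‖H ω l k‖)
      (fun _ _ => norm_nonneg _) (Finset.mem_univ l)
    have h7 : 7 / z.im = 7 * y := by rw [hy]; ring
    rw [h7]
    by_cases hl : l ∈ T
    · rw [fluct, if_pos hl, norm_zero]; positivity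
    · have hG := fun i j => h.norm_minorGreen_le hz i j (insert l T) ω
      have h2 : ‖∑ k ∈ Finset.univ \ insert l T, ∑ j ∈ (Finset.univ \ insert l T).erase k,
          H ω l k * minorGreen (H ω) z k j (insert l T) * (starRingEnd ℂ)
              (H ω l j)‖ ≤ X ^ 2 * y := by
        calc _ ≤ ∑ k ∈ Finset.univ \ insert l T, ∑ j ∈ (Finset.univ \ insert l T).erase k,
              ‖H ω l k‖ * ‖H ω l j‖ * y := by
              refine (norm_sum_le _ _).trans (Finset.sum_le_sum fun k _ =>
                (norm_sum_le _ _).trans (Finset.sum_le_sum fun j _ => ?_))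
              rw [norm_mul, norm_mul, RCLike.norm_conj, mul_right_comm]
              exact mul_le_mul_of_nonneg_left (hG k j) (by positivity)
          _ ≤ ∑ k, ∑ j, ‖H ω l k‖ * ‖H ω l j‖ * y := by
              refine (Finset.sum_le_sum fun k _ => Finset.sum_le_sum_of_subset_of_nonneg
                (Finset.subset_univ _) fun j _ _ => by positivity).trans ?_
              exact Finset.sum_le_sum_of_subset_of_nonneg (Finset.subset_univ _)
                fun k _ _ => Finset.sum_nonneg fun j _ => by positivity
          _ = X ^ 2 * y := by
              rw [hX, pow_two, Finset.sum_mul_sum, Finset.sum_mul]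
              exact Finset.sum_congr rfl fun k _ => (Finset.sum_mul _ _ _).symm
      have h3 : ‖∑ k ∈ Finset.univ \ insert l T,
          (((‖H ω l k‖ ^ 2 : ℝ) : ℂ) - (varMatrix P H l k : ℂ)) *
          minorGreen (H ω) z k k (insert l T)‖ ≤ (X ^ 2 + 1) * y := by
        calc _ ≤ ∑ k ∈ Finset.univ \ insert l T, (‖H ω l k‖ ^ 2 + varMatrix P H l k) * y := by
              refine (norm_sum_le _ _).trans (Finset.sum_le_sum fun k _ => ?_)
              rw [norm_mul]
              refine mul_le_mul ((norm_sub_le _ _).trans (le_of_eq ?_)) (hG k k) (norm_nonneg _)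
                (add_nonneg (by positivity) (h.varMatrix_nonneg l k))
              rw [Complex.norm_real, Complex.norm_real, Real.norm_of_nonneg (by positivity),
                Real.norm_of_nonneg (h.varMatrix_nonneg l k)]
          _ ≤ ∑ k, (‖H ω l k‖ ^ 2 + varMatrix P H l k) * y :=
              Finset.sum_le_sum_of_subset_of_nonneg (Finset.subset_univ _) fun k _ _ =>
                mul_nonneg (add_nonneg (by positivity) (h.varMatrix_nonneg l k)) hy0.le
          _ = (∑ k, ‖H ω l k‖ ^ 2 + 1) * y := by
              rw [← Finset.sum_mul, Finset.sum_add_distrib, h.stochastic l]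
          _ ≤ _ := by
              gcongr
              exact Finset.sum_sq_le_sq_sum_of_nonneg fun k _ => norm_nonneg _
      rw [h.fluct_eq hz hl]
      have h4 : X ≤ 5 * y * (1 + X ^ 2) := by nlinarith [sq_nonneg (X - 1)]
      calc _ ≤ ‖H ω l l‖ + X ^ 2 * y + (X ^ 2 + 1) * y :=
            (norm_sub_le _ _).trans (add_le_add ((norm_sub_le _ _).trans (add_le_add le_rfl h2)) h3)
        _ ≤ _ := by nlinarith
  have hS : HasAllMoments P fun ω => (((∑ k, ‖H ω l k‖) ^ 2 : ℝ) : ℂ) := by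
    have hn : ∀ k, HasAllMoments P fun ω => ((‖H ω l k‖ : ℝ) : ℂ) := fun k p =>
      ((h.hasAllMoments l k p).norm).ofReal
    have := (HasAllMoments.sum Finset.univ fun k _ => hn k).pow 2
    simpa using this
  have h1 := integral_norm_add_pow_le (HasAllMoments.const (P := P) 1) hS q
  have hX0 : ∀ ω, 0 ≤ ∑ k, ‖H ω l k‖ := fun ω => Finset.sum_nonneg fun k _ => norm_nonneg _
  have e1 : ∀ ω, ‖(1 : ℂ) + (((∑ k, ‖H ω l k‖) ^ 2 : ℝ) : ℂ)‖ = 1 + (∑ k, ‖H ω l k‖) ^ 2 := by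
    intro ω
    rw [← Complex.ofReal_one, ← Complex.ofReal_add, Complex.norm_real,
      Real.norm_of_nonneg (by positivity)]
  have e2 : ∀ ω, ‖(((∑ k, ‖H ω l k‖) ^ 2 : ℝ) : ℂ)‖ ^ q = (∑ k, ‖H ω l k‖) ^ (2 * q) := by
    intro ω
    rw [Complex.norm_real, Real.norm_of_nonneg (by positivity), pow_mul]
  have hint : Integrable (fun ω => (1 + (∑ k, ‖H ω l k‖) ^ 2) ^ q) P := by
    have := ((HasAllMoments.const (P := P) 1).add hS).integrable_norm_pow q
    simpa only [e1] using this
  simp only [e1, e2, norm_one, one_pow, integral_const, probReal_univ, smul_eq_mul, mul_one] at h1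
  have h2 : ∫ ω, (∑ k, ‖H ω l k‖) ^ (2 * q) ∂P ≤ (N : ℝ) ^ (2 * q) * |μ (2 * q)| := by
    obtain ⟨p, hp⟩ : ∃ p, 2 * q = p + 1 := ⟨2 * q - 1, by omega⟩
    rw [hp]
    have hN : (0 : ℝ) < N := by exact_mod_cast l.pos
    calc ∫ ω, (∑ k, ‖H ω l k‖) ^ (p + 1) ∂P
        ≤ ∫ ω, (N : ℝ) ^ p * ∑ k, ‖H ω l k‖ ^ (p + 1) ∂P := by
          refine integral_mono_of_nonneg (Filter.Eventually.of_forall fun ω =>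
            pow_nonneg (hX0 ω) _) ((integrable_finsetSum _ fun k _ =>
              (h.hasAllMoments l k).integrable_norm_pow _).const_mul _)
            (Filter.Eventually.of_forall fun ω => ?_)
          have := pow_sum_div_card_le_sum_pow (s := Finset.univ) (f := fun k => ‖H ω l k‖)
            (fun k _ => norm_nonneg _) p
          rw [Finset.card_univ, Fintype.card_fin, div_le_iff₀ (by positivity)] at this
          simpa only [mul_comm] using this
      _ = (N : ℝ) ^ p * ∑ k, ∫ ω, ‖H ω l k‖ ^ (p + 1) ∂P := by
          rw [integral_const_mul, integral_finsetSum _ fun k _ =>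
              (h.hasAllMoments l k).integrable_norm_pow _]
      _ ≤ (N : ℝ) ^ p * ∑ _k : Fin N, |μ (p + 1)| := by
          gcongr with k
          refine (h.integral_norm_pow_le l k (Nat.succ_ne_zero p)).trans
            (mul_le_of_le_one_right (abs_nonneg _) (pow_le_one₀ (Real.sqrt_nonneg _) ?_))
          exact Real.sqrt_le_one.2 (h.varMatrix_le_one l k)
      _ = _ := by simp; ring
  calc ∫ ω, ‖fluct P H z T l ω‖ ^ q ∂P
      ≤ ∫ ω, (7 / z.im) ^ q * (1 + (∑ k, ‖H ω l k‖) ^ 2) ^ q ∂P := by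
        refine integral_mono ((h.hasAllMoments_fluct hz T l).integrable_norm_pow q)
          (hint.const_mul _) fun ω => ?_
        simp only [← mul_pow]
        exact pow_le_pow_left₀ (norm_nonneg _) (hpt ω) q
    _ = (7 / z.im) ^ q * ∫ ω, (1 + (∑ k, ‖H ω l k‖) ^ 2) ^ q ∂P := integral_const_mul _ _
    _ ≤ _ := by
        refine mul_le_mul_of_nonneg_left (h1.trans ?_) (by positivity)
        gcongr

end IsModel

end FluctuationFamily
end LocalSemicircle

namespace LocalSemicircle

section LargeDeviationModel

variable {Ω : Type u} [MeasurableSpace Ω] {P : Measure Ω} [IsProbabilityMeasure P] {N : ℕ}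
  {δ : ℝ} {μ : ℕ → ℝ} {H : Ω → Matrix (Fin N) (Fin N) ℂ}

namespace IsModel

theorem measureReal_column_le (h : IsModel δ μ P H) (z : ℂ) (i l : Fin N)
    (r : ℕ) {t : ℝ} (ht : 0 < t) :
    P.real {ω | t * (∑ k ∈ Finset.univ.erase l,
        ‖minorGreen (H ω) z i k {l}‖ ^ 2 * varMatrix P H l k) ^ (r + 1)
      < ‖∑ k ∈ Finset.univ.erase l, minorGreen (H ω) z i k {l} * H ω k l‖ ^ (2 * r + 2)}
      ≤ momConst r * |μ (2 * r + 2)| / t := by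
  have hcol : ∀ k, (fun ω => H ω k l) = (starRingEnd ℂ) ∘ fun ω => H ω l k := fun k => by
    ext ω; exact h.apply_swap ω l k
  have hind : iIndepFun (fun k ω => H ω k l) P := by
    have e : (fun k ω => H ω k l) = fun k => (starRingEnd ℂ) ∘ fun ω => H ω l k := funext hcol
    rw [e]
    exact (h.iIndepFun_row l).comp (fun _ => (starRingEnd ℂ : ℂ → ℂ))
      fun _ => Complex.continuous_conj.measurable
  have hrow : ∀ k, Measurable[rowInfo H l] fun ω => H ω k l := fun k => by
    rw [hcol]; exact Complex.continuous_conj.measurable.comp (h.measurable_row l k)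
  have hsymm := h.isSymmStochastic.symm
  have hG : ∀ k, Measurable[minorInfo H {l}] fun ω => minorGreen (H ω) z i k {l} :=
    fun k => h.measurable_minorGreen (Finset.Subset.refl _) z i k
  have := measureReal_linear_le (P := P) (Finset.univ.erase l) r (X := fun k ω => H ω k l)
    (fun k => h.measurable k l) hind (fun k => h.hasAllMoments k l) (fun k => h.centered k l)
    (abs_nonneg (μ (2 * r + 2))) (σ := fun k => Real.sqrt (varMatrix P H k l))
    (fun k => Real.sqrt_nonneg _) (fun k => h.integral_norm_pow_le k l (by omega))
    (a := fun ω k => minorGreen (H ω) z i k {l})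
    (measurable_pi_lambda _ fun k => (hG k).mono (h.minorInfo_le _) le_rfl)
    (h.indepFun_row_minor (Finset.mem_singleton_self l)
      (@measurable_pi_lambda _ _ _ (rowInfo H l) _ _ hrow)
      (@measurable_pi_lambda _ _ _ (minorInfo H {l}) _ _ hG)) ht
  simpa only [mul_pow, Real.sq_sqrt (h.varMatrix_nonneg _ _), hsymm _ l] using this

theorem measureReal_quadratic_le (h : IsModel δ μ P H) (z : ℂ) (l : Fin N)
    (r : ℕ) {t : ℝ} (ht : 0 < t) :
    P.real {ω | t * (∑ k ∈ Finset.univ.erase l, ∑ j ∈ Finset.univ.erase l,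
        varMatrix P H l k * varMatrix P H l j * ‖minorGreen (H ω) z k j {l}‖ ^ 2) ^ (r + 1)
      < ‖∑ k ∈ Finset.univ.erase l, ∑ j ∈ (Finset.univ.erase l).erase k,
        H ω l k * minorGreen (H ω) z k j {l} * (starRingEnd ℂ) (H ω l j)‖ ^ (2 * r + 2)}
      ≤ 2 * quadConst r |μ (2 * r + 2)| / t := by
  have hG : ∀ k j, Measurable[minorInfo H {l}] fun ω => minorGreen (H ω) z k j {l} :=
    fun k j => h.measurable_minorGreen (Finset.Subset.refl _) z k j
  have := LocalSemicircle.measureReal_quadratic_le (P := P) (Finset.univ.erase l) r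
    (X := fun k ω => H ω l k)
    (fun k => h.measurable l k) (h.iIndepFun_row l) (fun k => h.hasAllMoments l k)
    (fun k => h.centered l k)
    (abs_nonneg (μ (2 * r + 2))) (σ := fun k => Real.sqrt (varMatrix P H l k))
    (fun k => Real.sqrt_nonneg _) (fun k => h.integral_norm_pow_le l k (by omega))
    (a := fun ω k j => minorGreen (H ω) z k j {l})
    (measurable_pi_lambda _ fun k => measurable_pi_lambda _ fun j =>
      (hG k j).mono (h.minorInfo_le _) le_rfl)
    (h.indepFun_row_minor (Finset.mem_singleton_self l)
      (@measurable_pi_lambda _ _ _ (rowInfo H l) _ _ fun k => h.measurable_row l k)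
      (@measurable_pi_lambda _ _ _ (minorInfo H {l}) _ _ fun k =>
        @measurable_pi_lambda _ _ _ (minorInfo H {l}) _ _ fun j => hG k j)) ht
  simpa only [Real.sq_sqrt (h.varMatrix_nonneg _ _)] using this

theorem measureReal_diagonal_le (h : IsModel δ μ P H) (z : ℂ) (l : Fin N)
    (r : ℕ) {t : ℝ} (ht : 0 < t) :
    P.real {ω | t * (∑ k ∈ Finset.univ.erase l,
        ‖minorGreen (H ω) z k k {l}‖ ^ 2 * varMatrix P H l k ^ 2) ^ (r + 1)
      < ‖∑ k ∈ Finset.univ.erase l, minorGreen (H ω) z k k {l} *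
        (((‖H ω l k‖ ^ 2 : ℝ) : ℂ) - (varMatrix P H l k : ℂ))‖ ^ (2 * r + 2)}
      ≤ momConst r * (2 ^ (2 * r + 2) * (|μ (2 * (2 * r + 2))| + 1)) / t := by
  have hG : ∀ k, Measurable[minorInfo H {l}] fun ω => minorGreen (H ω) z k k {l} :=
    fun k => h.measurable_minorGreen (Finset.Subset.refl _) z k k
  have hsq : ∀ k, Measurable fun x : ℂ => ((‖x‖ ^ 2 : ℝ) : ℂ) - (varMatrix P H l k : ℂ) :=
    fun k => by fun_prop
  have hrow : ∀ k, Measurable[rowInfo H l]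
      fun ω => ((‖H ω l k‖ ^ 2 : ℝ) : ℂ) - (varMatrix P H l k : ℂ) :=
    fun k => (hsq k).comp (h.measurable_row l k)
  have := measureReal_linear_le (P := P) (Finset.univ.erase l) r
    (X := fun k ω => ((‖H ω l k‖ ^ 2 : ℝ) : ℂ) - (varMatrix P H l k : ℂ))
    (fun k => (hsq k).comp (h.measurable l k)) ((h.iIndepFun_row l).comp _ hsq)
    (fun k => h.hasAllMoments_norm_sq_sub l k)
    (fun k => h.integral_norm_sq_sub l k) (c := 2 ^ (2 * r + 2) * (|μ (2 * (2 * r + 2))| + 1))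
    (by positivity) (σ := fun k => varMatrix P H l k)
    (fun k => h.varMatrix_nonneg l k) (fun k => h.integral_norm_sq_sub_pow_le l k (by omega))
    (a := fun ω k => minorGreen (H ω) z k k {l})
    (measurable_pi_lambda _ fun k => (hG k).mono (h.minorInfo_le _) le_rfl)
    (h.indepFun_row_minor (Finset.mem_singleton_self l)
      (@measurable_pi_lambda _ _ _ (rowInfo H l) _ _ hrow)
      (@measurable_pi_lambda _ _ _ (minorInfo H {l}) _ _ hG)) ht
  simpa only [mul_pow] using this

theorem measureReal_entry_le (h : IsModel δ μ P H) (i j : Fin N) (r : ℕ) {t : ℝ} (ht : 0 < t) :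
    P.real {ω | t * varMatrix P H i j ^ (r + 1) < ‖H ω i j‖ ^ (2 * r + 2)}
      ≤ |μ (2 * r + 2)| / t := by
  refine measureReal_lt_le_of_moment ((h.hasAllMoments i j).integrable_norm_pow _)
    (fun ω => by positivity) (pow_nonneg (h.varMatrix_nonneg i j) _) ht (abs_nonneg _) ?_
  have := h.integral_norm_pow_le i j (p := 2 * r + 2) (by omega)
  rwa [show 2 * r + 2 = 2 * (r + 1) by ring, pow_mul, Real.sq_sqrt (h.varMatrix_nonneg i j)] at this

end IsModel

end LargeDeviationModel

section OverwhelmingProbability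

variable {δ : ℝ} {μ : ℕ → ℝ} {ι : ℕ → Type*}

theorem eventually_le_rpow {c : ℝ} (hc : 0 < c) (K : ℝ) : ∀ᶠ N : ℕ in Filter.atTop,
    K ≤ (N : ℝ) ^ c :=
  ((tendsto_rpow_atTop hc).comp tendsto_natCast_atTop_atTop).eventually_ge_atTop K

/-- The event `good` holds with overwhelming probability, uniformly in all models and indices. -/
def Wop (good : ∀ (N : ℕ) (A : Model.{u} δ μ N), ι N → A.Ω → Prop) : Prop :=
  ∀ D : ℝ, 0 < D → ∀ᶠ N : ℕ in Filter.atTop, ∀ (A : Model.{u} δ μ N) (i : ι N),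
    A.P.real {ω | ¬good N A i ω} ≤ (N : ℝ) ^ (-D)

namespace Wop

variable {good good' : ∀ (N : ℕ) (A : Model.{u} δ μ N), ι N → A.Ω → Prop}

theorem mono (h : Wop good)
    (hg : ∀ᶠ N : ℕ in Filter.atTop, ∀ A i ω, good N A i ω → good' N A i ω) : Wop good' := by
  intro D hD
  filter_upwards [h D hD, hg] with N h1 h2 A i
  refine (measureReal_mono fun ω hω => ?_).trans (h1 A i)
  simp only [Set.mem_ofPred_eq] at *
  exact fun h3 => hω (h2 A i ω h3)

theorem of_eventually (hg : ∀ᶠ N : ℕ in Filter.atTop, ∀ A i ω, good N A i ω) : Wop good := by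
  intro D _
  filter_upwards [hg] with N h A i
  have : {ω | ¬good N A i ω} = ∅ := by ext ω; simp [h A i ω]
  rw [this, measureReal_empty]
  positivity

theorem and (h : Wop good) (h' : Wop good') :
    Wop fun N A i ω => good N A i ω ∧ good' N A i ω := by
  intro D hD
  filter_upwards [h (D + 1) (by linarith), h' (D + 1) (by linarith),
    Filter.eventually_ge_atTop 2] with N h1 h2 hN A i
  have hN' : (2 : ℝ) ≤ N := by exact_mod_cast hN
  have e : {ω | ¬(good N A i ω ∧ good' N A i ω)} ⊆ {ω | ¬good N A i ω} ∪ {ω | ¬good' N A i ω} := by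
    intro ω hω
    simp only [Set.mem_ofPred_eq, Set.mem_union] at *
    tauto
  calc _ ≤ A.P.real ({ω | ¬good N A i ω} ∪ {ω | ¬good' N A i ω}) := measureReal_mono e
    _ ≤ A.P.real {ω | ¬good N A i ω} + A.P.real {ω | ¬good' N A i ω} := measureReal_union_le _ _
    _ ≤ (N : ℝ) ^ (-(D + 1)) + (N : ℝ) ^ (-(D + 1)) := add_le_add (h1 A i) (h2 A i)
    _ = 2 * ((N : ℝ) ^ (-D) * (N : ℝ)⁻¹) := by
        rw [neg_add, Real.rpow_add (by linarith), Real.rpow_neg_one]; ring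
    _ ≤ (N : ℝ) * ((N : ℝ) ^ (-D) * (N : ℝ)⁻¹) := by gcongr
    _ = (N : ℝ) ^ (-D) := by field_simp

/-- Polynomially many events. -/
theorem forall_fintype {κ : ℕ → Type*} [∀ N, Fintype (κ N)] {C : ℝ} (hC : 0 ≤ C)
    (hκ : ∀ᶠ N : ℕ in Filter.atTop, (Fintype.card (κ N) : ℝ) ≤ (N : ℝ) ^ C)
    {good : ∀ (N : ℕ) (A : Model.{u} δ μ N), ι N × κ N → A.Ω → Prop}
    (h : Wop (ι := fun N => ι N × κ N) good) :
    Wop fun N A i ω => ∀ k, good N A (i, k) ω := by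
  intro D hD
  filter_upwards [h (D + C) (by linarith), hκ, Filter.eventually_ge_atTop 1] with N h1 h2 hN A i
  have hN' : (0 : ℝ) < N := by exact_mod_cast hN
  have e : {ω | ¬∀ k, good N A (i, k) ω} = ⋃ k, {ω | ¬good N A (i, k) ω} := by
    ext ω; simp
  rw [e]
  calc _ ≤ ∑ k, A.P.real {ω | ¬good N A (i, k) ω} := measureReal_iUnion_fintype_le _
    _ ≤ ∑ _k : κ N, (N : ℝ) ^ (-(D + C)) := Finset.sum_le_sum fun k _ => h1 A (i, k)
    _ = Fintype.card (κ N) * (N : ℝ) ^ (-(D + C)) := by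
        rw [Finset.sum_const, nsmul_eq_mul, Finset.card_univ]
    _ ≤ (N : ℝ) ^ C * (N : ℝ) ^ (-(D + C)) := by gcongr
    _ = (N : ℝ) ^ (-D) := by rw [← Real.rpow_add hN']; congr 1; ring

theorem forall_fin {good : ∀ (N : ℕ) (A : Model.{u} δ μ N), ι N × Fin N → A.Ω → Prop}
    (h : Wop (ι := fun N => ι N × Fin N) good) :
    Wop fun N A i ω => ∀ k, good N A (i, k) ω :=
  forall_fintype zero_le_one (Filter.Eventually.of_forall fun N => by simp) h

theorem comap {ι' : ℕ → Type*} (h : Wop good)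
    (f : ∀ (N : ℕ) (_ : Model.{u} δ μ N), ι' N → ι N) :
    Wop fun N A i ω => good N A (f N A i) ω := by
  intro D hD
  filter_upwards [h D hD] with N h1 A i
  exact h1 A (f N A i)

/-- Markov's inequality for high moments. -/
theorem of_moments {Y W : ∀ (N : ℕ) (A : Model.{u} δ μ N), ι N → A.Ω → ℝ}
    (hW : ∀ N A i ω, 0 ≤ W N A i ω) {C : ℕ → ℝ}
    (h : ∀ (r N : ℕ) (A : Model.{u} δ μ N) (i : ι N) (t : ℝ), 0 < t →
      A.P.real {ω | t * W N A i ω ^ (r + 1) < Y N A i ω ^ (2 * r + 2)} ≤ C r / t)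
    {ε : ℝ} (hε : 0 < ε) :
    Wop fun N A i ω => Y N A i ω ≤ (N : ℝ) ^ ε * Real.sqrt (W N A i ω) := by
  intro D hD
  obtain ⟨r, hr⟩ := exists_nat_ge ((D + 1) / ε)
  filter_upwards [eventually_le_rpow one_pos (C r), Filter.eventually_ge_atTop 1]
    with N hCN hN A i
  have hN' : (1 : ℝ) ≤ N := by exact_mod_cast hN
  have hN0 : (0 : ℝ) < N := by linarith
  have ht : (0 : ℝ) < ((N : ℝ) ^ ε) ^ (2 * r + 2) := by positivity
  refine (measureReal_mono fun ω hω => ?_).trans ((h r N A i _ ht).trans ?_)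
  · simp only [Set.mem_ofPred_eq, not_le] at hω ⊢
    calc ((N : ℝ) ^ ε) ^ (2 * r + 2) * W N A i ω ^ (r + 1)
        = ((N : ℝ) ^ ε * Real.sqrt (W N A i ω)) ^ (2 * r + 2) := by
          rw [mul_pow]
          congr 1
          rw [show 2 * r + 2 = 2 * (r + 1) by ring, pow_mul, Real.sq_sqrt (hW N A i ω)]
      _ < _ := pow_lt_pow_left₀ hω (by positivity) (by omega)
  · rw [div_le_iff₀ ht, ← Real.rpow_natCast, ← Real.rpow_mul hN0.le, ← Real.rpow_add hN0]
    refine hCN.trans (Real.rpow_le_rpow_of_exponent_le hN' ?_)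
    rw [div_le_iff₀ hε] at hr
    push_cast
    nlinarith

end Wop

end OverwhelmingProbability

end LocalSemicircle

namespace LocalSemicircle

section ResolventBounds

variable {N : ℕ}

/-- The conclusions of the large deviation bounds for the matrix `H`. -/
structure LDBound (S : Matrix (Fin N) (Fin N) ℝ) (H : Matrix (Fin N) (Fin N) ℂ) (z : ℂ)
    (τ κ : ℝ) : Prop where
  off : ∀ i l, i ≠ l → ‖green H z i l‖
    ≤ ‖green H z l l‖ * (τ * Real.sqrt (κ * ((minorGreen H z i i {l}).im / z.im)))
  inv : ∀ l, ‖invFluct (S l) H z l ∅‖ ≤ τ * (Real.sqrt κ + 2 * Real.sqrt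
    (κ * ((∑ k ∈ Finset.univ.erase l, S l k * (minorGreen H z k k {l}).im) / z.im)))

/-- The part of the self-consistent equation which is due to removing a row. -/
noncomputable def removalError (s : Fin N → ℝ) (H : Matrix (Fin N) (Fin N) ℂ) (z : ℂ) (l : Fin N) :
    ℂ := (∑ k, (s k : ℂ) * (green H z l k * green H z k l)) * (green H z l l)⁻¹

variable {S : Matrix (Fin N) (Fin N) ℝ} {H : Matrix (Fin N) (Fin N) ℂ} {z : ℂ}

theorem inv_green_eq (hH : H.IsHermitian) (hz : 0 < z.im) (s : Fin N → ℝ) (l : Fin N) :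
    (green H z l l)⁻¹ = -z - ∑ k, (s k : ℂ) * green H z k k
      + invFluct s H z l ∅ + removalError s H z l := by
  have h1 := sum_minor_diag hH hz s l
  have h2 : invFluct s H z l ∅ = (green H z l l)⁻¹ + z
      + ∑ k ∈ Finset.univ.erase l, (s k : ℂ) * green (zeroOut H {l}) z k k := by
    simp only [invFluct, minorGreen, zeroOut_empty, Finset.notMem_empty, if_false]
    rfl
  rw [h2, h1, removalError]
  ring

theorem norm_removalError_le (hH : H.IsHermitian) (hz : 0 < z.im) {s : Fin N → ℝ} {κ : ℝ}
    (hs : ∀ k, 0 ≤ s k) (hsκ : ∀ k, s k ≤ κ) (l : Fin N) :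
    ‖removalError s H z l‖ ≤ κ / z.im := by
  have h0 : 0 < ‖green H z l l‖ := norm_pos_iff.2 (green_diag_ne_zero hH hz l)
  have hκ : 0 ≤ κ := (hs l).trans (hsκ l)
  have h1 : ‖∑ k, (s k : ℂ) * (green H z l k * green H z k l)‖
      ≤ κ * ((green H z l l).im / z.im) := by
    calc _ ≤ ∑ k, κ * ((‖green H z l k‖ ^ 2 + ‖green H z k l‖ ^ 2) / 2) := by
          refine (norm_sum_le _ _).trans (Finset.sum_le_sum fun k _ => ?_)
          rw [norm_mul, norm_mul, Complex.norm_real, Real.norm_of_nonneg (hs k)]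
          refine mul_le_mul (hsκ k) ?_ (by positivity) hκ
          nlinarith [sq_nonneg (‖green H z l k‖ - ‖green H z k l‖)]
      _ = _ := by
          rw [← Finset.mul_sum, ← Finset.sum_div, Finset.sum_add_distrib,
            sum_norm_sq_green_row hH hz, sum_norm_sq_green_col hH hz]
          ring
  rw [removalError, norm_mul, norm_inv, ← div_eq_mul_inv, div_le_iff₀ h0]
  calc _ ≤ κ * ((green H z l l).im / z.im) := h1
    _ = κ / z.im * (green H z l l).im := by ring
    _ ≤ κ / z.im * ‖green H z l l‖ := by
        gcongr; exact (le_abs_self _).trans (Complex.abs_im_le_norm _)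

theorem norm_sum_green_diag_le {s : Fin N → ℝ} (hs : ∀ k, 0 ≤ s k) (hs1 : ∑ k, s k ≤ 1) {b : ℝ}
    (hb0 : 0 ≤ b) (hb : ∀ k, ‖green H z k k‖ ≤ b) : ‖∑ k, (s k : ℂ) * green H z k k‖ ≤ b :=
  norm_sum_mul_le_of_sum_le_one Finset.univ (fun k _ => hs k) hs1 hb0 fun k _ => hb k

namespace LDBound

variable {τ κ φ L ξ : ℝ}

theorem norm_off_le (h : LDBound S H z τ κ) (hH : H.IsHermitian) (hz : 0 < z.im) (hκ : 0 ≤ κ)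
    (hτ : 1 ≤ τ) (hL : 1 ≤ L) (hξ : κ / z.im = ξ) (hG : ∀ i, ‖green H z i i‖ ≤ 3 * L)
    (hφ : ∀ i, (green H z i i).im ≤ φ) (hsmall : 6 * L * τ ^ 2 * ξ ≤ 1) {i l : Fin N}
    (hil : i ≠ l) : ‖green H z i l‖ ≤ 5 * τ * L * Real.sqrt (φ * ξ) := by
  have hξ0 : 0 ≤ ξ := hξ ▸ by positivity
  have hφ0 : 0 ≤ φ := (green_diag_im_pos hH hz i).le.trans (hφ i)
  have : Nonempty {p : Fin N × Fin N // p.1 ≠ p.2} := ⟨⟨(i, l), hil⟩⟩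
  obtain ⟨⟨⟨i₀, l₀⟩, h₀⟩, hmax⟩ := Finite.exists_max
    (fun p : {p : Fin N × Fin N // p.1 ≠ p.2} => ‖green H z p.1.1 p.1.2‖)
  set o := ‖green H z i₀ l₀‖ with ho
  have h₀' : i₀ ≠ l₀ := h₀
  have hle : ∀ i l, i ≠ l → ‖green H z i l‖ ≤ o := fun i l hil => hmax ⟨(i, l), hil⟩
  have h1 := h.off i₀ l₀ h₀'
  have h0 : 0 < ‖green H z l₀ l₀‖ := norm_pos_iff.2 (green_diag_ne_zero hH hz l₀)
  have h2 : (minorGreen H z i₀ i₀ {l₀}).im ≤ φ + o * o * ‖green H z l₀ l₀‖⁻¹ := by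
    have h3 := green_sub_minor hH hz (a := l₀) (j := i₀) h₀'
    have h4 : minorGreen H z i₀ i₀ {l₀} = green H z i₀ i₀
        - green H z i₀ l₀ * green H z l₀ i₀ * (green H z l₀ l₀)⁻¹ := by
      rw [← h3, minorGreen]; ring
    rw [h4, Complex.sub_im, sub_eq_add_neg]
    refine add_le_add (hφ i₀) ((neg_le_abs _).trans ((Complex.abs_im_le_norm _).trans ?_))
    rw [norm_mul, norm_mul, norm_inv]
    gcongr
    exact hle _ _ h₀'.symm
  have hx0 : 0 ≤ (minorGreen H z i₀ i₀ {l₀}).im :=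
    (green_diag_im_pos (isHermitian_zeroOut hH {l₀}) hz i₀).le
  have h5 : κ * ((minorGreen H z i₀ i₀ {l₀}).im / z.im) = ξ * (minorGreen H z i₀ i₀ {l₀}).im := by
    rw [← hξ]; ring
  rw [h5] at h1
  set g := ‖green H z l₀ l₀‖ with hg
  have h6 : o ^ 2 ≤ g ^ 2 * τ ^ 2 * (ξ * (φ + o * o * g⁻¹)) := by
    calc o ^ 2 ≤ (g * (τ * Real.sqrt (ξ * (minorGreen H z i₀ i₀ {l₀}).im))) ^ 2 := by gcongr
      _ = g ^ 2 * τ ^ 2 * (ξ * (minorGreen H z i₀ i₀ {l₀}).im) := by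
          rw [mul_pow, mul_pow, Real.sq_sqrt (mul_nonneg hξ0 hx0)]; ring
      _ ≤ _ := by gcongr
  have h7 : g ^ 2 * τ ^ 2 * (ξ * (φ + o * o * g⁻¹))
      = g ^ 2 * (τ ^ 2 * (φ * ξ)) + g * (τ ^ 2 * ξ * o ^ 2) := by
    field_simp
  have hg3 := hG l₀
  have h8 : o ^ 2 ≤ (3 * L) ^ 2 * (τ ^ 2 * (φ * ξ)) + (3 * L) * (τ ^ 2 * ξ * o ^ 2) := by
    rw [h7] at h6
    refine h6.trans ?_
    gcongr
  have h9 : o ^ 2 ≤ (5 * τ * L) ^ 2 * (φ * ξ) := by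
    have : 0 ≤ o ^ 2 := sq_nonneg o
    have h10 : 0 ≤ L ^ 2 * (τ ^ 2 * (φ * ξ)) := by positivity
    nlinarith
  refine (hle i l hil).trans ?_
  have h11 : o ≤ Real.sqrt ((5 * τ * L) ^ 2 * (φ * ξ)) := Real.le_sqrt_of_sq_le h9
  rwa [Real.sqrt_mul (sq_nonneg _), Real.sqrt_sq (by positivity)] at h11

theorem norm_invFluct_le (h : LDBound S H z τ κ) (hS : IsSymmStochastic S)
    (hSκ : ∀ i j, S i j ≤ κ) (hH : H.IsHermitian) (hz : 0 < z.im) (hκ : 0 ≤ κ)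
    (hτ : 1 ≤ τ) (hξ : κ / z.im = ξ)
    (hφ : ∀ i, (green H z i i).im ≤ φ) (hξφ : ξ ≤ φ) (hzφ : z.im ≤ 100 * φ) (l : Fin N) :
    ‖invFluct (S l) H z l ∅‖ ≤ 31 * τ * Real.sqrt (φ * ξ) := by
  have hξ0 : 0 ≤ ξ := hξ ▸ by positivity
  have hφ0 : 0 ≤ φ := hξ0.trans hξφ
  have h1 := h.inv l
  have hκξ : κ = z.im * ξ := by rw [← hξ]; field_simp
  have h2 : ∑ k ∈ Finset.univ.erase l, S l k * (minorGreen H z k k {l}).im ≤ 2 * φ := by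
    have e1 := congrArg Complex.im (sum_minor_diag hH hz (S l) l)
    simp only [Complex.im_sum, Complex.im_ofReal_mul, Complex.sub_im] at e1
    have e2 : ∑ k, S l k * (green H z k k).im ≤ φ := by
      calc _ ≤ ∑ k, S l k * φ :=
            Finset.sum_le_sum fun k _ => mul_le_mul_of_nonneg_left (hφ k) (hS.nonneg l k)
        _ = φ := by rw [← Finset.sum_mul, hS.row_sum, one_mul]
    have e3 := norm_removalError_le hH hz (hS.nonneg l) (hSκ l) l
    have e4 := (neg_le_abs _).trans ((Complex.abs_im_le_norm _).trans e3)
    rw [removalError, hξ] at e4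
    simp only [minorGreen]
    rw [e1]
    linarith
  have h3 : κ * ((∑ k ∈ Finset.univ.erase l, S l k * (minorGreen H z k k {l}).im) / z.im)
      ≤ 2 * (φ * ξ) := by
    calc _ = ξ * ∑ k ∈ Finset.univ.erase l, S l k * (minorGreen H z k k {l}).im := by
          rw [← hξ]; ring
      _ ≤ ξ * (2 * φ) := by gcongr
      _ = _ := by ring
  have h4 : κ ≤ 100 * (φ * ξ) := by rw [hκξ]; nlinarith
  have hq := Real.sqrt_nonneg (φ * ξ)
  have h5 : Real.sqrt κ ≤ 10 * Real.sqrt (φ * ξ) := by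
    rw [Real.sqrt_le_left (by positivity), mul_pow, Real.sq_sqrt (by positivity)]
    linarith
  have h6 : Real.sqrt (κ * ((∑ k ∈ Finset.univ.erase l,
      S l k * (minorGreen H z k k {l}).im) / z.im)) ≤ 2 * Real.sqrt (φ * ξ) := by
    rw [Real.sqrt_le_left (by positivity), mul_pow, Real.sq_sqrt (by positivity)]
    nlinarith [mul_nonneg hφ0 hξ0]
  calc _ ≤ τ * (Real.sqrt κ + 2 * Real.sqrt _) := h1
    _ ≤ τ * (10 * Real.sqrt (φ * ξ) + 2 * (2 * Real.sqrt (φ * ξ))) := by gcongr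
    _ ≤ _ := by nlinarith [mul_nonneg (show (0 : ℝ) ≤ τ by linarith) hq]

theorem greenBound (h : LDBound S H z τ κ) (hS : IsSymmStochastic S)
    (hSκ : ∀ i j, S i j ≤ κ) (hH : H.IsHermitian) (hz : 0 < z.im) (hzn : ‖z‖ ≤ 15) (hκ : 0 ≤ κ)
    (hτ : 1 ≤ τ) (hL : 1 ≤ L) (hξ : κ / z.im = ξ) (hG : ∀ i, ‖green H z i i‖ ≤ 3 * L)
    (hφ : ∀ i, (green H z i i).im ≤ φ) (hξφ : ξ ≤ φ) (hzφ : z.im ≤ 100 * φ)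
    (hsmall : 6 * L * τ ^ 2 * ξ ≤ 1) (hsmall' : 31 * τ * Real.sqrt (φ * ξ) ≤ 1) :
    GreenBound H z (20 * L) (100 * τ * L ^ 2 * Real.sqrt (φ * ξ)) 1 ∅ := by
  have hξ0 : 0 ≤ ξ := hξ ▸ by positivity
  have hξ1 : ξ ≤ 1 := by
    have : 1 ≤ L * τ ^ 2 := one_le_mul_of_one_le_of_one_le hL (one_le_pow₀ hτ)
    nlinarith
  refine ⟨fun i j hij _ _ => ?_, fun i _ => ?_, fun i _ => ?_⟩
  · simp only [minorGreen, zeroOut_empty]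
    refine (h.norm_off_le hH hz hκ hτ hL hξ hG hφ hsmall hij).trans (le_of_eq ?_)
    field_simp
    ring
  · simp only [minorGreen, zeroOut_empty]
    rw [inv_green_eq hH hz (S i) i]
    have h1 := norm_removalError_le hH hz (hS.nonneg i) (hSκ i) i
    have h2 := h.norm_invFluct_le hS hSκ hH hz hκ hτ hξ hφ hξφ hzφ i
    have h3 := norm_sum_green_diag_le (hS.nonneg i) (hS.row_sum i).le (by positivity) hG
    calc _ ≤ ‖-z‖ + ‖∑ k, (S i k : ℂ) * green H z k k‖ + ‖invFluct (S i) H z i ∅‖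
          + ‖removalError (S i) H z i‖ :=
          (norm_add_le _ _).trans (add_le_add ((norm_add_le _ _).trans
            (add_le_add (norm_sub_le _ _) le_rfl)) le_rfl)
      _ ≤ 15 + 3 * L + 1 + 1 := by
          rw [norm_neg]
          rw [hξ] at h1
          linarith
      _ ≤ _ := by linarith
  · simp only [minorGreen, zeroOut_empty]
    exact (hG i).trans (by linarith)

end LDBound

end ResolventBounds

section LargeDeviationEvents

variable {δ : ℝ} {μ : ℕ → ℝ}

theorem wop_column {ε : ℝ} (hε : 0 < ε) :
    Wop (δ := δ) (μ := μ) (ι := fun N => (ℂ × Fin N) × Fin N) fun N A p ω =>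
      ‖∑ k ∈ Finset.univ.erase p.2, minorGreen (A.H ω) p.1.1 p.1.2 k {p.2} * A.H ω k p.2‖
      ≤ (N : ℝ) ^ ε * Real.sqrt (∑ k ∈ Finset.univ.erase p.2,
        ‖minorGreen (A.H ω) p.1.1 p.1.2 k {p.2}‖ ^ 2 * varMatrix A.P A.H p.2 k) :=
  Wop.of_moments (ι := fun N => (ℂ × Fin N) × Fin N)
    (Y := fun N A p ω =>
      ‖∑ k ∈ Finset.univ.erase p.2, minorGreen (A.H ω) p.1.1 p.1.2 k {p.2} * A.H ω k p.2‖)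
    (W := fun N A p ω => ∑ k ∈ Finset.univ.erase p.2,
        ‖minorGreen (A.H ω) p.1.1 p.1.2 k {p.2}‖ ^ 2 * varMatrix A.P A.H p.2 k)
    (fun N A p ω => Finset.sum_nonneg fun k _ =>
      mul_nonneg (by positivity) (A.isModel.varMatrix_nonneg p.2 k))
    (C := fun r => momConst r * |μ (2 * r + 2)|)
    (fun r N A p t ht => A.isModel.measureReal_column_le p.1.1 p.1.2 p.2 r ht) hε

theorem wop_quadratic {ε : ℝ} (hε : 0 < ε) :
    Wop (δ := δ) (μ := μ) (ι := fun N => ℂ × Fin N) fun N A p ω =>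
      ‖∑ k ∈ Finset.univ.erase p.2, ∑ j ∈ (Finset.univ.erase p.2).erase k,
        A.H ω p.2 k * minorGreen (A.H ω) p.1 k j {p.2} * (starRingEnd ℂ) (A.H ω p.2 j)‖
      ≤ (N : ℝ) ^ ε * Real.sqrt (∑ k ∈ Finset.univ.erase p.2, ∑ j ∈ Finset.univ.erase p.2,
        varMatrix A.P A.H p.2 k * varMatrix A.P A.H p.2 j *
          ‖minorGreen (A.H ω) p.1 k j {p.2}‖ ^ 2) :=
  Wop.of_moments (ι := fun N => ℂ × Fin N)
    (Y := fun N A p ω => ‖∑ k ∈ Finset.univ.erase p.2, ∑ j ∈ (Finset.univ.erase p.2).erase k,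
        A.H ω p.2 k * minorGreen (A.H ω) p.1 k j {p.2} * (starRingEnd ℂ) (A.H ω p.2 j)‖)
    (W := fun N A p ω => ∑ k ∈ Finset.univ.erase p.2, ∑ j ∈ Finset.univ.erase p.2,
        varMatrix A.P A.H p.2 k * varMatrix A.P A.H p.2 j *
          ‖minorGreen (A.H ω) p.1 k j {p.2}‖ ^ 2)
    (fun N A p ω => Finset.sum_nonneg fun k _ => Finset.sum_nonneg fun j _ =>
      mul_nonneg (mul_nonneg (A.isModel.varMatrix_nonneg p.2 k)
        (A.isModel.varMatrix_nonneg p.2 j)) (by positivity))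
    (C := fun r => 2 * quadConst r |μ (2 * r + 2)|)
    (fun r N A p t ht => A.isModel.measureReal_quadratic_le p.1 p.2 r ht) hε

theorem wop_diagonal {ε : ℝ} (hε : 0 < ε) :
    Wop (δ := δ) (μ := μ) (ι := fun N => ℂ × Fin N) fun N A p ω =>
      ‖∑ k ∈ Finset.univ.erase p.2, minorGreen (A.H ω) p.1 k k {p.2} *
        (((‖A.H ω p.2 k‖ ^ 2 : ℝ) : ℂ) - (varMatrix A.P A.H p.2 k : ℂ))‖
      ≤ (N : ℝ) ^ ε * Real.sqrt (∑ k ∈ Finset.univ.erase p.2,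
        ‖minorGreen (A.H ω) p.1 k k {p.2}‖ ^ 2 * varMatrix A.P A.H p.2 k ^ 2) :=
  Wop.of_moments (ι := fun N => ℂ × Fin N)
    (Y := fun N A p ω => ‖∑ k ∈ Finset.univ.erase p.2, minorGreen (A.H ω) p.1 k k {p.2} *
        (((‖A.H ω p.2 k‖ ^ 2 : ℝ) : ℂ) - (varMatrix A.P A.H p.2 k : ℂ))‖)
    (W := fun N A p ω => ∑ k ∈ Finset.univ.erase p.2,
        ‖minorGreen (A.H ω) p.1 k k {p.2}‖ ^ 2 * varMatrix A.P A.H p.2 k ^ 2)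
    (fun N A p ω => Finset.sum_nonneg fun k _ => by positivity)
    (C := fun r => momConst r * (2 ^ (2 * r + 2) * (|μ (2 * (2 * r + 2))| + 1)))
    (fun r N A p t ht => A.isModel.measureReal_diagonal_le p.1 p.2 r ht) hε

theorem wop_entry {ε : ℝ} (hε : 0 < ε) :
    Wop (δ := δ) (μ := μ) (ι := fun N => ℂ × Fin N) fun N A p ω =>
      ‖A.H ω p.2 p.2‖ ≤ (N : ℝ) ^ ε * Real.sqrt (varMatrix A.P A.H p.2 p.2) :=
  Wop.of_moments (ι := fun N => ℂ × Fin N)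
    (Y := fun N A p ω => ‖A.H ω p.2 p.2‖) (W := fun N A p _ => varMatrix A.P A.H p.2 p.2)
    (fun N A p ω => A.isModel.varMatrix_nonneg p.2 p.2) (C := fun r => |μ (2 * r + 2)|)
    (fun r N A p t ht => A.isModel.measureReal_entry_le p.2 p.2 r ht) hε

theorem wop_ldBound {ε : ℝ} (hε : 0 < ε) :
    Wop (δ := δ) (μ := μ) (ι := fun _ => ℂ) fun N A z ω => 0 < z.im →
      LDBound A.S (A.H ω) z ((N : ℝ) ^ ε) A.M⁻¹ := by
  have h1 := Wop.forall_fin (Wop.forall_fin (wop_column (δ := δ) (μ := μ) hε))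
  have h2 := Wop.forall_fin ((wop_quadratic (δ := δ) (μ := μ) hε).and
    ((wop_diagonal (δ := δ) (μ := μ) hε).and (wop_entry (δ := δ) (μ := μ) hε)))
  refine (h1.and h2).mono (Filter.Eventually.of_forall fun N A z ω hω hz => ?_)
  obtain ⟨hc, hq⟩ := hω
  have hH := A.isModel.hermitian ω
  have hs := A.isModel.varMatrix_nonneg
  have hsM := A.isModel.varMatrix_le
  change ∀ i j, A.S i j ≤ A.M⁻¹ at hsM
  change ∀ i j, 0 ≤ A.S i j at hs
  change ∀ i l, _ ≤ _ * Real.sqrt (∑ k ∈ Finset.univ.erase l, _ * A.S l k) at hc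
  have hτ : (0 : ℝ) ≤ (N : ℝ) ^ ε := by positivity
  refine ⟨fun i l hil => ?_, fun l => ?_⟩
  · have hM : 0 ≤ A.M⁻¹ := (hs i i).trans (hsM i i)
    rw [green_off_col hH hz hil, norm_neg, norm_mul, mul_comm]
    refine mul_le_mul_of_nonneg_left ((hc i l).trans ?_) (norm_nonneg _)
    refine mul_le_mul_of_nonneg_left (Real.sqrt_le_sqrt ?_) hτ
    have e := sum_norm_sq_green_row (isHermitian_zeroOut hH {l}) hz i
    simp only [minorGreen]
    rw [← e, Finset.mul_sum]
    refine (Finset.sum_le_sum fun k _ => ?_).trans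
      (Finset.sum_le_sum_of_subset_of_nonneg (Finset.subset_univ _) fun k _ _ => by positivity)
    rw [mul_comm]
    exact mul_le_mul_of_nonneg_right (hsM l k) (by positivity)
  · have hM : 0 ≤ A.M⁻¹ := (hs l l).trans (hsM l l)
    obtain ⟨h3, h4, h5⟩ := hq l
    have e : Finset.univ \ insert l (∅ : Finset (Fin N)) = Finset.univ.erase l := by
      ext k; simp
    rw [invFluct_eq hH hz _ (Finset.notMem_empty l), e, LawfulSingleton.insert_empty_eq]
    have hsum : ∑ k ∈ Finset.univ.erase l, ∑ j ∈ Finset.univ.erase l,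
        A.S l k * A.S l j * ‖minorGreen (A.H ω) z k j {l}‖ ^ 2
        ≤ A.M⁻¹ * ((∑ k ∈ Finset.univ.erase l,
          A.S l k * (minorGreen (A.H ω) z k k {l}).im) / z.im) := by
      rw [Finset.sum_div, Finset.mul_sum]
      refine Finset.sum_le_sum fun k _ => ?_
      have e := sum_norm_sq_green_row (isHermitian_zeroOut hH {l}) hz k
      simp only [minorGreen]
      rw [mul_div_assoc, ← e, Finset.mul_sum, Finset.mul_sum]
      refine (Finset.sum_le_sum fun j _ => ?_).trans
        (Finset.sum_le_sum_of_subset_of_nonneg (Finset.subset_univ _) fun j _ _ =>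
          mul_nonneg hM (mul_nonneg (hs l k) (by positivity)))
      have := mul_le_mul_of_nonneg_right (hsM l j)
        (mul_nonneg (hs l k) (sq_nonneg ‖green (zeroOut (A.H ω) {l}) z k j‖))
      linarith
    have hdiag : ∑ k ∈ Finset.univ.erase l, ‖minorGreen (A.H ω) z k k {l}‖ ^ 2 * A.S l k ^ 2
        ≤ ∑ k ∈ Finset.univ.erase l, ∑ j ∈ Finset.univ.erase l,
        A.S l k * A.S l j * ‖minorGreen (A.H ω) z k j {l}‖ ^ 2 := by
      refine Finset.sum_le_sum fun k hk => ?_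
      refine le_trans (le_of_eq ?_) (Finset.single_le_sum
        (f := fun j => A.S l k * A.S l j * ‖minorGreen (A.H ω) z k j {l}‖ ^ 2) (fun j _ =>
        mul_nonneg (mul_nonneg (hs l k) (hs l j)) (sq_nonneg _)) hk)
      ring
    set Q := A.M⁻¹ * ((∑ k ∈ Finset.univ.erase l,
          A.S l k * (minorGreen (A.H ω) z k k {l}).im) / z.im)
    have h3' := h3.trans (mul_le_mul_of_nonneg_left (Real.sqrt_le_sqrt hsum) hτ)
    have h4' := h4.trans
      (mul_le_mul_of_nonneg_left (Real.sqrt_le_sqrt (hdiag.trans hsum)) hτ)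
    have h5' := h5.trans (mul_le_mul_of_nonneg_left (Real.sqrt_le_sqrt (hsM l l)) hτ)
    simp only [mul_comm (minorGreen _ _ _ _ _)] at h4'
    refine (norm_sub_le _ _).trans ((add_le_add ((norm_sub_le _ _).trans
      (add_le_add h5' h3')) h4').trans (le_of_eq ?_))
    ring

end LargeDeviationEvents

end LocalSemicircle

namespace LocalSemicircle

section AveragingEvents

variable {δ : ℝ} {μ : ℕ → ℝ}

/-- The conditions on the spectral parameter `z` and the a priori bound `φ` on `Im G_ii` under which
the fluctuations are controlled, with `x` a small power of `N`. -/
structure ControlCond {N : ℕ} (A : Model.{u} δ μ N) (z : ℂ) (φ x : ℝ) : Prop where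
  re_le : |z.re| ≤ 10
  im_pos : 0 < z.im
  im_le : z.im ≤ 10
  inv_le : 1 / (A.M * z.im) ≤ φ
  im_le_mul : z.im ≤ 100 * φ
  small : x ^ 8 * (φ * (1 / (A.M * z.im))) ≤ 1

/-- The a priori bounds on the diagonal entries of the resolvent. -/
def DiagBound {N : ℕ} (H : Matrix (Fin N) (Fin N) ℂ) (z : ℂ) (φ x : ℝ) : Prop :=
  ∀ i, ‖green H z i i‖ ≤ 3 * x ∧ (green H z i i).im ≤ φ

namespace ControlCond

variable {N : ℕ} {A : Model.{u} δ μ N} {z : ℂ} {φ x : ℝ}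

theorem facts (h : ControlCond A z φ x) (hN : 0 < N) (hx : 1 ≤ x) :
    0 < A.M ∧ 0 < 1 / (A.M * z.im) ∧ 1 / (A.M * z.im) ≤ 1 ∧ 0 < φ ∧
      A.M⁻¹ / z.im = 1 / (A.M * z.im) ∧ A.M⁻¹ ≤ 100 * (φ * (1 / (A.M * z.im))) ∧
      x ^ 4 * (1 / (A.M * z.im)) ≤ 1 ∧ x ^ 4 * Real.sqrt (φ * (1 / (A.M * z.im))) ≤ 1 := by
  have hM : 0 < A.M := A.isModel.invMax_pos hN
  have hη := h.im_pos
  set ξ := 1 / (A.M * z.im) with hξ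
  have hξ0 : 0 < ξ := by positivity
  have hφ0 : 0 < φ := hξ0.trans_le h.inv_le
  have h1 : (x ^ 4 * ξ) ^ 2 ≤ 1 := by
    calc (x ^ 4 * ξ) ^ 2 = x ^ 8 * (ξ * ξ) := by ring
      _ ≤ x ^ 8 * (φ * ξ) := by have := h.inv_le; gcongr
      _ ≤ 1 := h.small
  have h2 : x ^ 4 * ξ ≤ 1 := by
    have : (0 : ℝ) ≤ x ^ 4 * ξ := by positivity
    nlinarith
  have h3 : (x ^ 4 * Real.sqrt (φ * ξ)) ^ 2 ≤ 1 := by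
    rw [mul_pow, Real.sq_sqrt (by positivity), ← pow_mul]
    exact h.small
  have h4 : x ^ 4 * Real.sqrt (φ * ξ) ≤ 1 := by
    have : (0 : ℝ) ≤ x ^ 4 * Real.sqrt (φ * ξ) := by positivity
    nlinarith
  have hx4 : (1 : ℝ) ≤ x ^ 4 := one_le_pow₀ hx
  refine ⟨hM, hξ0, by nlinarith, hφ0, by rw [hξ]; field_simp, ?_, h2, h4⟩
  calc A.M⁻¹ = z.im * ξ := by rw [hξ]; field_simp
    _ ≤ 100 * φ * ξ := by have := h.im_le_mul; gcongr
    _ = _ := by ring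

/-- The control parameter of the difference calculus. -/
noncomputable def diffParam (A : Model.{u} δ μ N) (z : ℂ) (φ x : ℝ) : ℝ :=
  100 * x ^ 3 * Real.sqrt (φ * (1 / (A.M * z.im)))

theorem diffParam_facts (h : ControlCond A z φ x) (hN : 0 < N) (hx : 1 ≤ x) :
    0 < diffParam A z φ x ∧ x * diffParam A z φ x ≤ 100 ∧ A.M⁻¹ ≤ diffParam A z φ x ^ 2 ∧
      (N : ℝ)⁻¹ ≤ diffParam A z φ x ^ 2 ∧
      diffParam A z φ x ^ 2 = 10000 * x ^ 6 * (φ * (1 / (A.M * z.im))) := by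
  obtain ⟨hM, hξ0, hξ1, hφ0, -, hMφ, -, h4⟩ := h.facts hN hx
  have e : diffParam A z φ x ^ 2 = 10000 * x ^ 6 * (φ * (1 / (A.M * z.im))) := by
    rw [diffParam, mul_pow, Real.sq_sqrt (by positivity)]; ring
  have h5 : A.M⁻¹ ≤ diffParam A z φ x ^ 2 := by
    rw [e]
    refine hMφ.trans ?_
    have : (1 : ℝ) ≤ x ^ 6 := one_le_pow₀ hx
    gcongr
    linarith
  refine ⟨by unfold diffParam; positivity, ?_, h5, le_trans ?_ h5, e⟩
  · have : x * diffParam A z φ x = 100 * (x ^ 4 * Real.sqrt (φ * (1 / (A.M * z.im)))) := by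
      rw [diffParam]; ring
    rw [this]; linarith
  · exact inv_anti₀ hM A.isModel.upper_M

theorem local_bounds (h : ControlCond A z φ x) (hN : 0 < N) (hx : 31 ≤ x)
    {H : Matrix (Fin N) (Fin N) ℂ} (hH : H.IsHermitian) (hG : DiagBound H z φ x)
    (hL : LDBound A.S H z x A.M⁻¹) :
    (∀ i l, i ≠ l → ‖green H z i l‖ ≤ x ^ 4 * Real.sqrt (φ * (1 / (A.M * z.im)))) ∧
      (∀ l, ‖invFluct (A.S l) H z l ∅‖ ≤ x ^ 4 * Real.sqrt (φ * (1 / (A.M * z.im)))) ∧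
      (∀ l, ‖invFluct (A.S l) H z l ∅‖ ≤ diffParam A z φ x) ∧
      GreenBound H z (20 * x) (diffParam A z φ x) 1 ∅ := by
  obtain ⟨hM, hξ0, hξ1, hφ0, hξ, hMφ, h3, h4⟩ := h.facts hN (by linarith)
  have hκ : 0 ≤ A.M⁻¹ := by positivity
  have hS := A.isModel.isSymmStochastic
  have hSM := A.isModel.varMatrix_le
  have hx1 : 1 ≤ x := by linarith
  have hsmall : 6 * x * x ^ 2 * (1 / (A.M * z.im)) ≤ 1 := by
    calc 6 * x * x ^ 2 * (1 / (A.M * z.im)) = 6 * x ^ 3 * (1 / (A.M * z.im)) := by ring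
      _ ≤ x * x ^ 3 * (1 / (A.M * z.im)) := by gcongr; linarith
      _ = x ^ 4 * (1 / (A.M * z.im)) := by ring
      _ ≤ 1 := h3
  set q := Real.sqrt (φ * (1 / (A.M * z.im))) with hq
  have hq0 : 0 ≤ q := Real.sqrt_nonneg _
  have hx3 : 1 ≤ x ^ 3 := one_le_pow₀ hx1
  have hx2 : 1 ≤ x ^ 2 := one_le_pow₀ hx1
  have h31 : 31 * x ≤ x ^ 4 := by
    calc 31 * x ≤ x * x * 1 := by nlinarith
      _ ≤ x * x * x ^ 2 := by gcongr
      _ = x ^ 4 := by ring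
  have hsmall' : 31 * x * q ≤ 1 := (mul_le_mul_of_nonneg_right h31 hq0).trans h4
  have hI := fun l => hL.norm_invFluct_le hS hSM hH h.im_pos hκ hx1 hξ (fun i => (hG i).2)
    h.inv_le h.im_le_mul l
  refine ⟨fun i l hil => ?_, fun l => ?_, fun l => ?_, ?_⟩
  · refine (hL.norm_off_le hH h.im_pos hκ hx1 hx1 hξ (fun i => (hG i).1) (fun i => (hG i).2)
      hsmall hil).trans ?_
    refine mul_le_mul_of_nonneg_right ?_ hq0
    nlinarith [mul_nonneg (show (0 : ℝ) ≤ x ^ 2 by positivity) (show 0 ≤ x ^ 2 - 5 by nlinarith)]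
  · exact (hI l).trans (mul_le_mul_of_nonneg_right h31 hq0)
  · refine (hI l).trans (mul_le_mul_of_nonneg_right ?_ hq0)
    nlinarith
  · have := hL.greenBound hS hSM hH h.im_pos (norm_le_of_box h.re_le h.im_pos h.im_le) hκ hx1 hx1 hξ
      (fun i => (hG i).1) (fun i => (hG i).2) h.inv_le h.im_le_mul hsmall hsmall'
    convert this using 1
    rw [diffParam]; ring

theorem smallDiff_fluct (h : ControlCond A z φ x) (hN : 0 < N) {d : ℕ}
    (hx : 1600 * (d + 3) ≤ x) {ω : A.Ω} (hG : DiagBound (A.H ω) z φ x)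
    (hL : LDBound A.S (A.H ω) z x A.M⁻¹) (l : Fin N) :
    SmallDiff (diffParam A z φ x) (d + 1) {l} 1 ((1 + fluctConst d) * (20 * x))
      fun T => fluct A.P A.H z T l ω := by
  have hd : (0 : ℝ) ≤ d := Nat.cast_nonneg d
  have hx31 : 31 ≤ x := by linarith
  have hH := A.isModel.hermitian ω
  have hS := A.isModel.isSymmStochastic
  have hSM := A.isModel.varMatrix_le
  obtain ⟨-, -, h3, h4⟩ := h.local_bounds hN hx31 hH hG hL
  obtain ⟨hψ0, hψx, hψM, -, -⟩ := h.diffParam_facts hN (by linarith)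
  set ψ := diffParam A z φ x
  have hn : 16 * (((d + 1 : ℕ) : ℝ) + 1) * ψ ≤ 1 := by
    push_cast
    have h5 : 1600 * ((d : ℝ) + 3) * ψ ≤ x * ψ := by gcongr
    have h6 : 0 ≤ (d : ℝ) * ψ := by positivity
    nlinarith
  have hψ1 : ψ ≤ 1 := by
    push_cast at hn
    have h6 : 0 ≤ (d : ℝ) * ψ := by positivity
    nlinarith
  have hf := fluctConst_pos d
  have hC : 1 ≤ (1 + fluctConst d) * (20 * x) := by nlinarith
  refine ⟨?_, fun a ha => ?_⟩
  · have e : fluct A.P A.H z ∅ l ω = invFluct (A.S l) (A.H ω) z l ∅ :=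
      if_neg (Finset.notMem_empty l)
    change ‖fluct A.P A.H z ∅ l ω‖ ≤ _
    rw [e, pow_one]
    exact (h3 l).trans (le_mul_of_one_le_left hψ0.le hC)
  · have hal : a ≠ l := by simpa using ha
    have := smallDiff_invFluct hH h.im_pos (L := 20 * x) (by linarith) hψ0.le hψ1
      (fun T hT => h4.minor hH h.im_pos (by linarith) hψ0.le hn T hT) le_rfl
      (hS.nonneg l) (fun k => (hSM l k).trans hψM) (hS.row_sum l).le hal
    refine (this.mono hψ0.le (Finset.Subset.refl _) ?_).congr fun T hT => ?_
    · gcongr; linarith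
    · rw [Finset.disjoint_insert_right, Finset.disjoint_singleton_right] at hT
      have hl : l ∉ insert a T := by simp [hal.symm, hT.2]
      simp only [rowDiff, fluct, if_neg hT.2, if_neg hl]

/-- The moments of the averages of the fluctuations. -/
theorem integral_average_le (h : ControlCond A z φ x) (hN : 0 < N) {d : ℕ}
    (hx : 1600 * (d + 3) ≤ x) (r : ℕ)
    (hP : A.P.real {ω | ¬(DiagBound (A.H ω) z φ x ∧ LDBound A.S (A.H ω) z x A.M⁻¹)}
      ≤ (N : ℝ) ^ (-(1 + 6 * (2 * r + 2 : ℕ) + (d + 2 : ℕ) * (2 * r + 2 : ℕ) : ℝ)))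
    (hK : (2 ^ (2 * (2 * r + 2)) * 2) ^ (d + 1) * (7 ^ (2 * (2 * r + 2)) * (2 ^ (2 * (2 * r + 2)) *
      (1 + |μ (2 * (2 * (2 * r + 2)))|))) ≤ (N : ℝ)) {t : Fin N → ℝ} (ht : ∀ l, 0 ≤ t l)
    (ht1 : ∑ l, t l ≤ 1) (htM : ∀ l, t l ≤ A.M⁻¹) :
    ∫ ω, ‖∑ l, (t l : ℂ) * fluct A.P A.H z ∅ l ω‖ ^ (2 * r + 2) ∂A.P
      ≤ (avgConst r (d + 1) * (2 * ((1 + fluctConst d) * (20 * x)) * diffParam A z φ x ^ 1)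
        * avgGain (diffParam A z φ x) (d + 1)) ^ (2 * r + 2) := by
  have hd : (0 : ℝ) ≤ d := Nat.cast_nonneg d
  have hN' : (1 : ℝ) ≤ N := by exact_mod_cast hN
  have hN0 : (0 : ℝ) < N := by linarith
  obtain ⟨hψ0, hψx, hψM, hψN, -⟩ := h.diffParam_facts hN (by linarith)
  obtain ⟨hM, hξ0, hξ1, -⟩ := h.facts hN (by linarith)
  set ψ := diffParam A z φ x
  have hψ1 : ψ ≤ 1 := by
    have h5 : 1600 * ((d : ℝ) + 3) * ψ ≤ x * ψ := by gcongr
    have h6 : 0 ≤ (d : ℝ) * ψ := by positivity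
    nlinarith
  have hf := fluctConst_pos d
  set C := (1 + fluctConst d) * (20 * x) with hCdef
  have hC : 1 ≤ C := by nlinarith
  set q := 2 * r + 2 with hq
  set bad := {ω | ¬(DiagBound (A.H ω) z φ x ∧ LDBound A.S (A.H ω) z x A.M⁻¹)}
  set Ξ : Set A.Ω := (toMeasurable A.P bad)ᶜ with hΞ
  have hΞm : MeasurableSet Ξ := (measurableSet_toMeasurable _ _).compl
  have hΞP : A.P.real Ξᶜ ≤ (N : ℝ) ^ (-(1 + 6 * (q : ℕ) + (d + 2 : ℕ) * (q : ℕ) : ℝ)) := by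
    rw [hΞ, compl_compl, measureReal_def, measure_toMeasurable]
    exact hP
  have hgood : ∀ ω ∈ Ξ, ∀ l, l ∉ (∅ : Finset (Fin N)) →
      SmallDiff ψ (d + 1) (insert l ∅) 1 C fun T => fluct A.P A.H z T l ω := by
    intro ω hω l _
    have h1 : ω ∉ bad := fun h1 => hω (subset_toMeasurable A.P bad h1)
    have h2 : DiagBound (A.H ω) z φ x ∧ LDBound A.S (A.H ω) z x A.M⁻¹ := by
      simpa [bad] using h1
    exact h.smallDiff_fluct hN hx h2.1 h2.2 l
  set B := (7 / z.im) ^ (2 * q) * (2 ^ (2 * q) *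
    (1 + (N : ℝ) ^ (2 * (2 * q)) * |μ (2 * (2 * q))|)) with hB
  have him := h.im_pos
  have hB0 : 0 ≤ B := by positivity
  have hη : 7 / z.im ≤ 7 * N := by
    rw [div_le_iff₀ him]
    have h1 : 1 ≤ A.M * z.im := by
      rwa [div_le_one (by positivity)] at hξ1
    have h2 : A.M ≤ N := A.isModel.upper_M
    nlinarith
  have hBN : B ≤ (7 ^ (2 * q) * (2 ^ (2 * q) * (1 + |μ (2 * (2 * q))|))) * (N : ℝ) ^ (6 * q) := by
    have h1 : (1 : ℝ) ≤ (N : ℝ) ^ (2 * (2 * q)) := one_le_pow₀ hN'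
    calc B ≤ (7 * N) ^ (2 * q) * (2 ^ (2 * q) * ((N : ℝ) ^ (2 * (2 * q))
          + (N : ℝ) ^ (2 * (2 * q)) * |μ (2 * (2 * q))|)) := by rw [hB]; gcongr
      _ = (7 ^ (2 * q) * (2 ^ (2 * q) * (1 + |μ (2 * (2 * q))|)))
          * ((N : ℝ) ^ (2 * q) * (N : ℝ) ^ (2 * (2 * q))) := by rw [mul_pow]; ring
      _ = _ := by rw [← pow_add]; congr 2; ring
  have hBK : (N : ℝ) ^ (-(1 + 6 * (q : ℕ) + (d + 2 : ℕ) * (q : ℕ) : ℝ))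
      * ((2 ^ (2 * q) * 2) ^ (d + 1) * B) ≤ (C * ψ ^ (1 + (d + 1))) ^ (2 * q) := by
    have h1 : (2 ^ (2 * q) * 2) ^ (d + 1) * B ≤ (N : ℝ) * (N : ℝ) ^ (6 * q) := by
      calc _ ≤ (2 ^ (2 * q) * 2) ^ (d + 1) * ((7 ^ (2 * q) * (2 ^ (2 * q) *
            (1 + |μ (2 * (2 * q))|))) * (N : ℝ) ^ (6 * q)) := by gcongr
        _ = ((2 ^ (2 * q) * 2) ^ (d + 1) * (7 ^ (2 * q) * (2 ^ (2 * q) *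
            (1 + |μ (2 * (2 * q))|)))) * (N : ℝ) ^ (6 * q) := by ring
        _ ≤ _ := by gcongr
    have h2 : (N : ℝ) ^ (-(1 + 6 * (q : ℕ) + (d + 2 : ℕ) * (q : ℕ) : ℝ))
        * ((N : ℝ) * (N : ℝ) ^ (6 * q)) = ((N : ℝ)⁻¹) ^ ((d + 2) * q) := by
      have e1 : (N : ℝ) * (N : ℝ) ^ (6 * q) = (N : ℝ) ^ ((1 + 6 * q : ℕ) : ℝ) := by
        rw [Real.rpow_natCast, pow_add, pow_one]
      rw [e1, ← Real.rpow_add hN0, inv_pow, ← Real.rpow_natCast, ← Real.rpow_neg hN0.le]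
      congr 1
      push_cast
      ring
    calc _ ≤ (N : ℝ) ^ (-(1 + 6 * (q : ℕ) + (d + 2 : ℕ) * (q : ℕ) : ℝ))
        * ((N : ℝ) * (N : ℝ) ^ (6 * q)) := by gcongr
      _ = ((N : ℝ)⁻¹) ^ ((d + 2) * q) := h2
      _ ≤ (ψ ^ 2) ^ ((d + 2) * q) := by gcongr
      _ = (1 * ψ ^ (1 + (d + 1))) ^ (2 * q) := by
          rw [one_mul, ← pow_mul, ← pow_mul]; congr 1; ring
      _ ≤ _ := by gcongr
  have hmd := momentDiff_of_smallDiff (q := q) hψ0 hψ1 hΞm (by positivity) hΞP (by linarith : 0 < C)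
    (E := ∅) (X := fluct A.P A.H z) hB0 (A.isModel.hasAllMoments_fluct him)
        (fun T l hl => by simp at hl)
    hgood (fun T l => A.isModel.integral_norm_fluct_pow_le him h.im_le (by omega) T l) hBK
        (by omega)
  exact fluctuation_averaging r hψ0 hψ1 ht ht1 (fun l => (htM l).trans hψM) (d + 1) (by positivity)
    (A.isModel.fluctFamily him) (fun T l hl => by simp at hl) hmd

end ControlCond

/-- Averages of the fluctuations are much smaller than the individual terms. -/
theorem wop_average {φ : ∀ N, Model.{u} δ μ N → ℂ → ℝ} {cond : ∀ N, Model.{u} δ μ N → ℂ → Prop}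
    {ε : ℝ} (hε : 0 < ε)
    (hcond : ∀ᶠ N : ℕ in Filter.atTop, ∀ A z, cond N A z →
      ControlCond A z (φ N A z) ((N : ℝ) ^ ε))
    (hdiag : Wop fun N (A : Model.{u} δ μ N) z ω => cond N A z →
      DiagBound (A.H ω) z (φ N A z) ((N : ℝ) ^ ε)) :
    Wop (ι := fun N => ℂ × (Fin N → ℝ)) fun N (A : Model.{u} δ μ N) p ω => cond N A p.1 →
      (∀ l, 0 ≤ p.2 l) → ∑ l, p.2 l ≤ 1 → (∀ l, p.2 l ≤ A.M⁻¹) →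
      ‖∑ l, (p.2 l : ℂ) * invFluct (A.S l) (A.H ω) p.1 l ∅‖
        ≤ ((N : ℝ) ^ ε) ^ 10 * (φ N A p.1 * (1 / (A.M * p.1.im))) := by
  intro D hD
  obtain ⟨r, hr⟩ := exists_nat_ge (D / ε)
  obtain ⟨d, hd⟩ := exists_pow_lt_of_lt_one hε (by norm_num : (2 : ℝ)⁻¹ < 1)
  have hw := (hdiag.and (wop_ldBound (δ := δ) (μ := μ) hε))
    (1 + 6 * (2 * r + 2 : ℕ) + (d + 2 : ℕ) * (2 * r + 2 : ℕ)) (by positivity)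
  set c := avgConst r (d + 1) * (2 * ((1 + fluctConst d) * 20)) * 10000 with hc
  filter_upwards [hw, hcond, eventually_le_rpow hε (1600 * (d + 3)), eventually_le_rpow hε c,
    eventually_le_rpow one_pos ((2 ^ (2 * (2 * r + 2)) * 2) ^ (d + 1) *
      (7 ^ (2 * (2 * r + 2)) * (2 ^ (2 * (2 * r + 2)) * (1 + |μ (2 * (2 * (2 * r + 2)))|)))),
    Filter.eventually_ge_atTop 1] with N h1 h2 hx hxc hK hN A p
  rw [Real.rpow_one] at hK
  obtain ⟨z, t⟩ := p
  set x := (N : ℝ) ^ ε with hxdef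
  have hN' : (1 : ℝ) ≤ N := by exact_mod_cast hN
  have hN0 : (0 : ℝ) < N := by linarith
  have hd0 : (0 : ℝ) ≤ d := Nat.cast_nonneg d
  have hx1 : 1 ≤ x := by linarith
  by_cases hp : cond N A z ∧ (∀ l, 0 ≤ t l) ∧ ∑ l, t l ≤ 1 ∧ ∀ l, t l ≤ A.M⁻¹
  swap
  · have : {ω | ¬(cond N A z → (∀ l, 0 ≤ t l) → ∑ l, t l ≤ 1 → (∀ l, t l ≤ A.M⁻¹) →
        ‖∑ l, (t l : ℂ) * invFluct (A.S l) (A.H ω) z l ∅‖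
          ≤ x ^ 10 * (φ N A z * (1 / (A.M * z.im))))} = ∅ := by
      ext ω
      simp only [Set.mem_ofPred_eq, Set.mem_empty_iff_false, iff_false, not_not]
      tauto
    rw [this, measureReal_empty]
    positivity
  obtain ⟨hcz, ht, ht1, htM⟩ := hp
  have h := h2 A z hcz
  have hI := h.integral_average_le hN hx r (by
    refine (measureReal_mono fun ω hω => ?_).trans (h1 A z)
    simp only [Set.mem_ofPred_eq] at *
    exact fun h3 => hω ⟨h3.1 hcz, h3.2 h.im_pos⟩) hK ht ht1 htM
  obtain ⟨hψ0, hψx, hψM, hψN, hψe⟩ := h.diffParam_facts hN hx1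
  set ψ := ControlCond.diffParam A z (φ N A z) x
  set W := avgConst r (d + 1) * (2 * ((1 + fluctConst d) * (20 * x)) * ψ ^ 1) * avgGain ψ (d + 1)
    with hW
  have hf := fluctConst_pos d
  have ha := one_le_avgConst r (d + 1)
  have hg := avgGain_pos hψ0 (d + 1)
  have hW0 : 0 ≤ W := by positivity
  have hgain : avgGain ψ (d + 1) ≤ x * ψ := by
    have h3 : avgGain ψ (d + 1) = ψ * ψ ^ (-(2 : ℝ)⁻¹ ^ (d + 1)) := by
      rw [avgGain_eq hψ0, sub_eq_add_neg, Real.rpow_add hψ0, Real.rpow_one]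
    have h4 : ψ ^ (-(2 : ℝ)⁻¹ ^ (d + 1)) ≤ x := by
      have e : ψ ^ (-(2 : ℝ)⁻¹ ^ (d + 1)) = ((ψ ^ 2)⁻¹) ^ ((2 : ℝ)⁻¹ ^ (d + 2)) := by
        rw [Real.inv_rpow (by positivity), ← Real.rpow_neg (by positivity), ← Real.rpow_natCast ψ 2,
          ← Real.rpow_mul hψ0.le]
        congr 1
        rw [pow_succ _ (d + 1)]; push_cast; ring
      rw [e]
      calc ((ψ ^ 2)⁻¹) ^ ((2 : ℝ)⁻¹ ^ (d + 2)) ≤ (N : ℝ) ^ ((2 : ℝ)⁻¹ ^ (d + 2)) := by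
            refine Real.rpow_le_rpow (by positivity) ?_ (by positivity)
            exact inv_le_of_inv_le₀ hN0 hψN
        _ ≤ x := by
            refine Real.rpow_le_rpow_of_exponent_le hN' (le_trans ?_ hd.le)
            exact pow_le_pow_of_le_one (by norm_num) (by norm_num) (by omega)
    rw [h3, mul_comm x]
    gcongr
  have hφξ : 0 ≤ φ N A z * (1 / (A.M * z.im)) := by
    obtain ⟨_, h3, _, h4, _⟩ := h.facts hN hx1
    exact mul_nonneg h4.le h3.le
  have hWx : x * W ≤ x ^ 10 * (φ N A z * (1 / (A.M * z.im))) := by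
    calc x * W ≤ x * (avgConst r (d + 1) * (2 * ((1 + fluctConst d) * (20 * x)) * ψ ^ 1)
          * (x * ψ)) := by rw [hW]; gcongr
      _ = avgConst r (d + 1) * (2 * ((1 + fluctConst d) * 20)) * x ^ 3 * ψ ^ 2 := by ring
      _ = c * (x ^ 9 * (φ N A z * (1 / (A.M * z.im)))) := by rw [hψe, hc]; ring
      _ ≤ x * (x ^ 9 * (φ N A z * (1 / (A.M * z.im)))) := by gcongr
      _ = _ := by ring
  have hY : HasAllMoments A.P fun ω => ∑ l, (t l : ℂ) * fluct A.P A.H z ∅ l ω :=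
    HasAllMoments.sum _ fun l _ => (HasAllMoments.const _).mul
      (A.isModel.hasAllMoments_fluct h.im_pos ∅ l)
  have hT : 0 < x ^ (2 * r + 2) := by positivity
  have hmk := measureReal_lt_le_of_moment (hY.integrable_norm_pow (2 * r + 2))
    (fun ω => by positivity) (C := 1) (w := W ^ (2 * r + 2)) (by positivity) hT zero_le_one
    (by rw [one_mul]; exact hI)
  refine (measureReal_mono fun ω hω => ?_).trans (hmk.trans ?_)
  · simp only [Set.mem_ofPred_eq, hcz, ht, ht1, htM, implies_true, forall_const, not_le] at hω ⊢
    rw [← mul_pow]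
    refine pow_lt_pow_left₀ (lt_of_le_of_lt hWx ?_) (by positivity) (by omega)
    refine lt_of_lt_of_eq hω ?_
    congr 1
  · rw [one_div, hxdef, ← Real.rpow_natCast, ← Real.rpow_mul hN0.le, ← Real.rpow_neg hN0.le]
    refine Real.rpow_le_rpow_of_exponent_le hN' (neg_le_neg ?_)
    rw [div_le_iff₀ hε] at hr
    push_cast
    nlinarith

end AveragingEvents

end LocalSemicircle

namespace LocalSemicircle

section SelfConsistent

variable {N : ℕ}

/-- The arithmetic mean. -/
noncomputable def mean (u : Fin N → ℂ) : ℂ := (N : ℂ)⁻¹ * ∑ i, u i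

theorem mean_add (u v : Fin N → ℂ) : mean (fun i => u i + v i) = mean u + mean v := by
  simp only [mean, Finset.sum_add_distrib, mul_add]

theorem mean_sub (u v : Fin N → ℂ) : mean (fun i => u i - v i) = mean u - mean v := by
  simp only [mean, Finset.sum_sub_distrib, mul_sub]

theorem mean_const_mul (c : ℂ) (u : Fin N → ℂ) : mean (fun i => c * u i) = c * mean u := by
  simp only [mean, ← Finset.mul_sum]; ring

theorem mean_const (hN : 0 < N) (c : ℂ) : mean (fun _ : Fin N => c) = c := by
  have : (N : ℂ) ≠ 0 := by exact_mod_cast hN.ne'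
  simp [mean, this]

theorem norm_mean_le {u : Fin N → ℂ} {b : ℝ} (hb : 0 ≤ b) (h : ∀ i, ‖u i‖ ≤ b) : ‖mean u‖ ≤ b := by
  rw [mean, norm_mul, norm_inv, Complex.norm_natCast]
  rcases Nat.eq_zero_or_pos N with rfl | hN
  · simpa using hb
  · have hN' : (0 : ℝ) < N := by exact_mod_cast hN
    rw [inv_mul_le_iff₀ hN']
    exact (norm_sum_le_of_le _ fun i _ => h i).trans (by simp)

variable {S : Matrix (Fin N) (Fin N) ℝ}

theorem mean_avg (hS : IsSymmStochastic S) (u : Fin N → ℂ) : mean (avg S u) = mean u := by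
  simp only [mean, sum_avg hS]

theorem norm_avg_apply_le (hS : IsSymmStochastic S) {u : Fin N → ℂ} {b : ℝ} (hb : 0 ≤ b)
    (h : ∀ i, ‖u i‖ ≤ b) (i : Fin N) : ‖avg S u i‖ ≤ b :=
  norm_sum_mul_le_of_sum_le_one _ (fun j _ => hS.nonneg i j) (hS.row_sum i).le hb fun j _ => h j

theorem avg_add_apply (u v : Fin N → ℂ) (i : Fin N) :
    avg S (fun i => u i + v i) i = avg S u i + avg S v i := by
  simp [avg, mul_add, Finset.sum_add_distrib]

theorem avg_sub_apply (u v : Fin N → ℂ) (i : Fin N) :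
    avg S (fun i => u i - v i) i = avg S u i - avg S v i := by
  simp [avg, mul_sub, Finset.sum_sub_distrib]

theorem avg_const_mul_apply (c : ℂ) (u : Fin N → ℂ) (i : Fin N) :
    avg S (fun i => c * u i) i = c * avg S u i := congrFun (avg_smul c u) i

/-- The nonlinear part of the self-consistent equation. -/
noncomputable def selfCons (m a : ℂ) : ℂ := a ^ 2 / (m + a)

variable {m a b : ℂ} {lam : ℝ}

theorem norm_add_ge (hm : 1 / 16 ≤ ‖m‖) (hlam : 6000 * lam ≤ 1) (ha : ‖a‖ ≤ lam) :
    m + a ≠ 0 ∧ ‖(m + a)⁻¹‖ ≤ 22 := by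
  have h1 : ‖m‖ - ‖a‖ ≤ ‖m + a‖ := by
    have := norm_sub_le (m + a) a
    rw [add_sub_cancel_right] at this
    linarith
  have h2 : 1 / 22 ≤ ‖m + a‖ := by norm_num at *; linarith
  have h3 : m + a ≠ 0 := norm_pos_iff.1 (by linarith)
  refine ⟨h3, ?_⟩
  rw [norm_inv, inv_le_comm₀ (by linarith) (by norm_num)]
  linarith

theorem norm_selfCons_sub_le (hm : 1 / 16 ≤ ‖m‖) (hm1 : ‖m‖ ≤ 1) (hlam : 6000 * lam ≤ 1)
    (ha : ‖a‖ ≤ lam) (hb : ‖b‖ ≤ lam) :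
    ‖selfCons m a - selfCons m b‖ ≤ 1500 * lam * ‖a - b‖ := by
  obtain ⟨ha0, ha1⟩ := norm_add_ge hm hlam ha
  obtain ⟨hb0, hb1⟩ := norm_add_ge hm hlam hb
  have hl0 : 0 ≤ lam := (norm_nonneg a).trans ha
  have e : selfCons m a - selfCons m b
      = (a - b) * (m * (a + b) + a * b) * ((m + a)⁻¹ * (m + b)⁻¹) := by
    rw [selfCons, selfCons]
    field_simp
    ring
  have h1 : ‖m * (a + b) + a * b‖ ≤ 3 * lam := by
    calc _ ≤ ‖m‖ * (‖a‖ + ‖b‖) + ‖a‖ * ‖b‖ := by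
          refine (norm_add_le _ _).trans ?_
          rw [norm_mul, norm_mul]
          gcongr
          exact norm_add_le _ _
      _ ≤ 1 * (lam + lam) + lam * lam := by gcongr
      _ ≤ 3 * lam := by nlinarith
  rw [e, norm_mul, norm_mul, norm_mul]
  calc _ ≤ ‖a - b‖ * (3 * lam) * (22 * 22) := by gcongr
    _ ≤ _ := by nlinarith [mul_nonneg (norm_nonneg (a - b)) hl0]

theorem norm_selfCons_taylor_le (hm : 1 / 16 ≤ ‖m‖) (hm1 : ‖m‖ ≤ 1) (hlam : 6000 * lam ≤ 1)
    (ha : ‖a‖ ≤ lam) (hb : ‖b‖ ≤ lam) :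
    ‖selfCons m a - selfCons m b - (1 - m ^ 2 * (m + b)⁻¹ ^ 2) * (a - b)‖
      ≤ 10648 * ‖a - b‖ ^ 2 := by
  obtain ⟨ha0, ha1⟩ := norm_add_ge hm hlam ha
  obtain ⟨hb0, hb1⟩ := norm_add_ge hm hlam hb
  have e : selfCons m a - selfCons m b - (1 - m ^ 2 * (m + b)⁻¹ ^ 2) * (a - b)
      = m ^ 2 * (a - b) ^ 2 * ((m + a)⁻¹ * ((m + b)⁻¹ * (m + b)⁻¹)) := by
    rw [selfCons, selfCons]
    field_simp
    ring
  rw [e, norm_mul, norm_mul, norm_mul, norm_mul, norm_pow, norm_pow]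
  calc _ ≤ 1 ^ 2 * ‖a - b‖ ^ 2 * (22 * (22 * 22)) := by gcongr
    _ = _ := by ring

/-- Consequences of the self-consistent equation for the fluctuations of `v` around its mean, and
for the mean. -/
theorem selfConsistent_bounds (hN : 0 < N) (hS : IsSymmStochastic S) (hm : 1 / 16 ≤ ‖m‖)
    (hm1 : ‖m‖ ≤ 1) {v X A : Fin N → ℂ}
    (heq : ∀ i, (m + v i)⁻¹ = m⁻¹ - avg S v i + X i + A i) {ψ Γ : ℝ}
    (hv : ∀ i, ‖v i‖ ≤ lam) (hlam : 6000 * lam ≤ 1) (hψ0 : 0 ≤ ψ) (hψ1 : 40 * ψ ≤ 1)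
    (hX : ∀ i, ‖X i‖ ≤ ψ) (hA : ∀ i, ‖A i‖ ≤ 40 * ψ ^ 2) (hSX : ∀ i, ‖avg S X i‖ ≤ ψ ^ 2)
    (hmX : ‖mean X‖ ≤ ψ ^ 2) (hΓ : 0 ≤ Γ)
    (hstab : ∀ u : Fin N → ℂ, ∑ i, u i = 0 → ‖u‖ ≤ Γ * ‖u - m ^ 2 • avg S u‖)
    (hΓψ : 21 * Γ * ψ ≤ 1) (hΓlam : 12000 * Γ * lam ≤ 1) :
    (∀ i, ‖v i - mean v‖ ≤ 32 * ψ) ∧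
      ‖mean v‖ * ‖mean v - (m⁻¹ - m)‖ ≤ 6000000000 * ψ ^ 2 := by
  have hm0 : m ≠ 0 := norm_pos_iff.1 (by linarith)
  have hl0 : 0 ≤ lam := (norm_nonneg _).trans (hv ⟨0, hN⟩)
  set θ := mean v with hθ
  have hθl : ‖θ‖ ≤ lam := norm_mean_le hl0 hv
  set w : Fin N → ℂ := fun i => v i - θ with hw
  set E : Fin N → ℂ := fun i => -m ^ 2 * (X i + A i) + (selfCons m (v i) - selfCons m θ) with hE
  have hsub : ∀ i, v i - m ^ 2 * avg S v i = E i + selfCons m θ := by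
    intro i
    obtain ⟨h0, -⟩ := norm_add_ge hm hlam (hv i)
    have h1 : selfCons m (v i) = v i - m + m ^ 2 * (m + v i)⁻¹ := by
      rw [selfCons]; field_simp; ring
    have h2 : m ^ 2 * m⁻¹ = m := by field_simp
    simp only [hE]
    rw [h1, heq i]
    linear_combination -h2
  have hmean : (1 - m ^ 2) * θ = mean E + selfCons m θ := by
    have h1 : mean (fun i => v i - m ^ 2 * avg S v i) = mean (fun i => E i + selfCons m θ) := by
      congr 1; ext i; exact hsub i
    rw [mean_sub, mean_const_mul, mean_avg hS, mean_add, mean_const hN] at h1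
    linear_combination h1
  have hmw : mean w = 0 := by
    rw [hw, mean_sub, mean_const hN, ← hθ, sub_self]
  have hSw : ∀ i, avg S w i = avg S v i - θ := by
    intro i
    rw [hw, avg_sub_apply, congrFun (avg_const hS θ) i]
  have hweq : ∀ i, w i - m ^ 2 * avg S w i = E i - mean E := by
    intro i
    rw [hSw i]
    simp only [hw]
    linear_combination hsub i - hmean
  set W := ‖w‖ with hW
  have hwi : ∀ i, ‖w i‖ ≤ W := norm_le_pi_norm w
  have hW0 : 0 ≤ W := norm_nonneg _
  have hlip : ∀ i, ‖selfCons m (v i) - selfCons m θ‖ ≤ 1500 * lam * W := fun i =>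
    (norm_selfCons_sub_le hm hm1 hlam (hv i) hθl).trans
      (mul_le_mul_of_nonneg_left (hwi i) (by positivity))
  have hm2 : ‖-m ^ 2‖ ≤ 1 := by
    rw [norm_neg, norm_pow]; exact pow_le_one₀ (norm_nonneg _) hm1
  have hψ2 : 40 * ψ ^ 2 ≤ ψ := by nlinarith
  have hb0 : 0 ≤ 2 * ψ + 1500 * lam * W := by positivity
  have hEi : ∀ i, ‖E i‖ ≤ 2 * ψ + 1500 * lam * W := by
    intro i
    refine (norm_add_le _ _).trans (add_le_add ?_ (hlip i))
    rw [norm_mul]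
    calc _ ≤ 1 * (ψ + 40 * ψ ^ 2) := by
          gcongr
          exact (norm_add_le _ _).trans (add_le_add (hX i) (hA i))
      _ ≤ _ := by linarith
  have hmXA : ‖-m ^ 2 * (mean X + mean A)‖ ≤ 41 * ψ ^ 2 := by
    rw [norm_mul]
    calc _ ≤ 1 * (ψ ^ 2 + 40 * ψ ^ 2) := by
          gcongr
          exact (norm_add_le _ _).trans (add_le_add hmX (norm_mean_le (by positivity) hA))
      _ = _ := by ring
  have hEmean : mean E = -m ^ 2 * (mean X + mean A)
      + mean (fun i => selfCons m (v i) - selfCons m θ) := by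
    rw [hE, mean_add, mean_const_mul, mean_add]
  have hEm1 : ‖mean E‖ ≤ 41 * ψ ^ 2 + 1500 * lam * W := by
    rw [hEmean]
    exact (norm_add_le _ _).trans (add_le_add hmXA (norm_mean_le (by positivity) hlip))
  have hSE : ∀ i, ‖avg S E i‖ ≤ 41 * ψ ^ 2 + 1500 * lam * W := by
    intro i
    rw [hE, avg_add_apply, avg_const_mul_apply, avg_add_apply]
    refine (norm_add_le _ _).trans (add_le_add ?_ (norm_avg_apply_le hS (by positivity) hlip i))
    rw [norm_mul]
    calc _ ≤ 1 * (ψ ^ 2 + 40 * ψ ^ 2) := by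
          gcongr
          exact (norm_add_le _ _).trans
            (add_le_add (hSX i) (norm_avg_apply_le hS (by positivity) hA i))
      _ = _ := by ring
  have hS1 : ‖avg S w‖ ≤ Γ * (82 * ψ ^ 2 + 3000 * lam * W) := by
    have h0 : ∑ i, avg S w i = 0 := by
      have hN' : (N : ℂ)⁻¹ ≠ 0 := inv_ne_zero (by exact_mod_cast hN.ne')
      rw [sum_avg hS]
      exact (mul_eq_zero.1 hmw).resolve_left hN'
    refine (hstab (avg S w) h0).trans (mul_le_mul_of_nonneg_left ?_ hΓ)
    rw [pi_norm_le_iff_of_nonneg (by positivity)]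
    intro i
    have h1 : (avg S w - m ^ 2 • avg S (avg S w)) i = avg S E i - mean E := by
      have h2 : avg S (fun i => w i - m ^ 2 * avg S w i) i = avg S (fun i => E i - mean E) i := by
        congr 1; ext i; exact hweq i
      have h3 := avg_sub_apply (S := S) w (fun i => m ^ 2 * avg S w i) i
      have h4 := avg_sub_apply (S := S) E (fun _ => mean E) i
      rw [avg_const_mul_apply] at h3
      rw [congrFun (avg_const hS (mean E)) i] at h4
      rw [← h4, ← h2, h3]
      rfl
    rw [h1]
    refine (norm_sub_le _ _).trans ((add_le_add (hSE i) hEm1).trans (le_of_eq (by ring)))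
  have hW1 : W ≤ ‖avg S w‖ + 4 * ψ + 3000 * lam * W := by
    rw [hW, pi_norm_le_iff_of_nonneg (by positivity)]
    intro i
    have h1 : w i = m ^ 2 * avg S w i + (E i - mean E) := by rw [← hweq i]; ring
    rw [h1]
    have hm2' : ‖m ^ 2‖ ≤ 1 := by rw [norm_pow]; exact pow_le_one₀ (norm_nonneg _) hm1
    have h2 : ‖m ^ 2 * avg S w i‖ ≤ ‖avg S w‖ := by
      rw [norm_mul]
      exact (mul_le_of_le_one_left (norm_nonneg _) hm2').trans (norm_le_pi_norm _ i)
    have h3 := (norm_sub_le (E i) (mean E)).trans (add_le_add (hEi i) (norm_mean_le hb0 hEi))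
    have h4 := (norm_add_le (m ^ 2 * avg S w i) (E i - mean E)).trans (add_le_add h2 h3)
    linarith
  have hW2 : W ≤ 32 * ψ := by
    have h1 : 3000 * lam * W ≤ W / 2 := by nlinarith
    have h2 : Γ * (82 * ψ ^ 2 + 3000 * lam * W) = 82 * (Γ * ψ) * ψ + 3000 * (Γ * lam) * W := by ring
    have h3 : 82 * (Γ * ψ) * ψ ≤ 4 * ψ := by nlinarith
    have h4 : 3000 * (Γ * lam) * W ≤ W / 4 := by nlinarith
    linarith
  refine ⟨fun i => (hwi i).trans hW2, ?_⟩
  have hEm2 : ‖mean E‖ ≤ 10903593 * ψ ^ 2 := by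
    set c := 1 - m ^ 2 * (m + θ)⁻¹ ^ 2
    have h1 : mean (fun i => selfCons m (v i) - selfCons m θ)
        = mean (fun i => selfCons m (v i) - selfCons m θ - c * w i) := by
      rw [mean_sub (fun i => selfCons m (v i) - selfCons m θ), mean_const_mul, hmw, mul_zero,
        sub_zero]
    rw [hEmean, h1]
    have h2 : ∀ i, ‖selfCons m (v i) - selfCons m θ - c * w i‖ ≤ 10648 * (32 * ψ) ^ 2 := fun i =>
      (norm_selfCons_taylor_le hm hm1 hlam (hv i) hθl).trans
        (mul_le_mul_of_nonneg_left (pow_le_pow_left₀ (norm_nonneg _) ((hwi i).trans hW2) 2)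
          (by norm_num))
    have h3 := (norm_add_le _ _).trans (add_le_add hmXA (norm_mean_le (by positivity) h2))
    refine h3.trans (le_of_eq (by ring))
  obtain ⟨h0, -⟩ := norm_add_ge hm hlam hθl
  have hkey : m ^ 2 * (θ * (θ - (m⁻¹ - m))) = -(mean E * (m + θ)) := by
    have h1 : mean E = (1 - m ^ 2) * θ - selfCons m θ := by linear_combination -hmean
    rw [h1, selfCons]
    field_simp
    ring
  have h2 := congrArg norm hkey
  rw [norm_neg, norm_mul, norm_mul, norm_mul, norm_pow] at h2
  have h3 : ‖m + θ‖ ≤ 2 := (norm_add_le _ _).trans (by linarith)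
  have h4 : ‖m‖ ^ 2 * (‖θ‖ * ‖θ - (m⁻¹ - m)‖) ≤ 10903593 * ψ ^ 2 * 2 := by
    rw [h2]; gcongr
  have h5 : (1 / 16 : ℝ) ^ 2 ≤ ‖m‖ ^ 2 := pow_le_pow_left₀ (by norm_num) hm 2
  have h6 : 0 ≤ ‖θ‖ * ‖θ - (m⁻¹ - m)‖ := by positivity
  have h7 := mul_le_mul_of_nonneg_right h5 h6
  have h8 : 0 ≤ ψ ^ 2 := sq_nonneg ψ
  linarith

end SelfConsistent

end LocalSemicircle

namespace LocalSemicircle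

section GapArgument

variable {N : ℕ} {H : Matrix (Fin N) (Fin N) ℂ} {S : Matrix (Fin N) (Fin N) ℝ} {z : ℂ}
  {M b γ : ℝ}

/-- The averaged control parameter `b / (M η)`. -/
noncomputable def avgParam (M b : ℝ) (z : ℂ) : ℝ := b / (M * z.im)

/-- The square of the entrywise control parameter. -/
noncomputable def sqParam (M b : ℝ) (z : ℂ) : ℝ := avgParam M b z * ((msc z).im + avgParam M b z)

/-- The entrywise control parameter. -/
noncomputable def entryParam (M b : ℝ) (z : ℂ) : ℝ := Real.sqrt (sqParam M b z)

/-- The error of the diagonal resolvent entries. -/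
noncomputable def diagError (H : Matrix (Fin N) (Fin N) ℂ) (z : ℂ) (i : Fin N) : ℂ :=
  green H z i i - msc z

/-- Bounds on the random inputs of the self-consistent equation. -/
structure FluctBound (S : Matrix (Fin N) (Fin N) ℝ) (H : Matrix (Fin N) (Fin N) ℂ) (M b : ℝ)
    (z : ℂ) : Prop where
  off_diag : ∀ i k, i ≠ k → ‖green H z i k‖ ≤ entryParam M b z
  fluct : ∀ i, ‖invFluct (S i) H z i ∅‖ ≤ entryParam M b z
  avg_fluct : ∀ i, ‖avg S (fun k => invFluct (S k) H z k ∅) i‖ ≤ sqParam M b z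
  mean_fluct : ‖mean fun k => invFluct (S k) H z k ∅‖ ≤ sqParam M b z

/-- The local law at the spectral parameter `z`. -/
structure LocalLawAt (H : Matrix (Fin N) (Fin N) ℂ) (M b : ℝ) (z : ℂ) : Prop where
  diag : ∀ i, ‖diagError H z i - mean (diagError H z)‖ ≤ 32 * entryParam M b z
  mean_le : ‖mean (diagError H z)‖ ≤ 96000000000 * avgParam M b z
  mean_outer : 48000000000 * avgParam M b z < rootGap z →
    ‖mean (diagError H z)‖ * rootGap z ≤ 12000000000 * sqParam M b z

theorem avgParam_pos (hM : 0 < M) (hb : 0 < b) (hz : 0 < z.im) : 0 < avgParam M b z := by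
  unfold avgParam; positivity

theorem sqParam_pos (hM : 0 < M) (hb : 0 < b) (hz : 0 < z.im) : 0 < sqParam M b z := by
  have h1 := avgParam_pos hM hb hz
  have h2 := im_msc_pos hz
  unfold sqParam; positivity

theorem entryParam_sq (hM : 0 < M) (hb : 0 < b) (hz : 0 < z.im) :
    entryParam M b z ^ 2 = sqParam M b z := Real.sq_sqrt (sqParam_pos hM hb hz).le

theorem entryParam_nonneg : 0 ≤ entryParam M b z := Real.sqrt_nonneg _

theorem avgParam_anti (hM : 0 < M) (hb : 0 < b) (E : ℝ) {y y' : ℝ} (hy : 0 < y) (hyy' : y ≤ y') :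
    avgParam M b ⟨E, y'⟩ ≤ avgParam M b ⟨E, y⟩ := by
  simp only [avgParam]; gcongr

theorem sqParam_anti (hM : 0 < M) (hb : 0 < b) (E : ℝ) {y y' : ℝ} (hy : 0 < y) (hyy' : y ≤ y') :
    sqParam M b ⟨E, y'⟩ ≤ sqParam M b ⟨E, y⟩ := by
  have e : ∀ t : ℝ, 0 < t → sqParam M b ⟨E, t⟩
      = b / M * ((msc ⟨E, t⟩).im / t) + avgParam M b ⟨E, t⟩ ^ 2 := by
    intro t ht
    simp only [sqParam, avgParam]
    field_simp
  have hy' := hy.trans_le hyy'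
  rw [e y hy, e y' hy']
  have h1 := im_msc_div_antitone E hy hyy'
  have h2 := avgParam_anti hM hb E hy hyy'
  have h3 := (avgParam_pos hM hb (z := ⟨E, y'⟩) hy').le
  gcongr

theorem entryParam_anti (hM : 0 < M) (hb : 0 < b) (E : ℝ) {y y' : ℝ} (hy : 0 < y) (hyy' : y ≤ y') :
    entryParam M b ⟨E, y'⟩ ≤ entryParam M b ⟨E, y⟩ :=
  Real.sqrt_le_sqrt (sqParam_anti hM hb E hy hyy')

theorem entryParam_add_le (hM : 0 < M) (hb : 1 ≤ b) (hz : 0 < z.im) :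
    entryParam M b z + avgParam M b z ≤ 2 * b * controlPi M z := by
  have hb0 : 0 < b := by linarith
  have hβ := avgParam_pos hM hb0 hz
  have hm := im_msc_pos hz
  have h1 : entryParam M b z ≤ Real.sqrt (avgParam M b z * (msc z).im) + avgParam M b z := by
    rw [entryParam]
    refine Real.sqrt_le_iff.2 ⟨by positivity, ?_⟩
    have hs := Real.sq_sqrt (show 0 ≤ avgParam M b z * (msc z).im by positivity)
    have hs0 := Real.sqrt_nonneg (avgParam M b z * (msc z).im)
    rw [sqParam]
    nlinarith [mul_nonneg hs0 hβ.le]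
  have h2 : Real.sqrt (avgParam M b z * (msc z).im) ≤ b * Real.sqrt ((msc z).im / (M * z.im)) := by
    refine Real.sqrt_le_iff.2 ⟨by positivity, ?_⟩
    rw [mul_pow, Real.sq_sqrt (by positivity)]
    have e : avgParam M b z * (msc z).im = b * ((msc z).im / (M * z.im)) := by
      rw [avgParam]; ring
    rw [e]
    have : b ≤ b ^ 2 := by nlinarith
    gcongr
  have e : avgParam M b z = b * (1 / (M * z.im)) := by rw [avgParam]; ring
  have h0 : 0 ≤ Real.sqrt ((msc z).im / (M * z.im)) := Real.sqrt_nonneg _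
  rw [controlPi]
  nlinarith [mul_nonneg hb0.le h0]

/-- The dichotomy for approximate roots of a quadratic equation with root gap `α`. -/
theorem root_bounds {β ι θ α d : ℝ} (hβ : 0 < β) (hι : 0 < ι) (hια : 2 * ι ≤ α) (hθ : 0 ≤ θ)
    (h1 : θ - α ≤ d) (h2 : α - θ ≤ d) (hq : θ * d ≤ 6000000000 * (β * (ι + β)))
    (hroot : 48000000000 * β < α → θ ≤ α / 2) :
    θ ≤ 96000000000 * β ∧
      (48000000000 * β < α → θ * α ≤ 12000000000 * (β * (ι + β))) := by
  have hout : 48000000000 * β < α → θ * α ≤ 12000000000 * (β * (ι + β)) := by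
    intro h
    have h3 := hroot h
    have h4 := mul_le_mul_of_nonneg_left (show α / 2 ≤ d by linarith) hθ
    linarith
  refine ⟨?_, hout⟩
  by_cases h : 48000000000 * β < α
  · have h3 := hout h
    by_contra! h4
    have h5 : 96000000000 * β * α ≤ θ * α := by gcongr; linarith
    have h6 : β * (ι + β) ≤ β * α := by gcongr; linarith
    have h7 : 0 < β * α := by nlinarith
    linarith
  · push Not at h
    by_contra! h3
    have h4 : θ * (θ / 2) ≤ 6000000000 * (β * (ι + β)) :=
      (mul_le_mul_of_nonneg_left (show θ / 2 ≤ d by linarith) hθ).trans hq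
    have h5 : (96000000000 * β) * (96000000000 * β) ≤ θ * θ := by gcongr
    have h6 : β * (ι + β) ≤ β * (24000000001 * β) := by gcongr; linarith
    have h7 := mul_pos hβ hβ
    linarith

/-- One step of the gap argument: an a priori bound on the diagonal errors and the correct choice of
the root for the mean improve to the local law. -/
theorem localLawAt_of_apriori {γ : ℝ} (hγ₀ : 0 < γ) (hγ₁ : γ < 1 / 2) (hN : 2 ≤ N)
    (hS : IsSymmStochastic S) (hSM : ∀ i j, S i j ≤ (invMax S)⁻¹) (hM : 1 ≤ invMax S)
    (hH : H.IsHermitian) (hb : 256 ≤ b) (hbM : 10 ^ 18 * (b * (invMax S) ^ (-γ)) ≤ 1)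
    (hz : z ∈ domain γ S) (hF : FluctBound S H (invMax S) b z)
    (hv : ∀ i, ‖diagError H z i‖
      ≤ 96000000001 * (entryParam (invMax S) b z + avgParam (invMax S) b z))
    (hroot : 48000000000 * avgParam (invMax S) b z < rootGap z →
      ‖mean (diagError H z)‖ ≤ rootGap z / 2) :
    LocalLawAt H (invMax S) b z := by
  obtain ⟨hre, him, -, hle⟩ := id hz
  set M := invMax S with hMdef
  have hM0 : 0 < M := by linarith
  have hb0 : 0 < b := by linarith
  set ψ := entryParam M b z with hψ
  set β := avgParam M b z with hβ
  set θ := mean (diagError H z) with hθ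
  have hβ0 : 0 < β := avgParam_pos hM0 hb0 him
  have hψ0 : 0 ≤ ψ := entryParam_nonneg
  have hψ2 : ψ ^ 2 = sqParam M b z := entryParam_sq hM0 hb0 him
  have hψe : ψ ^ 2 = β * ((msc z).im + β) := hψ2
  have hm16 := le_norm_msc hre him hle
  have hm1 := (norm_msc_lt_one him).le
  have hadd := entryParam_add_le hM0 (show 1 ≤ b by linarith) him
  have hQM := controlPi_le_of_mem_domain hγ₀ hγ₁ hN hS hM hz
  rw [← hψ, ← hβ] at hadd
  set Q := controlPi M z with hQ
  have hQ0 : 0 < Q := by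
    have h1 : 0 < 1 / (M * z.im) := by positivity
    have h2 := Real.sqrt_nonneg ((msc z).im / (M * z.im))
    rw [hQ, controlPi]; linarith
  set g := M ^ (-γ) with hg
  have hg0 : 0 < g := Real.rpow_pos_of_pos hM0 _
  set lam := 96000000001 * (ψ + β) with hlam
  have hs1 : ψ + β ≤ 24 * (b * g) := by
    refine hadd.trans ?_
    calc 2 * b * Q ≤ 2 * b * (12 * g) := by gcongr
      _ = _ := by ring
  have hψβ : 0 ≤ ψ + β := by positivity
  set Γ := 6 * g / Q with hΓ
  have hΓ0 : 0 ≤ Γ := by positivity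
  have hs2 : Γ * (ψ + β) ≤ 12 * (b * g) := by
    calc Γ * (ψ + β) ≤ Γ * (2 * b * Q) := by gcongr
      _ = _ := by rw [hΓ]; field_simp; ring
  have hlam1 : 6000 * lam ≤ 1 := by rw [hlam]; linarith
  have hΓl : 12000 * Γ * lam ≤ 1 := by
    calc 12000 * Γ * lam = 12000 * 96000000001 * (Γ * (ψ + β)) := by rw [hlam]; ring
      _ ≤ 1 := by linarith
  have hΓψ' : Γ * ψ ≤ Γ * (ψ + β) := by gcongr; linarith
  have hMψ : M⁻¹ ≤ ψ ^ 2 := by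
    rw [hψe]
    have h1 := im_le_im_msc hre him hle
    calc M⁻¹ = 256 / (M * z.im) * (z.im / 256) := by field_simp
      _ ≤ β * ((msc z).im + β) := by
          have : 256 / (M * z.im) ≤ β := by rw [hβ, avgParam]; gcongr
          gcongr
          linarith
  have heq : ∀ i, (msc z + diagError H z i)⁻¹ = (msc z)⁻¹ - avg S (diagError H z) i
      + invFluct (S i) H z i ∅ + removalError (S i) H z i := by
    intro i
    have h1 : msc z + diagError H z i = green H z i i := by rw [diagError]; ring
    have h2 : avg S (diagError H z) i = ∑ k, (S i k : ℂ) * green H z k k - msc z := by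
      have := avg_sub_apply (S := S) (fun k => green H z k k) (fun _ => msc z) i
      rw [congrFun (avg_const hS (msc z)) i] at this
      exact this
    rw [h1, inv_green_eq hH him, h2, inv_msc him]
    ring
  have hG1 : ∀ i, ‖green H z i i‖ ≤ 2 := by
    intro i
    have h1 : green H z i i = msc z + diagError H z i := by rw [diagError]; ring
    rw [h1]
    exact (norm_add_le _ _).trans (by linarith [hv i])
  have hA : ∀ i, ‖removalError (S i) H z i‖ ≤ 40 * ψ ^ 2 := by
    intro i
    have h1 : msc z + diagError H z i = green H z i i := by rw [diagError]; ring
    obtain ⟨-, h2⟩ := norm_add_ge hm16 hlam1 (hv i)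
    rw [h1] at h2
    have hG0 := green_diag_ne_zero hH him i
    have h3 : removalError (S i) H z i = (S i i : ℂ) * green H z i i
        + (∑ k ∈ Finset.univ.erase i, (S i k : ℂ) * (green H z i k * green H z k i))
          * (green H z i i)⁻¹ := by
      rw [removalError, ← Finset.add_sum_erase _ _ (Finset.mem_univ i), add_mul]
      congr 1
      field_simp
    have h4 : ‖∑ k ∈ Finset.univ.erase i, (S i k : ℂ) * (green H z i k * green H z k i)‖
        ≤ ψ ^ 2 := by
      refine norm_sum_mul_le_of_sum_le_one _ (fun k _ => hS.nonneg i k) ?_ (by positivity) ?_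
      · rw [← hS.row_sum i]
        exact Finset.sum_le_sum_of_subset_of_nonneg (Finset.erase_subset _ _)
          fun k _ _ => hS.nonneg i k
      · intro k hk
        have hki := Finset.ne_of_mem_erase hk
        rw [norm_mul, sq]
        exact mul_le_mul (hF.off_diag i k hki.symm) (hF.off_diag k i hki) (norm_nonneg _) hψ0
    have h5 : ‖(S i i : ℂ) * green H z i i‖ ≤ ψ ^ 2 * 2 := by
      rw [norm_mul, Complex.norm_real, Real.norm_of_nonneg (hS.nonneg i i)]
      exact mul_le_mul ((hSM i i).trans hMψ) (hG1 i) (norm_nonneg _) (by positivity)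
    rw [h3]
    calc _ ≤ ψ ^ 2 * 2 + ψ ^ 2 * 22 := by
          refine (norm_add_le _ _).trans (add_le_add h5 ?_)
          rw [norm_mul]
          gcongr
      _ ≤ _ := by nlinarith [sq_nonneg ψ]
  have hstab : ∀ u : Fin N → ℂ, ∑ i, u i = 0 → ‖u‖ ≤ Γ * ‖u - msc z ^ 2 • avg S u‖ := by
    intro u hu
    have h := domain_stable hγ₀ hγ₁ hN hS hM hz le_rfl hle u hu
    rw [Complex.eta, ← hMdef, ← hQ, ← hg] at h
    rw [hΓ, div_mul_eq_mul_div, le_div_iff₀ hQ0, mul_comm]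
    exact h
  obtain ⟨hw, hquad⟩ := selfConsistent_bounds (by omega) hS hm16 hm1 heq hv hlam1 hψ0
    (by linarith) hF.fluct hA (fun i => (hF.avg_fluct i).trans hψ2.ge)
    (hF.mean_fluct.trans hψ2.ge) hΓ0 hstab (by linarith) hΓl
  rw [← hθ] at hw hquad
  rw [hψe] at hquad
  have hθa : ‖θ‖ - rootGap z ≤ ‖θ - ((msc z)⁻¹ - msc z)‖ := norm_sub_norm_le _ _
  have haθ : rootGap z - ‖θ‖ ≤ ‖θ - ((msc z)⁻¹ - msc z)‖ := by
    rw [norm_sub_rev θ]; exact norm_sub_norm_le _ _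
  obtain ⟨h1, h2⟩ := root_bounds hβ0 (im_msc_pos him) (im_msc_le_rootGap him) (norm_nonneg θ)
    hθa haθ hquad hroot
  exact ⟨hw, h1, h2⟩

/-- The a priori bound at the top of the spectral domain. -/
theorem norm_diagError_le_top (hS : IsSymmStochastic S)
    (hSM : ∀ i j, S i j ≤ (invMax S)⁻¹) (hM : 0 < invMax S) (hH : H.IsHermitian) (hb : 1 ≤ b)
    (hz : z.im = 10) (hF : FluctBound S H (invMax S) b z) (i : Fin N) :
    ‖diagError H z i‖ ≤ entryParam (invMax S) b z + avgParam (invMax S) b z := by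
  have him : 0 < z.im := by rw [hz]; norm_num
  set ψ := entryParam (invMax S) b z
  set β := avgParam (invMax S) b z with hβ
  have hψ0 : 0 ≤ ψ := entryParam_nonneg
  have hβ0 : 0 < β := avgParam_pos hM (by linarith) him
  have key : ∀ i, ‖diagError H z i‖ ≤ (‖diagError H z‖ + ψ + β) / 100 := by
    intro i
    have hG0 := green_diag_ne_zero hH him i
    have hm0 := msc_ne_zero him
    have h2 : avg S (diagError H z) i = ∑ k, (S i k : ℂ) * green H z k k - msc z := by
      have := avg_sub_apply (S := S) (fun k => green H z k k) (fun _ => msc z) i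
      rw [congrFun (avg_const hS (msc z)) i] at this
      exact this
    have h3 : diagError H z i = green H z i i * msc z * (avg S (diagError H z) i
        - invFluct (S i) H z i ∅ - removalError (S i) H z i) := by
      have h4 : avg S (diagError H z) i - invFluct (S i) H z i ∅ - removalError (S i) H z i
          = (msc z)⁻¹ - (green H z i i)⁻¹ := by
        rw [inv_green_eq hH him (S i), h2, inv_msc him]; ring
      rw [h4, diagError]
      field_simp
    have hGi := norm_green_diag_le hH him i
    have hm := norm_msc_le_inv_im him
    rw [hz] at hGi hm
    have h5 := (norm_removalError_le hH him (hS.nonneg i) (hSM i) i)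
    have h6 : (invMax S)⁻¹ / z.im ≤ β := by
      rw [hβ, avgParam, inv_eq_one_div, div_div]; gcongr
    have h7 := norm_avg_apply_le hS (norm_nonneg _) (norm_le_pi_norm (diagError H z)) i
    rw [h3, norm_mul, norm_mul]
    calc _ ≤ 1 / 10 * (1 / 10) * (‖diagError H z‖ + ψ + β) := by
          gcongr
          exact (norm_sub_le _ _).trans (add_le_add ((norm_sub_le _ _).trans
            (add_le_add h7 (hF.fluct i))) (h5.trans h6))
      _ = _ := by ring
  have h1 : ‖diagError H z‖ ≤ (‖diagError H z‖ + ψ + β) / 100 :=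
    (pi_norm_le_iff_of_nonneg (by positivity)).2 key
  linarith [norm_le_pi_norm (diagError H z) i]

theorem norm_diagError_sub_le (hH : H.IsHermitian) {z' : ℂ} (hz : 0 < z.im) (hz' : 0 < z'.im)
    (i : Fin N) :
    ‖diagError H z i - diagError H z' i‖ ≤ 3 * (‖z - z'‖ / (z.im * z'.im)) := by
  have h1 := norm_green_diag_sub_le hH hz hz' i
  have h2 := norm_msc_sub_le hz hz'
  have e : diagError H z i - diagError H z' i
      = (green H z i i - green H z' i i) - (msc z - msc z') := by rw [diagError, diagError]; ring
  rw [e]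
  exact (norm_sub_le _ _).trans (by linarith)

/-- The local law propagates to a slightly smaller imaginary part. -/
theorem LocalLawAt.step {γ : ℝ} (hγ₀ : 0 < γ) (hγ₁ : γ < 1 / 2) (hN : 2 ≤ N)
    (hS : IsSymmStochastic S) (hSM : ∀ i j, S i j ≤ (invMax S)⁻¹) (hM : 1 ≤ invMax S)
    (hH : H.IsHermitian) (hb : 256 ≤ b) (hbM : 10 ^ 18 * (b * (invMax S) ^ (-γ)) ≤ 1)
    {E y y' : ℝ} (hz : (⟨E, y⟩ : ℂ) ∈ domain γ S) (hyy' : y ≤ y')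
    (hstep : invMax S * (y' - y) ≤ y') (hL : LocalLawAt H (invMax S) b ⟨E, y'⟩)
    (hF : FluctBound S H (invMax S) b ⟨E, y⟩) : LocalLawAt H (invMax S) b ⟨E, y⟩ := by
  have hy : 0 < y := hz.2.1
  have hy' : 0 < y' := hy.trans_le hyy'
  have hM0 : 0 < invMax S := by linarith
  have hb0 : 0 < b := by linarith
  have hψa := entryParam_anti hM0 hb0 E hy hyy'
  have hβa := avgParam_anti hM0 hb0 E hy hyy'
  have hga := rootGap_mono E hy hyy'
  have hβ0 := avgParam_pos hM0 hb0 (z := ⟨E, y'⟩) hy'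
  have hψ0 : 0 ≤ entryParam (invMax S) b ⟨E, y'⟩ := entryParam_nonneg
  set M := invMax S
  have htiny : ∀ i, ‖diagError H ⟨E, y⟩ i - diagError H ⟨E, y'⟩ i‖ ≤ avgParam M b ⟨E, y⟩ := by
    intro i
    refine (norm_diagError_sub_le hH (z := ⟨E, y⟩) (z' := ⟨E, y'⟩) hy hy' i).trans ?_
    have h1 : ‖(⟨E, y⟩ : ℂ) - ⟨E, y'⟩‖ = y' - y := by
      have : (⟨E, y⟩ : ℂ) - ⟨E, y'⟩ = ((y - y' : ℝ) : ℂ) * Complex.I := by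
        apply Complex.ext <;> simp
      rw [this, norm_mul, Complex.norm_I, mul_one, Complex.norm_real, Real.norm_eq_abs,
        abs_sub_comm, abs_of_nonneg (by linarith)]
    rw [h1, avgParam]
    simp only
    rw [← mul_div_assoc, div_le_div_iff₀ (by positivity) (by positivity)]
    have h3 : 0 ≤ y * (y' - M * (y' - y)) := mul_nonneg hy.le (by linarith)
    nlinarith [mul_nonneg (show (0 : ℝ) ≤ b - 3 by linarith) (mul_pos hy hy').le]
  have hmean : ‖mean (diagError H ⟨E, y⟩)‖
      ≤ ‖mean (diagError H ⟨E, y'⟩)‖ + avgParam M b ⟨E, y⟩ := by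
    have h := norm_mean_le (avgParam_pos hM0 hb0 (z := ⟨E, y⟩) hy).le htiny
    rw [mean_sub] at h
    have h2 := norm_sub_norm_le (mean (diagError H ⟨E, y⟩)) (mean (diagError H ⟨E, y'⟩))
    have h3 : (fun i => diagError H ⟨E, y⟩ i) = diagError H ⟨E, y⟩ := rfl
    linarith
  refine localLawAt_of_apriori hγ₀ hγ₁ hN hS hSM hM hH hb hbM hz hF ?_ ?_
  · intro i
    have h1 := hL.diag i
    have h2 := hL.mean_le
    have h3 := norm_sub_norm_le (diagError H ⟨E, y'⟩ i) (mean (diagError H ⟨E, y'⟩))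
    have h4 := norm_sub_norm_le (diagError H ⟨E, y⟩ i) (diagError H ⟨E, y'⟩ i)
    have h5 := htiny i
    linarith
  · intro h
    have h1 := hL.mean_outer (by linarith)
    have hm := im_msc_le_rootGap (z := ⟨E, y'⟩) hy'
    have h2 : ‖mean (diagError H ⟨E, y'⟩)‖ ≤ 12000000000 * avgParam M b ⟨E, y'⟩ := by
      have hg0 : 0 < rootGap ⟨E, y'⟩ := by linarith
      refine le_of_mul_le_mul_right (h1.trans ?_) hg0
      rw [sqParam]
      nlinarith
    linarith

/-- The gap argument: bounds on the random inputs along a fine vertical grid imply the local law at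
the bottom of the grid. -/
theorem localLawAt_of_grid {γ : ℝ} (hγ₀ : 0 < γ) (hγ₁ : γ < 1 / 2) (hN : 2 ≤ N)
    (hS : IsSymmStochastic S) (hSM : ∀ i j, S i j ≤ (invMax S)⁻¹) (hM : 1 ≤ invMax S)
    (hMN : invMax S ≤ N)
    (hH : H.IsHermitian) (hb : 256 ≤ b) (hbM : 10 ^ 18 * (b * (invMax S) ^ (-γ)) ≤ 1)
    (hz : z ∈ domain γ S)
    (hF : ∀ j : Fin (10 * N ^ 2 + 1), FluctBound S H (invMax S) b
      ⟨z.re, 10 - j * ((10 - z.im) / (10 * N ^ 2))⟩) : LocalLawAt H (invMax S) b z := by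
  obtain ⟨hre, him, -, hle⟩ := id hz
  have hN0 : (0 : ℝ) < N := by positivity
  have hM0 : 0 < invMax S := by linarith
  set h := (10 - z.im) / (10 * (N : ℝ) ^ 2) with hh
  have hh0 : 0 ≤ h := by have : 0 ≤ 10 - z.im := by linarith
                         positivity
  have hnh : (10 * (N : ℝ) ^ 2) * h = 10 - z.im := by rw [hh]; field_simp
  have hge : ∀ j : ℕ, j ≤ 10 * N ^ 2 → z.im ≤ 10 - j * h := by
    intro j hj
    have : (j : ℝ) ≤ 10 * (N : ℝ) ^ 2 := by exact_mod_cast hj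
    nlinarith
  have hdom : ∀ j : ℕ, j ≤ 10 * N ^ 2 → (⟨z.re, 10 - j * h⟩ : ℂ) ∈ domain γ S := fun j hj =>
    domain_vertical hz (hge j hj) (by have : 0 ≤ j * h := by positivity
                                      linarith)
  have hMη : 1 ≤ invMax S * z.im := by
    have h1 := controlPi_le_of_mem_domain hγ₀ hγ₁ hN hS hM hz
    have h2 := Real.sqrt_nonneg ((msc z).im / (invMax S * z.im))
    rw [controlPi] at h1
    have hg0 : 0 < (invMax S) ^ (-γ) := Real.rpow_pos_of_pos hM0 _
    have h3 : 1 / (invMax S * z.im) ≤ 1 := by nlinarith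
    rwa [div_le_one (by positivity)] at h3
  have main : ∀ j : ℕ, j ≤ 10 * N ^ 2 → LocalLawAt H (invMax S) b ⟨z.re, 10 - j * h⟩ := by
    intro j
    induction j with
    | zero =>
      intro hj
      have hF0 := hF ⟨0, by omega⟩
      have hd := hdom 0 hj
      simp only [Nat.cast_zero, zero_mul, sub_zero] at hF0 hd ⊢
      have h10 : (0 : ℝ) < (⟨z.re, 10⟩ : ℂ).im := by norm_num
      have htop := norm_diagError_le_top hS hSM hM0 hH (by linarith) rfl hF0
      have hψ0 : 0 ≤ entryParam (invMax S) b ⟨z.re, 10⟩ := entryParam_nonneg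
      have hβ0 := avgParam_pos hM0 (show 0 < b by linarith) h10
      refine localLawAt_of_apriori hγ₀ hγ₁ hN hS hSM hM hH hb hbM hd hF0
        (fun i => (htop i).trans ?_) fun _ => ?_
      · linarith
      · have h1 := norm_mean_le (by positivity) htop
        have h2 := entryParam_add_le hM0 (show 1 ≤ b by linarith) h10
        have h3 := controlPi_le_of_mem_domain hγ₀ hγ₁ hN hS hM hd
        have h4 := im_msc_le_rootGap h10
        have h5 := im_le_im_msc (z := ⟨z.re, 10⟩) hre h10 le_rfl
        have h6 : 2 * b * controlPi (invMax S) ⟨z.re, 10⟩ ≤ 2 * b * (12 * (invMax S) ^ (-γ)) := by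
          gcongr
        simp only at h5
        linarith
    | succ j ih =>
      intro hj
      have hy : 10 - ((j + 1 : ℕ) : ℝ) * h ≤ 10 - j * h := by push_cast; linarith
      refine (ih (by omega)).step hγ₀ hγ₁ hN hS hSM hM hH hb hbM (hdom _ hj) hy ?_
        (hF ⟨j + 1, by omega⟩)
      have h1 := hge j (by omega)
      have h2 : 10 - (j : ℝ) * h - (10 - ((j + 1 : ℕ) : ℝ) * h) = h := by push_cast; ring
      rw [h2]
      have h3 : (N : ℝ) ^ 2 * h ≤ 1 := by nlinarith
      have h4 : invMax S * (invMax S * h) ≤ 1 := by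
        calc _ = invMax S ^ 2 * h := by ring
          _ ≤ (N : ℝ) ^ 2 * h := by gcongr
          _ ≤ 1 := h3
      have h5 : invMax S * (invMax S * h) ≤ invMax S * z.im := h4.trans hMη
      exact (le_of_mul_le_mul_left h5 hM0).trans h1
  have hfin := main (10 * N ^ 2) le_rfl
  have e : (⟨z.re, 10 - ((10 * N ^ 2 : ℕ) : ℝ) * h⟩ : ℂ) = z := by
    apply Complex.ext
    · rfl
    · simp only; push_cast; rw [hnh]; ring
  rwa [e] at hfin

end GapArgument

end LocalSemicircle

namespace LocalSemicircle

section Bootstrap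

variable {δ γ ε : ℝ} {μ : ℕ → ℝ} {N : ℕ}

/-- The a priori bound on the imaginary parts of the diagonal resolvent entries. -/
noncomputable def apriori (M x : ℝ) (z : ℂ) : ℝ :=
  x ^ 2 * (3 * (msc z).im + x ^ 39 / (M * z.im))

/-- A coarse form of the local law. -/
def CoarseBound (H : Matrix (Fin N) (Fin N) ℂ) (M x : ℝ) (z : ℂ) : Prop :=
  ∀ i, ‖green H z i i‖ ≤ 2 ∧ (green H z i i).im ≤ 3 * (msc z).im + x ^ 39 / (M * z.im)

theorem CoarseBound.diagBound {H : Matrix (Fin N) (Fin N) ℂ} {M x y : ℝ} {z : ℂ}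
    (hH : H.IsHermitian) (hM : 0 < M) (hx : 2 ≤ x) (hz : 0 < z.im) (hzy : z.im ≤ y)
    (hyx : y ≤ x * z.im) (h : CoarseBound H M x ⟨z.re, y⟩) : DiagBound H z (apriori M x z) x := by
  intro i
  have hy : 0 < y := hz.trans_le hzy
  obtain ⟨h1, h2⟩ := h i
  have h3 := norm_green_diag_sub_vertical_le hH z.re hz hzy i
  have h4 := green_diag_im_vertical hH z.re hz hzy i
  rw [Complex.eta] at h3 h4
  have h5 := (Complex.abs_im_le_norm _).trans h1
  have h6 := (le_abs_self _).trans h5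
  have h0 := green_diag_im_pos hH (z := ⟨z.re, y⟩) hy i
  have hq : y / z.im ≤ x := (div_le_iff₀ hz).2 hyx
  have hm0 := im_msc_pos hz
  constructor
  · have h7 := norm_sub_norm_le (green H z i i) (green H ⟨z.re, y⟩ i i)
    have h8 : y / z.im * (green H ⟨z.re, y⟩ i i).im ≤ x * (green H ⟨z.re, y⟩ i i).im := by gcongr
    nlinarith
  · have h7 : (msc ⟨z.re, y⟩).im ≤ x * (msc z).im := by
      have := im_msc_div_antitone z.re hz hzy
      rw [Complex.eta, div_le_div_iff₀ hy hz] at this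
      have h8 : (msc z).im * y ≤ (msc z).im * (x * z.im) := by gcongr
      refine le_of_mul_le_mul_right ?_ hz
      linarith
    have h8 : x ^ 39 / (M * y) ≤ x ^ 39 / (M * z.im) := by gcongr
    have h9 : (green H z i i).im ≤ x * (green H ⟨z.re, y⟩ i i).im := by
      refine le_of_mul_le_mul_left (h4.trans ?_) hz
      calc _ ≤ (x * z.im) * (green H ⟨z.re, y⟩ i i).im := by gcongr
        _ = _ := by ring
    have h10 : 0 ≤ x ^ 39 / (M * z.im) := by positivity
    have h2' : (green H ⟨z.re, y⟩ i i).im ≤ 3 * (msc ⟨z.re, y⟩).im + x ^ 39 / (M * y) := h2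
    calc (green H z i i).im ≤ x * (3 * (x * (msc z).im) + x ^ 39 / (M * z.im)) := by
          refine h9.trans ?_
          gcongr
          linarith
      _ ≤ x * (3 * (x * (msc z).im) + x * (x ^ 39 / (M * z.im))) := by
          gcongr
          nlinarith
      _ = _ := by rw [apriori]; ring

theorem apriori_mul_le {M x : ℝ} {z : ℂ} (hM : 0 < M) (hx : 2 ≤ x) (hz : 0 < z.im) :
    x ^ 10 * (apriori M x z * (1 / (M * z.im))) ≤ sqParam M (x ^ 26) z := by
  have hm0 := im_msc_pos hz
  set ξ := 1 / (M * z.im) with hξ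
  have hξ0 : 0 < ξ := by positivity
  have e1 : apriori M x z = x ^ 2 * (3 * (msc z).im + x ^ 39 * ξ) := by
    rw [apriori, hξ]; ring
  have e2 : avgParam M (x ^ 26) z = x ^ 26 * ξ := by rw [avgParam, hξ]; ring
  rw [sqParam, e1, e2]
  have hx0 : 0 < x := by linarith
  have h1 : 3 * x ^ 12 ≤ x ^ 26 := by
    calc 3 * x ^ 12 ≤ x ^ 14 * x ^ 12 := by
          gcongr
          calc (3 : ℝ) ≤ 2 ^ 14 := by norm_num
            _ ≤ x ^ 14 := by gcongr
      _ = _ := by ring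
  have h2 : x ^ 51 ≤ x ^ 52 := pow_le_pow_right₀ (by linarith) (by norm_num)
  calc _ = (3 * x ^ 12) * (ξ * (msc z).im) + x ^ 51 * ξ ^ 2 := by ring
    _ ≤ x ^ 26 * (ξ * (msc z).im) + x ^ 52 * ξ ^ 2 := by gcongr
    _ = _ := by ring

theorem mul_sqrt_apriori_le {M x : ℝ} {z : ℂ} (hM : 0 < M) (hx : 2 ≤ x) (hz : 0 < z.im) :
    x ^ 8 * (apriori M x z * (1 / (M * z.im))) ≤ sqParam M (x ^ 26) z ∧
      x ^ 4 * Real.sqrt (apriori M x z * (1 / (M * z.im))) ≤ entryParam M (x ^ 26) z := by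
  have hm0 := im_msc_pos hz
  have hx0 : 0 < x := by linarith
  have h0 : 0 ≤ apriori M x z * (1 / (M * z.im)) := by unfold apriori; positivity
  have h1 : x ^ 8 * (apriori M x z * (1 / (M * z.im))) ≤ sqParam M (x ^ 26) z := by
    refine le_trans ?_ (apriori_mul_le hM hx hz)
    gcongr
    · linarith
    · norm_num
  refine ⟨h1, ?_⟩
  rw [entryParam]
  refine Real.le_sqrt_of_sq_le ?_
  rw [mul_pow, Real.sq_sqrt h0, ← pow_mul]
  exact h1

/-- The deterministic conditions under which the bootstrap runs. -/
structure Admissible (γ : ℝ) (A : Model.{u} δ μ N) (x : ℝ) : Prop where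
  two_le : 2 ≤ N
  one_le_M : 1 ≤ A.M
  le_x : 10 ^ 12 ≤ x
  small : 10 ^ 18 * (x ^ 26 * A.M ^ (-γ)) ≤ 1

theorem eventually_admissible (hγ : 0 < γ) (hδ : 0 < δ) (hε : 0 < ε) (hεγ : 27 * ε ≤ δ * γ) :
    ∀ᶠ N : ℕ in Filter.atTop, ∀ A : Model.{u} δ μ N, Admissible γ A ((N : ℝ) ^ ε) := by
  filter_upwards [eventually_le_rpow hε (10 ^ 18), Filter.eventually_ge_atTop 2] with N hx hN A
  have hN1 : (1 : ℝ) ≤ N := by exact_mod_cast (by omega : 1 ≤ N)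
  have hN0 : (0 : ℝ) < N := by linarith
  have hlow : (N : ℝ) ^ δ ≤ A.M := A.isModel.lower_M
  have hM1 : 1 ≤ A.M := (Real.one_le_rpow hN1 hδ.le).trans hlow
  refine ⟨hN, hM1, by linarith, ?_⟩
  set x := (N : ℝ) ^ ε with hxdef
  have h1 : A.M ^ (-γ) ≤ ((N : ℝ) ^ δ) ^ (-γ) :=
    Real.rpow_le_rpow_of_nonpos (by positivity) hlow (by linarith)
  have h2 : ((N : ℝ) ^ δ) ^ (-γ) ≤ (x ^ 27)⁻¹ := by
    rw [← Real.rpow_mul hN0.le, hxdef, ← Real.rpow_natCast, ← Real.rpow_mul hN0.le,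
      ← Real.rpow_neg hN0.le]
    refine Real.rpow_le_rpow_of_exponent_le hN1 ?_
    push_cast
    linarith
  have hx0 : 0 < x := by positivity
  calc 10 ^ 18 * (x ^ 26 * A.M ^ (-γ)) ≤ x * (x ^ 26 * (x ^ 27)⁻¹) := by
        gcongr
        exact h1.trans h2
    _ = 1 := by field_simp

namespace Admissible

variable {A : Model.{u} δ μ N} {x : ℝ} {z : ℂ}

theorem facts (h : Admissible γ A x) (hγ₀ : 0 < γ) (hγ₁ : γ < 1 / 2) (hz : z ∈ domain γ A.S) :
    0 < A.M ∧ 0 < avgParam A.M (x ^ 26) z ∧ 1 / (A.M * z.im) ≤ 1 ∧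
      40 * (entryParam A.M (x ^ 26) z + avgParam A.M (x ^ 26) z) ≤ 1 ∧
      96000000001 * (entryParam A.M (x ^ 26) z + avgParam A.M (x ^ 26) z) ≤ 1 := by
  obtain ⟨hre, him, -, hle⟩ := id hz
  have hM0 : 0 < A.M := by linarith [h.one_le_M]
  have hx := h.le_x
  have hb1 : 1 ≤ x ^ 26 := one_le_pow₀ (by linarith)
  have h1 := controlPi_le_of_mem_domain hγ₀ hγ₁ h.two_le A.isModel.isSymmStochastic h.one_le_M hz
  have h2 := entryParam_add_le hM0 hb1 him
  have h3 := h.small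
  have hg0 : 0 < A.M ^ (-γ) := Real.rpow_pos_of_pos hM0 _
  have h1' : controlPi A.M z ≤ 12 * A.M ^ (-γ) := h1
  have h4 : 2 * x ^ 26 * controlPi A.M z ≤ 2 * x ^ 26 * (12 * A.M ^ (-γ)) := by gcongr
  have h5 : 0 ≤ entryParam A.M (x ^ 26) z := entryParam_nonneg
  have hβ := avgParam_pos hM0 (show 0 < x ^ 26 by linarith) him
  have h6 : 1 / (A.M * z.im) ≤ avgParam A.M (x ^ 26) z := by rw [avgParam]; gcongr
  refine ⟨hM0, hβ, by linarith, by linarith, by linarith⟩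

theorem controlCond (h : Admissible γ A x) (hγ₀ : 0 < γ) (hγ₁ : γ < 1 / 2)
    (hz : z ∈ domain γ A.S) : ControlCond A z (apriori A.M x z) x := by
  obtain ⟨hM0, hβ, h1, h2, -⟩ := h.facts hγ₀ hγ₁ hz
  obtain ⟨hre, him, -, hle⟩ := id hz
  have hx := h.le_x
  have hx1 : 1 ≤ x := by linarith
  have hm := im_le_im_msc hre him hle
  have hm0 := im_msc_pos him
  have hξ0 : 0 < 1 / (A.M * z.im) := by positivity
  have hx2 : 1 ≤ x ^ 2 := one_le_pow₀ hx1
  have hx39 : 1 / (A.M * z.im) ≤ x ^ 39 / (A.M * z.im) := by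
    gcongr
    exact one_le_pow₀ hx1
  refine ⟨hre, him, hle, ?_, ?_, ?_⟩
  · rw [apriori]
    nlinarith
  · rw [apriori]
    nlinarith
  · refine (mul_sqrt_apriori_le hM0 (by linarith) him).1.trans ?_
    have h0 : 0 ≤ entryParam A.M (x ^ 26) z := entryParam_nonneg
    rw [← entryParam_sq hM0 (by positivity) him]
    nlinarith

theorem coarseBound_top (h : Admissible γ A x) (hz : z ∈ domain γ A.S) (h10 : 10 ≤ z.im) (ω : A.Ω) :
    CoarseBound (A.H ω) A.M x z := by
  obtain ⟨hre, him, -, hle⟩ := id hz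
  have hM0 : 0 < A.M := by linarith [h.one_le_M]
  have hx := h.le_x
  intro i
  have h1 := norm_green_diag_le (A.isModel.hermitian ω) him i
  have h2 : 1 / z.im ≤ 1 / 10 := one_div_le_one_div_of_le (by norm_num) h10
  have h3 := (le_abs_self _).trans (Complex.abs_im_le_norm (green (A.H ω) z i i))
  have h4 := im_le_im_msc hre him hle
  have h5 : 0 ≤ x ^ 39 / (A.M * z.im) := by positivity
  constructor <;> linarith

theorem coarseBound_of_localLawAt (h : Admissible γ A x) (hγ₀ : 0 < γ) (hγ₁ : γ < 1 / 2)
    (hz : z ∈ domain γ A.S) {ω : A.Ω} (hL : LocalLawAt (A.H ω) A.M (x ^ 26) z) :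
    CoarseBound (A.H ω) A.M x z := by
  obtain ⟨hM0, hβ, -, h2, h3⟩ := h.facts hγ₀ hγ₁ hz
  obtain ⟨hre, him, -, hle⟩ := id hz
  have hm0 := im_msc_pos him
  have hx := h.le_x
  have hx0 : 0 < x := by linarith
  have hψ0 : 0 ≤ entryParam A.M (x ^ 26) z := entryParam_nonneg
  intro i
  have e : green (A.H ω) z i i = msc z + diagError (A.H ω) z i := by rw [diagError]; ring
  have h4 := norm_sub_norm_le (diagError (A.H ω) z i) (mean (diagError (A.H ω) z))
  have h5 := hL.diag i
  have h6 := hL.mean_le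
  have h7 : ‖diagError (A.H ω) z i‖ ≤ 32 * entryParam A.M (x ^ 26) z
      + 96000000000 * avgParam A.M (x ^ 26) z := by linarith
  constructor
  · rw [e]
    exact (norm_add_le _ _).trans (by linarith [norm_msc_lt_one him])
  · have h8 := (le_abs_self _).trans (Complex.abs_im_le_norm (diagError (A.H ω) z i))
    have h9 : 32 * entryParam A.M (x ^ 26) z ≤ 2 * (msc z).im + 300 * avgParam A.M (x ^ 26) z := by
      refine abs_le_of_sq_le_sq' ?_ (by positivity) |>.2
      rw [mul_pow, entryParam_sq hM0 (by positivity) him, sqParam]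
      nlinarith [sq_nonneg ((msc z).im), sq_nonneg (avgParam A.M (x ^ 26) z),
        mul_pos hm0 hβ]
    have h10 : 96000000300 * avgParam A.M (x ^ 26) z ≤ x ^ 39 / (A.M * z.im) := by
      rw [avgParam, ← mul_div_assoc]
      gcongr
      calc 96000000300 * x ^ 26 ≤ x ^ 13 * x ^ 26 := by
            gcongr
            calc (96000000300 : ℝ) ≤ x ^ 1 := by rw [pow_one]; linarith
              _ ≤ x ^ 13 := pow_le_pow_right₀ (by linarith) (by norm_num)
        _ = _ := by ring
    rw [e, Complex.add_im]
    linarith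

end Admissible

/-- The part of the spectral domain which is reached after `k` steps of the bootstrap. -/
def reached (γ ε : ℝ) (k N : ℕ) (A : Model.{u} δ μ N) (z : ℂ) : Prop :=
  z ∈ domain γ A.S ∧ 10 / ((N : ℝ) ^ ε) ^ k ≤ z.im

theorem wop_diagBound (hγ₀ : 0 < γ) (hδ : 0 < δ) (hε : 0 < ε)
    (hεγ : 27 * ε ≤ δ * γ) {k : ℕ}
    (h : Wop fun N (A : Model.{u} δ μ N) z ω => reached γ ε k N A z →
      CoarseBound (A.H ω) A.M ((N : ℝ) ^ ε) z) :
    Wop fun N (A : Model.{u} δ μ N) z ω => reached γ ε (k + 1) N A z →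
      DiagBound (A.H ω) z (apriori A.M ((N : ℝ) ^ ε) z) ((N : ℝ) ^ ε) := by
  refine (h.comap (ι' := fun _ => ℂ)
    fun N _ z => (⟨z.re, min 10 ((N : ℝ) ^ ε * z.im)⟩ : ℂ)).mono ?_
  filter_upwards [eventually_admissible (μ := μ) hγ₀ hδ hε hεγ] with N hA A z ω hω hz
  have hx := (hA A).le_x
  have hM := (hA A).one_le_M
  set x := (N : ℝ) ^ ε
  obtain ⟨hzd, hzk⟩ := hz
  have him : 0 < z.im := hzd.2.1
  have hle : z.im ≤ 10 := hzd.2.2.2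
  have h1 : z.im ≤ min 10 (x * z.im) := le_min hle (by nlinarith)
  have h2 : 10 / x ^ k ≤ min 10 (x * z.im) := by
    refine le_min (div_le_self (by norm_num) (one_le_pow₀ (by linarith))) ?_
    calc 10 / x ^ k = x * (10 / x ^ (k + 1)) := by rw [pow_succ]; field_simp
      _ ≤ _ := by gcongr
  exact CoarseBound.diagBound (A.isModel.hermitian ω) (by linarith) (by linarith) him h1
    (min_le_right _ _) (hω ⟨domain_vertical hzd h1 (min_le_left _ _), h2⟩)

theorem wop_fluctBound (hγ₀ : 0 < γ) (hγ₁ : γ < 1 / 2) (hδ : 0 < δ) (hε : 0 < ε)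
    (hεγ : 27 * ε ≤ δ * γ) {k : ℕ}
    (h : Wop fun N (A : Model.{u} δ μ N) z ω => reached γ ε k N A z →
      DiagBound (A.H ω) z (apriori A.M ((N : ℝ) ^ ε) z) ((N : ℝ) ^ ε)) :
    Wop fun N (A : Model.{u} δ μ N) z ω => reached γ ε k N A z →
      FluctBound A.S (A.H ω) A.M (((N : ℝ) ^ ε) ^ 26) z := by
  have hadm := eventually_admissible (μ := μ) hγ₀ hδ hε hεγ
  have havg := wop_average hε (hadm.mono fun N hA A z hz => (hA A).controlCond hγ₀ hγ₁ hz.1) h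
  have h1 := havg.comap (ι' := fun N => ℂ × Fin N) fun N A p => (p.1, A.S p.2)
  have h2 := havg.comap (ι' := fun _ => ℂ) fun N A z => (z, fun _ => (N : ℝ)⁻¹)
  refine ((h.and (wop_ldBound hε)).and (h1.forall_fin.and h2)).mono ?_
  filter_upwards [hadm] with N hA A z ω hω hz
  obtain ⟨⟨hG, hLD⟩, hω1, hω2⟩ := hω
  have him : 0 < z.im := hz.1.2.1
  have hx := (hA A).le_x
  have hN := (hA A).two_le
  have hN0 : (0 : ℝ) < N := by exact_mod_cast (by omega : 0 < N)
  have hM0 : 0 < A.M := by linarith [(hA A).one_le_M]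
  have hcc := (hA A).controlCond hγ₀ hγ₁ hz.1
  obtain ⟨h3, h4, -, -⟩ := hcc.local_bounds (by omega) (by linarith) (A.isModel.hermitian ω) (hG hz)
    (hLD him)
  have hS := A.isModel.isSymmStochastic
  have h5 := (mul_sqrt_apriori_le hM0 (show 2 ≤ (N : ℝ) ^ ε by linarith) him).2
  have h6 := apriori_mul_le hM0 (show 2 ≤ (N : ℝ) ^ ε by linarith) him
  refine ⟨fun i k hik => (h3 i k hik).trans h5, fun i => (h4 i).trans h5, fun i => ?_, ?_⟩
  · exact (hω1 i hz (hS.nonneg i) (hS.row_sum i).le (A.isModel.varMatrix_le i)).trans h6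
  · have h7 := hω2 hz (fun _ => by positivity) (by simp [hN0.ne'])
      (fun _ => inv_anti₀ hM0 A.isModel.upper_M)
    refine le_trans (le_of_eq ?_) (h7.trans h6)
    rw [mean, Finset.mul_sum]
    push_cast
    rfl

theorem wop_localLawAt (hγ₀ : 0 < γ) (hγ₁ : γ < 1 / 2) (hδ : 0 < δ) (hε : 0 < ε)
    (hεγ : 27 * ε ≤ δ * γ) {k : ℕ}
    (h : Wop fun N (A : Model.{u} δ μ N) z ω => reached γ ε k N A z →
      FluctBound A.S (A.H ω) A.M (((N : ℝ) ^ ε) ^ 26) z) :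
    Wop fun N (A : Model.{u} δ μ N) z ω => reached γ ε k N A z →
      LocalLawAt (A.H ω) A.M (((N : ℝ) ^ ε) ^ 26) z := by
  have h1 := h.comap (ι' := fun N => ℂ × Fin (10 * N ^ 2 + 1)) fun N _ p =>
    (⟨p.1.re, 10 - p.2 * ((10 - p.1.im) / (10 * N ^ 2))⟩ : ℂ)
  have h2 := Wop.forall_fintype (C := 3) (by norm_num) (by
    filter_upwards [Filter.eventually_ge_atTop 11] with N hN
    have h3 : (10 * N ^ 2 + 1 : ℕ) ≤ N ^ 3 := by nlinarith
    rw [Fintype.card_fin]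
    exact_mod_cast h3) h1
  refine h2.mono ?_
  filter_upwards [eventually_admissible (μ := μ) hγ₀ hδ hε hεγ] with N hA A z ω hω hz
  have hx := (hA A).le_x
  have hN := (hA A).two_le
  have hN0 : (0 : ℝ) < N := by exact_mod_cast (by omega : 0 < N)
  have hle : z.im ≤ 10 := hz.1.2.2.2
  have hb : 256 ≤ ((N : ℝ) ^ ε) ^ 26 := by
    calc (256 : ℝ) ≤ ((N : ℝ) ^ ε) ^ 1 := by rw [pow_one]; linarith
      _ ≤ _ := pow_le_pow_right₀ (by linarith) (by norm_num)
  refine localLawAt_of_grid hγ₀ hγ₁ hN A.isModel.isSymmStochastic A.isModel.varMatrix_le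
    (hA A).one_le_M A.isModel.upper_M (A.isModel.hermitian ω) hb (hA A).small hz.1 fun j => ?_
  have hj : (j : ℝ) ≤ 10 * (N : ℝ) ^ 2 := by exact_mod_cast Nat.lt_succ_iff.1 j.2
  have h0 : 0 ≤ (10 - z.im) / (10 * (N : ℝ) ^ 2) := div_nonneg (by linarith) (by positivity)
  have h3 : (j : ℝ) * ((10 - z.im) / (10 * (N : ℝ) ^ 2)) ≤ 10 - z.im := by
    calc _ ≤ 10 * (N : ℝ) ^ 2 * ((10 - z.im) / (10 * (N : ℝ) ^ 2)) := by gcongr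
      _ = _ := by field_simp
  have h4 : 0 ≤ (j : ℝ) * ((10 - z.im) / (10 * (N : ℝ) ^ 2)) := by positivity
  exact hω j ⟨domain_vertical hz.1 (by linarith) (by linarith), hz.2.trans (by simp only; linarith)⟩

/-- The local law holds with overwhelming probability on the whole spectral domain. -/
theorem wop_domain (hγ₀ : 0 < γ) (hγ₁ : γ < 1 / 2) (hδ : 0 < δ) (hε : 0 < ε)
    (hεγ : 27 * ε ≤ δ * γ) :
    Wop fun N (A : Model.{u} δ μ N) z ω => z ∈ domain γ A.S →
      FluctBound A.S (A.H ω) A.M (((N : ℝ) ^ ε) ^ 26) z ∧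
        LocalLawAt (A.H ω) A.M (((N : ℝ) ^ ε) ^ 26) z := by
  have hadm := eventually_admissible (μ := μ) hγ₀ hδ hε hεγ
  have hcoarse : ∀ k, Wop fun N (A : Model.{u} δ μ N) z ω => reached γ ε k N A z →
      CoarseBound (A.H ω) A.M ((N : ℝ) ^ ε) z := by
    intro k
    induction k with
    | zero =>
      refine Wop.of_eventually ?_
      filter_upwards [hadm] with N hA A z ω hz
      exact (hA A).coarseBound_top hz.1 (by simpa using hz.2) ω
    | succ k ih =>
      refine (wop_localLawAt hγ₀ hγ₁ hδ hε hεγ (wop_fluctBound hγ₀ hγ₁ hδ hε hεγ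
        (wop_diagBound hγ₀ hδ hε hεγ ih))).mono ?_
      filter_upwards [hadm] with N hA A z ω hω hz
      exact (hA A).coarseBound_of_localLawAt hγ₀ hγ₁ hz.1 (hω hz)
  obtain ⟨k, hk⟩ := exists_nat_ge (2 / ε)
  have h1 := wop_fluctBound hγ₀ hγ₁ hδ hε hεγ (wop_diagBound hγ₀ hδ hε hεγ (hcoarse k))
  refine (h1.and (wop_localLawAt hγ₀ hγ₁ hδ hε hεγ h1)).mono ?_
  filter_upwards [hadm, Filter.eventually_ge_atTop 10] with N hA hN A z ω hω hz
  suffices hr : reached γ ε (k + 1) N A z from ⟨hω.1 hr, hω.2 hr⟩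
  refine ⟨hz, ?_⟩
  obtain ⟨hM0, -, h3, -⟩ := (hA A).facts hγ₀ hγ₁ hz
  have him : 0 < z.im := hz.2.1
  have hN10 : (10 : ℝ) ≤ N := by exact_mod_cast hN
  have h4 : (N : ℝ) ^ 2 ≤ ((N : ℝ) ^ ε) ^ (k + 1) := by
    rw [← Real.rpow_natCast, ← Real.rpow_natCast, ← Real.rpow_mul (by linarith)]
    refine Real.rpow_le_rpow_of_exponent_le (by linarith) ?_
    rw [div_le_iff₀ hε] at hk
    push_cast
    linarith
  have h5 : 1 ≤ N * z.im := by
    rw [div_le_one (by positivity)] at h3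
    exact h3.trans (mul_le_mul_of_nonneg_right A.isModel.upper_M him.le)
  rw [div_le_iff₀ (by positivity)]
  calc (10 : ℝ) ≤ N * (N * z.im) := by nlinarith
    _ = z.im * (N : ℝ) ^ 2 := by ring
    _ ≤ _ := by gcongr

end Bootstrap

end LocalSemicircle

namespace LocalSemicircle

section Conclusion

variable {δ γ ε : ℝ} {μ : ℕ → ℝ}

theorem stochDom_of_wop {dom : ∀ N, Model.{u} δ μ N → Set ℂ}
    {X Y : ∀ N (A : Model.{u} δ μ N), ℂ → A.Ω → ℝ}
    (h : ∀ ε : ℝ, 0 < ε → Wop fun N (A : Model.{u} δ μ N) z ω => z ∈ dom N A →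
      X N A z ω ≤ (N : ℝ) ^ ε * Y N A z ω) :
    StochDom (U := fun N => Σ A : Model.{u} δ μ N, ↥(dom N A)) (fun _ a => a.1.P)
      (fun N a ω => X N a.1 a.2 ω) (fun N a ω => Y N a.1 a.2 ω) := by
  intro ε hε D hD
  obtain ⟨N₀, hN₀⟩ := Filter.eventually_atTop.1 (h ε hε D hD)
  refine ⟨N₀, fun N hN a => (measureReal_mono fun ω hω => ?_).trans (hN₀ N hN a.1 a.2)⟩
  simp only [Set.mem_ofPred_eq] at *
  exact fun h1 => (not_le.2 hω) (h1 a.2.2)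

theorem mN_sub_msc {N : ℕ} (hN : 0 < N) (A : Model.{u} δ μ N) (z : ℂ) (ω : A.Ω) :
    A.mN z ω - msc z = mean (diagError (A.H ω) z) := by
  have h := mean_sub (fun i => green (A.H ω) z i i) fun _ => msc z
  rw [mean_const hN] at h
  have e : A.mN z ω = mean fun i => green (A.H ω) z i i := by
    rw [Model.mN, mean, one_div]; rfl
  rw [e, ← h]
  rfl

theorem exists_small_exponent (hγ : 0 < γ) (hδ : 0 < δ) (hε : 0 < ε) :
    ∃ ε₀ : ℝ, 0 < ε₀ ∧ 27 * ε₀ ≤ δ * γ ∧ 53 * ε₀ ≤ ε := by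
  have h : 0 < δ * γ := by positivity
  refine ⟨min (δ * γ) ε / 53, div_pos (lt_min h hε) (by norm_num), ?_, ?_⟩
  · linarith [min_le_left (δ * γ) ε]
  · linarith [min_le_right (δ * γ) ε]

theorem pow_le_rpow {N : ℕ} (hN : 1 ≤ N) {ε₀ : ℝ} (h : 53 * ε₀ ≤ ε) :
    ((N : ℝ) ^ ε₀) ^ 53 ≤ (N : ℝ) ^ ε := by
  have hN1 : (1 : ℝ) ≤ N := by exact_mod_cast hN
  rw [← Real.rpow_natCast, ← Real.rpow_mul (by linarith)]
  refine Real.rpow_le_rpow_of_exponent_le hN1 ?_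
  push_cast
  linarith

theorem wop_entryError (hγ₀ : 0 < γ) (hγ₁ : γ < 1 / 2) (hδ : 0 < δ) (hε : 0 < ε) :
    Wop fun N (A : Model.{u} δ μ N) z ω => z ∈ domain γ A.S →
      A.entryError z ω ≤ (N : ℝ) ^ ε * controlPi A.M z := by
  obtain ⟨ε₀, h0, h1, h2⟩ := exists_small_exponent hγ₀ hδ hε
  refine (wop_domain (μ := μ) hγ₀ hγ₁ hδ h0 h1).mono ?_
  filter_upwards [eventually_admissible (μ := μ) hγ₀ hδ h0 h1] with N hA A z ω hω hz
  obtain ⟨hF, hL⟩ := hω hz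
  have hN := (hA A).two_le
  have hx := (hA A).le_x
  have hxN := pow_le_rpow (by omega : 1 ≤ N) h2
  have hM0 : 0 < A.M := by linarith [(hA A).one_le_M]
  have him : 0 < z.im := hz.2.1
  set x := (N : ℝ) ^ ε₀
  have hb : 1 ≤ x ^ 26 := one_le_pow₀ (by linarith)
  have hψ0 : 0 ≤ entryParam A.M (x ^ 26) z := entryParam_nonneg
  have hβ0 := avgParam_pos hM0 (by linarith : 0 < x ^ 26) him
  have hQ : 0 ≤ controlPi A.M z := by
    have := entryParam_add_le hM0 hb him
    by_contra! h
    nlinarith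
  have key : 96000000000 * (entryParam A.M (x ^ 26) z + avgParam A.M (x ^ 26) z)
      ≤ (N : ℝ) ^ ε * controlPi A.M z := by
    calc _ ≤ 96000000000 * (2 * x ^ 26 * controlPi A.M z) := by
          gcongr
          exact entryParam_add_le hM0 hb him
      _ = (192000000000 * x ^ 26) * controlPi A.M z := by ring
      _ ≤ (x * x ^ 26) * controlPi A.M z := by gcongr; linarith
      _ ≤ x ^ 53 * controlPi A.M z := by
          rw [← pow_succ']
          gcongr
          · linarith
          · norm_num
      _ ≤ _ := by gcongr
  have : Nonempty (Fin N) := ⟨⟨0, by omega⟩⟩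
  refine ciSup_le fun p => le_trans ?_ key
  by_cases hp : p.1 = p.2
  · rw [if_pos hp, ← hp]
    have h3 := norm_sub_norm_le (diagError (A.H ω) z p.1) (mean (diagError (A.H ω) z))
    have h4 := hL.diag p.1
    have h5 := hL.mean_le
    change ‖diagError (A.H ω) z p.1‖ ≤ _
    linarith
  · rw [if_neg hp, sub_zero]
    have h3 := hF.off_diag p.1 p.2 hp
    change ‖green (A.H ω) z p.1 p.2‖ ≤ _
    linarith

theorem wop_trace (hγ₀ : 0 < γ) (hγ₁ : γ < 1 / 2) (hδ : 0 < δ) (hε : 0 < ε) :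
    Wop fun N (A : Model.{u} δ μ N) z ω => z ∈ domain γ A.S →
      ‖A.mN z ω - msc z‖ ≤ (N : ℝ) ^ ε * (1 / (A.M * z.im)) := by
  obtain ⟨ε₀, h0, h1, h2⟩ := exists_small_exponent hγ₀ hδ hε
  refine (wop_domain (μ := μ) hγ₀ hγ₁ hδ h0 h1).mono ?_
  filter_upwards [eventually_admissible (μ := μ) hγ₀ hδ h0 h1] with N hA A z ω hω hz
  obtain ⟨hF, hL⟩ := hω hz
  have hN := (hA A).two_le
  have hx := (hA A).le_x
  have hxN := pow_le_rpow (by omega : 1 ≤ N) h2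
  have hM0 : 0 < A.M := by linarith [(hA A).one_le_M]
  have him : 0 < z.im := hz.2.1
  set x := (N : ℝ) ^ ε₀
  rw [mN_sub_msc (by omega)]
  refine hL.mean_le.trans ?_
  calc 96000000000 * avgParam A.M (x ^ 26) z
      = (96000000000 * x ^ 26) * (1 / (A.M * z.im)) := by rw [avgParam]; ring
    _ ≤ (x * x ^ 26) * (1 / (A.M * z.im)) := by gcongr; linarith
    _ ≤ x ^ 53 * (1 / (A.M * z.im)) := by
        rw [← pow_succ']
        gcongr
        · linarith
        · norm_num
    _ ≤ _ := by gcongr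

theorem wop_trace_outer (hγ₀ : 0 < γ) (hγ₁ : γ < 1 / 2) (hδ : 0 < δ) (hε : 0 < ε) :
    Wop fun N (A : Model.{u} δ μ N) z ω => z ∈ outerDomain γ A.S →
      ‖A.mN z ω - msc z‖ ≤ (N : ℝ) ^ ε * (1 / (A.M * (kappa z.re + z.im))
        + 1 / ((A.M * z.im) ^ 2 * Real.sqrt (kappa z.re + z.im))) := by
  obtain ⟨ε₀, h0, h1, h2⟩ := exists_small_exponent hγ₀ hδ hε
  refine (wop_domain (μ := μ) hγ₀ hγ₁ hδ h0 h1).mono ?_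
  filter_upwards [eventually_admissible (μ := μ) hγ₀ hδ h0 h1] with N hA A z ω hω hzo
  obtain ⟨hz, hre2, hout⟩ := hzo
  obtain ⟨hF, hL⟩ := hω hz
  obtain ⟨hre, him, -, hle⟩ := id hz
  have hN := (hA A).two_le
  have hx := (hA A).le_x
  have hsm := (hA A).small
  have hxN := pow_le_rpow (by omega : 1 ≤ N) h2
  have hM0 : 0 < A.M := by linarith [(hA A).one_le_M]
  set x := (N : ℝ) ^ ε₀
  have hx0 : 0 < x := by linarith
  rw [mN_sub_msc (by omega)]
  set c := kappa z.re + z.im with hc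
  have hc0 : 0 < c := by
    have : 0 ≤ kappa z.re := abs_nonneg _
    linarith
  set ξ := 1 / (A.M * z.im) with hξ
  have hξ0 : 0 < ξ := by positivity
  set s := Real.sqrt c with hs
  have hs0 : 0 < s := Real.sqrt_pos.2 hc0
  have hss : s * s = c := Real.mul_self_sqrt hc0.le
  set α := rootGap z with hα
  have hαc : c ≤ α ^ 2 := kappa_add_le_rootGap_sq hre2 him
  have hα0 : 0 < α := by
    have := im_msc_le_rootGap him
    linarith [im_msc_pos him]
  have hsα : s ≤ α := Real.sqrt_le_iff.2 ⟨hα0.le, hαc⟩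
  have hια := im_msc_mul_rootGap_le hre2 hre him hle
  have hg0 : 0 < A.M ^ (-γ) := Real.rpow_pos_of_pos hM0 _
  have hξg : ξ ≤ A.M ^ (-γ) * s := by
    have h3 : A.M ^ γ ≤ A.M * z.im * s := hout
    have h4 : A.M ^ (-γ) * A.M ^ γ = 1 := by
      rw [← Real.rpow_add hM0, neg_add_cancel, Real.rpow_zero]
    rw [hξ, div_le_iff₀ (by positivity)]
    calc 1 = A.M ^ (-γ) * A.M ^ γ := h4.symm
      _ ≤ A.M ^ (-γ) * (A.M * z.im * s) := by gcongr
      _ = _ := by ring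
  have hβ : avgParam A.M (x ^ 26) z = x ^ 26 * ξ := by rw [avgParam, hξ]; ring
  have hgap : 48000000000 * avgParam A.M (x ^ 26) z < α := by
    rw [hβ]
    calc 48000000000 * (x ^ 26 * ξ) ≤ 48000000000 * (x ^ 26 * (A.M ^ (-γ) * s)) := by gcongr
      _ = 48000000000 * (x ^ 26 * A.M ^ (-γ)) * s := by ring
      _ < 1 * s := by gcongr; linarith
      _ ≤ α := by linarith
  have hq := hL.mean_outer hgap
  rw [sqParam, hβ] at hq
  have hι : (msc z).im ≤ 200 * z.im / α := (le_div_iff₀ hα0).2 hια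
  have e1 : ξ * (200 * z.im / α) / α = 200 * (1 / (A.M * α ^ 2)) := by
    rw [hξ]; field_simp
  have h3 : ‖mean (diagError (A.H ω) z)‖ ≤ 12000000000
      * (x ^ 26 * (200 * (1 / (A.M * c))) + x ^ 52 * (1 / ((A.M * z.im) ^ 2 * s))) := by
    have h4 : ‖mean (diagError (A.H ω) z)‖
        ≤ 12000000000 * (x ^ 26 * ξ * ((msc z).im + x ^ 26 * ξ)) / α := (le_div_iff₀ hα0).2 hq
    refine h4.trans ?_
    have e2 : 12000000000 * (x ^ 26 * ξ * ((msc z).im + x ^ 26 * ξ)) / α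
        = 12000000000 * (x ^ 26 * (ξ * (msc z).im / α) + x ^ 52 * (ξ ^ 2 / α)) := by ring
    rw [e2]
    have h5 : ξ ^ 2 / α ≤ 1 / ((A.M * z.im) ^ 2 * s) := by
      rw [← div_div, ← one_div_pow]
      gcongr
    have h6 : ξ * (msc z).im / α ≤ 200 * (1 / (A.M * c)) := by
      calc ξ * (msc z).im / α ≤ ξ * (200 * z.im / α) / α := by gcongr
        _ = 200 * (1 / (A.M * α ^ 2)) := e1
        _ ≤ _ := by gcongr
    gcongr
  refine h3.trans ?_
  have hp1 : 0 < 1 / (A.M * c) := by positivity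
  have hp2 : 0 < 1 / ((A.M * z.im) ^ 2 * s) := by positivity
  have h26 : x ^ 26 ≤ x ^ 51 := pow_le_pow_right₀ (by linarith) (by norm_num)
  have hx2 : 2400000000000 * x ^ 51 ≤ x ^ 53 := by
    calc 2400000000000 * x ^ 51 ≤ x ^ 2 * x ^ 51 := by gcongr; nlinarith
      _ = _ := by ring
  have hx1 : 12000000000 * x ^ 52 ≤ x ^ 53 := by
    calc 12000000000 * x ^ 52 ≤ x * x ^ 52 := by gcongr; linarith
      _ = _ := by ring
  calc _ = (2400000000000 * x ^ 26) * (1 / (A.M * c))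
        + (12000000000 * x ^ 52) * (1 / ((A.M * z.im) ^ 2 * s)) := by ring
    _ ≤ x ^ 53 * (1 / (A.M * c)) + x ^ 53 * (1 / ((A.M * z.im) ^ 2 * s)) := by
        gcongr
        linarith
    _ = x ^ 53 * (1 / (A.M * c) + 1 / ((A.M * z.im) ^ 2 * s)) := by ring
    _ ≤ _ := by gcongr

end Conclusion

end LocalSemicircle

/-- The local semicircle law. The threshold `N₀` hidden in each `StochDom` depends on
`γ`, `δ`, `(μ_p)`, `ε` and `D` only. -/
theorem theorem2p3 (γ : ℝ) (hγ₀ : 0 < γ) (hγ₁ : γ < 1 / 2) (δ : ℝ) (hδ : 0 < δ) (μ : ℕ → ℝ) :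
    LocalSemicircle.StochDom (U := LocalSemicircle.Param.{u} γ δ μ)
      (fun _ a => a.1.P)
      (fun _ a ω => a.1.entryError a.2.1 ω)
      (fun _ a _ => LocalSemicircle.controlPi a.1.M a.2.1)
    ∧ LocalSemicircle.StochDom (U := LocalSemicircle.Param.{u} γ δ μ)
      (fun _ a => a.1.P)
      (fun _ a ω => ‖a.1.mN a.2.1 ω - LocalSemicircle.msc a.2.1‖)
      (fun _ a _ => 1 / (a.1.M * (a.2.1 : ℂ).im))
    ∧ LocalSemicircle.StochDom (U := LocalSemicircle.OuterParam.{u} γ δ μ)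
      (fun _ a => a.1.P)
      (fun _ a ω => ‖a.1.mN a.2.1 ω - LocalSemicircle.msc a.2.1‖)
      (fun _ a _ =>
        1 / (a.1.M * (LocalSemicircle.kappa (a.2.1 : ℂ).re + (a.2.1 : ℂ).im))
        + 1 / ((a.1.M * (a.2.1 : ℂ).im) ^ 2
            * Real.sqrt (LocalSemicircle.kappa (a.2.1 : ℂ).re + (a.2.1 : ℂ).im))) := by
  refine ⟨LocalSemicircle.stochDom_of_wop fun ε hε => LocalSemicircle.wop_entryError hγ₀ hγ₁ hδ hε,
    LocalSemicircle.stochDom_of_wop fun ε hε => LocalSemicircle.wop_trace hγ₀ hγ₁ hδ hε,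
    LocalSemicircle.stochDom_of_wop (dom := fun _ A => LocalSemicircle.outerDomain γ A.S)
      (X := fun _ A z ω => ‖A.mN z ω - LocalSemicircle.msc z‖)
      (Y := fun _ A z _ => 1 / (A.M * (LocalSemicircle.kappa z.re + z.im))
        + 1 / ((A.M * z.im) ^ 2 * Real.sqrt (LocalSemicircle.kappa z.re + z.im)))
      fun ε hε => LocalSemicircle.wop_trace_outer hγ₀ hγ₁ hδ hε⟩
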